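/- **Setting.** Let $\mathcal A$ be the Hopf $*$-algebra of polynomial functions on a compact matrix quantum group $G$ (spanned by the matrix coefficients of its unitary corepresentations, and generated by the coefficients of one of them), with coproduct $a\mapsto\sum a^{(1)}\otimes a^{(2)}$ and antipode $\kappa$. Let $(\Gamma,d)$ be a bicovariant first-order $*$-calculus over $G$, with left action $\ell_\Gamma:\Gamma\to\mathcal A\otimes\Gamma$ and right action $\wp_\Gamma:\Gamma\to\Gamma\otimes\mathcal A$. Let $\Gamma_{inv}=\{\vartheta:\ell_\Gamma(\vartheta)=1\otimes\vartheta\}$, with the adjoint action $\varpi=\wp_\Gamma|_{\Gamma_{inv}}:\Gamma_{inv}\to\Gamma_{inv}\otimes\mathcal A$ and the right $\mathcal A$-module structure $\vartheta\circ a=\sum\kappa(a^{(1)})\vartheta a^{(2)}$. Let $\Gamma^\wedge$ be the universal differential envelope of $(\Gamma,d)$: the quotient of the tensor algebra of the bimodule $\Gamma$ over $\mathcal A$ by the relations $\sum_k d(a_k)d(b_k)=0$ whenever $\sum_k a_kd(b_k)=0$. Let $\Omega$ be the free differential graded algebra over $\mathbb C$ generated by $\Gamma_{inv}$ in degree $1$,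 and let $\widetilde{\mathrm{ad}}:\Omega\to\Omega\,\widehat\otimes\,\Gamma^\wedge$ (graded tensor product) be the homomorphism of differential algebras with $\widetilde{\mathrm{ad}}(\vartheta)=\varpi(\vartheta)+1\otimes\vartheta$ for $\vartheta\in\Gamma_{inv}$. Put $\daleth=\{w\in\Omega:\widetilde{\mathrm{ad}}(w)=w\otimes1\}$. Let $\delta:\Gamma_{inv}\to\Gamma_{inv}\otimes\Gamma_{inv}$ be an embedded differential, that is, a linear map such that the image of $\delta(\vartheta)$ under multiplication $\Gamma_{inv}\otimes\Gamma_{inv}\to\Gamma^\wedge$ is $d\vartheta$, and put $R(\vartheta)=d\vartheta-\delta(\vartheta)\in\Omega$. Let $\mathcal K\subseteq\Omega$ be the two-sided ideal generated by the kernel of the multiplication $\Gamma_{inv}\otimes\Gamma_{inv}\to\Gamma^\wedge$ and by the elements $$\eta R(\vartheta)-\sum_kR(\vartheta_k)(\eta\circ c_k),\qquad R(\eta)R(\vartheta)-\sum_kR(\vartheta_k)R(\eta\circ c_k),$$ where $\eta,\vartheta\in\Gamma_{inv}$ and $\varpi(\vartheta)=\sum_k\vartheta_k\otimes c_k$. Let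 $\Omega_*=\Omega/\mathcal K$, with projection $p_{\mathcal K}:\Omega\to\Omega_*$. **Statement.** The ideal $\mathcal K$ is stable under $d$, and $(p_{\mathcal K}\otimes\mathrm{id})\widetilde{\mathrm{ad}}$ vanishes on $\mathcal K$. So $\Omega_*$ is a differential algebra with an induced homomorphism $\widetilde{\mathrm{ad}}_*:\Omega_*\to\Omega_*\widehat\otimes\Gamma^\wedge$; put $\beth=\{w\in\Omega_*:\widetilde{\mathrm{ad}}_*(w)=w\otimes1\}$, so that $p_{\mathcal K}(\daleth)\subseteq\beth$. Consider the conditions 1. (i) the complex $\mathcal K\cap\daleth$ is acyclic; 2. (ii) the complex $\mathcal K$ is acyclic; 3. (iii) $H(\Omega_*)=\mathbb C$; 4. (iv) $p_{\mathcal K}$ induces an isomorphism $H(\daleth)\cong H(\beth)$ of cohomology algebras; in other words, the universal characteristic classes of the general case, $H(\daleth)$, and of the regular case, $H(\beth)$, coincide through $p_{\mathcal K}$. Then (i) $\Leftrightarrow$ (iv), (ii) $\Leftrightarrow$ (iii) and (ii) $\Rightarrow$ (i). If moreover $G$ is connected, in the sense that only scalars are annihilated by $d:\mathcal A\to\Gamma$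 (it is enough that this holds in the subalgebra of $\mathcal A$ generated by the matrix coefficients $(f\otimes\mathrm{id})\varpi(\vartheta)$, $f\in\Gamma_{inv}^*$, $\vartheta\in\Gamma_{inv}$, of $\varpi$), then (i), (ii), (iii) and (iv) are all equivalent. -/

import Mathlib

open scoped TensorProduct

namespace QPB

noncomputable section

/-- An algebra homomorphism that vanishes on a two-sided ideal, on the quotient. -/
def idealLift {R P : Type*} [Ring R] [Algebra ℂ R] [Ring P] [Algebra ℂ P] (I : TwoSidedIdeal R)
    (f : R →ₐ[ℂ] P) (h : ∀ x ∈ I, f x = 0) : I.ringCon.Quotient →ₐ[ℂ] P :=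
  I.ringCon.liftₐ f (fun x y hxy => by
    have h' := h _ ((TwoSidedIdeal.rel_iff I x y).1 hxy)
    rw [map_sub, sub_eq_zero] at h'
    exact h')

theorem eq_zero_of_mem_span {R P : Type*} [Ring R] [Ring P] (s : Set R) (f : R →+* P)
    (h : ∀ x ∈ s, f x = 0) : ∀ x ∈ TwoSidedIdeal.span s, f x = 0 := by
  have : TwoSidedIdeal.span s ≤ TwoSidedIdeal.ker f :=
    TwoSidedIdeal.span_le.2 (fun x hx => (TwoSidedIdeal.mem_ker f).2 (h x hx))
  exact fun x hx => (TwoSidedIdeal.mem_ker f).1 (this hx)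

/-! ### Super (`ℤ/2`-graded) algebras and their differentials -/

/-- A super algebra: a complex algebra with its parity automorphism `x ↦ (-1)^{∂x} x`. -/
class Super (B : Type*) [Ring B] [Algebra ℂ B] where
  par : B →ₐ[ℂ] B
  par_par : ∀ x, par (par x) = x

/-- Even (`i = 0`) and odd (`i = 1`) elements. -/
def Super.part (B : Type*) [Ring B] [Algebra ℂ B] [Super B] (i : ZMod 2) : Submodule ℂ B where
  carrier := {x | Super.par x = (-1 : ℂ) ^ i.val • x}
  zero_mem' := by simp
  add_mem' := by
    intro x y hx hy
    simp only [Set.mem_ofPred_eq] at hx hy ⊢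
    rw [map_add, hx, hy, smul_add]
  smul_mem' := by
    intro c x hx
    simp only [Set.mem_ofPred_eq] at hx ⊢
    rw [map_smul, hx, smul_comm]

section
variable {B : Type*} [Ring B] [Algebra ℂ B] [Super B]

theorem Super.mem_part {i : ZMod 2} {x : B} :
    x ∈ Super.part B i ↔ Super.par x = (-1 : ℂ) ^ i.val • x := Iff.rfl

theorem Super.mem_part_zero {x : B} : x ∈ Super.part B 0 ↔ Super.par x = x := by
  rw [Super.mem_part]; simp

theorem Super.mem_part_one {x : B} : x ∈ Super.part B 1 ↔ Super.par x = -x := by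
  rw [Super.mem_part]
  have : (1 : ZMod 2).val = 1 := rfl
  rw [this]; simp

/-- The projection of an element to its even or odd component. -/
def Super.proj (i : ZMod 2) : B →ₗ[ℂ] Super.part B i where
  toFun x := ⟨(2⁻¹ : ℂ) • (x + (-1 : ℂ) ^ i.val • Super.par x), by
    rw [Super.mem_part, map_smul, map_add, map_smul, Super.par_par]
    have h : ((-1 : ℂ) ^ i.val) * ((-1 : ℂ) ^ i.val) = 1 := by
      rw [← mul_pow]; simp
    rw [smul_comm ((-1 : ℂ) ^ i.val), smul_add ((-1 : ℂ) ^ i.val) x, smul_smul, h, one_smul,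
      add_comm]⟩
  map_add' x y := by
    ext; simp only [map_add, smul_add, Submodule.coe_add]; abel
  map_smul' c x := by
    ext; simp only [map_smul, smul_add, Submodule.coe_smul, RingHom.id_apply, smul_comm c]

instance Super.gradedAlgebra : GradedAlgebra (Super.part B) where
  one_mem := by rw [Super.mem_part_zero, map_one]
  mul_mem := by
    intro i j x y hx hy
    have h : ((-1 : ℂ) ^ (i + j).val) = (-1 : ℂ) ^ i.val * (-1 : ℂ) ^ j.val := by
      rw [ZMod.val_add, ← neg_one_pow_eq_pow_mod_two, pow_add]
    rw [Super.mem_part] at *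
    rw [map_mul, hx, hy, h, smul_mul_smul_comm]
  decompose' x := DirectSum.of (fun i => Super.part B i) 0 (Super.proj 0 x) +
    DirectSum.of (fun i => Super.part B i) 1 (Super.proj 1 x)
  left_inv x := by
    rw [map_add, DirectSum.coeAddMonoidHom_of, DirectSum.coeAddMonoidHom_of]
    have h1 : (1 : ZMod 2).val = 1 := rfl
    simp only [Super.proj, LinearMap.coe_mk, AddHom.coe_mk, h1, ZMod.val_zero]
    module
  right_inv x := by
    induction x using DirectSum.induction_on with
    | zero => simp
    | add x y hx hy =>
      conv_rhs => rw [← hx, ← hy]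
      simp only [map_add]
      abel
    | of i x =>
      obtain ⟨x, hx⟩ := x
      rw [DirectSum.coeAddMonoidHom_of]
      have h1 : (1 : ZMod 2).val = 1 := rfl
      fin_cases i
      · have hx' := Super.mem_part_zero.1 hx
        have e0 : Super.proj 0 x = ⟨x, hx⟩ := by
          ext; simp only [Super.proj, LinearMap.coe_mk, AddHom.coe_mk, hx', ZMod.val_zero]; module
        have e1 : Super.proj 1 x = 0 := by
          ext; simp only [Super.proj, LinearMap.coe_mk, AddHom.coe_mk, hx', h1]; simp
        simp only [e0, e1, map_zero, add_zero]; rfl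
      · have hx' := Super.mem_part_one.1 hx
        have e0 : Super.proj 1 x = ⟨x, hx⟩ := by
          ext; simp only [Super.proj, LinearMap.coe_mk, AddHom.coe_mk, hx', h1]; module
        have e1 : Super.proj 0 x = 0 := by
          ext; simp only [Super.proj, LinearMap.coe_mk, AddHom.coe_mk, hx', ZMod.val_zero]; simp
        simp only [e0, e1, map_zero, zero_add]; rfl
end

/-- The graded tensor product `B ⊗̂ B'`:
`(x ⊗ y) (x' ⊗ y') = (-1)^{∂y ∂x'} x x' ⊗ y y'`. -/
abbrev STensor (B B' : Type*) [Ring B] [Algebra ℂ B] [Super B] [Ring B'] [Algebra ℂ B']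
    [Super B'] : Type _ :=
  GradedTensorProduct ℂ (Super.part B) (Super.part B')

/-- A differential on a super algebra: an odd antiderivation with square zero. -/
structure SuperDiff (B : Type*) [Ring B] [Algebra ℂ B] [Super B] where
  d : B →ₗ[ℂ] B
  d_mul : ∀ x y, d (x * y) = d x * y + Super.par x * d y
  d_par : ∀ x, d (Super.par x) = -Super.par (d x)
  d_d : ∀ x, d (d x) = 0

namespace SuperDiff
variable {B B' : Type*} [Ring B] [Algebra ℂ B] [Super B] [Ring B'] [Algebra ℂ B'] [Super B']

theorem d_one (D : SuperDiff B) : D.d 1 = 0 := by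
  have h := D.d_mul 1 1
  simp only [mul_one, map_one, one_mul] at h
  simpa using h

/-- The complex `(N, d)` is acyclic: every cocycle is a coboundary. -/
def IsAcyclic (D : SuperDiff B) (N : Set B) : Prop :=
  ∀ w ∈ N, D.d w = 0 → ∃ w' ∈ N, D.d w' = w

/-- The algebra of cocycles of the subalgebra `S`. -/
def cocycles (D : SuperDiff B) (S : Subalgebra ℂ B) : Subalgebra ℂ B where
  carrier := {w | w ∈ S ∧ D.d w = 0}
  mul_mem' := by
    rintro x y ⟨hx, hx'⟩ ⟨hy, hy'⟩
    exact ⟨mul_mem hx hy, by rw [D.d_mul, hx', hy', zero_mul, mul_zero, add_zero]⟩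
  add_mem' := by
    rintro x y ⟨hx, hx'⟩ ⟨hy, hy'⟩
    exact ⟨add_mem hx hy, by rw [map_add, hx', hy', add_zero]⟩
  algebraMap_mem' c := ⟨S.algebraMap_mem c, by
    rw [Algebra.algebraMap_eq_smul_one, map_smul, D.d_one, smul_zero]⟩

/-- The ideal of coboundaries in the algebra of cocycles of the subalgebra `S`. -/
def coboundaries (D : SuperDiff B) (S : Subalgebra ℂ B) : TwoSidedIdeal (D.cocycles S) :=
  TwoSidedIdeal.span {z | ∃ w ∈ S, D.d w = z}

/-- The cohomology algebra `H(S)` of the subalgebra `S`. -/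
abbrev Cohomology (D : SuperDiff B) (S : Subalgebra ℂ B) : Type _ :=
  (D.coboundaries S).ringCon.Quotient

/-- The algebra homomorphism `H(S) → H(S')` induced by a homomorphism of differential algebras
that maps `S` to `S'`. -/
def cohomologyMap (D : SuperDiff B) (D' : SuperDiff B') (S : Subalgebra ℂ B)
    (S' : Subalgebra ℂ B') (f : B →ₐ[ℂ] B') (hf : ∀ x, f (D.d x) = D'.d (f x))
    (hS : ∀ x ∈ S, f x ∈ S') : D.Cohomology S →ₐ[ℂ] D'.Cohomology S' :=
  let g : D.cocycles S →ₐ[ℂ] D'.cocycles S' :=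
    (f.comp (D.cocycles S).val).codRestrict (D'.cocycles S') (fun x =>
      ⟨hS _ x.2.1, by
        change D'.d (f x) = 0
        rw [← hf, x.2.2, map_zero]⟩)
  idealLift (D.coboundaries S) (((D'.coboundaries S').ringCon.mkₐ ℂ).comp g)
    (eq_zero_of_mem_span _ (((D'.coboundaries S').ringCon.mkₐ ℂ).comp g).toRingHom (by
      rintro z ⟨w, hw, hz⟩
      have hgz : g z ∈ D'.coboundaries S' :=
        TwoSidedIdeal.subset_span ⟨f w, hS w hw, by rw [← hf, hz]; rfl⟩
      exact (RingCon.eq _).2 hgz))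
end SuperDiff

section Sweedler
variable {A M : Type*} [Ring A] [HopfAlgebra ℂ A] [AddCommGroup M] [Module ℂ M]

/-- `a ↦ ∑ ρ(a⁽¹⁾) F(a⁽²⁾)`. -/
def sweedler (ρ : A →ₗ[ℂ] M →ₗ[ℂ] M) (F : A →ₗ[ℂ] M) : A →ₗ[ℂ] M :=
  TensorProduct.lift (ρ.compl₂ F) ∘ₗ Coalgebra.comul

theorem sweedler_cancel (ρ ρ' : A →ₗ[ℂ] M →ₗ[ℂ] M) (F : A →ₗ[ℂ] M)
    (h : ∀ (a : A) (m : M), TensorProduct.lift (LinearMap.mk₂ ℂ (fun x y => ρ' x (ρ y m))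
      (by simp) (by simp) (by simp) (by simp)) (Coalgebra.comul (R := ℂ) a)
        = Coalgebra.counit (R := ℂ) a • m) :
    sweedler ρ' (sweedler ρ F) = F := by
  ext a
  let X : A ⊗[ℂ] (A ⊗[ℂ] A) →ₗ[ℂ] M :=
    TensorProduct.lift (ρ'.compl₂ (TensorProduct.lift (ρ.compl₂ F)))
  have h1 : sweedler ρ' (sweedler ρ F) a
      = X (Coalgebra.comul.lTensor A (Coalgebra.comul (R := ℂ) a)) := by
    change (TensorProduct.lift (ρ'.compl₂ (sweedler ρ F))) _ = _
    have : TensorProduct.lift (ρ'.compl₂ (sweedler ρ F))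
        = X ∘ₗ (Coalgebra.comul (R := ℂ) (A := A)).lTensor A := by
      ext x y; simp [X, sweedler]
    rw [this]; rfl
  have h2 : X ∘ₗ (TensorProduct.assoc ℂ A A A).toLinearMap ∘ₗ
      (Coalgebra.comul (R := ℂ) (A := A)).rTensor A
      = TensorProduct.lift (LinearMap.mk₂ ℂ (fun x z => Coalgebra.counit (R := ℂ) x • F z)
      (by simp [add_smul]) (by simp [mul_smul]) (by simp) (fun c x z => by rw [map_smul, smul_comm])) := by
    ext x z
    simp only [TensorProduct.AlgebraTensorModule.curry_apply, LinearMap.restrictScalars_self,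
      TensorProduct.curry_apply, LinearMap.coe_comp, Function.comp_apply,
      LinearMap.rTensor_tmul, TensorProduct.lift.tmul, LinearMap.mk₂_apply, ← h x (F z)]
    generalize Coalgebra.comul (R := ℂ) x = t
    induction t using TensorProduct.induction_on with
    | zero => simp
    | tmul x y => simp [X]
    | add s t hs ht => simp only [TensorProduct.add_tmul, map_add, hs, ht]
  rw [h1, ← Coalgebra.coassoc_apply]
  have h3 := congrArg (fun f => f (Coalgebra.comul (R := ℂ) a)) h2
  simp only [LinearMap.coe_comp, Function.comp_apply, LinearEquiv.coe_coe] at h3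
  rw [h3]
  have h4 := Coalgebra.rTensor_counit_comul (R := ℂ) a
  have h5 : TensorProduct.lift (LinearMap.mk₂ ℂ (fun x z => Coalgebra.counit (R := ℂ) x • F z)
      (by simp [add_smul]) (by simp [mul_smul]) (by simp) (fun c x z => by rw [map_smul, smul_comm]))
      = F ∘ₗ (TensorProduct.lid ℂ A).toLinearMap ∘ₗ (Coalgebra.counit (R := ℂ) (A := A)).rTensor A := by
    ext x z; simp
  rw [h5]
  simp [h4]

theorem sweedler_antipode_left (ρ : A →ₗ[ℂ] M →ₗ[ℂ] M) (h1 : ∀ m, ρ 1 m = m)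
    (hm : ∀ a b m, ρ (a * b) m = ρ a (ρ b m)) (F : A →ₗ[ℂ] M) :
    sweedler (ρ ∘ₗ HopfAlgebra.antipode ℂ) (sweedler ρ F) = F := by
  refine sweedler_cancel _ _ _ (fun a m => ?_)
  have := HopfAlgebra.mul_antipode_rTensor_comul_apply (R := ℂ) a
  have h2 := congrArg (fun x => ρ x m) this
  simp only [Algebra.algebraMap_eq_smul_one, map_smul, LinearMap.smul_apply, h1] at h2
  rw [← h2]
  generalize Coalgebra.comul (R := ℂ) a = t
  induction t using TensorProduct.induction_on with
  | zero => simp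
  | tmul x y => simp [hm]
  | add s t hs ht => simp only [map_add, hs, ht, LinearMap.add_apply]

theorem sweedler_antipode_right (ρ : A →ₗ[ℂ] M →ₗ[ℂ] M) (h1 : ∀ m, ρ 1 m = m)
    (hm : ∀ a b m, ρ (a * b) m = ρ a (ρ b m)) (F : A →ₗ[ℂ] M) :
    sweedler ρ (sweedler (ρ ∘ₗ HopfAlgebra.antipode ℂ) F) = F := by
  refine sweedler_cancel _ _ _ (fun a m => ?_)
  have := HopfAlgebra.mul_antipode_lTensor_comul_apply (R := ℂ) a
  have h2 := congrArg (fun x => ρ x m) this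
  simp only [Algebra.algebraMap_eq_smul_one, map_smul, LinearMap.smul_apply, h1] at h2
  rw [← h2]
  generalize Coalgebra.comul (R := ℂ) a = t
  induction t using TensorProduct.induction_on with
  | zero => simp
  | tmul x y => simp [hm]
  | add s t hs ht => simp only [map_add, hs, ht, LinearMap.add_apply]

end Sweedler

/-- A unitary matrix corepresentation of `A`. -/
structure IsUnitaryCorep {A : Type*} [Ring A] [HopfAlgebra ℂ A] [StarRing A] {n : ℕ}
    (u : Matrix (Fin n) (Fin n) A) : Prop where
  comul_apply : ∀ i j, Coalgebra.comul (R := ℂ) (u i j) = ∑ k, u i k ⊗ₜ[ℂ] u k j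
  counit_apply : ∀ i j, Coalgebra.counit (R := ℂ) (u i j) = if i = j then 1 else 0
  unitary : u ∈ unitary (Matrix (Fin n) (Fin n) A)

/-- `A` is the Hopf `*`-algebra of polynomial functions on a compact matrix quantum group. -/
structure IsCompactMatrixQuantumGroup (A : Type*) [Ring A] [HopfAlgebra ℂ A] [StarRing A]
    [StarModule ℂ A] : Prop where
  comul_star : ∀ a : A, Coalgebra.comul (R := ℂ) (star a) = star (Coalgebra.comul (R := ℂ) a)
  counit_star : ∀ a : A, Coalgebra.counit (R := ℂ) (star a) = star (Coalgebra.counit (R := ℂ) a)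
  /-- `A` is spanned by the matrix coefficients of its unitary corepresentations. -/
  span_coeff : Submodule.span ℂ
    {a : A | ∃ (n : ℕ) (u : Matrix (Fin n) (Fin n) A), IsUnitaryCorep u ∧ ∃ i j, a = u i j} = ⊤
  /-- The coefficients of one unitary corepresentation generate `A` as a `*`-algebra. -/
  fundamental : ∃ (n : ℕ) (u : Matrix (Fin n) (Fin n) A), IsUnitaryCorep u ∧
    StarAlgebra.adjoin ℂ {a : A | ∃ i j, a = u i j} = ⊤

section LeftModule
variable (A Γ : Type*) [Ring A] [HopfAlgebra ℂ A] [AddCommGroup Γ] [Module ℂ Γ] [Module A Γ]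
  [IsScalarTower ℂ A Γ]

/-- The left action `a, γ ↦ a γ`. -/
def lact : A →ₗ[ℂ] Γ →ₗ[ℂ] Γ :=
  LinearMap.mk₂ ℂ (fun a γ => a • γ) (fun a b γ => add_smul a b γ)
    (fun c a γ => smul_assoc c a γ) (fun a γ γ' => smul_add a γ γ')
    (fun c a γ => by rw [← algebraMap_smul A c γ, ← algebraMap_smul A c (a • γ), smul_smul,
      smul_smul, Algebra.commutes])

/-- `(x ⊗ y), (b ⊗ γ) ↦ x b ⊗ y γ`. -/
def lactL : A ⊗[ℂ] A →ₗ[ℂ] A ⊗[ℂ] Γ →ₗ[ℂ] A ⊗[ℂ] Γ :=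
  TensorProduct.map₂ (LinearMap.mul ℂ A) (lact A Γ)

theorem lactL_mul (s t : A ⊗[ℂ] A) (z : A ⊗[ℂ] Γ) :
    lactL A Γ (s * t) z = lactL A Γ s (lactL A Γ t z) := by
  induction s using TensorProduct.induction_on with
  | zero => simp
  | add s s' hs hs' => simp only [add_mul, map_add, LinearMap.add_apply, hs, hs']
  | tmul x y =>
    induction t using TensorProduct.induction_on with
    | zero => simp
    | add s s' hs hs' => simp only [mul_add, map_add, LinearMap.add_apply, hs, hs']
    | tmul x' y' =>
      induction z using TensorProduct.induction_on with
      | zero => simp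
      | add s s' hs hs' => simp only [map_add, hs, hs']
      | tmul b γ => simp [lactL, lact, mul_assoc, mul_smul]

theorem lactL_one (z : A ⊗[ℂ] Γ) : lactL A Γ 1 z = z := by
  induction z using TensorProduct.induction_on with
  | zero => simp
  | add s s' hs hs' => simp only [map_add, hs, hs']
  | tmul b γ => simp [lactL, lact, Algebra.TensorProduct.one_def]

end LeftModule

section Bimodule
variable (A Γ : Type*) [Ring A] [HopfAlgebra ℂ A] [AddCommGroup Γ] [Module ℂ Γ] [Module A Γ]
  [Module Aᵐᵒᵖ Γ] [IsScalarTower ℂ A Γ] [IsScalarTower ℂ Aᵐᵒᵖ Γ]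

/-- The right action `a, γ ↦ γ a`. -/
def ract : A →ₗ[ℂ] Γ →ₗ[ℂ] Γ :=
  LinearMap.mk₂ ℂ (fun a γ => MulOpposite.op a • γ)
    (fun a b γ => by rw [MulOpposite.op_add, add_smul])
    (fun c a γ => by rw [MulOpposite.op_smul, smul_assoc]) (fun a γ γ' => smul_add _ γ γ')
    (fun c a γ => by rw [← algebraMap_smul Aᵐᵒᵖ c γ, ← algebraMap_smul Aᵐᵒᵖ c (_ • γ), smul_smul,
      smul_smul, Algebra.commutes])

/-- `(x ⊗ y), (b ⊗ γ) ↦ b x ⊗ γ y`. -/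
def ractL : A ⊗[ℂ] A →ₗ[ℂ] A ⊗[ℂ] Γ →ₗ[ℂ] A ⊗[ℂ] Γ :=
  TensorProduct.map₂ (LinearMap.mul ℂ A).flip (ract A Γ)

/-- `(x ⊗ y), (γ ⊗ b) ↦ x γ ⊗ y b`. -/
def lactR : A ⊗[ℂ] A →ₗ[ℂ] Γ ⊗[ℂ] A →ₗ[ℂ] Γ ⊗[ℂ] A :=
  TensorProduct.map₂ (lact A Γ) (LinearMap.mul ℂ A)

/-- `(x ⊗ y), (γ ⊗ b) ↦ γ x ⊗ b y`. -/
def ractR : A ⊗[ℂ] A →ₗ[ℂ] Γ ⊗[ℂ] A →ₗ[ℂ] Γ ⊗[ℂ] A :=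
  TensorProduct.map₂ (ract A Γ) (LinearMap.mul ℂ A).flip

end Bimodule

/-- A first-order bicovariant `*`-calculus `(Γ, d)` over the quantum group represented by the
Hopf `*`-algebra `A`: `Γ` is an `A`-bimodule, `d : A → Γ` a derivation whose image generates `Γ`,
with a compatible `*`-structure on `Γ`; the left and right actions
`ℓ_Γ : Γ → A ⊗ Γ` and `℘_Γ : Γ → Γ ⊗ A` make `Γ` a bicovariant bimodule and `d` bicovariant. -/
structure BicovariantStarCalculus (A Γ : Type*) [Ring A] [HopfAlgebra ℂ A] [StarRing A]
    [AddCommGroup Γ] [Module ℂ Γ] [Module A Γ] [Module Aᵐᵒᵖ Γ] [SMulCommClass A Aᵐᵒᵖ Γ]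
    [IsScalarTower ℂ A Γ] [IsScalarTower ℂ Aᵐᵒᵖ Γ] where
  d : A →ₗ[ℂ] Γ
  d_mul : ∀ a b : A, d (a * b) = MulOpposite.op b • d a + a • d b
  span_d : Submodule.span A (Set.range d) = ⊤
  /-- The `*`-structure; it is determined by `(a db)^* = d(b^*) a^*`. -/
  starMap : Γ →+ Γ
  star_smul_d : ∀ a b : A, starMap (a • d b) = MulOpposite.op (star a) • d (star b)
  lco : Γ →ₗ[ℂ] A ⊗[ℂ] Γ
  rco : Γ →ₗ[ℂ] Γ ⊗[ℂ] A
  lco_coassoc : ∀ γ, TensorProduct.assoc ℂ A A Γ ((Coalgebra.comul (R := ℂ)).rTensor Γ (lco γ))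
    = lco.lTensor A (lco γ)
  lco_counit : ∀ γ, TensorProduct.lid ℂ Γ ((Coalgebra.counit (R := ℂ)).rTensor Γ (lco γ)) = γ
  rco_coassoc : ∀ γ, TensorProduct.assoc ℂ Γ A A (rco.rTensor A (rco γ))
    = (Coalgebra.comul (R := ℂ)).lTensor Γ (rco γ)
  rco_counit : ∀ γ, TensorProduct.rid ℂ Γ ((Coalgebra.counit (R := ℂ)).lTensor Γ (rco γ)) = γ
  lco_rco : ∀ γ, TensorProduct.assoc ℂ A Γ A (lco.rTensor A (rco γ)) = rco.lTensor A (lco γ)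
  lco_smul : ∀ (a : A) γ, lco (a • γ) = lactL A Γ (Coalgebra.comul (R := ℂ) a) (lco γ)
  lco_op_smul : ∀ (a : A) γ,
    lco (MulOpposite.op a • γ) = ractL A Γ (Coalgebra.comul (R := ℂ) a) (lco γ)
  rco_smul : ∀ (a : A) γ, rco (a • γ) = lactR A Γ (Coalgebra.comul (R := ℂ) a) (rco γ)
  rco_op_smul : ∀ (a : A) γ,
    rco (MulOpposite.op a • γ) = ractR A Γ (Coalgebra.comul (R := ℂ) a) (rco γ)
  lco_d : ∀ a : A, lco (d a) = d.lTensor A (Coalgebra.comul (R := ℂ) a)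
  rco_d : ∀ a : A, rco (d a) = d.rTensor A (Coalgebra.comul (R := ℂ) a)

namespace BicovariantStarCalculus
variable {A Γ : Type*} [Ring A] [HopfAlgebra ℂ A] [StarRing A]
    [AddCommGroup Γ] [Module ℂ Γ] [Module A Γ] [Module Aᵐᵒᵖ Γ] [SMulCommClass A Aᵐᵒᵖ Γ]
    [IsScalarTower ℂ A Γ] [IsScalarTower ℂ Aᵐᵒᵖ Γ] (C : BicovariantStarCalculus A Γ)

/-- The space `Γ_inv` of left-invariant elements of `Γ`. -/
def inv : Submodule ℂ Γ := LinearMap.ker (C.lco - TensorProduct.mk ℂ A Γ 1)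

theorem mem_inv {γ : Γ} : γ ∈ C.inv ↔ C.lco γ = 1 ⊗ₜ γ := by
  simp [inv, sub_eq_zero]

/-- If `ℓ_Γ(m(a)) = ∑ a⁽¹⁾ ⊗ m(a⁽²⁾)`, then `∑ κ(a⁽¹⁾) m(a⁽²⁾)` is left-invariant. -/
theorem sweedler_mem_inv (m : A →ₗ[ℂ] Γ)
    (hm : ∀ a, C.lco (m a) = m.lTensor A (Coalgebra.comul (R := ℂ) a)) (a : A) :
    sweedler (lact A Γ ∘ₗ HopfAlgebra.antipode ℂ) m a ∈ C.inv := by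
  rw [mem_inv]
  set y := sweedler (lact A Γ ∘ₗ HopfAlgebra.antipode ℂ) m with hy
  have hmy : m = sweedler (lact A Γ) y :=
    (sweedler_antipode_right (lact A Γ) (by simp [lact]) (by simp [lact, mul_smul]) m).symm
  let ρ : A →ₗ[ℂ] (A ⊗[ℂ] Γ) →ₗ[ℂ] (A ⊗[ℂ] Γ) := lactL A Γ ∘ₗ Coalgebra.comul
  have hρ1 : ∀ z, ρ 1 z = z := fun z => by simp [ρ, lactL_one]
  have hρm : ∀ a b z, ρ (a * b) z = ρ a (ρ b z) := fun a b z => by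
    simp [ρ, lactL_mul]
  let F₁ : A →ₗ[ℂ] A ⊗[ℂ] Γ := C.lco ∘ₗ y
  let F₂ : A →ₗ[ℂ] A ⊗[ℂ] Γ := TensorProduct.mk ℂ A Γ 1 ∘ₗ y
  have e₁ : sweedler ρ F₁ = C.lco ∘ₗ m := by
    ext a
    conv_rhs => rw [hmy]
    simp only [sweedler, LinearMap.coe_comp, Function.comp_apply]
    generalize Coalgebra.comul (R := ℂ) a = t
    induction t using TensorProduct.induction_on with
    | zero => simp
    | tmul x z => simp [ρ, F₁, lact, lco_smul]
    | add s t hs ht => simp only [map_add, hs, ht]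
  have e₂ : sweedler ρ F₂ = C.lco ∘ₗ m := by
    ext a
    simp only [LinearMap.coe_comp, Function.comp_apply, hm]
    have hm2 : m.lTensor A = (TensorProduct.lift ((lact A Γ).compl₂ y)).lTensor A
        ∘ₗ (Coalgebra.comul (R := ℂ) (A := A)).lTensor A := by
      rw [← LinearMap.lTensor_comp]
      conv_lhs => rw [hmy]
      rfl
    rw [hm2]
    simp only [LinearMap.coe_comp, Function.comp_apply]
    rw [← Coalgebra.coassoc_apply]
    simp only [sweedler, LinearMap.coe_comp, Function.comp_apply]
    generalize Coalgebra.comul (R := ℂ) a = t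
    induction t using TensorProduct.induction_on with
    | zero => simp
    | add s t hs ht => simp only [map_add, hs, ht]
    | tmul x z =>
      simp only [TensorProduct.lift.tmul, LinearMap.compl₂_apply, ρ, F₂, LinearMap.coe_comp,
        Function.comp_apply, LinearMap.rTensor_tmul, TensorProduct.mk_apply]
      generalize Coalgebra.comul (R := ℂ) x = t
      induction t using TensorProduct.induction_on with
      | zero => simp
      | add s t hs ht => simp only [map_add, hs, ht, LinearMap.add_apply, TensorProduct.add_tmul]
      | tmul x x' => simp [lactL, lact]
  have e : F₁ = F₂ := by
    rw [← sweedler_antipode_left ρ hρ1 hρm F₁, ← sweedler_antipode_left ρ hρ1 hρm F₂, e₁, e₂]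
  exact congrArg (fun f => f a) e

/-- The right `A`-module structure `ϑ ∘ a = ∑ κ(a⁽¹⁾) ϑ a⁽²⁾` on `Γ_inv`. -/
def circ : C.inv ⊗[ℂ] A →ₗ[ℂ] C.inv :=
  TensorProduct.lift (LinearMap.mk₂ ℂ
    (fun ϑ a => ⟨sweedler (lact A Γ ∘ₗ HopfAlgebra.antipode ℂ) ((ract A Γ).flip ϑ.1) a,
      C.sweedler_mem_inv _ (fun b => by
        simp only [LinearMap.flip_apply]
        change C.lco (MulOpposite.op b • ϑ.1) = _
        rw [lco_op_smul, C.mem_inv.1 ϑ.2]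
        generalize Coalgebra.comul (R := ℂ) b = t
        induction t using TensorProduct.induction_on with
        | zero => simp
        | tmul x z => simp [ractL]
        | add s t hs ht => simp only [map_add, hs, ht, LinearMap.add_apply]) a⟩)
    (fun ϑ ϑ' a => by
      ext
      simp only [sweedler, LinearMap.coe_comp, Function.comp_apply, Submodule.coe_add, map_add]
      generalize Coalgebra.comul (R := ℂ) a = t
      induction t using TensorProduct.induction_on with
      | zero => simp
      | tmul x z => simp
      | add s t hs ht => simp only [map_add, hs, ht]; abel)
    (fun c ϑ a => by
      ext
      simp only [sweedler, LinearMap.coe_comp, Function.comp_apply, Submodule.coe_smul, map_smul]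
      generalize Coalgebra.comul (R := ℂ) a = t
      induction t using TensorProduct.induction_on with
      | zero => simp
      | tmul x z => simp
      | add s t hs ht => simp only [map_add, hs, ht, smul_add])
    (fun ϑ a b => by ext; simp)
    (fun c ϑ a => by ext; simp))

theorem inv_rTensor_injective : Function.Injective (C.inv.subtype.rTensor A) :=
  Module.Flat.rTensor_preserves_injective_linearMap _ (Submodule.injective_subtype _)

theorem rco_mem (γ : C.inv) :
    C.rco γ ∈ LinearMap.range (C.inv.subtype.rTensor A) := by
  have hex : Function.Exact C.inv.subtype (C.lco - TensorProduct.mk ℂ A Γ 1) := by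
    rw [LinearMap.exact_iff, Submodule.range_subtype]; rfl
  have h := (Module.Flat.rTensor_exact A hex) (C.rco γ)
  refine h.1 ?_
  apply (TensorProduct.assoc ℂ A Γ A).injective
  rw [LinearMap.rTensor_sub]
  change TensorProduct.assoc ℂ A Γ A (C.lco.rTensor A (C.rco γ)
    - (TensorProduct.mk ℂ A Γ 1).rTensor A (C.rco γ)) = TensorProduct.assoc ℂ A Γ A 0
  rw [map_sub, C.lco_rco, C.mem_inv.1 γ.2, map_zero, sub_eq_zero, LinearMap.lTensor_tmul]
  generalize C.rco γ = t
  induction t using TensorProduct.induction_on with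
  | zero => simp
  | tmul x z => simp
  | add s t hs ht => simp only [map_add, ← hs, ← ht, TensorProduct.tmul_add]

/-- The adjoint action `ϖ : Γ_inv → Γ_inv ⊗ A`, the restriction of `℘_Γ`. -/
def varpi : C.inv →ₗ[ℂ] C.inv ⊗[ℂ] A :=
  (LinearEquiv.ofInjective _ C.inv_rTensor_injective).symm.toLinearMap ∘ₗ
    (C.rco ∘ₗ C.inv.subtype).codRestrict (LinearMap.range (C.inv.subtype.rTensor A)) C.rco_mem

/-- The defining property of `ϖ`. -/
theorem varpi_spec (ϑ : C.inv) : C.inv.subtype.rTensor A (C.varpi ϑ) = C.rco ϑ := by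
  have := LinearEquiv.apply_symm_apply (LinearEquiv.ofInjective _ C.inv_rTensor_injective)
    ((C.rco ∘ₗ C.inv.subtype).codRestrict
      (LinearMap.range (C.inv.subtype.rTensor A)) C.rco_mem ϑ)
  exact congrArg Subtype.val this

/-- The braiding `σ(η ⊗ ϑ) = ∑ ϑ_k ⊗ (η ∘ c_k)`, where `ϖ(ϑ) = ∑ ϑ_k ⊗ c_k`. -/
def braid : C.inv ⊗[ℂ] C.inv →ₗ[ℂ] C.inv ⊗[ℂ] C.inv :=
  C.circ.lTensor C.inv ∘ₗ (TensorProduct.leftComm ℂ C.inv C.inv A).toLinearMap ∘ₗ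
    C.varpi.lTensor C.inv

/-- The matrix coefficients `(f ⊗ id) ϖ(ϑ)` of the adjoint action `ϖ`. -/
def adCoeff : Set A :=
  {a | ∃ (f : C.inv →ₗ[ℂ] ℂ) (ϑ : C.inv), a = TensorProduct.lid ℂ A (f.rTensor A (C.varpi ϑ))}

/-- Connectedness of the quantum group as far as its adjoint action `ϖ` can see it: in the
subalgebra generated by the matrix coefficients of `ϖ`, only scalars are annihilated by `d`.
This holds in particular if only scalars are annihilated by `d : A → Γ`. -/
def AdConnected : Prop :=
  ∀ a ∈ Algebra.adjoin ℂ C.adCoeff, C.d a = 0 → ∃ c : ℂ, a = algebraMap ℂ A c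

end BicovariantStarCalculus

/-- An endomorphism that is an involution on generators is an involution. -/
theorem par_par_of_adjoin {B : Type*} [Ring B] [Algebra ℂ B] (p : B →ₐ[ℂ] B) (s : Set B)
    (hs : Algebra.adjoin ℂ s = ⊤) (h : ∀ x ∈ s, p (p x) = x) (x : B) : p (p x) = x := by
  have := AlgHom.ext_of_adjoin_eq_top (φ₁ := p.comp p) (φ₂ := AlgHom.id ℂ B) hs h
  exact congrArg (fun f => f x) this

/-- A differential from its values on generators; `Φ x` is the matrix with rows `par x, d x`
and `0, x`. -/
def SuperDiff.ofHom {B : Type*} [Ring B] [Algebra ℂ B] [Super B]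
    (Φ : B →ₐ[ℂ] Matrix (Fin 2) (Fin 2) B) (s : Set B) (hs : Algebra.adjoin ℂ s = ⊤)
    (h00 : ∀ x ∈ s, Φ x 0 0 = Super.par x) (h10 : ∀ x ∈ s, Φ x 1 0 = 0)
    (h11 : ∀ x ∈ s, Φ x 1 1 = x) (hpar : ∀ x ∈ s, Φ (Super.par x) 0 1 = -Super.par (Φ x 0 1))
    (hdd : ∀ x ∈ s, Φ (Φ x 0 1) 0 1 = 0) : SuperDiff B :=
  have key : ∀ x, Φ x 0 0 = Super.par x ∧ Φ x 1 0 = 0 ∧ Φ x 1 1 = x := by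
    intro x
    have hx : x ∈ Algebra.adjoin ℂ s := hs ▸ Algebra.mem_top
    induction hx using Algebra.adjoin_induction with
    | mem x hx => exact ⟨h00 x hx, h10 x hx, h11 x hx⟩
    | algebraMap r =>
      simp [Matrix.algebraMap_matrix_apply]
    | add x y _ _ hx hy => simp [hx, hy]
    | mul x y _ _ hx hy => simp [Matrix.mul_apply, hx, hy]
  have hmul : ∀ x y, Φ (x * y) 0 1 = Φ x 0 1 * y + Super.par x * Φ y 0 1 := by
    intro x y
    rw [map_mul, Matrix.mul_apply, Fin.sum_univ_two, (key x).1, (key y).2.2, add_comm]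
  have hpar' : ∀ x, Φ (Super.par x) 0 1 = -Super.par (Φ x 0 1) := by
    intro x
    have hx : x ∈ Algebra.adjoin ℂ s := hs ▸ Algebra.mem_top
    induction hx using Algebra.adjoin_induction with
    | mem x hx => exact hpar x hx
    | algebraMap r => simp [Matrix.algebraMap_matrix_apply]
    | add x y _ _ hx hy => simp only [map_add, Matrix.add_apply, hx, hy]; abel
    | mul x y _ _ hx hy => simp only [map_mul, hmul, hx, hy, map_add]; noncomm_ring
  { d :=
      { toFun := fun x => Φ x 0 1
        map_add' := fun x y => by simp
        map_smul' := fun c x => by simp }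
    d_mul := hmul
    d_par := hpar'
    d_d := by
      intro x
      change Φ (Φ x 0 1) 0 1 = 0
      have hx : x ∈ Algebra.adjoin ℂ s := hs ▸ Algebra.mem_top
      induction hx using Algebra.adjoin_induction with
      | mem x hx => exact hdd x hx
      | algebraMap r => simp [Matrix.algebraMap_matrix_apply]
      | add x y _ _ hx hy => simp only [map_add, Matrix.add_apply, hx, hy, add_zero]
      | mul x y _ _ hx hy =>
        rw [hmul, map_add, Matrix.add_apply, hmul, hmul, hx, hy, hpar']
        simp }

namespace BicovariantStarCalculus
variable {A Γ : Type*} [Ring A] [HopfAlgebra ℂ A] [StarRing A]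
    [AddCommGroup Γ] [Module ℂ Γ] [Module A Γ] [Module Aᵐᵒᵖ Γ] [SMulCommClass A Aᵐᵒᵖ Γ]
    [IsScalarTower ℂ A Γ] [IsScalarTower ℂ Aᵐᵒᵖ Γ] (C : BicovariantStarCalculus A Γ)

theorem d_one : C.d 1 = 0 := by
  have h := C.d_mul 1 1
  simp only [mul_one, MulOpposite.op_one, one_smul] at h
  simpa using h

/-- `a ⊗ b ↦ a d(b)`. -/
def smulD : A ⊗[ℂ] A →ₗ[ℂ] Γ := TensorProduct.lift ((lact A Γ).compl₂ C.d)

theorem smulD_tmul (a b : A) : C.smulD (a ⊗ₜ b) = a • C.d b := rfl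

theorem smulD_surjective : Function.Surjective C.smulD := by
  intro γ
  have hγ : γ ∈ Submodule.span A (Set.range C.d) := C.span_d ▸ Submodule.mem_top
  induction hγ using Submodule.span_induction with
  | mem x hx => obtain ⟨b, rfl⟩ := hx; exact ⟨1 ⊗ₜ b, by rw [smulD_tmul, one_smul]⟩
  | zero => exact ⟨0, map_zero _⟩
  | add x y _ _ hx hy =>
    obtain ⟨s, rfl⟩ := hx; obtain ⟨t, rfl⟩ := hy; exact ⟨s + t, map_add _ _ _⟩
  | smul a x _ hx =>
    obtain ⟨s, rfl⟩ := hx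
    clear * -
    refine ⟨(LinearMap.mulLeft ℂ a).rTensor A s, ?_⟩
    induction s using TensorProduct.induction_on with
    | zero => simp
    | tmul x y => simp [smulD_tmul, mul_smul]
    | add s t hs ht => simp only [map_add, hs, ht, smul_add]

/-! ### The universal differential envelope -/

/-- The generator of `Γ^∧` given by an element of `A`, in the free algebra on `A` and `Γ`. -/
def preA : A →ₗ[ℂ] TensorAlgebra ℂ (A × Γ) := TensorAlgebra.ι ℂ ∘ₗ LinearMap.inl ℂ A Γ

/-- The generator of `Γ^∧` given by an element of `Γ`, in the free algebra on `A` and `Γ`. -/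
def preΓ : Γ →ₗ[ℂ] TensorAlgebra ℂ (A × Γ) := TensorAlgebra.ι ℂ ∘ₗ LinearMap.inr ℂ A Γ

/-- The relations of `Γ^∧`: those of the tensor algebra of the bimodule `Γ` over `A`, and
`∑ d(a_k) d(b_k) = 0` whenever `∑ a_k d(b_k) = 0` in `Γ`. -/
inductive EnvRel : TensorAlgebra ℂ (A × Γ) → TensorAlgebra ℂ (A × Γ) → Prop
  | one : EnvRel (preA 1) 1
  | mul (a b : A) : EnvRel (preA (a * b)) (preA a * preA b)
  | left (a : A) (γ : Γ) : EnvRel (preΓ (a • γ)) (preA a * preΓ γ)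
  | right (a : A) (γ : Γ) : EnvRel (preΓ (MulOpposite.op a • γ)) (preΓ γ * preA a)
  | quad (t : A ⊗[ℂ] A) (ht : C.smulD t = 0) :
      EnvRel (TensorProduct.lift ((LinearMap.mul ℂ _).compl₁₂ (preΓ ∘ₗ C.d) (preΓ ∘ₗ C.d)) t) 0

/-- The universal differential envelope `Γ^∧` of `(Γ, d)`. -/
def Env : Type _ := RingQuot C.EnvRel

instance : Ring C.Env := inferInstanceAs (Ring (RingQuot C.EnvRel))
instance : Algebra ℂ C.Env := inferInstanceAs (Algebra ℂ (RingQuot C.EnvRel))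

/-- The quotient map from the free algebra. -/
def envMk : TensorAlgebra ℂ (A × Γ) →ₐ[ℂ] C.Env := RingQuot.mkAlgHom ℂ C.EnvRel

/-- The inclusion of `A` in `Γ^∧`. -/
def gA : A →ₗ[ℂ] C.Env := C.envMk.toLinearMap ∘ₗ preA

/-- The inclusion of `Γ` in `Γ^∧`. -/
def gΓ : Γ →ₗ[ℂ] C.Env := C.envMk.toLinearMap ∘ₗ preΓ

theorem envMk_rel {x y : TensorAlgebra ℂ (A × Γ)} (h : C.EnvRel x y) : C.envMk x = C.envMk y :=
  RingQuot.mkAlgHom_rel ℂ h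

theorem gA_one : C.gA 1 = 1 := by simpa [gA] using C.envMk_rel .one

theorem gA_mul (a b : A) : C.gA (a * b) = C.gA a * C.gA b := by
  simpa [gA] using C.envMk_rel (.mul a b)

theorem gΓ_smul (a : A) (γ : Γ) : C.gΓ (a • γ) = C.gA a * C.gΓ γ := by
  simpa [gA, gΓ] using C.envMk_rel (.left a γ)

theorem gΓ_op_smul (a : A) (γ : Γ) : C.gΓ (MulOpposite.op a • γ) = C.gΓ γ * C.gA a := by
  simpa [gA, gΓ] using C.envMk_rel (.right a γ)

/-- `a ⊗ b ↦ d(a) d(b)`. -/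
def dd : A ⊗[ℂ] A →ₗ[ℂ] C.Env :=
  TensorProduct.lift ((LinearMap.mul ℂ _).compl₁₂ (C.gΓ ∘ₗ C.d) (C.gΓ ∘ₗ C.d))

theorem dd_tmul (a b : A) : C.dd (a ⊗ₜ b) = C.gΓ (C.d a) * C.gΓ (C.d b) := rfl

theorem dd_eq_zero (t : A ⊗[ℂ] A) (ht : C.smulD t = 0) : C.dd t = 0 := by
  have h := C.envMk_rel (.quad t ht)
  rw [map_zero] at h
  rw [← h]
  have e : C.dd = C.envMk.toLinearMap ∘ₗ
      TensorProduct.lift ((LinearMap.mul ℂ _).compl₁₂ (preΓ ∘ₗ C.d) (preΓ ∘ₗ C.d)) := by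
    ext a b; simp [dd, gΓ]
  exact congrArg (fun f => f t) e

/-- A homomorphism out of `Γ^∧` from its values on generators. -/
def envLift {P : Type*} [Ring P] [Algebra ℂ P] (f : A →ₗ[ℂ] P) (g : Γ →ₗ[ℂ] P) (h1 : f 1 = 1)
    (hm : ∀ a b, f (a * b) = f a * f b) (hl : ∀ a γ, g (a • γ) = f a * g γ)
    (hr : ∀ (a : A) γ, g (MulOpposite.op a • γ) = g γ * f a)
    (hq : ∀ t, C.smulD t = 0 →
      TensorProduct.lift ((LinearMap.mul ℂ P).compl₁₂ (g ∘ₗ C.d) (g ∘ₗ C.d)) t = 0) :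
    C.Env →ₐ[ℂ] P :=
  RingQuot.liftAlgHom ℂ ⟨TensorAlgebra.lift ℂ (f.coprod g), by
    intro x y h
    induction h with
    | one => simp [preA, h1]
    | mul a b => simp [preA, hm]
    | left a γ => simp [preA, preΓ, hl]
    | right a γ => simp [preA, preΓ, hr]
    | quad t ht =>
      rw [map_zero, ← hq t ht]
      have e : (TensorAlgebra.lift ℂ (f.coprod g)).toLinearMap ∘ₗ
          TensorProduct.lift ((LinearMap.mul ℂ _).compl₁₂ (preΓ ∘ₗ C.d) (preΓ ∘ₗ C.d)) =
          TensorProduct.lift ((LinearMap.mul ℂ P).compl₁₂ (g ∘ₗ C.d) (g ∘ₗ C.d)) := by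
        ext a b; simp [preΓ]
      exact congrArg (fun f => f t) e⟩

section
variable {P : Type*} [Ring P] [Algebra ℂ P] (f : A →ₗ[ℂ] P) (g : Γ →ₗ[ℂ] P) (h1 : f 1 = 1)
    (hm : ∀ a b, f (a * b) = f a * f b) (hl : ∀ a γ, g (a • γ) = f a * g γ)
    (hr : ∀ (a : A) γ, g (MulOpposite.op a • γ) = g γ * f a)
    (hq : ∀ t, C.smulD t = 0 →
      TensorProduct.lift ((LinearMap.mul ℂ P).compl₁₂ (g ∘ₗ C.d) (g ∘ₗ C.d)) t = 0)

theorem envLift_gA (a : A) : C.envLift f g h1 hm hl hr hq (C.gA a) = f a := by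
  change (RingQuot.liftAlgHom ℂ _) (RingQuot.mkAlgHom ℂ C.EnvRel _) = _
  rw [RingQuot.liftAlgHom_mkAlgHom_apply]
  simp [preA]

theorem envLift_gΓ (γ : Γ) : C.envLift f g h1 hm hl hr hq (C.gΓ γ) = g γ := by
  change (RingQuot.liftAlgHom ℂ _) (RingQuot.mkAlgHom ℂ C.EnvRel _) = _
  rw [RingQuot.liftAlgHom_mkAlgHom_apply]
  simp [preΓ]
end

/-- The generators of `Γ^∧`. -/
def envGen : Set C.Env := Set.range C.gA ∪ Set.range C.gΓ

theorem adjoin_envGen : Algebra.adjoin ℂ C.envGen = ⊤ := by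
  refine eq_top_iff.2 fun x hx => ?_
  clear hx
  obtain ⟨y, rfl⟩ : ∃ y, C.envMk y = x := RingQuot.mkAlgHom_surjective ℂ C.EnvRel x
  induction y using TensorAlgebra.induction with
  | algebraMap r => rw [AlgHom.commutes]; exact Subalgebra.algebraMap_mem _ r
  | ι m =>
    have : C.envMk (TensorAlgebra.ι ℂ m) = C.gA m.1 + C.gΓ m.2 := by
      simp [gA, gΓ, preA, preΓ, ← map_add]
    rw [this]
    exact add_mem (Algebra.subset_adjoin (.inl ⟨_, rfl⟩)) (Algebra.subset_adjoin (.inr ⟨_, rfl⟩))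
  | mul a b ha hb => rw [map_mul]; exact mul_mem ha hb
  | add a b ha hb => rw [map_add]; exact add_mem ha hb

/-- The parity automorphism of `Γ^∧`: elements of `A` are even, elements of `Γ` are odd. -/
def envPar : C.Env →ₐ[ℂ] C.Env :=
  C.envLift C.gA (-C.gΓ) C.gA_one C.gA_mul (fun a γ => by simp [gΓ_smul])
    (fun a γ => by simp [gΓ_op_smul]) (fun t ht => by
      rw [← C.dd_eq_zero t ht]
      have e : TensorProduct.lift ((LinearMap.mul ℂ _).compl₁₂ (-C.gΓ ∘ₗ C.d) (-C.gΓ ∘ₗ C.d))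
          = C.dd := by
        ext a b; simp [dd]
      exact congrArg (fun f => f t) e)

theorem envPar_gA (a : A) : C.envPar (C.gA a) = C.gA a := C.envLift_gA _ _ _ _ _ _ _ a

theorem envPar_gΓ (γ : Γ) : C.envPar (C.gΓ γ) = -C.gΓ γ := C.envLift_gΓ _ _ _ _ _ _ _ γ

instance : Super C.Env where
  par := C.envPar
  par_par := par_par_of_adjoin C.envPar C.envGen C.adjoin_envGen (by
    rintro _ (⟨a, rfl⟩ | ⟨γ, rfl⟩)
    · rw [envPar_gA, envPar_gA]
    · rw [envPar_gΓ, map_neg, envPar_gΓ, neg_neg])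

/-- The differential of `Γ^∧` on `Γ`: `d(a d(b)) = d(a) d(b)`. -/
def d1 : Γ →ₗ[ℂ] C.Env :=
  (LinearMap.ker C.smulD).liftQ C.dd (fun t ht => C.dd_eq_zero t ht) ∘ₗ
    (C.smulD.quotKerEquivOfSurjective C.smulD_surjective).symm.toLinearMap

theorem d1_smulD (t : A ⊗[ℂ] A) : C.d1 (C.smulD t) = C.dd t := by
  have : (C.smulD.quotKerEquivOfSurjective C.smulD_surjective).symm (C.smulD t)
      = (LinearMap.ker C.smulD).mkQ t := by
    rw [LinearEquiv.symm_apply_eq]; rfl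
  simp only [d1, LinearMap.coe_comp, Function.comp_apply, LinearEquiv.coe_coe, this]
  rfl

theorem d1_smul_d (a b : A) : C.d1 (a • C.d b) = C.gΓ (C.d a) * C.gΓ (C.d b) :=
  C.d1_smulD (a ⊗ₜ b)

theorem d1_d (b : A) : C.d1 (C.d b) = 0 := by
  have := C.d1_smul_d 1 b
  rwa [one_smul, d_one, map_zero, zero_mul] at this

theorem d1_smul (a : A) (γ : Γ) :
    C.d1 (a • γ) = C.gΓ (C.d a) * C.gΓ γ + C.gA a * C.d1 γ := by
  obtain ⟨t, rfl⟩ := C.smulD_surjective γ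
  induction t using TensorProduct.induction_on with
  | zero => simp
  | tmul x y =>
    rw [smulD_tmul, smul_smul, d1_smul_d, d1_smul_d, C.d_mul, map_add, gΓ_op_smul, gΓ_smul, gΓ_smul]
    noncomm_ring
  | add s t hs ht => simp only [map_add, smul_add, hs, ht]; noncomm_ring

theorem d1_op_smul (a : A) (γ : Γ) :
    C.d1 (MulOpposite.op a • γ) = C.d1 γ * C.gA a - C.gΓ γ * C.gΓ (C.d a) := by
  obtain ⟨t, rfl⟩ := C.smulD_surjective γ
  induction t using TensorProduct.induction_on with
  | zero => simp
  | tmul x y =>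
    have h : MulOpposite.op a • (x • C.d y) = x • C.d (y * a) - (x * y) • C.d a := by
      rw [C.d_mul, smul_add, smul_smul, add_sub_cancel_right,
        ← smul_comm x]
    rw [smulD_tmul, h, map_sub, d1_smul_d, d1_smul_d, d1_smul_d, C.d_mul, C.d_mul, map_add,
      map_add, gΓ_op_smul, gΓ_op_smul, gΓ_smul, gΓ_smul]
    noncomm_ring
  | add s t hs ht => simp only [map_add, smul_add, hs, ht]; noncomm_ring

/-- The matrix of a linear map with entries `p`, `q`, `0`, `r`. -/
def mat2 {M P : Type*} [AddCommGroup M] [Module ℂ M] [Ring P] [Algebra ℂ P] (p q r : M →ₗ[ℂ] P) :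
    M →ₗ[ℂ] Matrix (Fin 2) (Fin 2) P where
  toFun x := !![p x, q x; 0, r x]
  map_add' x y := by ext i j; fin_cases i <;> fin_cases j <;> simp
  map_smul' c x := by ext i j; fin_cases i <;> fin_cases j <;> simp

/-- The homomorphism that encodes the differential of `Γ^∧`. -/
def envMat : C.Env →ₐ[ℂ] Matrix (Fin 2) (Fin 2) C.Env :=
  C.envLift (mat2 C.gA (C.gΓ ∘ₗ C.d) C.gA) (mat2 (-C.gΓ) C.d1 C.gΓ)
    (by
      ext i j; fin_cases i <;> fin_cases j <;> simp [mat2, gA_one, d_one])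
    (fun a b => by
      ext i j; fin_cases i <;> fin_cases j <;>
        simp [mat2, gA_mul, C.d_mul, gΓ_smul, gΓ_op_smul, add_comm])
    (fun a b => by
      ext i j; fin_cases i <;> fin_cases j <;> simp [mat2, gΓ_smul, d1_smul, add_comm])
    (fun a b => by
      ext i j; fin_cases i <;> fin_cases j <;>
        simp [mat2, gΓ_op_smul, d1_op_smul, sub_eq_add_neg, add_comm])
    (fun t ht => by
      have e : TensorProduct.lift ((LinearMap.mul ℂ _).compl₁₂
          (mat2 (-C.gΓ) C.d1 C.gΓ ∘ₗ C.d) (mat2 (-C.gΓ) C.d1 C.gΓ ∘ₗ C.d)) = mat2 C.dd 0 C.dd := by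
        ext a b i j
        fin_cases i <;> fin_cases j <;> simp [mat2, dd, d1_d]
      rw [e]
      ext i j
      fin_cases i <;> fin_cases j <;> simp [mat2, C.dd_eq_zero t ht])

theorem envMat_gA (a : A) : C.envMat (C.gA a) = !![C.gA a, C.gΓ (C.d a); 0, C.gA a] :=
  C.envLift_gA _ _ _ _ _ _ _ a

theorem envMat_gΓ (γ : Γ) : C.envMat (C.gΓ γ) = !![-C.gΓ γ, C.d1 γ; 0, C.gΓ γ] :=
  C.envLift_gΓ _ _ _ _ _ _ _ γ

theorem d1_even (γ : Γ) : Super.par (C.d1 γ) = C.d1 γ := by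
  obtain ⟨t, rfl⟩ := C.smulD_surjective γ
  induction t using TensorProduct.induction_on with
  | zero => simp
  | tmul x y =>
    rw [smulD_tmul, d1_smul_d, map_mul]
    change C.envPar _ * C.envPar _ = _
    rw [envPar_gΓ, envPar_gΓ, neg_mul_neg]
  | add s t hs ht => simp only [map_add, hs, ht]

/-- The differential of `Γ^∧`; it extends `d : A → Γ`. -/
def envDiff : SuperDiff C.Env :=
  SuperDiff.ofHom C.envMat C.envGen C.adjoin_envGen
    (by
      rintro _ (⟨a, rfl⟩ | ⟨γ, rfl⟩)
      · rw [envMat_gA]; exact (C.envPar_gA a).symm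
      · rw [envMat_gΓ]; exact (C.envPar_gΓ γ).symm)
    (by
      rintro _ (⟨a, rfl⟩ | ⟨γ, rfl⟩)
      · rw [envMat_gA]; rfl
      · rw [envMat_gΓ]; rfl)
    (by
      rintro _ (⟨a, rfl⟩ | ⟨γ, rfl⟩)
      · rw [envMat_gA]; rfl
      · rw [envMat_gΓ]; rfl)
    (by
      rintro _ (⟨a, rfl⟩ | ⟨γ, rfl⟩)
      · change C.envMat (C.envPar _) 0 1 = -C.envPar _
        rw [envPar_gA, envMat_gA]
        change C.gΓ _ = -C.envPar (C.gΓ _)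
        rw [envPar_gΓ, neg_neg]
      · change C.envMat (C.envPar _) 0 1 = -Super.par _
        rw [envPar_gΓ, map_neg, envMat_gΓ]
        change -C.d1 _ = -Super.par (C.d1 _)
        rw [d1_even])
    (by
      rintro _ (⟨a, rfl⟩ | ⟨γ, rfl⟩)
      · rw [envMat_gA]
        change C.envMat (C.gΓ (C.d a)) 0 1 = 0
        rw [envMat_gΓ]
        exact C.d1_d a
      · rw [envMat_gΓ]
        change C.envMat (C.d1 γ) 0 1 = 0
        obtain ⟨t, rfl⟩ := C.smulD_surjective γ
        induction t using TensorProduct.induction_on with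
        | zero => simp
        | tmul x y =>
          rw [smulD_tmul, d1_smul_d, map_mul, envMat_gΓ, envMat_gΓ, d1_d, d1_d]
          simp
        | add s t hs ht => simp only [map_add, Matrix.add_apply, hs, ht, add_zero])

theorem envDiff_gA (a : A) : C.envDiff.d (C.gA a) = C.gΓ (C.d a) := by
  change C.envMat (C.gA a) 0 1 = _
  rw [envMat_gA]; rfl

theorem envDiff_gΓ (γ : Γ) : C.envDiff.d (C.gΓ γ) = C.d1 γ := by
  change C.envMat (C.gΓ γ) 0 1 = _
  rw [envMat_gΓ]; rfl

end BicovariantStarCalculus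

/-- The differential `d ⊗ id + par ⊗ d` of the graded tensor product. -/
def tensorD {B B' : Type*} [Ring B] [Algebra ℂ B] [Super B] [Ring B'] [Algebra ℂ B'] [Super B']
    (D : SuperDiff B) (D' : SuperDiff B') : STensor B B' →ₗ[ℂ] STensor B B' :=
  (GradedTensorProduct.of ℂ (Super.part B) (Super.part B')).toLinearMap ∘ₗ
    (TensorProduct.map D.d LinearMap.id + TensorProduct.map (Super.par (B := B)).toLinearMap D'.d) ∘ₗ
    (GradedTensorProduct.of ℂ (Super.part B) (Super.part B')).symm.toLinearMap

/-- The homomorphism `f ⊗ id` of graded tensor products. -/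
def tensorMap {B₁ B₂ B' : Type*} [Ring B₁] [Algebra ℂ B₁] [Super B₁] [Ring B₂] [Algebra ℂ B₂]
    [Super B₂] [Ring B'] [Algebra ℂ B'] [Super B'] (f : B₁ →ₐ[ℂ] B₂)
    (hf : ∀ x, f (Super.par x) = Super.par (f x)) : STensor B₁ B' →ₐ[ℂ] STensor B₂ B' :=
  GradedTensorProduct.lift (Super.part B₁) (Super.part B')
    ((GradedTensorProduct.includeLeft (Super.part B₂) (Super.part B')).comp f)
    (GradedTensorProduct.includeRight (Super.part B₂) (Super.part B'))
    (fun i j a b => by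
      have ha : f a ∈ Super.part B₂ i := by
        rw [Super.mem_part, ← hf, Super.mem_part.1 a.2, map_smul]
      have h := GradedTensorProduct.tmul_one_mul_one_tmul (R := ℂ) (𝒜 := Super.part B₂)
        (ℬ := Super.part B') (f a) (b : B')
      have h' := GradedTensorProduct.tmul_coe_mul_coe_tmul (R := ℂ) (𝒜 := Super.part B₂)
        (ℬ := Super.part B') (1 : B₂) b ⟨f a, ha⟩ (1 : B')
      simp only [one_mul, mul_one] at h'
      simp only [AlgHom.comp_apply, GradedTensorProduct.includeLeft_apply,
        GradedTensorProduct.includeRight_apply]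
      change (GradedTensorProduct.tmul ℂ (f a) (1 : B') : STensor B₂ B') *
        GradedTensorProduct.tmul ℂ (1 : B₂) (b : B') = _ • (GradedTensorProduct.tmul ℂ (1 : B₂) (b : B') *
        GradedTensorProduct.tmul ℂ (f a) (1 : B'))
      rw [h, h', smul_smul, Int.units_mul_self, one_smul])

theorem tensorMap_tmul {B₁ B₂ B' : Type*} [Ring B₁] [Algebra ℂ B₁] [Super B₁] [Ring B₂]
    [Algebra ℂ B₂] [Super B₂] [Ring B'] [Algebra ℂ B'] [Super B'] (f : B₁ →ₐ[ℂ] B₂)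
    (hf : ∀ x, f (Super.par x) = Super.par (f x)) (x : B₁) (y : B') :
    tensorMap f hf (GradedTensorProduct.tmul ℂ x y : STensor B₁ B')
      = GradedTensorProduct.tmul ℂ (f x) y := by
  change (GradedTensorProduct.tmul ℂ (f x) (1 : B') : STensor B₂ B') *
        GradedTensorProduct.tmul ℂ (1 : B₂) y = _
  rw [GradedTensorProduct.tmul_one_mul_one_tmul]

namespace BicovariantStarCalculus
variable {A Γ : Type*} [Ring A] [HopfAlgebra ℂ A] [StarRing A]
    [AddCommGroup Γ] [Module ℂ Γ] [Module A Γ] [Module Aᵐᵒᵖ Γ] [SMulCommClass A Aᵐᵒᵖ Γ]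
    [IsScalarTower ℂ A Γ] [IsScalarTower ℂ Aᵐᵒᵖ Γ] (C : BicovariantStarCalculus A Γ)

/-! ### The free differential algebra on `Γ_inv` -/

/-- The free differential algebra `Ω` generated by `Γ_inv`: the free algebra on the symbols
`ϑ` and `dϑ`, linear in `ϑ ∈ Γ_inv`. -/
def Univ : Type _ := TensorAlgebra ℂ (C.inv × C.inv)

instance : Ring C.Univ := inferInstanceAs (Ring (TensorAlgebra ℂ (C.inv × C.inv)))
instance : Algebra ℂ C.Univ := inferInstanceAs (Algebra ℂ (TensorAlgebra ℂ (C.inv × C.inv)))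

/-- The generators `ϑ`. -/
def θ : C.inv →ₗ[ℂ] C.Univ := TensorAlgebra.ι ℂ ∘ₗ LinearMap.inl ℂ C.inv C.inv

/-- The generators `dϑ`. -/
def dθ : C.inv →ₗ[ℂ] C.Univ := TensorAlgebra.ι ℂ ∘ₗ LinearMap.inr ℂ C.inv C.inv

/-- The homomorphism on `Ω` with given values on the generators `ϑ` and `dϑ`. -/
def univLift {P : Type*} [Ring P] [Algebra ℂ P] (f g : C.inv →ₗ[ℂ] P) : C.Univ →ₐ[ℂ] P :=
  TensorAlgebra.lift ℂ (f.coprod g)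

theorem univLift_θ {P : Type*} [Ring P] [Algebra ℂ P] (f g : C.inv →ₗ[ℂ] P) (v : C.inv) :
    C.univLift f g (C.θ v) = f v :=
  (TensorAlgebra.lift_ι_apply (f.coprod g) _).trans (by simp)

theorem univLift_dθ {P : Type*} [Ring P] [Algebra ℂ P] (f g : C.inv →ₗ[ℂ] P) (v : C.inv) :
    C.univLift f g (C.dθ v) = g v :=
  (TensorAlgebra.lift_ι_apply (f.coprod g) _).trans (by simp)

/-- The generators of `Ω`. -/
def univGen : Set C.Univ := Set.range C.θ ∪ Set.range C.dθ

theorem adjoin_univGen : Algebra.adjoin ℂ C.univGen = ⊤ := by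
  refine eq_top_iff.2 fun x hx => ?_
  clear hx
  refine TensorAlgebra.induction (C := fun y : C.Univ => y ∈ Algebra.adjoin ℂ C.univGen)
    (fun r => Subalgebra.algebraMap_mem (Algebra.adjoin ℂ C.univGen) r) (fun m => ?_)
    (fun a b ha hb => mul_mem (S := Subalgebra ℂ C.Univ) ha hb)
    (fun a b ha hb => add_mem (S := Subalgebra ℂ C.Univ) ha hb) x
  have : TensorAlgebra.ι ℂ m = C.θ m.1 + C.dθ m.2 :=
    (congrArg (TensorAlgebra.ι ℂ) (show m = (m.1, 0) + (0, m.2) by simp)).trans (map_add _ _ _)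
  rw [this]
  exact add_mem (Algebra.subset_adjoin (.inl ⟨_, rfl⟩)) (Algebra.subset_adjoin (.inr ⟨_, rfl⟩))

/-- The parity automorphism of `Ω`: `ϑ` is odd and `dϑ` is even. -/
instance : Super C.Univ where
  par := C.univLift (-C.θ) C.dθ
  par_par := par_par_of_adjoin _ C.univGen C.adjoin_univGen (by
    rintro _ (⟨v, rfl⟩ | ⟨v, rfl⟩)
    · simp [univLift_θ]
    · simp [univLift_dθ])

theorem par_θ (v : C.inv) : Super.par (C.θ v) = -C.θ v := C.univLift_θ _ _ v

theorem par_dθ (v : C.inv) : Super.par (C.dθ v) = C.dθ v := C.univLift_dθ _ _ v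

/-- The homomorphism that encodes the differential of `Ω`. -/
def univMat : C.Univ →ₐ[ℂ] Matrix (Fin 2) (Fin 2) C.Univ :=
  C.univLift (mat2 (-C.θ) C.dθ C.θ) (mat2 C.dθ 0 C.dθ)

theorem univMat_θ (v : C.inv) : C.univMat (C.θ v) = !![-C.θ v, C.dθ v; 0, C.θ v] :=
  C.univLift_θ _ _ v

theorem univMat_dθ (v : C.inv) : C.univMat (C.dθ v) = !![C.dθ v, 0; 0, C.dθ v] :=
  C.univLift_dθ _ _ v

/-- The differential of `Ω`. -/
def diff : SuperDiff C.Univ :=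
  SuperDiff.ofHom C.univMat C.univGen C.adjoin_univGen
    (by
      rintro _ (⟨v, rfl⟩ | ⟨v, rfl⟩)
      · rw [univMat_θ, par_θ]; rfl
      · rw [univMat_dθ, par_dθ]; rfl)
    (by
      rintro _ (⟨v, rfl⟩ | ⟨v, rfl⟩)
      · rw [univMat_θ]; rfl
      · rw [univMat_dθ]; rfl)
    (by
      rintro _ (⟨v, rfl⟩ | ⟨v, rfl⟩)
      · rw [univMat_θ]; rfl
      · rw [univMat_dθ]; rfl)
    (by
      rintro _ (⟨v, rfl⟩ | ⟨v, rfl⟩)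
      · rw [par_θ, map_neg, univMat_θ]; exact congrArg Neg.neg (C.par_dθ v).symm
      · rw [par_dθ, univMat_dθ]
        change (0 : C.Univ) = -Super.par (0 : C.Univ)
        rw [map_zero, neg_zero])
    (by
      rintro _ (⟨v, rfl⟩ | ⟨v, rfl⟩)
      · rw [univMat_θ]
        change C.univMat (C.dθ v) 0 1 = 0
        rw [univMat_dθ]; rfl
      · rw [univMat_dθ]
        change C.univMat 0 0 1 = 0
        rw [map_zero]; rfl)

theorem diff_θ (v : C.inv) : C.diff.d (C.θ v) = C.dθ v := by
  change C.univMat (C.θ v) 0 1 = _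
  rw [univMat_θ]; rfl

theorem diff_dθ (v : C.inv) : C.diff.d (C.dθ v) = 0 := by
  change C.univMat (C.dθ v) 0 1 = _
  rw [univMat_dθ]; rfl

/-- The inclusion of `Γ_inv` in `Γ^∧`. -/
def invEnv : C.inv →ₗ[ℂ] C.Env := C.gΓ ∘ₗ C.inv.subtype

/-- The extended adjoint action on generators: `ϑ ↦ ϖ(ϑ) + 1 ⊗ ϑ`. -/
def adGen : C.inv →ₗ[ℂ] STensor C.Univ C.Env :=
  (GradedTensorProduct.of ℂ (Super.part C.Univ) (Super.part C.Env)).toLinearMap ∘ₗ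
    (TensorProduct.map C.θ C.gA ∘ₗ C.varpi + TensorProduct.mk ℂ C.Univ C.Env 1 ∘ₗ C.invEnv)

/-- The extended adjoint action `Ω → Ω ⊗̂ Γ^∧`: the homomorphism of differential algebras with
`ϑ ↦ ϖ(ϑ) + 1 ⊗ ϑ`. -/
def adTilde : C.Univ →ₐ[ℂ] STensor C.Univ C.Env :=
  C.univLift C.adGen (tensorD C.diff C.envDiff ∘ₗ C.adGen)

/-- The algebra `ℸ` of invariant elements of `Ω`. -/
def daleth : Subalgebra ℂ C.Univ :=
  AlgHom.equalizer C.adTilde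
    (GradedTensorProduct.includeLeft (Super.part C.Univ) (Super.part C.Env))

/-- An embedded differential: `δ : Γ_inv → Γ_inv ⊗ Γ_inv` such that `δ(ϑ)` represents `dϑ ∈ Γ^∧`. -/
structure EmbeddedDifferential where
  δ : C.inv →ₗ[ℂ] C.inv ⊗[ℂ] C.inv
  lift : ∀ ϑ, TensorProduct.lift ((LinearMap.mul ℂ C.Env).compl₁₂ C.invEnv C.invEnv) (δ ϑ)
    = C.envDiff.d (C.invEnv ϑ)

variable {C}
variable (δ : C.EmbeddedDifferential)

namespace EmbeddedDifferential

/-- The element `R(ϑ) = dϑ - δ(ϑ)` of `Ω`. -/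
def R : C.inv →ₗ[ℂ] C.Univ :=
  C.dθ - TensorProduct.lift ((LinearMap.mul ℂ C.Univ).compl₁₂ C.θ C.θ) ∘ₗ δ.δ

/-- `j₃(η, ϑ) = η R(ϑ) - ∑ R(ϑ_k) (η ∘ c_k)`, where `ϖ(ϑ) = ∑ ϑ_k ⊗ c_k`. -/
def j₃ (η ϑ : C.inv) : C.Univ :=
  C.θ η * δ.R ϑ -
    TensorProduct.lift ((LinearMap.mul ℂ C.Univ).compl₁₂ δ.R C.θ) (C.braid (η ⊗ₜ ϑ))

/-- `j₄(η, ϑ) = R(η) R(ϑ) - ∑ R(ϑ_k) R(η ∘ c_k)`. -/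
def j₄ (η ϑ : C.inv) : C.Univ :=
  δ.R η * δ.R ϑ -
    TensorProduct.lift ((LinearMap.mul ℂ C.Univ).compl₁₂ δ.R δ.R) (C.braid (η ⊗ₜ ϑ))

/-- The generators of the ideal `𝒦`: the quadratic relations of `Γ_inv^∧`, and all `j₃`, `j₄`. -/
def kGen : Set C.Univ :=
  {w | ∃ t : C.inv ⊗[ℂ] C.inv,
      TensorProduct.lift ((LinearMap.mul ℂ C.Env).compl₁₂ C.invEnv C.invEnv) t = 0 ∧
      w = TensorProduct.lift ((LinearMap.mul ℂ C.Univ).compl₁₂ C.θ C.θ) t} ∪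
  {w | ∃ η ϑ, w = δ.j₃ η ϑ} ∪ {w | ∃ η ϑ, w = δ.j₄ η ϑ}

/-- The ideal `𝒦` of `Ω`. -/
def K : TwoSidedIdeal C.Univ := TwoSidedIdeal.span δ.kGen

/-- The algebra `Ω_* = Ω / 𝒦`. -/
abbrev OmegaStar : Type _ := δ.K.ringCon.Quotient

/-- The projection `p_𝒦 : Ω → Ω_*`. -/
def p : C.Univ →ₐ[ℂ] δ.OmegaStar := δ.K.ringCon.mkₐ ℂ

theorem p_eq_zero {w : C.Univ} (hw : w ∈ δ.K) : δ.p w = 0 := (RingCon.eq _).2 hw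

theorem p_surjective : Function.Surjective δ.p := RingCon.mk'_surjective _

theorem par_lift {f g f' g' : C.inv →ₗ[ℂ] C.Univ} (hf : ∀ v, Super.par (f v) = f' v)
    (hg : ∀ v, Super.par (g v) = g' v) (t : C.inv ⊗[ℂ] C.inv) :
    Super.par (TensorProduct.lift ((LinearMap.mul ℂ C.Univ).compl₁₂ f g) t)
      = TensorProduct.lift ((LinearMap.mul ℂ C.Univ).compl₁₂ f' g') t := by
  induction t using TensorProduct.induction_on with
  | zero => simp
  | tmul x y => simp [hf, hg]
  | add s t hs ht => simp only [map_add, hs, ht]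

theorem par_R (v : C.inv) : Super.par (δ.R v) = δ.R v := by
  simp only [R, LinearMap.sub_apply, LinearMap.coe_comp, Function.comp_apply, map_sub, C.par_dθ]
  rw [par_lift (f' := -C.θ) (g' := -C.θ) (fun v => C.par_θ v) (fun v => C.par_θ v)]
  congr 2
  ext x y; simp

theorem par_kGen {w : C.Univ} (hw : w ∈ δ.kGen) : Super.par w ∈ δ.K := by
  have hK : w ∈ δ.K := TwoSidedIdeal.subset_span hw
  rcases hw with (⟨t, ht, rfl⟩ | ⟨η, ϑ, rfl⟩) | ⟨η, ϑ, rfl⟩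
  · convert hK using 1
    rw [par_lift (f' := -C.θ) (g' := -C.θ) (fun v => C.par_θ v) (fun v => C.par_θ v)]
    congr 1
    ext x y; simp
  · convert neg_mem hK using 1
    rw [j₃, map_sub, map_mul, par_R, par_θ,
      par_lift (f' := δ.R) (g' := -C.θ) (fun v => δ.par_R v) (fun v => C.par_θ v)]
    have e : TensorProduct.lift ((LinearMap.mul ℂ C.Univ).compl₁₂ δ.R (-C.θ))
        = -TensorProduct.lift ((LinearMap.mul ℂ C.Univ).compl₁₂ δ.R C.θ) := by
      ext x y; simp
    rw [e, LinearMap.neg_apply, neg_mul]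
    abel
  · convert hK using 1
    rw [j₄, map_sub, map_mul, par_R, par_R,
      par_lift (f' := δ.R) (g' := δ.R) (fun v => δ.par_R v) (fun v => δ.par_R v)]

theorem p_par {w : C.Univ} (hw : w ∈ δ.K) : δ.p (Super.par w) = 0 :=
  eq_zero_of_mem_span δ.kGen (δ.p.comp Super.par).toRingHom
    (fun _ hx => δ.p_eq_zero (δ.par_kGen hx)) w hw

instance : Super δ.OmegaStar where
  par := idealLift δ.K (δ.p.comp Super.par) (fun _ hw => δ.p_par hw)
  par_par x := by
    obtain ⟨w, rfl⟩ := δ.p_surjective x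
    change δ.p (Super.par (Super.par w)) = δ.p w
    rw [Super.par_par]

theorem par_p (w : C.Univ) : δ.p (Super.par w) = Super.par (δ.p w) := rfl

/-- The map on `Ω_*` induced by `d`, for a `d`-stable ideal `𝒦`. -/
def dStar (hd : ∀ w ∈ δ.K, C.diff.d w ∈ δ.K) : δ.OmegaStar →ₗ[ℂ] δ.OmegaStar where
  toFun := Quotient.lift (fun w => δ.p (C.diff.d w)) (fun x y hxy => by
    have h := hd _ ((TwoSidedIdeal.rel_iff δ.K x y).1 hxy)
    have h2 := δ.p_eq_zero h
    rwa [map_sub, map_sub, sub_eq_zero] at h2)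
  map_add' x y := by
    obtain ⟨x, rfl⟩ := δ.p_surjective x
    obtain ⟨y, rfl⟩ := δ.p_surjective y
    change δ.p (C.diff.d (x + y)) = δ.p (C.diff.d x) + δ.p (C.diff.d y)
    rw [map_add, map_add]
  map_smul' c x := by
    obtain ⟨x, rfl⟩ := δ.p_surjective x
    rw [← map_smul]
    change δ.p (C.diff.d (c • x)) = c • δ.p (C.diff.d x)
    rw [map_smul, map_smul]

theorem dStar_p (hd : ∀ w ∈ δ.K, C.diff.d w ∈ δ.K) (w : C.Univ) :
    δ.dStar hd (δ.p w) = δ.p (C.diff.d w) := rfl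

/-- The differential of `Ω_*`, for a `d`-stable ideal `𝒦`. -/
def diffStar (hd : ∀ w ∈ δ.K, C.diff.d w ∈ δ.K) : SuperDiff δ.OmegaStar where
  d := δ.dStar hd
  d_mul x y := by
    obtain ⟨x, rfl⟩ := δ.p_surjective x
    obtain ⟨y, rfl⟩ := δ.p_surjective y
    rw [← map_mul, ← par_p, dStar_p, dStar_p, dStar_p, C.diff.d_mul, map_add, map_mul, map_mul]
  d_par x := by
    obtain ⟨x, rfl⟩ := δ.p_surjective x
    rw [← par_p, dStar_p, dStar_p, ← par_p, C.diff.d_par, map_neg]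
  d_d x := by
    obtain ⟨x, rfl⟩ := δ.p_surjective x
    rw [dStar_p, dStar_p, C.diff.d_d, map_zero]

theorem p_d (hd : ∀ w ∈ δ.K, C.diff.d w ∈ δ.K) (w : C.Univ) :
    δ.p (C.diff.d w) = (δ.diffStar hd).d (δ.p w) := rfl

/-- The homomorphism `p_𝒦 ⊗ id : Ω ⊗̂ Γ^∧ → Ω_* ⊗̂ Γ^∧`. -/
def pTensor : STensor C.Univ C.Env →ₐ[ℂ] STensor δ.OmegaStar C.Env := tensorMap δ.p δ.par_p

/-- The action `Ω_* → Ω_* ⊗̂ Γ^∧` induced by the extended adjoint action, when that respects the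
ideal `𝒦`. -/
def adStar (had : ∀ w ∈ δ.K, δ.pTensor (C.adTilde w) = 0) :
    δ.OmegaStar →ₐ[ℂ] STensor δ.OmegaStar C.Env :=
  idealLift δ.K (δ.pTensor.comp C.adTilde) had

/-- The algebra `ℶ` of invariant elements of `Ω_*`. -/
def beth (had : ∀ w ∈ δ.K, δ.pTensor (C.adTilde w) = 0) : Subalgebra ℂ δ.OmegaStar :=
  AlgHom.equalizer (δ.adStar had)
    (GradedTensorProduct.includeLeft (Super.part δ.OmegaStar) (Super.part C.Env))

theorem p_mem_beth (had : ∀ w ∈ δ.K, δ.pTensor (C.adTilde w) = 0) (w : C.Univ)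
    (hw : w ∈ C.daleth) : δ.p w ∈ δ.beth had := by
  change δ.pTensor (C.adTilde w) = _
  rw [show C.adTilde w = _ from hw]
  exact tensorMap_tmul δ.p δ.par_p w 1

/-- The homomorphism `H(ℸ) → H(ℶ)` of cohomology algebras induced by `p_𝒦`. -/
def cohomologyP (hd : ∀ w ∈ δ.K, C.diff.d w ∈ δ.K)
    (had : ∀ w ∈ δ.K, δ.pTensor (C.adTilde w) = 0) :
    C.diff.Cohomology C.daleth →ₐ[ℂ] (δ.diffStar hd).Cohomology (δ.beth had) :=
  C.diff.cohomologyMap (δ.diffStar hd) C.daleth (δ.beth had) δ.p (δ.p_d hd) (δ.p_mem_beth had)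

/-- The complex `𝒦 ∩ ℸ` is acyclic. -/
def InvariantPartAcyclic : Prop := C.diff.IsAcyclic {w | w ∈ δ.K ∧ w ∈ C.daleth}

/-- The complex `𝒦` is acyclic. -/
def IdealAcyclic : Prop := C.diff.IsAcyclic {w | w ∈ δ.K}

/-- `H(Ω_*) = ℂ`. -/
def StarTrivial (hd : ∀ w ∈ δ.K, C.diff.d w ∈ δ.K) : Prop :=
  Function.Bijective (algebraMap ℂ ((δ.diffStar hd).Cohomology ⊤))

/-- `p_𝒦` induces an isomorphism of the algebras `H(ℸ)` and `H(ℶ)`: the universal characteristic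
classes of the general and of the regular case coincide. -/
def ClassesCoincide (hd : ∀ w ∈ δ.K, C.diff.d w ∈ δ.K)
    (had : ∀ w ∈ δ.K, δ.pTensor (C.adTilde w) = 0) : Prop :=
  ∃ e : C.diff.Cohomology C.daleth ≃ₐ[ℂ] (δ.diffStar hd).Cohomology (δ.beth had),
    ∀ x, e x = δ.cohomologyP hd had x

end EmbeddedDifferential
end BicovariantStarCalculus

end

end QPB

/-! Write π(a) = ∑ κ(a⁽¹⁾) d(a⁽²⁾) for the germs map A → Γ_inv. It is onto, and Γ is A ⊗ Γ_inv as a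
left module, so that every identity about Γ^∧ can be tested on left-invariant forms and on
coproducts of elements of A.

The ideal 𝒦. The kernel of Γ_inv ⊗ Γ_inv → Γ^∧ consists exactly of the tensors ∑ π(a⁽¹⁾) ⊗ π(a⁽²⁾)
with π(a) = 0 (`exists_of_invMul_eq_zero`); no further relations can occur because Γ^∧ has a
representation in which only these hold. With the Maurer–Cartan formula it follows that every
embedded differential satisfies δ(ϑ) = -∑ π(a⁽¹⁾) ⊗ π(a⁽²⁾) for a suitable a with π(a) = ϑ
(`exists_germ`). In Ω_* this yields a Bianchi identity for dR(ϑ) (`pd_R`) and the covariance of R(ϑ)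
(`pAd_R`). The generators of 𝒦 are then checked one by one, which gives `diff_mem_K` and
`pAd_eq_zero`.

The formal equivalences. The free differential algebra Ω is contractible and its augmentation
vanishes on 𝒦, so the exact sequence 0 → 𝒦 → Ω → Ω_* → 0 gives (ii) ⇔ (iii) (`idealAcyclic_iff`).
Likewise 0 → 𝒦 ∩ ℸ → ℸ → ℶ → 0 gives (i) ⇔ (iv), as soon as ℸ → ℶ is onto. For this, an invariant
element of Ω_* is shown to be a polynomial in the classes of the R(ϑ) (`retr_of_mem_beth`). The same
polynomial in Ω is horizontal, that is, its coaction has values in Ω ⊗ A, and its average under the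
Haar functional is an invariant lift (`exists_mem_daleth`).

The comparison of (i) and (ii). The coaction of Γ^∧ on 𝒦 defines a filtration: `filt k` consists of
the elements whose coaction has degree at most k in Γ^∧, and the part of degree k is the symbol. By
`isCot_lam` and `exists_symbol` the symbols form the cotensor product over A of the horizontal
elements with the k-forms of Γ^∧. Let `loc` be the complex of horizontal elements whose coefficients
in A are closed, or equivalently of horizontal elements with horizontal differential. The main step
is `exists_reduce`. If u has filtration k + 1 and du has filtration k, then the symbol of u is,
modulo exact forms in the second factor, a tensor whose first factors are cocycles of `loc`. If
these bound in `loc`, then u can be changed by a coboundary so as to have filtration k. All choices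
are made factor by factor and then pushed into the cotensor product by averaging, which commutes
with every differential involved.

Hence `loc` is acyclic iff 𝒦 is (`acyclic_of_loc`, `loc_acyclic`). In the second direction there is
no circularity: the symbol of filtration k + 1 of a primitive has first factors of smaller degree
than the given cocycle, so induction on the degree works. The basic elements, 𝒦 ∩ ℸ, lie in `loc`
and are reached from it by averaging; this proves (ii) ⇒ (i). If G is connected, closed coefficients
are scalars, so `loc` is 𝒦 ∩ ℸ (`loc_le_basic`), and (i) ⇒ (ii).

The Haar functional is obtained algebraically (`exists_haar`): with the unitarity of the
corepresentations, finitely many convolution operators by functionals vanishing at 1 combine into an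
operator of the form F*F, and spectral calculus shows that 1 is not in the sum of their ranges. -/

open scoped TensorProduct

namespace QPB

noncomputable section

/-! ### The germs map and the left trivialization of Γ. -/

namespace BicovariantStarCalculus
variable {A Γ : Type*} [Ring A] [HopfAlgebra ℂ A] [StarRing A]
    [AddCommGroup Γ] [Module ℂ Γ] [Module A Γ] [Module Aᵐᵒᵖ Γ] [SMulCommClass A Aᵐᵒᵖ Γ]
    [IsScalarTower ℂ A Γ] [IsScalarTower ℂ Aᵐᵒᵖ Γ] (C : BicovariantStarCalculus A Γ)

/-- The quantum germs map `π(a) = ∑ κ(a⁽¹⁾) d(a⁽²⁾)`. -/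
def germ : A →ₗ[ℂ] C.inv :=
  (sweedler (lact A Γ ∘ₗ HopfAlgebra.antipode ℂ) C.d).codRestrict C.inv
    (C.sweedler_mem_inv C.d C.lco_d)

theorem sweedler_germ : sweedler (lact A Γ) (C.inv.subtype ∘ₗ C.germ) = C.d :=
  sweedler_antipode_right (lact A Γ) (by simp [lact]) (by simp [lact, mul_smul]) C.d

/-- `a ⊗ ϑ ↦ a ϑ`. -/
def mulInv : A ⊗[ℂ] C.inv →ₗ[ℂ] Γ := TensorProduct.lift ((lact A Γ).compl₂ C.inv.subtype)

theorem mulInv_tmul (a : A) (ϑ : C.inv) : C.mulInv (a ⊗ₜ ϑ) = a • (ϑ : Γ) := rfl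

theorem mulInv_comul (F : A →ₗ[ℂ] C.inv) (a : A) :
    C.mulInv (F.lTensor A (Coalgebra.comul (R := ℂ) a))
      = sweedler (lact A Γ) (C.inv.subtype ∘ₗ F) a := by
  simp only [sweedler, LinearMap.coe_comp, Function.comp_apply]
  generalize Coalgebra.comul (R := ℂ) a = t
  induction t using TensorProduct.induction_on with
  | zero => simp
  | tmul x y => simp [mulInv_tmul, lact]
  | add s t hs ht => simp only [map_add, hs, ht]

theorem mulInv_mul (a : A) (t : A ⊗[ℂ] C.inv) :
    C.mulInv ((LinearMap.mulLeft ℂ a).rTensor C.inv t) = a • C.mulInv t := by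
  induction t using TensorProduct.induction_on with
  | zero => simp
  | tmul x y => simp [mulInv_tmul, mul_smul]
  | add s t hs ht => simp only [map_add, hs, ht, smul_add]

theorem mulInv_surjective : Function.Surjective C.mulInv := by
  intro γ
  obtain ⟨t, rfl⟩ := C.smulD_surjective γ
  induction t using TensorProduct.induction_on with
  | zero => exact ⟨0, by simp⟩
  | tmul x y =>
    refine ⟨(LinearMap.mulLeft ℂ x).rTensor C.inv (C.germ.lTensor A (Coalgebra.comul (R := ℂ) y)), ?_⟩
    rw [mulInv_mul, mulInv_comul, sweedler_germ, smulD_tmul]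
  | add s t hs ht =>
    obtain ⟨x, hx⟩ := hs
    obtain ⟨y, hy⟩ := ht
    exact ⟨x + y, by rw [map_add, map_add, hx, hy]⟩

theorem lco_smul_inv (a : A) (ϑ : C.inv) :
    C.lco (a • (ϑ : Γ)) = ((lact A Γ).flip (ϑ : Γ)).lTensor A (Coalgebra.comul (R := ℂ) a) := by
  rw [lco_smul, C.mem_inv.1 ϑ.2]
  generalize Coalgebra.comul (R := ℂ) a = t
  induction t using TensorProduct.induction_on with
  | zero => simp
  | tmul x y => simp [lactL]
  | add s t hs ht => simp only [map_add, LinearMap.add_apply, hs, ht]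

/-- `γ ↦ ∑ κ(γ₍₋₁₎) γ₍₀₎`. -/
def invPart : Γ →ₗ[ℂ] Γ := TensorProduct.lift (lact A Γ ∘ₗ HopfAlgebra.antipode ℂ) ∘ₗ C.lco

theorem invPart_smul (a : A) (ϑ : C.inv) :
    C.invPart (a • (ϑ : Γ)) = Coalgebra.counit (R := ℂ) a • (ϑ : Γ) := by
  have h := congrArg (fun x : A => x • (ϑ : Γ))
    (HopfAlgebra.mul_antipode_rTensor_comul_apply (R := ℂ) a)
  simp only [algebraMap_smul] at h
  rw [← h, invPart, LinearMap.comp_apply, lco_smul_inv]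
  generalize Coalgebra.comul (R := ℂ) a = t
  induction t using TensorProduct.induction_on with
  | zero => simp
  | tmul x y => simp [lact, mul_smul]
  | add s t hs ht => simp only [map_add, add_smul, hs, ht]

/-- The left coaction sends aϑ to ∑ a⁽¹⁾ ⊗ a⁽²⁾ϑ, and `invPart` replaces a⁽²⁾ϑ by ε(a⁽²⁾)ϑ, so a ⊗ ϑ
is recovered in A ⊗ Γ. Nothing is lost there, since A ⊗ Γ_inv embeds by flatness. -/
theorem mulInv_injective : Function.Injective C.mulInv := by
  have h : C.invPart.lTensor A ∘ₗ C.lco ∘ₗ C.mulInv = C.inv.subtype.lTensor A := by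
    ext a ϑ
    simp only [TensorProduct.AlgebraTensorModule.curry_apply, LinearMap.restrictScalars_self,
      TensorProduct.curry_apply, LinearMap.coe_comp, Function.comp_apply, mulInv_tmul,
      lco_smul_inv, LinearMap.lTensor_tmul, Submodule.subtype_apply]
    have h2 := Coalgebra.lTensor_counit_comul (R := ℂ) a
    rw [← LinearMap.lTensor_comp_apply]
    have e : C.invPart ∘ₗ (lact A Γ).flip (ϑ : Γ)
        = LinearMap.toSpanSingleton ℂ Γ (ϑ : Γ) ∘ₗ Coalgebra.counit (R := ℂ) := by
      ext b; exact C.invPart_smul b ϑ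
    rw [e, LinearMap.lTensor_comp_apply, h2]
    simp
  have hi : Function.Injective (C.inv.subtype.lTensor A) :=
    Module.Flat.lTensor_preserves_injective_linearMap _ (Submodule.injective_subtype _)
  rw [← h] at hi
  exact Function.Injective.of_comp (f := C.invPart.lTensor A ∘ C.lco) hi

/-- The left trivialization `Γ ≅ A ⊗ Γ_inv`. -/
def triv : Γ ≃ₗ[ℂ] A ⊗[ℂ] C.inv :=
  (LinearEquiv.ofBijective C.mulInv ⟨C.mulInv_injective, C.mulInv_surjective⟩).symm

theorem triv_mulInv (t : A ⊗[ℂ] C.inv) : C.triv (C.mulInv t) = t :=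
  (LinearEquiv.ofBijective C.mulInv ⟨C.mulInv_injective, C.mulInv_surjective⟩).symm_apply_apply t

theorem triv_smul_inv (a : A) (ϑ : C.inv) : C.triv (a • (ϑ : Γ)) = a ⊗ₜ ϑ :=
  C.triv_mulInv (a ⊗ₜ ϑ)

theorem triv_inv (ϑ : C.inv) : C.triv (ϑ : Γ) = 1 ⊗ₜ ϑ := by
  rw [← triv_smul_inv, one_smul]

theorem triv_smul (a : A) (γ : Γ) :
    C.triv (a • γ) = (LinearMap.mulLeft ℂ a).rTensor C.inv (C.triv γ) := by
  obtain ⟨t, rfl⟩ := C.mulInv_surjective γ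
  rw [← mulInv_mul, triv_mulInv, triv_mulInv]

theorem triv_d (a : A) : C.triv (C.d a) = C.germ.lTensor A (Coalgebra.comul (R := ℂ) a) := by
  rw [← sweedler_germ, ← mulInv_comul, triv_mulInv]

/-- The projection `γ ↦ ∑ κ(γ₍₋₁₎) γ₍₀₎` of `Γ` onto `Γ_inv`. -/
def toInv : Γ →ₗ[ℂ] C.inv :=
  (TensorProduct.lid ℂ C.inv).toLinearMap ∘ₗ (Coalgebra.counit (R := ℂ)).rTensor C.inv ∘ₗ
    C.triv.toLinearMap

theorem toInv_smul (a : A) (γ : Γ) :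
    C.toInv (a • γ) = Coalgebra.counit (R := ℂ) a • C.toInv γ := by
  simp only [toInv, LinearMap.coe_comp, Function.comp_apply, LinearEquiv.coe_coe, triv_smul]
  generalize C.triv γ = t
  induction t using TensorProduct.induction_on with
  | zero => simp
  | tmul x y => simp [mul_smul]
  | add s t hs ht => simp only [map_add, smul_add, hs, ht]

theorem toInv_inv (ϑ : C.inv) : C.toInv (ϑ : Γ) = ϑ := by simp [toInv, triv_inv]

theorem toInv_d (a : A) : C.toInv (C.d a) = C.germ a := by
  simp only [toInv, LinearMap.coe_comp, Function.comp_apply, LinearEquiv.coe_coe, triv_d]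
  have h : (Coalgebra.counit (R := ℂ)).rTensor C.inv ∘ₗ C.germ.lTensor A
      = C.germ.lTensor ℂ ∘ₗ (Coalgebra.counit (R := ℂ)).rTensor A := by
    ext; simp
  have h' := congrArg (fun f => f (Coalgebra.comul (R := ℂ) a)) h
  simp only [LinearMap.coe_comp, Function.comp_apply, Coalgebra.rTensor_counit_comul] at h'
  rw [h']; simp

/-- The projection to Γ_inv sends a d(b) to ε(a) π(b), and these elements span Γ. -/
theorem germ_surjective : Function.Surjective C.germ := by
  intro ϑ
  obtain ⟨t, ht⟩ := C.smulD_surjective (ϑ : Γ)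
  have h : C.toInv ∘ₗ C.smulD = C.germ ∘ₗ (TensorProduct.lid ℂ A).toLinearMap ∘ₗ
      (Coalgebra.counit (R := ℂ)).rTensor A := by
    ext a b; simp [smulD_tmul, toInv_smul, toInv_d]
  have h' := congrArg (fun f => f t) h
  simp only [LinearMap.coe_comp, Function.comp_apply, ht, toInv_inv] at h'
  exact ⟨_, h'.symm⟩

/-- `ϑ ∘ a`, as a bilinear map. -/
def circ₂ : C.inv →ₗ[ℂ] A →ₗ[ℂ] C.inv := TensorProduct.curry C.circ

theorem circ₂_apply (ϑ : C.inv) (a : A) : C.circ₂ ϑ a = C.circ (ϑ ⊗ₜ a) := rfl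

theorem sweedler_circ (ϑ : C.inv) (b : A) :
    sweedler (lact A Γ) (C.inv.subtype ∘ₗ C.circ₂ ϑ) b = MulOpposite.op b • (ϑ : Γ) :=
  congrArg (fun f => f b) (sweedler_antipode_right (lact A Γ) (by simp [lact])
    (by simp [lact, mul_smul]) ((ract A Γ).flip (ϑ : Γ)))

theorem triv_op_smul (ϑ : C.inv) (b : A) :
    C.triv (MulOpposite.op b • (ϑ : Γ)) = (C.circ₂ ϑ).lTensor A (Coalgebra.comul (R := ℂ) b) := by
  rw [← sweedler_circ, ← mulInv_comul, triv_mulInv]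

theorem toInv_sweedler (F : A →ₗ[ℂ] C.inv) (b : A) :
    C.toInv (sweedler (lact A Γ) (C.inv.subtype ∘ₗ F) b) = F b := by
  have h : (C.toInv ∘ₗ TensorProduct.lift ((lact A Γ).compl₂ (C.inv.subtype ∘ₗ F)))
      = F ∘ₗ (TensorProduct.lid ℂ A).toLinearMap ∘ₗ (Coalgebra.counit (R := ℂ)).rTensor A := by
    ext x y; simp [lact, toInv_smul, toInv_inv]
  have h' := congrArg (fun f => f (Coalgebra.comul (R := ℂ) b)) h
  simp only [LinearMap.coe_comp, Function.comp_apply, Coalgebra.rTensor_counit_comul] at h'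
  simpa [sweedler] using h'

theorem toInv_op_smul (ϑ : C.inv) (b : A) :
    C.toInv (MulOpposite.op b • (ϑ : Γ)) = C.circ₂ ϑ b := by
  rw [← sweedler_circ, toInv_sweedler]

theorem toInv_op_smul' (γ : Γ) (b : A) :
    C.toInv (MulOpposite.op b • γ) = C.circ₂ (C.toInv γ) b := by
  obtain ⟨t, rfl⟩ := C.mulInv_surjective γ
  induction t using TensorProduct.induction_on with
  | zero => simp
  | tmul x y =>
    rw [mulInv_tmul, ← smul_comm, toInv_smul, toInv_smul, toInv_op_smul, toInv_inv, map_smul,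
      LinearMap.smul_apply]
  | add s t hs ht => simp only [map_add, smul_add, hs, ht, LinearMap.add_apply]

/-- This is the projection to Γ_inv of the Leibniz rule d(a) b = d(ab) - a d(b). -/
theorem circ_germ (a b : A) :
    C.circ₂ (C.germ a) b = C.germ (a * b) - Coalgebra.counit (R := ℂ) a • C.germ b := by
  rw [← toInv_d, ← toInv_op_smul']
  have h := C.d_mul a b
  rw [← sub_eq_iff_eq_add] at h
  rw [← h, map_sub, toInv_smul, toInv_d, toInv_d]

/-- Left multiplication by elements of `A` on the second factor of `M ⊗ A`. -/
def lmulR (A M : Type*) [Ring A] [HopfAlgebra ℂ A] [AddCommGroup M] [Module ℂ M] :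
    A →ₗ[ℂ] M ⊗[ℂ] A →ₗ[ℂ] M ⊗[ℂ] A :=
  LinearMap.lTensorHom M ∘ₗ LinearMap.mul ℂ A

theorem lmulR_tmul {M : Type*} [AddCommGroup M] [Module ℂ M] (a : A) (m : M) (b : A) :
    lmulR A M a (m ⊗ₜ b) = m ⊗ₜ (a * b) := rfl

theorem toInv_rco_smul (a : A) (ϑ : C.inv) :
    C.toInv.rTensor A (C.rco (a • (ϑ : Γ))) = lmulR A C.inv a (C.varpi ϑ) := by
  rw [rco_smul, ← varpi_spec]
  generalize C.varpi ϑ = t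
  induction t using TensorProduct.induction_on with
  | zero => simp
  | add s t hs ht => simp only [map_add, hs, ht]
  | tmul v e =>
    rw [lmulR_tmul]
    conv_rhs => rw [← Coalgebra.sum_counit_smul (Coalgebra.Repr.arbitrary ℂ a)]
    rw [← (Coalgebra.Repr.arbitrary ℂ a).eq]
    simp [lactR, lact, toInv_smul, toInv_inv, Finset.sum_mul, TensorProduct.tmul_sum,
      TensorProduct.smul_tmul]

/-- In ℘(aϑ) = ∑ a⁽¹⁾ϑ_k ⊗ a⁽²⁾c_k the projection to Γ_inv evaluates a⁽¹⁾ by the counit. With γ =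
d(a) and γ = ηc this yields formulas for ϖ on π(a) and on η ∘ c in which the antipode does not
appear; all later computations use them in that form. -/
theorem toInv_rco (γ : Γ) :
    C.toInv.rTensor A (C.rco γ) = TensorProduct.lift ((lmulR A C.inv).compl₂ C.varpi) (C.triv γ) := by
  obtain ⟨t, rfl⟩ := C.mulInv_surjective γ
  rw [triv_mulInv]
  induction t using TensorProduct.induction_on with
  | zero => simp
  | tmul x y => rw [mulInv_tmul, toInv_rco_smul]; rfl
  | add s t hs ht => simp only [map_add, hs, ht]

theorem lift_lTensor_comul {M N : Type*} [AddCommGroup M] [Module ℂ M] [AddCommGroup N]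
    [Module ℂ N] (ρ : A →ₗ[ℂ] N →ₗ[ℂ] M) (F : A →ₗ[ℂ] N) (t : A ⊗[ℂ] A) :
    TensorProduct.lift ρ (F.lTensor A t) = TensorProduct.lift (ρ.compl₂ F) t := by
  induction t using TensorProduct.induction_on with
  | zero => simp
  | tmul x y => rfl
  | add s t hs ht => simp only [map_add, hs, ht]

/-- `∑ (1 ⊗ a⁽¹⁾) ϖ(π(a⁽²⁾)) = ∑ π(a⁽¹⁾) ⊗ a⁽²⁾`. -/
theorem sweedler_varpi_germ (a : A) :
    sweedler (lmulR A C.inv) (C.varpi ∘ₗ C.germ) a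
      = C.germ.rTensor A (Coalgebra.comul (R := ℂ) a) := by
  have h := C.toInv_rco (C.d a)
  rw [triv_d, lift_lTensor_comul, rco_d, ← LinearMap.rTensor_comp_apply] at h
  rw [show C.toInv ∘ₗ C.d = C.germ from LinearMap.ext C.toInv_d] at h
  exact h.symm

/-- `∑ (1 ⊗ c⁽¹⁾) ϖ(η ∘ c⁽²⁾) = ∑ (η_l ∘ c⁽¹⁾) ⊗ e_l c⁽²⁾`, where `ϖ(η) = ∑ η_l ⊗ e_l`. -/
theorem sweedler_varpi_circ (η : C.inv) (c : A) :
    sweedler (lmulR A C.inv) (C.varpi ∘ₗ C.circ₂ η) c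
      = TensorProduct.map₂ C.circ₂ (LinearMap.mul ℂ A) (C.varpi η) (Coalgebra.comul (R := ℂ) c) := by
  have h := C.toInv_rco (MulOpposite.op c • (η : Γ))
  rw [triv_op_smul, lift_lTensor_comul, rco_op_smul, ← varpi_spec] at h
  refine h.symm.trans ?_
  generalize C.varpi η = t
  induction t using TensorProduct.induction_on with
  | zero => simp
  | add s t hs ht => simp only [map_add, hs, ht, LinearMap.add_apply]
  | tmul v e =>
    generalize Coalgebra.comul (R := ℂ) c = t
    induction t using TensorProduct.induction_on with
    | zero => simp
    | add s t hs ht => simp only [map_add, hs, ht, LinearMap.add_apply]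
    | tmul x y => simp [ractR, ract, toInv_op_smul]

/-! ### The braiding and germs. -/

theorem braid_germ (b : A) (ϑ : C.inv) :
    C.braid (C.germ b ⊗ₜ ϑ) = C.germ.lTensor C.inv (lmulR A C.inv b (C.varpi ϑ))
      - Coalgebra.counit (R := ℂ) b • C.germ.lTensor C.inv (C.varpi ϑ) := by
  simp only [braid, LinearMap.coe_comp, Function.comp_apply, LinearMap.lTensor_tmul,
    LinearEquiv.coe_coe]
  generalize C.varpi ϑ = t
  induction t using TensorProduct.induction_on with
  | zero => simp
  | add s t hs ht => simp only [map_add, hs, ht, TensorProduct.tmul_add, smul_add]; abel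
  | tmul v e =>
    simp [lmulR_tmul, ← circ₂_apply, circ_germ, TensorProduct.tmul_sub]

/-- `a ↦ ∑ π(a⁽¹⁾) ⊗ π(a⁽²⁾)`. -/
def germ₂ : A →ₗ[ℂ] C.inv ⊗[ℂ] C.inv :=
  TensorProduct.map C.germ C.germ ∘ₗ Coalgebra.comul

/-- When `braid_germ` is summed over the coproduct of a, its first term collapses to ∑ π(a⁽¹⁾) ⊗
π(a⁽²⁾) by `sweedler_varpi_germ`, and its counit term is (id ⊗ π)ϖ(π(a)). This defect of braid
invariance produces both the Bianchi identity and the mixed terms in the coaction. -/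
theorem braid_germ₂ (a : A) :
    C.braid (C.germ₂ a) = C.germ₂ a - C.germ.lTensor C.inv (C.varpi (C.germ a)) := by
  have h1 : C.braid (C.germ₂ a) = C.germ.lTensor C.inv
      (sweedler (lmulR A C.inv) (C.varpi ∘ₗ C.germ) a)
      - C.germ.lTensor C.inv (C.varpi (C.germ a)) := by
    -- The element a is written as ∑ ε(a⁽¹⁾) a⁽²⁾, so that both terms of `braid_germ` become sums
    -- over the same coproduct.
    have h2 : C.germ.lTensor C.inv (C.varpi (C.germ a)) =
        (C.germ.lTensor C.inv ∘ₗ C.varpi ∘ₗ C.germ) (∑ i ∈ (Coalgebra.Repr.arbitrary ℂ a).index,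
          Coalgebra.counit (R := ℂ) ((Coalgebra.Repr.arbitrary ℂ a).left i) •
          (Coalgebra.Repr.arbitrary ℂ a).right i) := by
      rw [Coalgebra.sum_counit_smul]; rfl
    rw [h2]
    simp only [germ₂, sweedler, LinearMap.coe_comp, Function.comp_apply,
      ← (Coalgebra.Repr.arbitrary ℂ a).eq, map_sum, TensorProduct.map_tmul, braid_germ,
      Finset.sum_sub_distrib, map_smul, TensorProduct.lift.tmul, LinearMap.compl₂_apply]
  rw [h1, sweedler_varpi_germ]
  congr 1
  simp only [germ₂, LinearMap.coe_comp, Function.comp_apply]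
  rw [← LinearMap.comp_apply, LinearMap.lTensor_comp_rTensor]

/-- `x ⊗ y ↦ f(x) g(y)`. -/
abbrev mul₂ {P M N : Type*} [Ring P] [Algebra ℂ P] [AddCommGroup M] [Module ℂ M]
    [AddCommGroup N] [Module ℂ N] (f : M →ₗ[ℂ] P) (g : N →ₗ[ℂ] P) : M ⊗[ℂ] N →ₗ[ℂ] P :=
  TensorProduct.lift ((LinearMap.mul ℂ P).compl₁₂ f g)

theorem lTensor_rTensor_apply {M N M' N' : Type*} [AddCommGroup M] [Module ℂ M]
    [AddCommGroup N] [Module ℂ N] [AddCommGroup M'] [Module ℂ M'] [AddCommGroup N'] [Module ℂ N']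
    (f : M →ₗ[ℂ] M') (g : N →ₗ[ℂ] N') (t : M ⊗[ℂ] N) :
    g.lTensor M' (f.rTensor N t) = f.rTensor N' (g.lTensor M t) := by
  rw [← LinearMap.comp_apply, ← LinearMap.comp_apply, LinearMap.lTensor_comp_rTensor,
    LinearMap.rTensor_comp_lTensor]

theorem varpi_coassoc (ϑ : C.inv) :
    TensorProduct.assoc ℂ C.inv A A (C.varpi.rTensor A (C.varpi ϑ))
      = (Coalgebra.comul (R := ℂ)).lTensor C.inv (C.varpi ϑ) := by
  have hi : Function.Injective (C.inv.subtype.rTensor (A ⊗[ℂ] A)) :=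
    Module.Flat.rTensor_preserves_injective_linearMap _ (Submodule.injective_subtype _)
  apply hi
  have h := C.rco_coassoc (ϑ : Γ)
  rw [← varpi_spec] at h
  have e1 : C.rco.rTensor A ∘ₗ C.inv.subtype.rTensor A
      = (C.inv.subtype.rTensor A).rTensor A ∘ₗ C.varpi.rTensor A := by
    rw [← LinearMap.rTensor_comp, ← LinearMap.rTensor_comp]
    congr 1
    ext v
    exact (C.varpi_spec v).symm
  rw [← LinearMap.comp_apply, e1] at h
  have e2 : (TensorProduct.assoc ℂ Γ A A).toLinearMap ∘ₗ (C.inv.subtype.rTensor A).rTensor A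
      = C.inv.subtype.rTensor (A ⊗[ℂ] A) ∘ₗ (TensorProduct.assoc ℂ C.inv A A).toLinearMap := by
    ext; simp
  have e2' := congrArg (fun f => f (C.varpi.rTensor A (C.varpi ϑ))) e2
  simp only [LinearMap.coe_comp, Function.comp_apply, LinearEquiv.coe_coe] at e2' h
  rw [← e2', h, lTensor_rTensor_apply]

theorem varpi_counit (ϑ : C.inv) :
    TensorProduct.rid ℂ C.inv ((Coalgebra.counit (R := ℂ)).lTensor C.inv (C.varpi ϑ)) = ϑ := by
  apply Subtype.ext
  have h := C.rco_counit (ϑ : Γ)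
  rw [← varpi_spec] at h
  refine Eq.trans ?_ h
  generalize C.varpi ϑ = t
  induction t using TensorProduct.induction_on with
  | zero => simp
  | tmul x y => simp
  | add s t hs ht => simp only [map_add, Submodule.coe_add, hs, ht]

/-- `∑ π(c⁽¹⁾)` braided with `η ∘ c⁽²⁾`, in terms of `ϖ(η)`. -/
theorem braid_germ_circ (η : C.inv) (c : A) :
    C.braid (TensorProduct.map C.germ (C.circ₂ η) (Coalgebra.comul (R := ℂ) c))
      + C.germ.lTensor C.inv (C.varpi (C.circ₂ η c))
      = TensorProduct.map₂ C.circ₂ (C.circ₂ ∘ₗ C.germ) (C.varpi η) (Coalgebra.comul (R := ℂ) c)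
        + TensorProduct.map (C.circ₂ η) C.germ (Coalgebra.comul (R := ℂ) c) := by
  have h1 : C.braid (TensorProduct.map C.germ (C.circ₂ η) (Coalgebra.comul (R := ℂ) c))
      + C.germ.lTensor C.inv (C.varpi (C.circ₂ η c))
      = C.germ.lTensor C.inv (sweedler (lmulR A C.inv) (C.varpi ∘ₗ C.circ₂ η) c) := by
    have h2 : C.germ.lTensor C.inv (C.varpi (C.circ₂ η c)) =
        (C.germ.lTensor C.inv ∘ₗ C.varpi ∘ₗ C.circ₂ η)
          (∑ i ∈ (Coalgebra.Repr.arbitrary ℂ c).index,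
          Coalgebra.counit (R := ℂ) ((Coalgebra.Repr.arbitrary ℂ c).left i) •
          (Coalgebra.Repr.arbitrary ℂ c).right i) := by
      rw [Coalgebra.sum_counit_smul]; rfl
    rw [h2]
    simp only [sweedler, LinearMap.coe_comp, Function.comp_apply,
      ← (Coalgebra.Repr.arbitrary ℂ c).eq, map_sum, TensorProduct.map_tmul, braid_germ,
      Finset.sum_sub_distrib, map_smul, TensorProduct.lift.tmul, LinearMap.compl₂_apply,
      sub_add_cancel]
  rw [h1, sweedler_varpi_circ]
  -- The counit property of ϖ is inserted for η, so that both sides become bilinear in ϖ(η) and the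
  -- coproduct of c and can be compared on pure tensors.
  have h3 : TensorProduct.map (C.circ₂ η) C.germ (Coalgebra.comul (R := ℂ) c) =
      TensorProduct.map (C.circ₂ (TensorProduct.rid ℂ C.inv
        ((Coalgebra.counit (R := ℂ)).lTensor C.inv (C.varpi η)))) C.germ
        (Coalgebra.comul (R := ℂ) c) := by rw [varpi_counit]
  rw [h3]
  generalize C.varpi η = t
  induction t using TensorProduct.induction_on with
  | zero => simp
  | add s t hs ht =>
    simp only [map_add, LinearMap.add_apply, TensorProduct.map_add_left, hs, ht]
    abel
  | tmul v e =>
    generalize Coalgebra.comul (R := ℂ) c = t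
    induction t using TensorProduct.induction_on with
    | zero => simp
    | add s t hs ht => rw [map_add, map_add, map_add, map_add, hs, ht]; abel
    | tmul x y =>
      simp [circ_germ, TensorProduct.tmul_sub, TensorProduct.smul_tmul]

/-! ### Representations of `Γ^∧` on `A ⊗ N` -/

section Rep
variable {N : Type*} [AddCommGroup N] [Module ℂ N] (j : C.inv →ₗ[ℂ] Module.End ℂ N)

/-- `(b ⊗ ϑ), n ↦ b ⊗ j(ϑ) n`. -/
def trivAct : A ⊗[ℂ] C.inv →ₗ[ℂ] N →ₗ[ℂ] A ⊗[ℂ] N :=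
  TensorProduct.lift (((LinearMap.llcomp ℂ N N (A ⊗[ℂ] N)).compl₂ j) ∘ₗ TensorProduct.mk ℂ A N)

theorem trivAct_tmul (b : A) (ϑ : C.inv) (n : N) : C.trivAct j (b ⊗ₜ ϑ) n = b ⊗ₜ j ϑ n := rfl

theorem trivAct_mul (a : A) (t : A ⊗[ℂ] C.inv) (n : N) :
    C.trivAct j ((LinearMap.mulLeft ℂ a).rTensor C.inv t) n
      = (LinearMap.mulLeft ℂ a).rTensor N (C.trivAct j t n) := by
  induction t using TensorProduct.induction_on with
  | zero => simp
  | tmul x y => simp [trivAct_tmul]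
  | add s t hs ht => simp only [map_add, LinearMap.add_apply, hs, ht]

/-- The action of `A` on `A ⊗ N`. -/
def repA : A →ₗ[ℂ] Module.End ℂ (A ⊗[ℂ] N) := LinearMap.rTensorHom N ∘ₗ LinearMap.mul ℂ A

/-- The action of `Γ` on `A ⊗ N`: `γ (b ⊗ n) = ∑ b_k ⊗ j(ϑ_k) n`, where `γ b = ∑ b_k ϑ_k`. -/
def repΓ : Γ →ₗ[ℂ] Module.End ℂ (A ⊗[ℂ] N) :=
  TensorProduct.uncurry (.id ℂ) A N (A ⊗[ℂ] N) ∘ₗ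
    LinearMap.llcomp ℂ A (A ⊗[ℂ] C.inv) _ (C.trivAct j) ∘ₗ
    LinearMap.llcomp ℂ A Γ _ C.triv.toLinearMap ∘ₗ (ract A Γ).flip

theorem repΓ_tmul (γ : Γ) (b : A) (n : N) :
    C.repΓ j γ (b ⊗ₜ n) = C.trivAct j (C.triv (MulOpposite.op b • γ)) n := rfl

omit [StarRing A] in
theorem repA_tmul (a b : A) (n : N) : repA a (b ⊗ₜ[ℂ] n) = (a * b) ⊗ₜ n := rfl

omit [StarRing A] in
theorem repA_apply (a : A) (z : A ⊗[ℂ] N) : repA a z = (LinearMap.mulLeft ℂ a).rTensor N z := rfl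

omit [StarRing A] in
theorem repA_one : (repA 1 : Module.End ℂ (A ⊗[ℂ] N)) = 1 := by
  refine TensorProduct.ext' fun b n => ?_
  rw [repA_tmul, one_mul]; rfl

omit [StarRing A] in
theorem repA_mul (a a' : A) : (repA (a * a') : Module.End ℂ (A ⊗[ℂ] N)) = repA a * repA a' := by
  refine TensorProduct.ext' fun b n => ?_
  rw [Module.End.mul_apply, repA_tmul, repA_tmul, repA_tmul, mul_assoc]

theorem repΓ_smul (a : A) (γ : Γ) : C.repΓ j (a • γ) = repA a * C.repΓ j γ := by
  ext b n
  change C.repΓ j (a • γ) (b ⊗ₜ n) = repA a (C.repΓ j γ (b ⊗ₜ n))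
  rw [repΓ_tmul, repΓ_tmul, ← smul_comm, triv_smul, trivAct_mul, repA_apply]

theorem repΓ_op_smul (a : A) (γ : Γ) :
    C.repΓ j (MulOpposite.op a • γ) = C.repΓ j γ * repA a := by
  ext b n
  change C.repΓ j (MulOpposite.op a • γ) (b ⊗ₜ n) = C.repΓ j γ (repA a (b ⊗ₜ n))
  rw [repA_tmul, repΓ_tmul, repΓ_tmul, MulOpposite.op_mul, mul_smul]

theorem repΓ_inv_one (ϑ : C.inv) (n : N) : C.repΓ j (ϑ : Γ) (1 ⊗ₜ n) = 1 ⊗ₜ j ϑ n := by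
  rw [repΓ_tmul, MulOpposite.op_one, one_smul, triv_inv, trivAct_tmul]

theorem repΓ_d_one (b : A) (n : N) : C.repΓ j (C.d b) (1 ⊗ₜ n)
    = ((j.flip n) ∘ₗ C.germ).lTensor A (Coalgebra.comul (R := ℂ) b) := by
  rw [repΓ_tmul, MulOpposite.op_one, one_smul, triv_d]
  generalize Coalgebra.comul (R := ℂ) b = t
  induction t using TensorProduct.induction_on with
  | zero => simp
  | tmul x y => simp [trivAct_tmul]
  | add s t hs ht => simp only [map_add, LinearMap.add_apply, hs, ht]

theorem repΓ_d (a b : A) (z : A ⊗[ℂ] N) : C.repΓ j (C.d a) (repA b z)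
    = C.repΓ j (C.d (a * b)) z - repA a (C.repΓ j (C.d b) z) := by
  have h := congrArg (fun f => C.repΓ j f z) (C.d_mul a b)
  simp only [map_add, repΓ_smul, repΓ_op_smul, LinearMap.add_apply, Module.End.mul_apply] at h
  rw [h, add_sub_cancel_right]

/-- The products `∑ j(π(a⁽¹⁾)) j(π(a⁽²⁾))`. -/
def jGerm₂ {P : Type*} [Ring P] [Algebra ℂ P] (j : C.inv →ₗ[ℂ] P) : A →ₗ[ℂ] P :=
  mul₂ j j ∘ₗ C.germ₂

theorem exists_factor_germ {P : Type*} [AddCommGroup P] [Module ℂ P] (f : A →ₗ[ℂ] P)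
    (hf : ∀ a, C.germ a = 0 → f a = 0) : ∃ ψ : C.inv →ₗ[ℂ] P, ∀ a, ψ (C.germ a) = f a := by
  obtain ⟨s, hs⟩ := C.germ.exists_rightInverse_of_surjective
    (LinearMap.range_eq_top.2 C.germ_surjective)
  refine ⟨f ∘ₗ s, fun a => ?_⟩
  have h : C.germ (s (C.germ a) - a) = 0 := by
    rw [map_sub, sub_eq_zero]; exact congrArg (fun g => g (C.germ a)) hs
  have h2 := hf _ h
  rwa [map_sub, sub_eq_zero] at h2

variable (hj : ∀ a, C.germ a = 0 → C.jGerm₂ j a = 0)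
include hj

/-- On 1 ⊗ n the operator of d(a)d(b) depends only on the form a d(b). Indeed d(b)(1 ⊗ n) = ∑ b⁽¹⁾ ⊗
jπ(b⁽²⁾)n, and the Leibniz rule turns d(a)b⁽¹⁾ into d(ab⁽¹⁾) - a d(b⁽¹⁾). The first term is a
function of ∑ ab⁽¹⁾ ⊗ π(b⁽²⁾), the trivialization of a d(b). The second is ∑ ab⁽¹⁾ ⊗ jπ(b⁽²⁾)
jπ(b⁽³⁾)n, and by the hypothesis on j the product jπ(b⁽²⁾) jπ(b⁽³⁾) is a linear function ψ of the
germ. -/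
theorem repΓ_dd_one (t : A ⊗[ℂ] A) (ht : C.smulD t = 0) (n : N) :
    mul₂ (P := Module.End ℂ (A ⊗[ℂ] N)) (C.repΓ j ∘ₗ C.d) (C.repΓ j ∘ₗ C.d) t (1 ⊗ₜ n) = 0 := by
  obtain ⟨ψ, hψ⟩ := C.exists_factor_germ _ hj
  let G₁ : A ⊗[ℂ] C.inv →ₗ[ℂ] A ⊗[ℂ] N :=
    TensorProduct.lift (((C.repΓ j ∘ₗ C.d).flip ∘ₗ TensorProduct.mk ℂ A N 1 ∘ₗ j.flip n).flip)
  let G₂ : A ⊗[ℂ] C.inv →ₗ[ℂ] A ⊗[ℂ] N := (ψ.flip n).lTensor A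
  have key : ∀ s, mul₂ (P := Module.End ℂ (A ⊗[ℂ] N)) (C.repΓ j ∘ₗ C.d) (C.repΓ j ∘ₗ C.d) s (1 ⊗ₜ n)
      = G₁ (C.triv (C.smulD s)) - G₂ (C.triv (C.smulD s)) := by
    intro s
    induction s using TensorProduct.induction_on with
    | zero => simp
    | add s t hs ht => simp only [map_add, LinearMap.add_apply, hs, ht]; abel
    | tmul a b =>
      rw [smulD_tmul, triv_smul, triv_d, TensorProduct.lift.tmul, LinearMap.compl₁₂_apply,
        LinearMap.mul_apply', Module.End.mul_apply, LinearMap.comp_apply, LinearMap.comp_apply,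
        repΓ_d_one]
      have e1 : ∀ z : A ⊗[ℂ] A, C.repΓ j (C.d a) (((j.flip n) ∘ₗ C.germ).lTensor A z)
          = G₁ ((LinearMap.mulLeft ℂ a).rTensor C.inv (C.germ.lTensor A z))
            - repA a (TensorProduct.lift ((C.repΓ j ∘ₗ C.d).flip ∘ₗ TensorProduct.mk ℂ A N 1 ∘ₗ
                j.flip n ∘ₗ C.germ).flip z) := by
        intro z
        induction z using TensorProduct.induction_on with
        | zero => simp
        | add s t hs ht => simp only [map_add, hs, ht]; abel
        | tmul x y =>
          have h := C.repΓ_d j a x (1 ⊗ₜ j (C.germ y) n)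
          rw [repA_tmul, mul_one] at h
          exact h
      rw [e1]
      congr 1
      have e3 : ((C.jGerm₂ j).flip n).lTensor A (Coalgebra.comul (R := ℂ) b)
          = TensorProduct.lift ((C.repΓ j ∘ₗ C.d).flip ∘ₗ TensorProduct.mk ℂ A N 1 ∘ₗ
                j.flip n ∘ₗ C.germ).flip (Coalgebra.comul (R := ℂ) b) := by
        let Y : A ⊗[ℂ] (A ⊗[ℂ] A) →ₗ[ℂ] A ⊗[ℂ] N :=
          ((mul₂ j j ∘ₗ
            TensorProduct.map C.germ C.germ).flip n).lTensor A
        have f1 : ((C.jGerm₂ j).flip n).lTensor A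
            = Y ∘ₗ (Coalgebra.comul (R := ℂ)).lTensor A := by
          rw [← LinearMap.lTensor_comp]; rfl
        rw [f1, LinearMap.comp_apply, ← Coalgebra.coassoc_apply]
        generalize Coalgebra.comul (R := ℂ) b = t
        induction t using TensorProduct.induction_on with
        | zero => simp
        | add s t hs ht => simp only [map_add, hs, ht]
        | tmul x y =>
          have f2 := C.repΓ_d_one j x (j (C.germ y) n)
          refine Eq.trans ?_ f2.symm
          rw [LinearMap.rTensor_tmul]
          generalize Coalgebra.comul (R := ℂ) x = t
          induction t using TensorProduct.induction_on with
          | zero => simp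
          | add s t hs ht => simp only [map_add, hs, ht, TensorProduct.add_tmul]
          | tmul u v => simp [Y]
      rw [← e3]
      have e4 : (C.jGerm₂ j).flip n = ψ.flip n ∘ₗ C.germ := by
        ext x; exact congrArg (fun f => f n) (hψ x).symm
      rw [e4, LinearMap.lTensor_comp_apply, repA_apply]
      exact (lTensor_rTensor_apply _ _ _).symm
  rw [key, ht]; simp

theorem repΓ_dd (t : A ⊗[ℂ] A) (ht : C.smulD t = 0) :
    mul₂ (P := Module.End ℂ (A ⊗[ℂ] N)) (C.repΓ j ∘ₗ C.d) (C.repΓ j ∘ₗ C.d) t = 0 := by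
  ext c n
  let T := mul₂ (P := Module.End ℂ (A ⊗[ℂ] N)) (C.repΓ j ∘ₗ C.d) (C.repΓ j ∘ₗ C.d)
  -- From d(a)d(b)c = d(a)d(bc) - d(ab)d(c) + a d(b) d(c): the tensor a ⊗ bc - ab ⊗ c represents the
  -- form a d(b) c, so it still represents zero when a ⊗ b is replaced by t, and the case of 1 ⊗ n
  -- applies to it.
  let t' : A ⊗[ℂ] A →ₗ[ℂ] A ⊗[ℂ] A := (LinearMap.mulRight ℂ c).lTensor A
    - (TensorProduct.mk ℂ A A).flip c ∘ₗ LinearMap.mul' ℂ A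
  have h1 : ∀ s, C.smulD (t' s) = MulOpposite.op c • C.smulD s := by
    intro s
    induction s using TensorProduct.induction_on with
    | zero => simp
    | add s t hs ht => simp only [map_add, hs, ht, smul_add]
    | tmul a b =>
      simp only [t', LinearMap.sub_apply, LinearMap.lTensor_tmul, LinearMap.mulRight_apply,
        LinearMap.comp_apply, LinearMap.mul'_apply, LinearMap.flip_apply, TensorProduct.mk_apply,
        map_sub, smulD_tmul, C.d_mul, smul_add, mul_smul]
      rw [add_sub_cancel_right, smul_comm]
  have h2 : ∀ s, T s (c ⊗ₜ n) = T (t' s) (1 ⊗ₜ n)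
      + C.repΓ j (C.smulD s) (C.repΓ j (C.d c) (1 ⊗ₜ n)) := by
    intro s
    induction s using TensorProduct.induction_on with
    | zero => simp
    | add s t hs ht => simp only [map_add, hs, ht, LinearMap.add_apply]; abel
    | tmul a b =>
      have e : T (a ⊗ₜ b) (c ⊗ₜ n) = C.repΓ j (C.d a) (C.repΓ j (C.d b) (repA c (1 ⊗ₜ n))) := by
        rw [repA_tmul, mul_one]; rfl
      rw [e, repΓ_d, map_sub, repΓ_d, smulD_tmul, repΓ_smul, Module.End.mul_apply]
      have e2 : T (t' (a ⊗ₜ b)) (1 ⊗ₜ n) = C.repΓ j (C.d a) (C.repΓ j (C.d (b * c)) (1 ⊗ₜ n))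
          - C.repΓ j (C.d (a * b)) (C.repΓ j (C.d c) (1 ⊗ₜ n)) := by
        simp [t', T]
      rw [e2]; abel
  have h3 := h2 t
  rw [ht, map_zero, LinearMap.zero_apply, add_zero,
    C.repΓ_dd_one j hj _ (by rw [h1, ht, smul_zero])] at h3
  exact h3

end Rep

section Rep
variable {N : Type*} [AddCommGroup N] [Module ℂ N] (j : C.inv →ₗ[ℂ] Module.End ℂ N)
  (hj : ∀ a, C.germ a = 0 → C.jGerm₂ j a = 0)

set_option maxHeartbeats 2000000 in
/-- The representation of `Γ^∧` on `A ⊗ N` in which `ϑ (1 ⊗ n) = 1 ⊗ j(ϑ) n`. -/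
def envRep : C.Env →ₐ[ℂ] Module.End ℂ (A ⊗[ℂ] N) :=
  @envLift A Γ _ _ _ _ _ _ _ _ _ _ C (Module.End ℂ (A ⊗[ℂ] N)) _ _ repA (C.repΓ j) repA_one
    repA_mul (C.repΓ_smul j) (C.repΓ_op_smul j) (C.repΓ_dd j hj)

set_option maxHeartbeats 2000000 in
theorem envRep_gA (a : A) : C.envRep j hj (C.gA a) = repA a := C.envLift_gA _ _ _ _ _ _ _ a

set_option maxHeartbeats 2000000 in
theorem envRep_gΓ (γ : Γ) : C.envRep j hj (C.gΓ γ) = C.repΓ j γ := C.envLift_gΓ _ _ _ _ _ _ _ γ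

theorem envRep_inv (ϑ : C.inv) (n : N) :
    C.envRep j hj (C.invEnv ϑ) (1 ⊗ₜ n) = 1 ⊗ₜ j ϑ n := by
  rw [← repΓ_inv_one, ← C.envRep_gΓ j hj]; rfl

end Rep

/-- The multiplication `Γ_inv ⊗ Γ_inv → Γ^∧`. -/
abbrev invMul : C.inv ⊗[ℂ] C.inv →ₗ[ℂ] C.Env := mul₂ C.invEnv C.invEnv

/-! ### The quadratic relations of Γ_inv and the Maurer–Cartan formula. -/

section Quadratic

/-- The quadratic relations `∑ π(a⁽¹⁾) ⊗ π(a⁽²⁾)`, where `π(a) = 0`. -/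
def quadRel : Submodule ℂ (C.inv ⊗[ℂ] C.inv) := (LinearMap.ker C.germ).map C.germ₂

/-- The truncated action of `Γ_inv` on `ℂ ⊕ Γ_inv ⊕ Γ_inv ⊗ Γ_inv / quadRel`. -/
def truncAct : C.inv →ₗ[ℂ] Module.End ℂ (ℂ × C.inv × ((C.inv ⊗[ℂ] C.inv) ⧸ C.quadRel)) :=
  LinearMap.mk₂ ℂ (fun ϑ n => (0, n.1 • ϑ, C.quadRel.mkQ (ϑ ⊗ₜ n.2.1)))
    (by intros; simp [TensorProduct.add_tmul]) (fun c ϑ n => Prod.ext (by simp) (Prod.ext (smul_comm _ _ _)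
      (by simp [← TensorProduct.smul_tmul'])))
    (by intros; simp [add_smul, TensorProduct.tmul_add]) (by intros; simp [mul_smul])

theorem truncAct_mul (t : C.inv ⊗[ℂ] C.inv)
    (n : ℂ × C.inv × ((C.inv ⊗[ℂ] C.inv) ⧸ C.quadRel)) :
    mul₂ (P := Module.End ℂ _) C.truncAct C.truncAct t n = (0, 0, n.1 • C.quadRel.mkQ t) := by
  induction t using TensorProduct.induction_on with
  | zero => simp; rfl
  | tmul x y => simp [truncAct]
  | add s t hs ht => rw [map_add, LinearMap.add_apply, hs, ht]; simp

/-- The truncated action satisfies the relations in `quadRel` by construction, so it extends to a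
representation of Γ^∧. There the product of the factors of t sends 1 ⊗ (1, 0, 0) to the class of t
modulo `quadRel`, and hence a tensor that vanishes in Γ^∧ is in `quadRel`. This makes the first
family of generators of 𝒦 computable. -/
theorem exists_of_invMul_eq_zero (t : C.inv ⊗[ℂ] C.inv) (ht : C.invMul t = 0) :
    ∃ a, C.germ a = 0 ∧ C.germ₂ a = t := by
  have hj : ∀ a, C.germ a = 0 → C.jGerm₂ C.truncAct a = 0 := by
    intro a ha
    refine LinearMap.ext fun n => ?_
    refine (C.truncAct_mul (C.germ₂ a) n).trans ?_
    have : C.quadRel.mkQ (C.germ₂ a) = 0 :=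
      (Submodule.Quotient.mk_eq_zero _).2 ⟨a, ha, rfl⟩
    rw [this, smul_zero]; rfl
  have key : ∀ s, C.envRep C.truncAct hj (C.invMul s) (1 ⊗ₜ (1, 0, 0))
      = 1 ⊗ₜ (mul₂ (P := Module.End ℂ _) C.truncAct C.truncAct s (1, 0, 0)) := by
    intro s
    induction s using TensorProduct.induction_on with
    | zero => simp
    | tmul x y =>
      simp only [TensorProduct.lift.tmul, LinearMap.compl₁₂_apply, LinearMap.mul_apply', map_mul,
        Module.End.mul_apply, envRep_inv]
    | add s t hs ht => simp only [map_add, LinearMap.add_apply, hs, ht, TensorProduct.tmul_add]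
  have h := key t
  rw [ht, map_zero, LinearMap.zero_apply, truncAct_mul] at h
  have h2 := congrArg (TensorProduct.lid ℂ _ ∘ (Coalgebra.counit (R := ℂ) (A := A)).rTensor _) h
  simp only [Function.comp_apply, map_zero, LinearMap.rTensor_tmul, Bialgebra.counit_one,
    TensorProduct.lid_tmul, one_smul] at h2
  have h3 : C.quadRel.mkQ t = 0 := (Prod.ext_iff.1 (Prod.ext_iff.1 h2).2).2.symm
  obtain ⟨a, ha, h4⟩ := (Submodule.Quotient.mk_eq_zero _).1 h3
  exact ⟨a, ha, h4⟩

theorem gΓ_sweedler (F : A →ₗ[ℂ] Γ) (a : A) :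
    C.gΓ (sweedler (lact A Γ) F a)
      = sweedler ((LinearMap.mul ℂ C.Env) ∘ₗ C.gA) (C.gΓ ∘ₗ F) a := by
  simp only [sweedler, LinearMap.coe_comp, Function.comp_apply]
  generalize Coalgebra.comul (R := ℂ) a = t
  induction t using TensorProduct.induction_on with
  | zero => simp
  | tmul x y => simp [lact, gΓ_smul]
  | add s t hs ht => simp only [map_add, hs, ht]

theorem gΓ_d (a : A) : C.gΓ (C.d a)
    = sweedler ((LinearMap.mul ℂ C.Env) ∘ₗ C.gA) (C.invEnv ∘ₗ C.germ) a := by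
  conv_lhs => rw [← sweedler_germ]
  rw [gΓ_sweedler]; rfl

/-- The Maurer–Cartan formula `dπ(a) = -∑ π(a⁽¹⁾) π(a⁽²⁾)`. -/
theorem envDiff_germ (a : A) :
    C.envDiff.d (C.invEnv (C.germ a)) = -C.invMul (C.germ₂ a) := by
  let ρ : A →ₗ[ℂ] C.Env →ₗ[ℂ] C.Env := (LinearMap.mul ℂ C.Env) ∘ₗ C.gA
  let F₁ : A →ₗ[ℂ] C.Env := C.envDiff.d ∘ₗ C.invEnv ∘ₗ C.germ
  let F₂ : A →ₗ[ℂ] C.Env := -(C.invMul ∘ₗ C.germ₂)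
  -- Differentiating d(a) = ∑ a⁽¹⁾π(a⁽²⁾) and using the same formula for d(a⁽¹⁾) gives ∑
  -- a⁽¹⁾(dπ(a⁽²⁾) + π(a⁽²⁾)π(a⁽³⁾)) = 0. The factor a⁽¹⁾ is then cancelled by the antipode.
  have hd : ∀ a, C.envDiff.d (C.gΓ (C.d a)) = 0 := fun a => by
    rw [envDiff_gΓ, d1_d]
  have e1 : ∀ t : A ⊗[ℂ] A, C.envDiff.d (TensorProduct.lift (ρ.compl₂ (C.invEnv ∘ₗ C.germ)) t)
      = TensorProduct.lift (ρ.compl₂ F₁) t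
        + mul₂ (C.gΓ ∘ₗ C.d) (C.invEnv ∘ₗ C.germ) t := by
    intro t
    induction t using TensorProduct.induction_on with
    | zero => simp
    | add s t hs ht => simp only [map_add, hs, ht]; abel
    | tmul x y =>
      have hp : Super.par (C.gA x) = C.gA x := C.envPar_gA x
      simp only [TensorProduct.lift.tmul, LinearMap.compl₂_apply, LinearMap.comp_apply, ρ, F₁,
        LinearMap.mul_apply', SuperDiff.d_mul, hp, envDiff_gA, LinearMap.compl₁₂_apply]
      rw [add_comm]
  have e2 : ∀ a, mul₂ (C.gΓ ∘ₗ C.d) (C.invEnv ∘ₗ C.germ) (Coalgebra.comul (R := ℂ) a)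
      = - sweedler ρ F₂ a := by
    intro a
    let Y : A ⊗[ℂ] (A ⊗[ℂ] A) →ₗ[ℂ] C.Env := TensorProduct.lift (ρ.compl₂
      (mul₂ (C.invEnv ∘ₗ C.germ) (C.invEnv ∘ₗ C.germ)))
    have f1 : - sweedler ρ F₂ a
        = Y ((Coalgebra.comul (R := ℂ)).lTensor A (Coalgebra.comul (R := ℂ) a)) := by
      simp only [sweedler, LinearMap.comp_apply, F₂]
      generalize Coalgebra.comul (R := ℂ) a = t
      induction t using TensorProduct.induction_on with
      | zero => simp
      | add s t hs ht => simp only [map_add, neg_add, hs, ht]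
      | tmul x y =>
        simp only [TensorProduct.lift.tmul, LinearMap.compl₂_apply, LinearMap.neg_apply, map_neg,
          neg_neg, LinearMap.lTensor_tmul, Y, LinearMap.comp_apply, germ₂]
        congr 1
        generalize Coalgebra.comul (R := ℂ) y = t
        induction t using TensorProduct.induction_on with
        | zero => simp
        | add s t hs ht => simp only [map_add, hs, ht]
        | tmul x y => rfl
    rw [f1, ← Coalgebra.coassoc_apply]
    generalize Coalgebra.comul (R := ℂ) a = t
    induction t using TensorProduct.induction_on with
    | zero => simp
    | add s t hs ht => simp only [map_add, hs, ht]
    | tmul x y =>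
      rw [TensorProduct.lift.tmul, LinearMap.compl₁₂_apply, LinearMap.mul_apply',
        LinearMap.comp_apply, gΓ_d, sweedler, LinearMap.comp_apply, LinearMap.rTensor_tmul]
      generalize Coalgebra.comul (R := ℂ) x = t
      induction t using TensorProduct.induction_on with
      | zero => simp
      | add s t hs ht => simp only [map_add, hs, ht, TensorProduct.add_tmul, add_mul]
      | tmul u v => simp [Y, ρ, mul_assoc]
  have h : sweedler ρ F₁ = sweedler ρ F₂ := by
    ext a
    have h1 := hd a
    rw [gΓ_d, sweedler, LinearMap.comp_apply, e1, e2] at h1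
    exact add_neg_eq_zero.1 h1
  have h1 : ∀ m, ρ 1 m = m := fun m => by simp [ρ, gA_one]
  have hm : ∀ a b m, ρ (a * b) m = ρ a (ρ b m) := fun a b m => by simp [ρ, gA_mul, mul_assoc]
  have e : F₁ = F₂ := by
    rw [← sweedler_antipode_left ρ h1 hm F₁, h, sweedler_antipode_left ρ h1 hm]
  exact congrArg (fun f => f a) e

theorem invMul_germ₂ (a : A) (ha : C.germ a = 0) : C.invMul (C.germ₂ a) = 0 := by
  have h := C.envDiff_germ a
  rw [ha, map_zero, map_zero] at h
  exact neg_eq_zero.1 h.symm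

-- By the Maurer–Cartan formula δ(π(a)) + ∑ π(a⁽¹⁾) ⊗ π(a⁽²⁾) vanishes in Γ^∧, so it is `germ₂ b`
-- for some b with π(b) = 0, and a - b is the required representative. Thus δ, known only through
-- its class in Γ^∧, may be replaced at each single ϑ by a coproduct.
variable {C} in
theorem EmbeddedDifferential.exists_germ (δ : C.EmbeddedDifferential) (ϑ : C.inv) :
    ∃ a, C.germ a = ϑ ∧ δ.δ ϑ = -C.germ₂ a := by
  obtain ⟨a, rfl⟩ := C.germ_surjective ϑ
  have h := δ.lift (C.germ a)
  rw [envDiff_germ] at h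
  obtain ⟨b, hb, hb'⟩ := C.exists_of_invMul_eq_zero (δ.δ (C.germ a) + C.germ₂ a) (by
    rw [map_add, eq_neg_iff_add_eq_zero.1 h])
  refine ⟨a - b, by rw [map_sub, hb, sub_zero], ?_⟩
  rw [map_sub, hb']; abel

end Quadratic

/-! ### Convolution products and commutation relations. -/

theorem braid_tmul (η ϑ : C.inv) :
    C.braid (η ⊗ₜ ϑ) = (C.circ₂ η).lTensor C.inv (C.varpi ϑ) := by
  simp only [braid, LinearMap.coe_comp, Function.comp_apply, LinearMap.lTensor_tmul,
    LinearEquiv.coe_coe]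
  generalize C.varpi ϑ = t
  induction t using TensorProduct.induction_on with
  | zero => simp
  | add s t hs ht => simp only [map_add, hs, ht, TensorProduct.tmul_add]
  | tmul v e => simp [circ₂_apply]

theorem mul₂_lTensor {P M N N' : Type*} [Ring P] [Algebra ℂ P] [AddCommGroup M] [Module ℂ M]
    [AddCommGroup N] [Module ℂ N] [AddCommGroup N'] [Module ℂ N'] (f : M →ₗ[ℂ] P) (g : N →ₗ[ℂ] P)
    (h : N' →ₗ[ℂ] N) (t : M ⊗[ℂ] N') : mul₂ f g (h.lTensor M t) = mul₂ f (g ∘ₗ h) t := by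
  induction t using TensorProduct.induction_on with
  | zero => simp
  | add s t hs ht => simp only [map_add, hs, ht]
  | tmul v e => simp

theorem map_mul₂ {P P' M N : Type*} [Ring P] [Algebra ℂ P] [Ring P'] [Algebra ℂ P']
    [AddCommGroup M] [Module ℂ M] [AddCommGroup N] [Module ℂ N] (f : M →ₗ[ℂ] P) (g : N →ₗ[ℂ] P)
    (F : P →ₐ[ℂ] P') (t : M ⊗[ℂ] N) :
    F (mul₂ f g t) = mul₂ (F.toLinearMap ∘ₗ f) (F.toLinearMap ∘ₗ g) t := by
  induction t using TensorProduct.induction_on with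
  | zero => simp
  | add s t hs ht => simp only [map_add, hs, ht]
  | tmul v e => simp

/-- The convolution product `∑ z(a⁽¹⁾) z'(a⁽²⁾)`. -/
def conv {P : Type*} [Ring P] [Algebra ℂ P] (z z' : A →ₗ[ℂ] P) : A →ₗ[ℂ] P :=
  mul₂ z z' ∘ₗ Coalgebra.comul

section Conv
variable {P : Type*} [Ring P] [Algebra ℂ P]

omit [StarRing A] in
theorem conv_assoc (z z' z'' : A →ₗ[ℂ] P) : conv (conv z z') z'' = conv z (conv z' z'') := by
  ext a
  have h := Coalgebra.coassoc_apply (R := ℂ) a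
  let Y : A ⊗[ℂ] (A ⊗[ℂ] A) →ₗ[ℂ] P := mul₂ z (mul₂ z' z'')
  have h1 : conv z (conv z' z'') a
      = Y ((Coalgebra.comul (R := ℂ)).lTensor A (Coalgebra.comul (R := ℂ) a)) :=
    (mul₂_lTensor _ _ _ _).symm
  rw [h1, ← h, conv, LinearMap.comp_apply]
  generalize Coalgebra.comul (R := ℂ) a = t
  induction t using TensorProduct.induction_on with
  | zero => simp
  | add s t hs ht => simp only [map_add, hs, ht]
  | tmul x y =>
    rw [TensorProduct.lift.tmul, LinearMap.compl₁₂_apply, LinearMap.mul_apply', conv,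
      LinearMap.comp_apply, LinearMap.rTensor_tmul]
    generalize Coalgebra.comul (R := ℂ) x = t
    induction t using TensorProduct.induction_on with
    | zero => simp
    | add s t hs ht => simp only [map_add, hs, ht, TensorProduct.add_tmul, add_mul]
    | tmul u v => simp [Y, mul_assoc]

theorem mul₂_varpi_varpi (r : C.inv →ₗ[ℂ] P) (z z' : A →ₗ[ℂ] P) (ϑ : C.inv) :
    mul₂ (mul₂ r z ∘ₗ C.varpi) z' (C.varpi ϑ) = mul₂ r (conv z z') (C.varpi ϑ) := by
  let Y : C.inv ⊗[ℂ] (A ⊗[ℂ] A) →ₗ[ℂ] P := mul₂ r (mul₂ z z')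
  have h1 : mul₂ r (conv z z') (C.varpi ϑ)
      = Y ((Coalgebra.comul (R := ℂ)).lTensor C.inv (C.varpi ϑ)) := (mul₂_lTensor _ _ _ _).symm
  rw [h1, ← varpi_coassoc]
  generalize C.varpi ϑ = t
  induction t using TensorProduct.induction_on with
  | zero => simp
  | add s t hs ht => simp only [map_add, hs, ht]
  | tmul x y =>
    rw [TensorProduct.lift.tmul, LinearMap.compl₁₂_apply, LinearMap.mul_apply',
      LinearMap.comp_apply, LinearMap.rTensor_tmul]
    generalize C.varpi x = t
    induction t using TensorProduct.induction_on with
    | zero => simp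
    | add s t hs ht => simp only [map_add, hs, ht, TensorProduct.add_tmul, add_mul]
    | tmul u v => simp [Y, mul_assoc]

/-- The commutation relations `y(η) r(ϑ) = ∑ r(ϑ_k) y(η ∘ c_k)`. -/
def Commutes (y r : C.inv →ₗ[ℂ] P) : Prop :=
  ∀ η ϑ, y η * r ϑ = mul₂ r (y ∘ₗ C.circ₂ η) (C.varpi ϑ)

variable {C}

/-- The commutation relation brings r to the left, and the coassociativity of ϖ collects what
remains into a convolution on A. In this way all products with a factor r(ϑ) take the form ∑ r(ϑ_k)
f(c_k), and identities between them reduce to identities between functions f on A. -/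
theorem Commutes.mul_mul₂ {y r : C.inv →ₗ[ℂ] P} (h : C.Commutes y r) (z : A →ₗ[ℂ] P) (η ϑ : C.inv) :
    y η * mul₂ r z (C.varpi ϑ) = mul₂ r (conv (y ∘ₗ C.circ₂ η) z) (C.varpi ϑ) := by
  rw [← mul₂_varpi_varpi]
  generalize C.varpi ϑ = t
  induction t using TensorProduct.induction_on with
  | zero => simp
  | add s t hs ht => simp only [map_add, hs, ht, mul_add]
  | tmul u v => simp [← mul_assoc, h η u]

theorem Commutes.mul₂_mul {y y' r : C.inv →ₗ[ℂ] P} (h : C.Commutes y r) (h' : C.Commutes y' r)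
    (t : C.inv ⊗[ℂ] C.inv) (ϑ : C.inv) :
    mul₂ y y' t * r ϑ = mul₂ r (mul₂ y y' ∘ₗ TensorProduct.map₂ C.circ₂ C.circ₂ t ∘ₗ
      Coalgebra.comul) (C.varpi ϑ) := by
  induction t using TensorProduct.induction_on with
  | zero =>
    rw [map_zero, map_zero, LinearMap.zero_comp, LinearMap.comp_zero, zero_mul]
    have e : mul₂ r (0 : A →ₗ[ℂ] P) = 0 := by ext; simp
    rw [e]; rfl
  | add s t hs ht =>
    rw [map_add, add_mul, hs, ht, map_add, LinearMap.add_comp, LinearMap.comp_add]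
    have e : ∀ z z' : A →ₗ[ℂ] P, mul₂ r (z + z') = mul₂ r z + mul₂ r z' := by
      intro z z'; ext; simp [mul_add]
    rw [e]; rfl
  | tmul u v =>
    have e : (mul₂ y y' ∘ₗ TensorProduct.map₂ C.circ₂ C.circ₂ (u ⊗ₜ v) ∘ₗ Coalgebra.comul)
        = conv (y ∘ₗ C.circ₂ u) (y' ∘ₗ C.circ₂ v) := by
      rw [conv, ← LinearMap.comp_assoc]
      congr 1
      ext; simp
    rw [e, ← h.mul_mul₂, ← h' v ϑ, ← mul_assoc]; rfl
end Conv

/-! ### Stability of 𝒦 under d. -/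

namespace EmbeddedDifferential
variable {C}
variable (δ : C.EmbeddedDifferential)

/-- The classes of the generators `ϑ` in `Ω_*`. -/
def x : C.inv →ₗ[ℂ] δ.OmegaStar := δ.p.toLinearMap ∘ₗ C.θ

/-- The classes of the elements `R(ϑ)` in `Ω_*`. -/
def r : C.inv →ₗ[ℂ] δ.OmegaStar := δ.p.toLinearMap ∘ₗ δ.R

theorem mul₂_x_eq_zero (t : C.inv ⊗[ℂ] C.inv) (ht : C.invMul t = 0) : mul₂ δ.x δ.x t = 0 := by
  have h : δ.p (mul₂ C.θ C.θ t) = 0 :=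
    δ.p_eq_zero (TwoSidedIdeal.subset_span (.inl (.inl ⟨t, ht, rfl⟩)))
  rwa [map_mul₂] at h

theorem commutes_x : C.Commutes δ.x δ.r := by
  intro η ϑ
  have h : δ.p (δ.j₃ η ϑ) = 0 :=
    δ.p_eq_zero (TwoSidedIdeal.subset_span (.inl (.inr ⟨η, ϑ, rfl⟩)))
  rw [j₃, map_sub, sub_eq_zero, map_mul, map_mul₂, braid_tmul, mul₂_lTensor] at h
  exact h

theorem commutes_r : C.Commutes δ.r δ.r := by
  intro η ϑ
  have h : δ.p (δ.j₄ η ϑ) = 0 :=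
    δ.p_eq_zero (TwoSidedIdeal.subset_span (.inr ⟨η, ϑ, rfl⟩))
  rw [j₄, map_sub, sub_eq_zero, map_mul, map_mul₂, braid_tmul, mul₂_lTensor] at h
  exact h

/-- The representative supplied by `exists_germ` may be replaced by any a, because two elements with
the same germ differ by a quadratic relation, which is zero in Ω_*. -/
theorem mul₂_x_germ₂ (a : A) : mul₂ δ.x δ.x (C.germ₂ a) = -mul₂ δ.x δ.x (δ.δ (C.germ a)) := by
  obtain ⟨b, hb, hb'⟩ := δ.exists_germ (C.germ a)
  have h := δ.mul₂_x_eq_zero _ (C.invMul_germ₂ (a - b) (by rw [map_sub, hb, sub_self]))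
  rw [hb', map_neg, neg_neg, ← sub_eq_zero, ← map_sub, ← map_sub, h]

theorem conv_x_germ (a : A) :
    conv (δ.x ∘ₗ C.germ) (δ.x ∘ₗ C.germ) a = mul₂ δ.x δ.x (C.germ₂ a) := by
  simp only [conv, germ₂, LinearMap.comp_apply]
  generalize Coalgebra.comul (R := ℂ) a = t
  induction t using TensorProduct.induction_on with
  | zero => simp
  | add s t hs ht => simp only [map_add, hs, ht]
  | tmul u v => simp

/-- The composition of `d : Ω → Ω` with the projection on `Ω_*`. -/
def pd : C.Univ →ₗ[ℂ] δ.OmegaStar := δ.p.toLinearMap ∘ₗ C.diff.d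

theorem pd_mul (u v : C.Univ) :
    δ.pd (u * v) = δ.pd u * δ.p v + δ.p (Super.par u) * δ.pd v := by
  simp only [pd, LinearMap.comp_apply, SuperDiff.d_mul, AlgHom.toLinearMap_apply, map_add, map_mul]

theorem pd_θ (ϑ : C.inv) : δ.pd (C.θ ϑ) = δ.r ϑ + mul₂ δ.x δ.x (δ.δ ϑ) := by
  have h : C.dθ ϑ = δ.R ϑ + mul₂ C.θ C.θ (δ.δ ϑ) := by
    simp only [R, LinearMap.sub_apply, LinearMap.comp_apply, sub_add_cancel]
  simp only [pd, LinearMap.comp_apply, diff_θ, AlgHom.toLinearMap_apply, h, map_add, map_mul₂]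
  rfl

theorem pd_θ_germ (a : A) : δ.pd (C.θ (C.germ a)) = δ.r (C.germ a) - mul₂ δ.x δ.x (C.germ₂ a) := by
  rw [pd_θ, mul₂_x_germ₂, sub_neg_eq_add]

theorem pd_mul₂_θ (t : C.inv ⊗[ℂ] C.inv) : δ.pd (mul₂ C.θ C.θ t)
    = mul₂ (δ.pd ∘ₗ C.θ) δ.x t - mul₂ δ.x (δ.pd ∘ₗ C.θ) t := by
  induction t using TensorProduct.induction_on with
  | zero => simp
  | add s t hs ht => simp only [map_add, hs, ht]; abel
  | tmul u v => simp [pd_mul, par_θ, x, sub_eq_add_neg]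

theorem mul₂_r_x (t : C.inv ⊗[ℂ] C.inv) : mul₂ δ.r δ.x (C.braid t) = mul₂ δ.x δ.r t := by
  induction t using TensorProduct.induction_on with
  | zero => simp
  | add s t hs ht => simp only [map_add, hs, ht]
  | tmul u v =>
    rw [braid_tmul, mul₂_lTensor, ← δ.commutes_x]; rfl

/-- Inserting dπ(a) = r(π(a)) - ∑ x(π(a⁽¹⁾)) x(π(a⁽²⁾)) leaves two cubic terms, which cancel by
associativity, and ∑ r(π(a⁽¹⁾)) x(π(a⁽²⁾)) - ∑ x(π(a⁽¹⁾)) r(π(a⁽²⁾)). The commutation relation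
writes the last sum as r·x applied to the braided tensor, so that only the defect in `braid_germ₂`
survives. For π(a) = 0 this says that the quadratic relations are preserved by d; in general it
contains the Bianchi identity. -/
theorem pd_mul₂_θ_germ₂ (a : A) : δ.pd (mul₂ C.θ C.θ (C.germ₂ a))
    = mul₂ δ.r (δ.x ∘ₗ C.germ) (C.varpi (C.germ a)) := by
  have h : ∀ a, δ.pd (C.θ (C.germ a))
      = (δ.r ∘ₗ C.germ - conv (δ.x ∘ₗ C.germ) (δ.x ∘ₗ C.germ)) a := fun a => by
    rw [pd_θ_germ, ← conv_x_germ]; rfl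
  have h' : (δ.pd ∘ₗ C.θ) ∘ₗ C.germ
      = δ.r ∘ₗ C.germ - conv (δ.x ∘ₗ C.germ) (δ.x ∘ₗ C.germ) := LinearMap.ext h
  have e : ∀ f g : C.inv →ₗ[ℂ] δ.OmegaStar,
      mul₂ f g (C.germ₂ a) = conv (f ∘ₗ C.germ) (g ∘ₗ C.germ) a := by
    intro f g
    simp only [conv, germ₂, LinearMap.comp_apply]
    generalize Coalgebra.comul (R := ℂ) a = t
    induction t using TensorProduct.induction_on with
    | zero => simp
    | add s t hs ht => simp only [map_add, hs, ht]
    | tmul u v => simp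
  have sub_conv : ∀ z z' z'' : A →ₗ[ℂ] δ.OmegaStar,
      conv (z - z') z'' a = conv z z'' a - conv z' z'' a := by
    intro z z' z''
    have : mul₂ (z - z') z'' = mul₂ z z'' - mul₂ z' z'' := by ext; simp
    simp only [conv, this]; rfl
  have conv_sub : ∀ z z' z'' : A →ₗ[ℂ] δ.OmegaStar,
      conv z'' (z - z') a = conv z'' z a - conv z'' z' a := by
    intro z z' z''
    have : mul₂ z'' (z - z') = mul₂ z'' z - mul₂ z'' z' := by ext; simp [mul_sub]
    simp only [conv, this]; rfl
  rw [pd_mul₂_θ, e, e, h', sub_conv, conv_sub, conv_assoc, ← e, ← e, ← δ.mul₂_r_x, braid_germ₂,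
    map_sub, mul₂_lTensor]
  abel

/-- The Bianchi identity. -/
theorem pd_R (ϑ : C.inv) : δ.pd (δ.R ϑ) = mul₂ δ.r (δ.x ∘ₗ C.germ) (C.varpi ϑ) := by
  obtain ⟨a, rfl, ha⟩ := δ.exists_germ ϑ
  rw [← pd_mul₂_θ_germ₂, R, LinearMap.sub_apply, LinearMap.comp_apply, ha, map_neg, sub_neg_eq_add,
    map_add]
  simp [pd, ← diff_θ, SuperDiff.d_d]

/-- With π(b) ∘ c = π(bc) - ε(b)π(c), the product of π(b⁽¹⁾) ∘ c⁽¹⁾ and π(b⁽²⁾) ∘ c⁽²⁾ expands into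
π(b⁽¹⁾c⁽¹⁾) π(b⁽²⁾c⁽²⁾) - π(bc⁽¹⁾) π(c⁽²⁾) - π(c⁽¹⁾) π(bc⁽²⁾) + ε(b) π(c⁽¹⁾) π(c⁽²⁾). The two
convolutions remove the mixed terms, and the rest is the Maurer–Cartan expression of π(b) ∘ c. -/
theorem mul₂_x_circ_germ₂ (b c : A) :
    mul₂ δ.x δ.x (TensorProduct.map₂ C.circ₂ C.circ₂ (C.germ₂ b) (Coalgebra.comul (R := ℂ) c))
      + conv (δ.x ∘ₗ C.circ₂ (C.germ b)) (δ.x ∘ₗ C.germ) c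
      + conv (δ.x ∘ₗ C.germ) (δ.x ∘ₗ C.circ₂ (C.germ b)) c
      = -mul₂ δ.x δ.x (δ.δ (C.circ₂ (C.germ b) c)) := by
  rw [circ_germ, map_sub, map_smul, map_sub, map_smul, neg_sub, ← neg_neg (mul₂ _ _ (δ.δ (C.germ c))),
    smul_neg, ← mul₂_x_germ₂, sub_eq_add_neg, ← mul₂_x_germ₂, ← conv_x_germ, ← conv_x_germ]
  let ρ : A →ₗ[ℂ] δ.OmegaStar := δ.x ∘ₗ C.germ
  have hz : δ.x ∘ₗ C.circ₂ (C.germ b)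
      = ρ ∘ₗ LinearMap.mulLeft ℂ b - Coalgebra.counit (R := ℂ) b • ρ := by
    ext c; simp [circ_germ, ρ]
  have key : ∀ t s : A ⊗[ℂ] A, mul₂ δ.x δ.x
      (TensorProduct.map₂ C.circ₂ C.circ₂ (TensorProduct.map C.germ C.germ t) s)
      = mul₂ ρ ρ (t * s) - mul₂ (ρ ∘ₗ LinearMap.mulLeft ℂ
          (TensorProduct.rid ℂ A ((Coalgebra.counit (R := ℂ)).lTensor A t))) ρ s
        - mul₂ ρ (ρ ∘ₗ LinearMap.mulLeft ℂ
          (TensorProduct.lid ℂ A ((Coalgebra.counit (R := ℂ)).rTensor A t))) s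
        + Coalgebra.counit (R := ℂ) (TensorProduct.lid ℂ A
          ((Coalgebra.counit (R := ℂ)).rTensor A t)) • mul₂ ρ ρ s := by
    intro t s
    induction s using TensorProduct.induction_on with
    | zero => simp
    | add s s' hs hs' => simp only [map_add, hs, hs', mul_add, smul_add]; abel
    | tmul w z =>
      induction t using TensorProduct.induction_on with
      | zero => simp
      | add t t' ht ht' =>
        simp only [map_add, LinearMap.add_apply, ht, ht', add_mul, add_smul, TensorProduct.lift.tmul,
          LinearMap.compl₁₂_apply, LinearMap.comp_apply, LinearMap.mulLeft_apply]
        abel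
      | tmul u v =>
        simp [circ_germ, ρ, mul_sub, mul_smul, smul_sub]
        module
  have hk := key (Coalgebra.comul (R := ℂ) b) (Coalgebra.comul (R := ℂ) c)
  rw [Coalgebra.lTensor_counit_comul, Coalgebra.rTensor_counit_comul, TensorProduct.rid_tmul,
    TensorProduct.lid_tmul, one_smul, ← Bialgebra.comul_mul] at hk
  have e1 : ∀ z z' : A →ₗ[ℂ] δ.OmegaStar, conv z z' c = mul₂ z z' (Coalgebra.comul (R := ℂ) c) :=
    fun _ _ => rfl
  have e2 : ∀ f g h : A →ₗ[ℂ] δ.OmegaStar, ∀ q : ℂ, mul₂ (f - q • g) h = mul₂ f h - q • mul₂ g h := by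
    intro f g h q; ext; simp
  have e3 : ∀ f g h : A →ₗ[ℂ] δ.OmegaStar, ∀ q : ℂ, mul₂ h (f - q • g) = mul₂ h f - q • mul₂ h g := by
    intro f g h q; ext; simp [mul_sub]
  have hk' : mul₂ δ.x δ.x (TensorProduct.map₂ C.circ₂ C.circ₂ (C.germ₂ b) (Coalgebra.comul (R := ℂ) c))
    = _ := hk
  rw [hk', hz, e1, e1, e1, e2, e3]
  simp only [LinearMap.sub_apply, LinearMap.smul_apply]
  have e4 : conv (δ.x ∘ₗ C.germ) (δ.x ∘ₗ C.germ) (b * c)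
    = mul₂ ρ ρ (Coalgebra.comul (R := ℂ) (b * c)) := rfl
  rw [e4]
  abel

theorem mul₂_add_right {P M N : Type*} [Ring P] [Algebra ℂ P] [AddCommGroup M] [Module ℂ M]
    [AddCommGroup N] [Module ℂ N] (f : M →ₗ[ℂ] P) (g g' : N →ₗ[ℂ] P) :
    mul₂ f (g + g') = mul₂ f g + mul₂ f g' := by
  ext; simp [mul_add]

theorem pd_R_eq : δ.pd ∘ₗ δ.R = mul₂ δ.r (δ.x ∘ₗ C.germ) ∘ₗ C.varpi := LinearMap.ext δ.pd_R

theorem pd_mul₂_R_θ (t : C.inv ⊗[ℂ] C.inv) : δ.pd (mul₂ δ.R C.θ t)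
    = mul₂ (δ.pd ∘ₗ δ.R) δ.x t + mul₂ δ.r (δ.pd ∘ₗ C.θ) t := by
  induction t using TensorProduct.induction_on with
  | zero => simp
  | add s t hs ht => simp only [map_add, hs, ht]; abel
  | tmul u v => simp [pd_mul, par_R, x, r]

theorem pd_mul₂_R_R (t : C.inv ⊗[ℂ] C.inv) : δ.pd (mul₂ δ.R δ.R t)
    = mul₂ (δ.pd ∘ₗ δ.R) δ.r t + mul₂ δ.r (δ.pd ∘ₗ δ.R) t := by
  induction t using TensorProduct.induction_on with
  | zero => simp
  | add s t hs ht => simp only [map_add, hs, ht]; abel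
  | tmul u v => simp [pd_mul, par_R, r]

/-- After the commutation relations every term reads ∑ r(ϑ_k) f(c_k), and the functions f cancel by
`mul₂_x_circ_germ₂`. The curvature part of dη contributes R(η)R(ϑ), which is reordered by
`commutes_r`: this is why the relations j₄ have to accompany the relations j₃. -/
theorem pd_j₃ (η ϑ : C.inv) : δ.pd (δ.j₃ η ϑ) = 0 := by
  have h1 : δ.pd (C.θ η * δ.R ϑ) = δ.pd (C.θ η) * δ.r ϑ - δ.x η * δ.pd (δ.R ϑ) := by
    rw [pd_mul, par_θ, map_neg, neg_mul, sub_eq_add_neg]; rfl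
  rw [j₃, map_sub, h1, pd_mul₂_R_θ, pd_θ, pd_R, add_mul, δ.commutes_x.mul_mul₂, pd_R_eq, braid_tmul,
    mul₂_lTensor, mul₂_lTensor, mul₂_varpi_varpi, δ.commutes_r, δ.commutes_x.mul₂_mul δ.commutes_x]
  have e : (δ.pd ∘ₗ C.θ) ∘ₗ C.circ₂ η = δ.r ∘ₗ C.circ₂ η +
      (mul₂ δ.x δ.x ∘ₗ TensorProduct.map₂ C.circ₂ C.circ₂ (δ.δ η) ∘ₗ Coalgebra.comul
        + -conv (δ.x ∘ₗ C.circ₂ η) (δ.x ∘ₗ C.germ) + -conv (δ.x ∘ₗ C.germ) (δ.x ∘ₗ C.circ₂ η)) := by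
    obtain ⟨b, rfl, hb⟩ := δ.exists_germ η
    ext c
    have h := δ.mul₂_x_circ_germ₂ b c
    simp only [LinearMap.comp_apply, pd_θ, LinearMap.add_apply, LinearMap.neg_apply, hb, map_neg]
    rw [← neg_eq_iff_eq_neg] at h
    rw [← h]
    abel
  have e' : ∀ f : A →ₗ[ℂ] δ.OmegaStar, mul₂ δ.r (-f) = -mul₂ δ.r f := by intro f; ext; simp
  rw [e, mul₂_add_right, mul₂_add_right, mul₂_add_right, e', e']
  simp only [LinearMap.add_apply, LinearMap.neg_apply]
  abel

/-- By the Bianchi identity all terms again have the form ∑ r(ϑ_k) f(c_k). The identity between the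
functions f is the image of `braid_germ_circ` under η ⊗ ϑ ↦ r(η)x(ϑ), which turns the braiding into
x·r by `mul₂_r_x`. -/
theorem pd_j₄ (η ϑ : C.inv) : δ.pd (δ.j₄ η ϑ) = 0 := by
  have h1 : δ.pd (δ.R η * δ.R ϑ) = δ.pd (δ.R η) * δ.r ϑ + δ.r η * δ.pd (δ.R ϑ) := by
    rw [pd_mul, par_R]; rfl
  have h2 : mul₂ δ.r (δ.x ∘ₗ C.germ) (C.varpi η)
      = mul₂ δ.r δ.x (C.germ.lTensor C.inv (C.varpi η)) := (mul₂_lTensor _ _ _ _).symm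
  rw [j₄, map_sub, h1, pd_mul₂_R_R, pd_R, pd_R, δ.commutes_r.mul_mul₂, pd_R_eq, braid_tmul,
    mul₂_lTensor, mul₂_lTensor, mul₂_varpi_varpi, h2, δ.commutes_r.mul₂_mul δ.commutes_x]
  have e : mul₂ δ.r δ.x ∘ₗ TensorProduct.map₂ C.circ₂ C.circ₂ (C.germ.lTensor C.inv (C.varpi η)) ∘ₗ
        Coalgebra.comul + conv (δ.r ∘ₗ C.circ₂ η) (δ.x ∘ₗ C.germ)
      = conv (δ.x ∘ₗ C.germ) (δ.r ∘ₗ C.circ₂ η)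
        + (mul₂ δ.r (δ.x ∘ₗ C.germ) ∘ₗ C.varpi) ∘ₗ C.circ₂ η := by
    ext c
    have h := congrArg (mul₂ δ.r δ.x) (C.braid_germ_circ η c)
    rw [map_add, map_add, mul₂_r_x, mul₂_lTensor] at h
    have f1 : ∀ (f : C.inv →ₗ[ℂ] δ.OmegaStar) (g : C.inv →ₗ[ℂ] δ.OmegaStar) (u v : A →ₗ[ℂ] C.inv),
        conv (f ∘ₗ u) (g ∘ₗ v) c = mul₂ f g (TensorProduct.map u v (Coalgebra.comul (R := ℂ) c)) := by
      intro f g u v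
      simp only [conv, LinearMap.comp_apply]
      generalize Coalgebra.comul (R := ℂ) c = t
      induction t using TensorProduct.induction_on with
      | zero => simp
      | add s t hs ht => simp only [map_add, hs, ht]
      | tmul u v => simp
    have f2 : ∀ s : C.inv ⊗[ℂ] A, TensorProduct.map₂ C.circ₂ C.circ₂ (C.germ.lTensor C.inv s)
        = TensorProduct.map₂ C.circ₂ (C.circ₂ ∘ₗ C.germ) s := by
      intro s
      induction s using TensorProduct.induction_on with
      | zero => simp
      | add s t hs ht => simp only [map_add, hs, ht]
      | tmul u v => ext; simp
    rw [LinearMap.add_apply, LinearMap.add_apply, f1, f1, f2]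
    exact h.symm
  have e' := congrArg (fun f => mul₂ δ.r f (C.varpi ϑ)) e
  simp only [mul₂_add_right, LinearMap.add_apply] at e'
  rw [sub_eq_zero, e']

theorem mem_K_iff (w : C.Univ) : w ∈ δ.K ↔ δ.p w = 0 :=
  ⟨δ.p_eq_zero, fun h => (TwoSidedIdeal.mem_iff _ _).2 ((RingCon.eq _).1 h)⟩

theorem pd_kGen {w : C.Univ} (hw : w ∈ δ.kGen) : δ.pd w = 0 := by
  rcases hw with (⟨t, ht, rfl⟩ | ⟨η, ϑ, rfl⟩) | ⟨η, ϑ, rfl⟩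
  · obtain ⟨a, ha, rfl⟩ := C.exists_of_invMul_eq_zero t ht
    exact (δ.pd_mul₂_θ_germ₂ a).trans (by rw [ha, map_zero, map_zero])
  · exact δ.pd_j₃ η ϑ
  · exact δ.pd_j₄ η ϑ

theorem diff_mem_K (w : C.Univ) (hw : w ∈ δ.K) : C.diff.d w ∈ δ.K := by
  -- The elements of 𝒦 whose differential lies in 𝒦 form an ideal, by the Leibniz rule and the
  -- stability of 𝒦 under parity; so only generators have to be examined.
  let I : TwoSidedIdeal C.Univ := TwoSidedIdeal.mk' {w | w ∈ δ.K ∧ δ.pd w = 0}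
    ⟨zero_mem _, map_zero _⟩ (fun hx hy => ⟨add_mem hx.1 hy.1, by rw [map_add, hx.2, hy.2, add_zero]⟩)
    (fun hx => ⟨neg_mem hx.1, by rw [map_neg, hx.2, neg_zero]⟩)
    (fun {x y} hy => ⟨δ.K.mul_mem_left x y hy.1, by
      rw [pd_mul, hy.2, δ.p_eq_zero hy.1, mul_zero, mul_zero, add_zero]⟩)
    (fun {x y} hx => ⟨δ.K.mul_mem_right x y hx.1, by
      rw [pd_mul, hx.2, δ.p_par hx.1, zero_mul, zero_mul, add_zero]⟩)
  have h : δ.K ≤ I := TwoSidedIdeal.span_le.2 fun x hx =>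
    (TwoSidedIdeal.mem_mk' ..).2 ⟨TwoSidedIdeal.subset_span hx, δ.pd_kGen hx⟩
  exact (δ.mem_K_iff _).2 ((TwoSidedIdeal.mem_mk' ..).1 (h hw)).2

end EmbeddedDifferential
end BicovariantStarCalculus
end
end QPB

/-! ### Graded tensor products of super algebras and their differentials. -/

open scoped TensorProduct

namespace QPB

noncomputable section

section SuperTensor
variable {B B' : Type*} [Ring B] [Algebra ℂ B] [Super B] [Ring B'] [Algebra ℂ B'] [Super B']

/-- The inclusion `b ↦ b ⊗ 1`. -/
def iL (B B' : Type*) [Ring B] [Algebra ℂ B] [Super B] [Ring B'] [Algebra ℂ B'] [Super B'] :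
    B →ₐ[ℂ] STensor B B' :=
  GradedTensorProduct.includeLeft (Super.part B) (Super.part B')

/-- The inclusion `e ↦ 1 ⊗ e`. -/
def iR (B B' : Type*) [Ring B] [Algebra ℂ B] [Super B] [Ring B'] [Algebra ℂ B'] [Super B'] :
    B' →ₐ[ℂ] STensor B B' :=
  GradedTensorProduct.includeRight (Super.part B) (Super.part B')

theorem iL_mul_iR (b : B) (e : B') :
    iL B B' b * iR B B' e = GradedTensorProduct.tmul ℂ b e :=
  GradedTensorProduct.tmul_one_mul_one_tmul (R := ℂ) (𝒜 := Super.part B) (ℬ := Super.part B') b e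

theorem iL_apply (b : B) : iL B B' b = GradedTensorProduct.tmul ℂ b 1 := rfl
theorem iR_apply (e : B') : iR B B' e = GradedTensorProduct.tmul ℂ 1 e := rfl

theorem Super.exists_add (x : B) : ∃ y z : B, Super.par y = y ∧ Super.par z = -z ∧ x = y + z := by
  refine ⟨(2⁻¹ : ℂ) • (x + Super.par x), (2⁻¹ : ℂ) • (x - Super.par x), ?_, ?_, ?_⟩
  · rw [map_smul, map_add, Super.par_par, add_comm]
  · rw [map_smul, map_sub, Super.par_par, ← smul_neg, neg_sub]
  · module

theorem iR_mul_iL_of_even {e : B'} (he : Super.par e = e) (b : B) :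
    iR B B' e * iL B B' b = iL B B' b * iR B B' e := by
  obtain ⟨y, z, hy, hz, rfl⟩ := Super.exists_add b
  have h : ∀ i, ∀ w ∈ Super.part B i, iR B B' e * iL B B' w = iL B B' w * iR B B' e := by
    intro i w hw
    rw [iL_mul_iR, iL_apply, iR_apply]
    have := GradedTensorProduct.tmul_zero_coe_mul_coe_tmul (R := ℂ) (𝒜 := Super.part B)
      (ℬ := Super.part B') (1 : B) ⟨e, Super.mem_part_zero.2 he⟩ ⟨w, hw⟩ (1 : B')
    simpa using this
  rw [map_add, mul_add, add_mul, h 0 y (Super.mem_part_zero.2 hy), h 1 z (Super.mem_part_one.2 hz)]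

theorem iR_mul_iL_of_odd {e : B'} (he : Super.par e = -e) (b : B) :
    iR B B' e * iL B B' b = iL B B' (Super.par b) * iR B B' e := by
  obtain ⟨y, z, hy, hz, rfl⟩ := Super.exists_add b
  have h := GradedTensorProduct.tmul_coe_mul_zero_coe_tmul (R := ℂ) (𝒜 := Super.part B)
      (ℬ := Super.part B') (1 : B) ⟨e, Super.mem_part_one.2 he⟩ ⟨y, Super.mem_part_zero.2 hy⟩ (1 : B')
  have h' := GradedTensorProduct.tmul_coe_mul_coe_tmul (R := ℂ) (𝒜 := Super.part B)
      (ℬ := Super.part B') (1 : B) ⟨e, Super.mem_part_one.2 he⟩ ⟨z, Super.mem_part_one.2 hz⟩ (1 : B')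
  simp only [one_mul, mul_one, ← iL_mul_iR, map_one] at h h'
  rw [map_add, map_add, hy, hz, map_add, map_neg, mul_add, add_mul, neg_mul, h, h']
  simp

theorem iR_mul_iL_of_even' {b : B} (hb : Super.par b = b) (e : B') :
    iR B B' e * iL B B' b = iL B B' b * iR B B' e := by
  obtain ⟨y, z, hy, hz, rfl⟩ := Super.exists_add e
  rw [map_add, add_mul, mul_add, iR_mul_iL_of_even hy, iR_mul_iL_of_odd hz, hb]

theorem iR_mul_iL_of_odd' {b : B} (hb : Super.par b = -b) (e : B') :
    iR B B' e * iL B B' b = iL B B' b * iR B B' (Super.par e) := by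
  obtain ⟨y, z, hy, hz, rfl⟩ := Super.exists_add e
  rw [map_add, add_mul, iR_mul_iL_of_even hy, iR_mul_iL_of_odd hz, hb, map_add, hy, hz, map_add,
    mul_add, map_neg, map_neg, neg_mul, mul_neg]

/-- Elements of the graded tensor product are sums of products. -/
theorem STensor.induction {P : STensor B B' → Prop} (h0 : P 0)
    (ha : ∀ s t, P s → P t → P (s + t)) (hm : ∀ b e, P (iL B B' b * iR B B' e)) (z) : P z := by
  have h : ∀ t : B ⊗[ℂ] B',
      P (GradedTensorProduct.of ℂ (Super.part B) (Super.part B') t) := by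
    intro t
    induction t using TensorProduct.induction_on with
    | zero => rw [map_zero]; exact h0
    | add s t hs ht => rw [map_add]; exact ha _ _ hs ht
    | tmul b e =>
      have := hm b e
      rwa [iL_mul_iR] at this
  exact h ((GradedTensorProduct.of ℂ (Super.part B) (Super.part B')).symm z)

theorem adjoin_iL_iR {s : Set B} {s' : Set B'} (hs : Algebra.adjoin ℂ s = ⊤)
    (hs' : Algebra.adjoin ℂ s' = ⊤) :
    Algebra.adjoin ℂ (iL B B' '' s ∪ iR B B' '' s') = ⊤ := by
  have h : ∀ b, iL B B' b ∈ Algebra.adjoin ℂ (iL B B' '' s ∪ iR B B' '' s') := fun b => by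
    have hb : b ∈ Algebra.adjoin ℂ s := hs ▸ Algebra.mem_top
    induction hb using Algebra.adjoin_induction with
    | mem x hx => exact Algebra.subset_adjoin (.inl ⟨x, hx, rfl⟩)
    | algebraMap r => rw [AlgHom.commutes]; exact Subalgebra.algebraMap_mem _ r
    | add x y _ _ hx hy => rw [map_add]; exact add_mem hx hy
    | mul x y _ _ hx hy => rw [map_mul]; exact mul_mem hx hy
  have h' : ∀ b, iR B B' b ∈ Algebra.adjoin ℂ (iL B B' '' s ∪ iR B B' '' s') := fun b => by
    have hb : b ∈ Algebra.adjoin ℂ s' := hs' ▸ Algebra.mem_top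
    induction hb using Algebra.adjoin_induction with
    | mem x hx => exact Algebra.subset_adjoin (.inr ⟨x, hx, rfl⟩)
    | algebraMap r => rw [AlgHom.commutes]; exact Subalgebra.algebraMap_mem _ r
    | add x y _ _ hx hy => rw [map_add]; exact add_mem hx hy
    | mul x y _ _ hx hy => rw [map_mul]; exact mul_mem hx hy
  refine eq_top_iff.2 fun z hz => ?_
  clear hz
  induction z using STensor.induction with
  | h0 => exact zero_mem _
  | ha s t hs ht => exact add_mem hs ht
  | hm b e => exact mul_mem (h b) (h' e)

/-- A homomorphism out of the graded tensor product. -/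
def stLift {P : Type*} [Ring P] [Algebra ℂ P] (f : B →ₐ[ℂ] P) (g : B' →ₐ[ℂ] P)
    (h0 : ∀ b e, Super.par e = e → g e * f b = f b * g e)
    (h1 : ∀ b e, Super.par e = -e → g e * f b = f (Super.par b) * g e) : STensor B B' →ₐ[ℂ] P :=
  GradedTensorProduct.lift (Super.part B) (Super.part B') f g (fun i j a b => by
    obtain ⟨b, hb⟩ := b
    obtain ⟨a, ha⟩ := a
    fin_cases j
    · change f a * g b = (-1 : ℤˣ) ^ ((0 : ZMod 2) * i) • (g b * f a)
      rw [h0 a b (Super.mem_part_zero.1 hb)]; simp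
    · change f a * g b = (-1 : ℤˣ) ^ ((1 : ZMod 2) * i) • (g b * f a)
      rw [h1 a b (Super.mem_part_one.1 hb), one_mul]
      fin_cases i
      · have := Super.mem_part_zero.1 ha
        change f a * g b = (-1 : ℤˣ) ^ (0 : ZMod 2) • _
        rw [this]; simp
      · have := Super.mem_part_one.1 ha
        change f a * g b = (-1 : ℤˣ) ^ (1 : ZMod 2) • _
        rw [this]; simp)

section
variable {P : Type*} [Ring P] [Algebra ℂ P] (f : B →ₐ[ℂ] P) (g : B' →ₐ[ℂ] P)
    (h0 : ∀ b e, Super.par e = e → g e * f b = f b * g e)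
    (h1 : ∀ b e, Super.par e = -e → g e * f b = f (Super.par b) * g e)

theorem stLift_iL (b : B) : stLift f g h0 h1 (iL B B' b) = f b := by
  refine (GradedTensorProduct.lift_tmul _ _ f g _ b 1).trans ?_
  rw [map_one, mul_one]

theorem stLift_iR (e : B') : stLift f g h0 h1 (iR B B' e) = g e := by
  refine (GradedTensorProduct.lift_tmul _ _ f g _ 1 e).trans ?_
  rw [map_one, one_mul]
end

instance STensor.super : Super (STensor B B') where
  par := stLift ((iL B B').comp Super.par) ((iR B B').comp Super.par)
    (fun b e he => by
      simp only [AlgHom.comp_apply, he]; exact iR_mul_iL_of_even he _)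
    (fun b e he => by
      simp only [AlgHom.comp_apply, he, map_neg, neg_mul, mul_neg]
      rw [iR_mul_iL_of_odd he])
  par_par z := by
    induction z using STensor.induction with
    | h0 => simp
    | ha s t hs ht => simp only [map_add, hs, ht]
    | hm b e => simp only [map_mul, stLift_iL, stLift_iR, AlgHom.comp_apply, Super.par_par]

theorem par_iL (b : B) : Super.par (iL B B' b) = iL B B' (Super.par b) := stLift_iL _ _ _ _ b
theorem par_iR (e : B') : Super.par (iR B B' e) = iR B B' (Super.par e) := stLift_iR _ _ _ _ e

theorem tensorD_mul_iL_iR (D : SuperDiff B) (D' : SuperDiff B') (b : B) (e : B') :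
    tensorD D D' (iL B B' b * iR B B' e)
      = iL B B' (D.d b) * iR B B' e + iL B B' (Super.par b) * iR B B' (D'.d e) := by
  rw [iL_mul_iR, iL_mul_iR, iL_mul_iR]; rfl

theorem tensorD_iL (D : SuperDiff B) (D' : SuperDiff B') (b : B) :
    tensorD D D' (iL B B' b) = iL B B' (D.d b) := by
  have := tensorD_mul_iL_iR D D' b 1
  simpa [D'.d_one] using this

theorem tensorD_iR (D : SuperDiff B) (D' : SuperDiff B') (e : B') :
    tensorD D D' (iR B B' e) = iR B B' (D'.d e) := by
  have := tensorD_mul_iL_iR D D' 1 e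
  simpa [D.d_one] using this

theorem SuperDiff.odd_of_even (D : SuperDiff B) {b : B} (hb : Super.par b = b) :
    Super.par (D.d b) = -D.d b := by
  have := D.d_par b
  rw [hb] at this
  rw [this, neg_neg, ← this]

theorem SuperDiff.even_of_odd (D : SuperDiff B) {b : B} (hb : Super.par b = -b) :
    Super.par (D.d b) = D.d b := by
  have := D.d_par b
  rw [hb, map_neg] at this
  exact (neg_injective this).symm

set_option maxHeartbeats 1000000 in
/-- The differential of the graded tensor product. -/
def tensorDiff (D : SuperDiff B) (D' : SuperDiff B') : SuperDiff (STensor B B') where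
  d := tensorD D D'
  d_mul x y := by
    induction x using STensor.induction with
    | h0 => simp
    | ha s t hs ht => simp only [map_add, add_mul, hs, ht]; abel
    | hm b e =>
      induction y using STensor.induction with
      | h0 => simp
      | ha s t hs ht => simp only [map_add, mul_add, hs, ht]; abel
      | hm b' e' =>
        -- The sign produced by moving e past a left factor depends on the parity of e only. After
        -- the splitting, each product is put into the order left factor times right factor and the
        -- Leibniz rule is compared term by term.
        obtain ⟨y, z, hy, hz, rfl⟩ := Super.exists_add e
        have h0 : ∀ b, iR B B' y * iL B B' b = iL B B' b * iR B B' y := iR_mul_iL_of_even hy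
        have h1 : ∀ b, iR B B' z * iL B B' b = iL B B' (Super.par b) * iR B B' z :=
          iR_mul_iL_of_odd hz
        have h0' : ∀ b, iR B B' (D'.d y) * iL B B' b = iL B B' (Super.par b) * iR B B' (D'.d y) :=
          iR_mul_iL_of_odd (D'.odd_of_even hy)
        have h1' : ∀ b, iR B B' (D'.d z) * iL B B' b = iL B B' b * iR B B' (D'.d z) :=
          iR_mul_iL_of_even (D'.even_of_odd hz)
        have e0 : iL B B' b * iR B B' y * (iL B B' b' * iR B B' e')
            = iL B B' (b * b') * iR B B' (y * e') := by
          rw [map_mul, map_mul, mul_assoc, ← mul_assoc (iR B B' y), h0]; noncomm_ring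
        have e1 : iL B B' b * iR B B' z * (iL B B' b' * iR B B' e')
            = iL B B' (b * Super.par b') * iR B B' (z * e') := by
          rw [map_mul, map_mul, mul_assoc, ← mul_assoc (iR B B' z), h1]; noncomm_ring
        have swap : ∀ (u : B) (w : B') (c : B) (w' : B') (c' : B),
            iR B B' w * iL B B' c = iL B B' c' * iR B B' w →
            iL B B' u * iR B B' w * (iL B B' c * iR B B' w')
              = iL B B' u * (iL B B' c' * (iR B B' w * iR B B' w')) := by
          intro u w c w' c' h
          rw [mul_assoc, ← mul_assoc (iR B B' w), h]; noncomm_ring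
        have hyz : iL B B' b * iR B B' (y + z) * (iL B B' b' * iR B B' e')
          = iL B B' (b * b') * iR B B' (y * e') + iL B B' (b * Super.par b') * iR B B' (z * e') := by
          rw [← e0, ← e1, map_add, mul_add, add_mul]
        rw [hyz, map_add, tensorD_mul_iL_iR, tensorD_mul_iL_iR]
        simp only [tensorD_mul_iL_iR, map_mul, par_iL, par_iR, map_add, hy, hz, D.d_mul, D'.d_mul,
          Super.par_par, D.d_par, mul_add, add_mul, map_neg, neg_mul, mul_neg]
        rw [swap _ _ _ _ _ (h0 _), swap _ _ _ _ _ (h1 _), swap _ _ _ _ _ (h0' _),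
          swap _ _ _ _ _ (h1' _), swap _ _ _ _ _ (h0 _), swap _ _ _ _ _ (h1 _),
          swap _ _ _ _ _ (h0 _), swap _ _ _ _ _ (h1 _)]
        simp only [Super.par_par, mul_assoc]
        abel
  d_par z := by
    induction z using STensor.induction with
    | h0 => simp
    | ha s t hs ht => simp only [map_add, hs, ht]; abel
    | hm b e =>
      simp only [map_mul, par_iL, par_iR, tensorD_mul_iL_iR, map_add, D.d_par, D'.d_par, map_neg,
        neg_mul, mul_neg, neg_add]
  d_d z := by
    induction z using STensor.induction with
    | h0 => simp
    | ha s t hs ht => simp only [map_add, hs, ht, add_zero]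
    | hm b e =>
      simp only [tensorD_mul_iL_iR, map_add, D.d_par, D.d_d, D'.d_d, map_neg, map_zero]
      simp

/-- A homomorphism commutes with the differentials and parities if it does so on generators. -/
theorem map_d_of_adjoin {B B' : Type*} [Ring B] [Algebra ℂ B] [Super B] [Ring B'] [Algebra ℂ B']
    [Super B'] (D : SuperDiff B) (D' : SuperDiff B') (f : B →ₐ[ℂ] B') {s : Set B}
    (hs : Algebra.adjoin ℂ s = ⊤) (hp : ∀ x ∈ s, f (Super.par x) = Super.par (f x))
    (hd : ∀ x ∈ s, f (D.d x) = D'.d (f x)) (x : B) :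
    f (Super.par x) = Super.par (f x) ∧ f (D.d x) = D'.d (f x) := by
  have hx : x ∈ Algebra.adjoin ℂ s := hs ▸ Algebra.mem_top
  induction hx using Algebra.adjoin_induction with
  | mem x hx => exact ⟨hp x hx, hd x hx⟩
  | algebraMap r =>
    simp only [Algebra.algebraMap_eq_smul_one, map_smul, map_one, D.d_one, D'.d_one,
      map_zero, and_self]
  | add x y _ _ hx hy => simp only [map_add, hx, hy, and_self]
  | mul x y _ _ hx hy => simp only [map_mul, D.d_mul, D'.d_mul, map_add, hx, hy, and_self]

theorem tensorMap_iL {B₂ : Type*} [Ring B₂] [Algebra ℂ B₂] [Super B₂] (f : B →ₐ[ℂ] B₂)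
    (hf : ∀ x, f (Super.par x) = Super.par (f x)) (b : B) :
    tensorMap f hf (iL B B' b) = iL B₂ B' (f b) := tensorMap_tmul f hf b 1

theorem tensorMap_iR {B₂ : Type*} [Ring B₂] [Algebra ℂ B₂] [Super B₂] (f : B →ₐ[ℂ] B₂)
    (hf : ∀ x, f (Super.par x) = Super.par (f x)) (e : B') :
    tensorMap f hf (iR B B' e) = iR B₂ B' e := by
  have := tensorMap_tmul f hf 1 e
  rwa [map_one] at this

theorem tensorMap_d {B₂ : Type*} [Ring B₂] [Algebra ℂ B₂] [Super B₂] (f : B →ₐ[ℂ] B₂)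
    (hf : ∀ x, f (Super.par x) = Super.par (f x)) (D : SuperDiff B) (D₂ : SuperDiff B₂)
    (D' : SuperDiff B') (hd : ∀ x, f (D.d x) = D₂.d (f x)) (z : STensor B B') :
    tensorMap f hf (tensorD D D' z) = tensorD D₂ D' (tensorMap f hf z) := by
  induction z using STensor.induction with
  | h0 => simp
  | ha s t hs ht => simp only [map_add, hs, ht]
  | hm b e => simp only [tensorD_mul_iL_iR, map_mul, map_add, tensorMap_iL, tensorMap_iR, hf, hd]

end SuperTensor

end
end QPB

/-! ### The extended adjoint action vanishes on 𝒦 modulo 𝒦. -/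

open scoped TensorProduct

namespace QPB

noncomputable section

namespace BicovariantStarCalculus
variable {A Γ : Type*} [Ring A] [HopfAlgebra ℂ A] [StarRing A]
    [AddCommGroup Γ] [Module ℂ Γ] [Module A Γ] [Module Aᵐᵒᵖ Γ] [SMulCommClass A Aᵐᵒᵖ Γ]
    [IsScalarTower ℂ A Γ] [IsScalarTower ℂ Aᵐᵒᵖ Γ] (C : BicovariantStarCalculus A Γ)


theorem adGen_apply (v : C.inv) :
    C.adGen v = mul₂ ((iL C.Univ C.Env).toLinearMap ∘ₗ C.θ)
      ((iR C.Univ C.Env).toLinearMap ∘ₗ C.gA) (C.varpi v) + iR C.Univ C.Env (C.invEnv v) := by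
  have h : ∀ t : C.inv ⊗[ℂ] A,
      (GradedTensorProduct.of ℂ (Super.part C.Univ) (Super.part C.Env))
        (TensorProduct.map C.θ C.gA t) = mul₂ ((iL C.Univ C.Env).toLinearMap ∘ₗ C.θ)
      ((iR C.Univ C.Env).toLinearMap ∘ₗ C.gA) t := by
    intro t
    induction t using TensorProduct.induction_on with
    | zero => simp
    | add s t hs ht => simp only [map_add, hs, ht]
    | tmul v e => exact (iL_mul_iR (C.θ v) (C.gA e)).symm
  rw [← h]; rfl

theorem adTilde_θ (v : C.inv) : C.adTilde (C.θ v) = C.adGen v := C.univLift_θ _ _ v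

theorem adTilde_dθ (v : C.inv) :
    C.adTilde (C.dθ v) = tensorD C.diff C.envDiff (C.adGen v) := C.univLift_dθ _ _ v

theorem par_gA (a : A) : Super.par (C.gA a) = C.gA a := C.envPar_gA a
theorem par_gΓ (γ : Γ) : Super.par (C.gΓ γ) = -C.gΓ γ := C.envPar_gΓ γ

theorem par_adGen (v : C.inv) : Super.par (C.adGen v) = -C.adGen v := by
  rw [adGen_apply, map_add, par_iR]
  have h1 : Super.par (C.invEnv v) = -C.invEnv v := C.par_gΓ _
  rw [h1, map_neg, neg_add]
  congr 1
  generalize C.varpi v = t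
  induction t using TensorProduct.induction_on with
  | zero => simp
  | add s t hs ht => simp only [map_add, hs, ht, neg_add]
  | tmul v e => simp [par_iL, par_iR, par_gA, par_θ]

theorem adTilde_par_d (w : C.Univ) : C.adTilde (Super.par w) = Super.par (C.adTilde w) ∧
    C.adTilde (C.diff.d w) = tensorD C.diff C.envDiff (C.adTilde w) := by
  refine map_d_of_adjoin C.diff (tensorDiff C.diff C.envDiff) C.adTilde C.adjoin_univGen ?_ ?_ w
  · rintro _ (⟨v, rfl⟩ | ⟨v, rfl⟩)
    · rw [par_θ, map_neg, adTilde_θ, par_adGen]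
    · rw [par_dθ, adTilde_dθ]
      exact ((tensorDiff C.diff C.envDiff).even_of_odd (C.par_adGen v)).symm
  · rintro _ (⟨v, rfl⟩ | ⟨v, rfl⟩)
    · rw [diff_θ, adTilde_dθ, adTilde_θ]; rfl
    · rw [diff_dθ, adTilde_dθ, map_zero]
      exact ((tensorDiff C.diff C.envDiff).d_d _).symm

section Twist
variable {B : Type*} [Ring B] [Algebra ℂ B] [Super B]

/-- The map `a ↦ 1 ⊗ a`. -/
def iA (B : Type*) [Ring B] [Algebra ℂ B] [Super B] : A →ₗ[ℂ] STensor B C.Env :=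
  (iR B C.Env).toLinearMap ∘ₗ C.gA

/-- The map `v ↦ ∑ y(v_k) ⊗ c_k`, where `ϖ(v) = ∑ v_k ⊗ c_k`. -/
def twist (y : C.inv →ₗ[ℂ] B) : C.inv →ₗ[ℂ] STensor B C.Env :=
  mul₂ ((iL B C.Env).toLinearMap ∘ₗ y) (C.iA B) ∘ₗ C.varpi

theorem iA_one : C.iA B 1 = 1 := by simp [iA, gA_one]

theorem iA_mul (a b : A) : C.iA B (a * b) = C.iA B a * C.iA B b := by simp [iA, gA_mul]

theorem iA_mul_iL (a : A) (b : B) : C.iA B a * iL B C.Env b = iL B C.Env b * C.iA B a :=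
  iR_mul_iL_of_even (C.par_gA a) b

/-- The map a ↦ 1 ⊗ a is multiplicative, so its composition with the antipode is a convolution
inverse. Identities for twisted maps are proved after convolution with a ↦ 1 ⊗ a, where the
antipode-free formulas for ϖ apply. -/
theorem conv_iA_cancel {f g : A →ₗ[ℂ] STensor B C.Env}
    (h : conv (C.iA B) f = conv (C.iA B) g) : f = g := by
  let ρ : A →ₗ[ℂ] STensor B C.Env →ₗ[ℂ] STensor B C.Env :=
    LinearMap.mul ℂ (STensor B C.Env) ∘ₗ C.iA B
  have e : ∀ f, sweedler ρ f = conv (C.iA B) f := fun f => rfl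
  have h1 : ∀ m, ρ 1 m = m := fun m => by simp [ρ, iA_one]
  have h2 : ∀ a b m, ρ (a * b) m = ρ a (ρ b m) := fun a b m => by simp [ρ, iA_mul, mul_assoc]
  rw [← sweedler_antipode_left ρ h1 h2 f, ← sweedler_antipode_left ρ h1 h2 g, e, e, h]

theorem mul₂_comp_lmulR (f : C.inv →ₗ[ℂ] B) (a : A) (t : C.inv ⊗[ℂ] A) :
    mul₂ ((iL B C.Env).toLinearMap ∘ₗ f) (C.iA B) (lmulR A C.inv a t)
      = C.iA B a * mul₂ ((iL B C.Env).toLinearMap ∘ₗ f) (C.iA B) t := by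
  induction t using TensorProduct.induction_on with
  | zero => simp
  | add s t hs ht => simp only [map_add, hs, ht, mul_add]
  | tmul v e => simp [lmulR_tmul, iA_mul, ← mul_assoc, iA_mul_iL]

theorem conv_iA_twist (f : C.inv →ₗ[ℂ] B) (u : A →ₗ[ℂ] C.inv) (a : A) :
    conv (C.iA B) (C.twist f ∘ₗ u) a = mul₂ ((iL B C.Env).toLinearMap ∘ₗ f) (C.iA B)
      (sweedler (lmulR A C.inv) (C.varpi ∘ₗ u) a) := by
  simp only [conv, sweedler, LinearMap.comp_apply]
  generalize Coalgebra.comul (R := ℂ) a = t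
  induction t using TensorProduct.induction_on with
  | zero => simp
  | add s t hs ht => simp only [map_add, hs, ht]
  | tmul x y =>
    simp only [TensorProduct.lift.tmul, LinearMap.compl₂_apply, LinearMap.compl₁₂_apply,
      LinearMap.mul_apply', LinearMap.comp_apply, mul₂_comp_lmulR]
    rfl

/-- This is `sweedler_varpi_germ` inside the graded tensor product. It moves 1 ⊗ a from the left to
the right of a germ and removes the twist. -/
theorem conv_iA_twist_germ (f : C.inv →ₗ[ℂ] B) :
    conv (C.iA B) (C.twist f ∘ₗ C.germ)
      = conv ((iL B C.Env).toLinearMap ∘ₗ f ∘ₗ C.germ) (C.iA B) := by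
  ext a
  rw [conv_iA_twist, sweedler_varpi_germ]
  simp only [conv, LinearMap.comp_apply]
  generalize Coalgebra.comul (R := ℂ) a = t
  induction t using TensorProduct.induction_on with
  | zero => simp
  | add s t hs ht => simp only [map_add, hs, ht]
  | tmul x y => simp

theorem iA_invEnv (η : C.inv) :
    conv (C.iA B) ((iR B C.Env).toLinearMap ∘ₗ C.invEnv ∘ₗ C.circ₂ η)
      = LinearMap.mulLeft ℂ (iR B C.Env (C.invEnv η)) ∘ₗ C.iA B := by
  ext c
  have h := C.gΓ_sweedler (C.inv.subtype ∘ₗ C.circ₂ η) c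
  rw [sweedler_circ, gΓ_op_smul] at h
  have h2 := congrArg (iR B C.Env) h
  have h3 := map_mul₂ C.gA (C.gΓ ∘ₗ C.inv.subtype ∘ₗ C.circ₂ η) (iR B C.Env)
    (Coalgebra.comul (R := ℂ) c)
  rw [map_mul] at h2
  exact (h2.trans h3).symm

theorem mul₂_twist (r : C.inv →ₗ[ℂ] B) (z : A →ₗ[ℂ] STensor B C.Env) (ϑ : C.inv) :
    mul₂ (C.twist r) z (C.varpi ϑ)
      = mul₂ ((iL B C.Env).toLinearMap ∘ₗ r) (conv (C.iA B) z) (C.varpi ϑ) :=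
  C.mul₂_varpi_varpi _ _ _ _

/-- The relations `y(η) r(ϑ) = ∑ r(ϑ_k) y(η ∘ c_k)` for the twisted maps. -/
theorem twist_mul_twist {y r : C.inv →ₗ[ℂ] B} (h : C.Commutes y r) (η ϑ : C.inv) :
    C.twist y η * C.twist r ϑ = mul₂ (C.twist r) (C.twist y ∘ₗ C.circ₂ η) (C.varpi ϑ) := by
  have h' : C.Commutes ((iL B C.Env).toLinearMap ∘ₗ y) ((iL B C.Env).toLinearMap ∘ₗ r) := by
    intro η ϑ
    have h1 := congrArg (iL B C.Env) (h η ϑ)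
    rw [map_mul, map_mul₂] at h1
    exact h1
  -- On the right-hand side `mul₂_twist` produces the convolution of 1 ⊗ c with the twist of η ∘ c,
  -- which is evaluated by `sweedler_varpi_circ`. What remains is the original commutation relation,
  -- with the elements of A carried along in the second factor.
  have e : conv (C.iA B) (C.twist y ∘ₗ C.circ₂ η)
      = mul₂ ((iL B C.Env).toLinearMap ∘ₗ y) (C.iA B) ∘ₗ
        TensorProduct.map₂ C.circ₂ (LinearMap.mul ℂ A) (C.varpi η) ∘ₗ Coalgebra.comul := by
    ext c
    rw [conv_iA_twist, sweedler_varpi_circ]; rfl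
  rw [mul₂_twist, e, twist, LinearMap.comp_apply]
  generalize C.varpi η = s
  induction s using TensorProduct.induction_on with
  | zero =>
    have e0 : mul₂ ((iL B C.Env).toLinearMap ∘ₗ r) (0 : A →ₗ[ℂ] STensor B C.Env) = 0 := by ext; simp
    simp [e0]
  | add s t hs ht =>
    rw [map_add, add_mul, hs, ht, map_add, LinearMap.add_comp, LinearMap.comp_add,
      EmbeddedDifferential.mul₂_add_right]; rfl
  | tmul v e =>
    have e1 : mul₂ ((iL B C.Env).toLinearMap ∘ₗ y) (C.iA B) ∘ₗ
        TensorProduct.map₂ C.circ₂ (LinearMap.mul ℂ A) (v ⊗ₜ e) ∘ₗ Coalgebra.comul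
        = conv (((iL B C.Env).toLinearMap ∘ₗ y) ∘ₗ C.circ₂ v) (C.iA B ∘ₗ LinearMap.mulLeft ℂ e) := by
      rw [conv, ← LinearMap.comp_assoc]
      congr 1
      ext; simp
    rw [e1, ← h'.mul_mul₂]
    simp only [TensorProduct.lift.tmul, LinearMap.compl₁₂_apply, LinearMap.mul_apply', mul_assoc]
    congr 1
    rw [twist, LinearMap.comp_apply]
    generalize C.varpi ϑ = t
    induction t using TensorProduct.induction_on with
    | zero => simp
    | add s t hs ht => simp only [map_add, hs, ht, mul_add]
    | tmul v' e' => simp [iA_mul, ← mul_assoc, iA_mul_iL]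

theorem inv_mul_twist {r : C.inv →ₗ[ℂ] B} (hr : ∀ v, Super.par (r v) = r v) (η ϑ : C.inv) :
    iR B C.Env (C.invEnv η) * C.twist r ϑ
      = mul₂ (C.twist r) ((iR B C.Env).toLinearMap ∘ₗ C.invEnv ∘ₗ C.circ₂ η) (C.varpi ϑ) := by
  rw [mul₂_twist, iA_invEnv, twist, LinearMap.comp_apply]
  generalize C.varpi ϑ = t
  induction t using TensorProduct.induction_on with
  | zero => simp
  | add s t hs ht => simp only [map_add, hs, ht, mul_add]
  | tmul v e =>
    simp [← mul_assoc, iR_mul_iL_of_even' (hr v)]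

end Twist

section Twist
variable {B : Type*} [Ring B] [Algebra ℂ B] [Super B]

/-- The map `v ↦ 1 ⊗ v`. -/
def iV (B : Type*) [Ring B] [Algebra ℂ B] [Super B] : C.inv →ₗ[ℂ] STensor B C.Env :=
  (iR B C.Env).toLinearMap ∘ₗ C.invEnv

theorem iV_mul_twist {f : C.inv →ₗ[ℂ] B} (hf : ∀ v, Super.par (f v) = -f v) (v w : C.inv) :
    C.iV B v * C.twist f w = -mul₂ (C.twist f) (C.iV B) (C.braid (v ⊗ₜ w)) := by
  rw [braid_tmul, mul₂_lTensor, mul₂_twist, iV, LinearMap.comp_assoc, iA_invEnv, twist,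
    LinearMap.comp_apply, LinearMap.comp_apply]
  generalize C.varpi w = t
  induction t using TensorProduct.induction_on with
  | zero => simp
  | add s t hs ht => simp only [map_add, hs, ht, mul_add, neg_add]
  | tmul u e =>
    have h : Super.par (C.invEnv v) = -C.invEnv v := C.par_gΓ _
    simp [← mul_assoc, iR_mul_iL_of_odd' (hf _), h]

theorem mul₂_twist_iV_germ (f : C.inv →ₗ[ℂ] B) (v : C.inv) :
    mul₂ (C.twist f) (C.iV B ∘ₗ C.germ) (C.varpi v)
      = mul₂ ((iL B C.Env).toLinearMap ∘ₗ f)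
        ((iR B C.Env).toLinearMap ∘ₗ C.gΓ ∘ₗ C.d) (C.varpi v) := by
  rw [mul₂_twist]
  congr 2
  ext a
  have h := congrArg (iR B C.Env) (C.gΓ_d a)
  have h2 := map_mul₂ C.gA (C.invEnv ∘ₗ C.germ) (iR B C.Env) (Coalgebra.comul (R := ℂ) a)
  exact (h.trans h2).symm

/-- For odd f the factors 1 ⊗ v and f(w_k) ⊗ 1 anticommute, so by `iV_mul_twist` one mixed term is
minus the other one evaluated on the braided tensor. Together they measure the failure of t to be
braid invariant. -/
theorem mul₂_twist_add_iV {f : C.inv →ₗ[ℂ] B} (hf : ∀ v, Super.par (f v) = -f v)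
    (t : C.inv ⊗[ℂ] C.inv) :
    mul₂ (C.twist f + C.iV B) (C.twist f + C.iV B) t = mul₂ (C.twist f) (C.twist f) t
      + mul₂ (C.twist f) (C.iV B) (t - C.braid t) + iR B C.Env (C.invMul t) := by
  induction t using TensorProduct.induction_on with
  | zero => simp
  | add s t hs ht => simp only [map_add, hs, ht, map_sub]; abel
  | tmul u v =>
    rw [map_sub, sub_eq_add_neg, ← C.iV_mul_twist hf]
    simp only [TensorProduct.lift.tmul, LinearMap.compl₁₂_apply, LinearMap.mul_apply', map_mul,
      invMul, add_mul, mul_add, LinearMap.add_apply]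
    change _ = _ + (_ + _) + C.iV B u * C.iV B v
    abel

theorem mul₂_twist_add_iV_germ₂ {f : C.inv →ₗ[ℂ] B} (hf : ∀ v, Super.par (f v) = -f v) (a : A) :
    mul₂ (C.twist f + C.iV B) (C.twist f + C.iV B) (C.germ₂ a)
      = mul₂ (C.twist f) (C.twist f) (C.germ₂ a) + mul₂ ((iL B C.Env).toLinearMap ∘ₗ f)
        ((iR B C.Env).toLinearMap ∘ₗ C.gΓ ∘ₗ C.d) (C.varpi (C.germ a))
      + iR B C.Env (C.invMul (C.germ₂ a)) := by
  rw [C.mul₂_twist_add_iV hf, ← mul₂_twist_iV_germ, braid_germ₂, sub_sub_cancel, mul₂_lTensor]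

/-- The minus sign comes from differentiating the second factor behind the odd element f(v_k). This
term, with d(c_k), is designed to meet its negative, the mixed term of `mul₂_twist_add_iV_germ₂`. -/
theorem tensorD_twist {f g : C.inv →ₗ[ℂ] B} (hf : ∀ v, Super.par (f v) = -f v) (D : SuperDiff B)
    (hg : ∀ v, D.d (f v) = g v) (v : C.inv) :
    tensorD D C.envDiff (C.twist f v) = C.twist g v
      - mul₂ ((iL B C.Env).toLinearMap ∘ₗ f)
        ((iR B C.Env).toLinearMap ∘ₗ C.gΓ ∘ₗ C.d) (C.varpi v) := by
  rw [twist, twist, LinearMap.comp_apply, LinearMap.comp_apply]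
  generalize C.varpi v = t
  induction t using TensorProduct.induction_on with
  | zero => simp
  | add s t hs ht => rw [map_add, map_add, hs, ht, map_add, map_add]; abel
  | tmul u e =>
    have h := tensorD_mul_iL_iR D C.envDiff (f u) (C.gA e)
    rw [hg, hf, envDiff_gA, map_neg, neg_mul, ← sub_eq_add_neg] at h
    exact h

theorem twist_add (f g : C.inv →ₗ[ℂ] B) : C.twist (f + g) = C.twist f + C.twist g := by
  rw [twist, twist, twist, ← LinearMap.add_comp]
  congr 1
  ext; simp

theorem adGen_eq : C.adGen = C.twist C.θ + C.iV C.Univ := LinearMap.ext C.adGen_apply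

/-- The terms θ(ϑ_k) ⊗ d(c_k) coming from dϖ(ϑ) cancel the mixed quadratic terms, and the
Maurer–Cartan formula cancels 1 ⊗ dϑ. Hence the curvature is horizontal already in Ω and not merely
modulo 𝒦; the lifting of ℶ to ℸ depends on this. -/
theorem adTilde_R_aux (a : A) :
    C.adTilde (C.dθ (C.germ a) + mul₂ C.θ C.θ (C.germ₂ a))
      = C.twist C.dθ (C.germ a) + mul₂ (C.twist C.θ) (C.twist C.θ) (C.germ₂ a) := by
  have h : C.adTilde.toLinearMap ∘ₗ C.θ = C.twist C.θ + C.iV C.Univ := by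
    rw [← adGen_eq]; exact LinearMap.ext C.adTilde_θ
  rw [map_add, adTilde_dθ, map_mul₂, h, C.mul₂_twist_add_iV_germ₂ C.par_θ, adGen_eq,
    LinearMap.add_apply, map_add, C.tensorD_twist C.par_θ C.diff C.diff_θ, iV, LinearMap.comp_apply,
    AlgHom.toLinearMap_apply, tensorD_iR, envDiff_germ, map_neg]
  abel

end Twist

namespace EmbeddedDifferential
variable {C}
variable (δ : C.EmbeddedDifferential)

/-- The homomorphism `(p_𝒦 ⊗ id) ad`. -/
def pAd : C.Univ →ₐ[ℂ] STensor δ.OmegaStar C.Env := δ.pTensor.comp C.adTilde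

theorem pAd_θ (v : C.inv) : δ.pAd (C.θ v) = C.twist δ.x v + C.iV δ.OmegaStar v := by
  change δ.pTensor (C.adTilde (C.θ v)) = _
  rw [adTilde_θ, adGen_apply, map_add, map_mul₂]
  congr 1
  · change _ = mul₂ _ _ _
    have e1 : δ.pTensor.toLinearMap ∘ₗ (iL C.Univ C.Env).toLinearMap ∘ₗ C.θ
        = (iL δ.OmegaStar C.Env).toLinearMap ∘ₗ δ.x :=
      LinearMap.ext fun u => tensorMap_iL δ.p δ.par_p (C.θ u)
    have e2 : δ.pTensor.toLinearMap ∘ₗ (iR C.Univ C.Env).toLinearMap ∘ₗ C.gA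
        = C.iA δ.OmegaStar := LinearMap.ext fun a => tensorMap_iR δ.p δ.par_p (C.gA a)
    rw [e1, e2]
  · exact tensorMap_iR δ.p δ.par_p _

theorem pAd_d (w : C.Univ) :
    δ.pAd (C.diff.d w) = tensorD (δ.diffStar δ.diff_mem_K) C.envDiff (δ.pAd w) := by
  change δ.pTensor (C.adTilde _) = tensorD _ _ (δ.pTensor (C.adTilde _))
  rw [(C.adTilde_par_d w).2]
  exact tensorMap_d δ.p δ.par_p C.diff (δ.diffStar δ.diff_mem_K) C.envDiff (δ.p_d δ.diff_mem_K) _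

/-- After convolution with a ↦ 1 ⊗ a on the left, `conv_iA_twist_germ` carries both twisted factors
to the untwisted side. There `mul₂_x_germ₂` applies, and 1 ⊗ a is moved back and cancelled. -/
theorem twist_twist_germ₂ (a : A) : mul₂ (C.twist δ.x) (C.twist δ.x) (C.germ₂ a)
    = -C.twist (mul₂ δ.x δ.x ∘ₗ δ.δ) (C.germ a) := by
  let B := δ.OmegaStar
  have h1 : conv (C.iA B) (conv (C.twist δ.x ∘ₗ C.germ) (C.twist δ.x ∘ₗ C.germ))
      = conv (C.iA B) (-(C.twist (mul₂ δ.x δ.x ∘ₗ δ.δ) ∘ₗ C.germ)) := by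
    have e : ∀ f g : A →ₗ[ℂ] STensor B C.Env, conv f (-g) = -conv f g := by
      intro f g; simp only [conv]
      have : mul₂ f (-g) = -mul₂ f g := by ext; simp
      rw [this]; rfl
    rw [e, conv_iA_twist_germ, ← conv_assoc, conv_iA_twist_germ, conv_assoc, conv_iA_twist_germ,
      ← conv_assoc]
    have e2 : conv ((iL B C.Env).toLinearMap ∘ₗ δ.x ∘ₗ C.germ)
        ((iL B C.Env).toLinearMap ∘ₗ δ.x ∘ₗ C.germ)
        = -((iL B C.Env).toLinearMap ∘ₗ (mul₂ δ.x δ.x ∘ₗ δ.δ) ∘ₗ C.germ) := by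
      ext a
      have h := congrArg (iL B C.Env) ((δ.conv_x_germ a).trans (δ.mul₂_x_germ₂ a))
      rw [conv, LinearMap.comp_apply, map_mul₂, map_neg] at h
      exact h
    rw [e2]
    ext a
    simp only [conv]
    have : ∀ f g : A →ₗ[ℂ] STensor B C.Env, mul₂ (-f) g = -mul₂ f g := by intro f g; ext; simp
    rw [this]; rfl
  have h2 := congrArg (fun f => f a) (C.conv_iA_cancel h1)
  refine Eq.trans ?_ h2
  simp only [conv, germ₂, LinearMap.comp_apply]
  generalize Coalgebra.comul (R := ℂ) a = t
  induction t using TensorProduct.induction_on with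
  | zero => simp
  | add s t hs ht => simp only [map_add, hs, ht]
  | tmul u v => simp

theorem par_x (v : C.inv) : Super.par (δ.x v) = -δ.x v := by
  change Super.par (δ.p (C.θ v)) = -δ.p (C.θ v)
  rw [← par_p, par_θ, map_neg]

theorem par_r (v : C.inv) : Super.par (δ.r v) = δ.r v := by
  change Super.par (δ.p (δ.R v)) = δ.p (δ.R v)
  rw [← par_p, par_R]

theorem pAd_comp_θ : δ.pAd.toLinearMap ∘ₗ C.θ = C.twist δ.x + C.iV δ.OmegaStar :=
  LinearMap.ext δ.pAd_θ

/-- The action of `(p_𝒦 ⊗ id) ad` on the quadratic part of a Maurer–Cartan formula. -/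
theorem pAd_mul₂_θ_germ₂ (a : A) : δ.pAd (mul₂ C.θ C.θ (C.germ₂ a))
    = -C.twist (mul₂ δ.x δ.x ∘ₗ δ.δ) (C.germ a)
      + mul₂ ((iL δ.OmegaStar C.Env).toLinearMap ∘ₗ δ.x)
        ((iR δ.OmegaStar C.Env).toLinearMap ∘ₗ C.gΓ ∘ₗ C.d) (C.varpi (C.germ a))
      + iR δ.OmegaStar C.Env (C.invMul (C.germ₂ a)) := by
  rw [map_mul₂, pAd_comp_θ, C.mul₂_twist_add_iV_germ₂ δ.par_x, twist_twist_germ₂]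

/-- The cancellation is that of `adTilde_R_aux`; in Ω_* the purely twisted quadratic terms cancel as
well, by `twist_twist_germ₂`. -/
theorem pAd_R (v : C.inv) : δ.pAd (δ.R v) = C.twist δ.r v := by
  obtain ⟨a, rfl, ha⟩ := δ.exists_germ v
  have hd : ∀ v, (δ.diffStar δ.diff_mem_K).d (δ.x v) = (δ.r + mul₂ δ.x δ.x ∘ₗ δ.δ) v := δ.pd_θ
  have h1 : δ.pAd (C.dθ (C.germ a)) = C.twist (δ.r + mul₂ δ.x δ.x ∘ₗ δ.δ) (C.germ a)
      - mul₂ ((iL δ.OmegaStar C.Env).toLinearMap ∘ₗ δ.x)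
        ((iR δ.OmegaStar C.Env).toLinearMap ∘ₗ C.gΓ ∘ₗ C.d) (C.varpi (C.germ a))
      + iR δ.OmegaStar C.Env (C.envDiff.d (C.invEnv (C.germ a))) := by
    rw [← diff_θ, pAd_d, pAd_θ, map_add, C.tensorD_twist δ.par_x _ hd]
    congr 1
    exact tensorD_iR _ _ _
  have h2 : δ.R (C.germ a) = C.dθ (C.germ a) + mul₂ C.θ C.θ (C.germ₂ a) := by
    rw [R, LinearMap.sub_apply, LinearMap.comp_apply, ha, map_neg, sub_neg_eq_add]
  rw [h2, map_add, h1, pAd_mul₂_θ_germ₂, envDiff_germ, twist_add, map_neg, LinearMap.add_apply]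
  abel

theorem pAd_kGen {w : C.Univ} (hw : w ∈ δ.kGen) : δ.pAd w = 0 := by
  have hR : δ.pAd.toLinearMap ∘ₗ δ.R = C.twist δ.r := LinearMap.ext δ.pAd_R
  rcases hw with (⟨t, ht, rfl⟩ | ⟨η, ϑ, rfl⟩) | ⟨η, ϑ, rfl⟩
  · obtain ⟨a, ha, rfl⟩ := C.exists_of_invMul_eq_zero t ht
    refine (δ.pAd_mul₂_θ_germ₂ a).trans ?_
    rw [ha, C.invMul_germ₂ a ha]
    simp
  · rw [j₃, map_sub, map_mul, map_mul₂, hR, pAd_comp_θ, pAd_R, pAd_θ, braid_tmul, mul₂_lTensor,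
      LinearMap.add_comp, mul₂_add_right, add_mul, twist_mul_twist C δ.commutes_x, iV,
      LinearMap.comp_apply, AlgHom.toLinearMap_apply, inv_mul_twist C δ.par_r, LinearMap.add_apply]
    exact sub_self _
  · rw [j₄, map_sub, map_mul, map_mul₂, hR, pAd_R, pAd_R, braid_tmul, mul₂_lTensor,
      twist_mul_twist C δ.commutes_r, sub_self]

theorem pAd_eq_zero : ∀ w ∈ δ.K, δ.pTensor (C.adTilde w) = 0 :=
  eq_zero_of_mem_span _ δ.pAd.toRingHom fun _ hx => δ.pAd_kGen hx

end EmbeddedDifferential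
end BicovariantStarCalculus
end
end QPB

/-! ### Cohomology algebras, the contraction of Ω, and the formal equivalences. -/

open scoped TensorProduct

namespace QPB

noncomputable section

namespace SuperDiff
variable {B B' : Type*} [Ring B] [Algebra ℂ B] [Super B] [Ring B'] [Algebra ℂ B'] [Super B']

/-- For a cocycle x one has x·dw = d(par(x)·w). So the coboundaries of a parity-stable subalgebra
already form a two-sided ideal in the cocycles, and the ideal they span is no larger. -/
theorem mem_coboundaries (D : SuperDiff B) (S : Subalgebra ℂ B) (hS : ∀ x ∈ S, Super.par x ∈ S)
    (z : D.cocycles S) : z ∈ D.coboundaries S ↔ ∃ w ∈ S, D.d w = z := by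
  refine ⟨fun hz => ?_, fun hz => TwoSidedIdeal.subset_span hz⟩
  let I : TwoSidedIdeal (D.cocycles S) := TwoSidedIdeal.mk' {z | ∃ w ∈ S, D.d w = z}
    ⟨0, zero_mem _, map_zero _⟩
    (by
      rintro x y ⟨w, hw, hx⟩ ⟨w', hw', hy⟩
      exact ⟨w + w', add_mem hw hw', by rw [map_add, hx, hy]; rfl⟩)
    (by
      rintro x ⟨w, hw, hx⟩
      exact ⟨-w, neg_mem hw, by rw [map_neg, hx]; rfl⟩)
    (by
      rintro x y ⟨w, hw, hy⟩
      refine ⟨Super.par x.1 * w, mul_mem (hS _ x.2.1) hw, ?_⟩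
      rw [D.d_mul, D.d_par, x.2.2, Super.par_par, hy]
      simp)
    (by
      rintro x y ⟨w, hw, hx⟩
      refine ⟨w * y.1, mul_mem hw y.2.1, ?_⟩
      rw [D.d_mul, y.2.2, hx]
      simp)
  have h : D.coboundaries S ≤ I :=
    TwoSidedIdeal.span_le.2 fun x hx => (TwoSidedIdeal.mem_mk' ..).2 hx
  have h2 : z ∈ {z : D.cocycles S | ∃ w ∈ S, D.d w = z} := (TwoSidedIdeal.mem_mk' ..).1 (h hz)
  exact h2

/-- The cohomology class of a cocycle. -/
def cls (D : SuperDiff B) (S : Subalgebra ℂ B) : D.cocycles S →ₐ[ℂ] D.Cohomology S :=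
  (D.coboundaries S).ringCon.mkₐ ℂ

theorem cls_surjective (D : SuperDiff B) (S : Subalgebra ℂ B) : Function.Surjective (D.cls S) :=
  RingCon.mk'_surjective _

theorem cls_eq_zero (D : SuperDiff B) (S : Subalgebra ℂ B) (hS : ∀ x ∈ S, Super.par x ∈ S)
    (z : D.cocycles S) : D.cls S z = 0 ↔ ∃ w ∈ S, D.d w = z := by
  rw [← D.mem_coboundaries S hS]
  exact ⟨fun h => (TwoSidedIdeal.mem_iff _ _).2 ((RingCon.eq _).1 h), fun h => (RingCon.eq _).2 h⟩

theorem cohomologyMap_cls (D : SuperDiff B) (D' : SuperDiff B') (S : Subalgebra ℂ B)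
    (S' : Subalgebra ℂ B') (f : B →ₐ[ℂ] B') (hf : ∀ x, f (D.d x) = D'.d (f x))
    (hS : ∀ x ∈ S, f x ∈ S') (z : D.cocycles S) (z' : D'.cocycles S') (h : (z' : B') = f z) :
    D.cohomologyMap D' S S' f hf hS (D.cls S z) = D'.cls S' z' := by
  obtain ⟨z', hz'⟩ := z'
  cases h
  rfl

/-- A homomorphism of differential algebras that maps `S` onto `S'` induces an isomorphism of the
cohomology algebras iff its kernel in `S` is acyclic. -/
theorem bijective_cohomologyMap_iff (D : SuperDiff B) (D' : SuperDiff B') (S : Subalgebra ℂ B)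
    (S' : Subalgebra ℂ B') (f : B →ₐ[ℂ] B') (hf : ∀ x, f (D.d x) = D'.d (f x))
    (hS : ∀ x ∈ S, f x ∈ S') (hsurj : ∀ y ∈ S', ∃ x ∈ S, f x = y)
    (hp : ∀ x ∈ S, Super.par x ∈ S) (hp' : ∀ x ∈ S', Super.par x ∈ S') (hd : ∀ x ∈ S, D.d x ∈ S) :
    Function.Bijective (D.cohomologyMap D' S S' f hf hS) ↔ D.IsAcyclic {w | f w = 0 ∧ w ∈ S} := by
  constructor
  · rintro ⟨hi, hs⟩ k ⟨hk, hkS⟩ hdk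
    have h0 : D.cls S ⟨k, hkS, hdk⟩ = 0 := by
      apply hi
      rw [map_zero, D.cohomologyMap_cls D' S S' f hf hS ⟨k, hkS, hdk⟩ 0 (by simp [hk]), map_zero]
    -- The primitive u lies in S but perhaps not in the kernel of f. Its image is a cocycle, hence
    -- cohomologous to f(z) for a cocycle z of S, and the difference is d of some f(u'). Then u - z
    -- + du' is a primitive in the kernel.
    obtain ⟨u, hu, hdu⟩ := (D.cls_eq_zero S hp _).1 h0
    have hfu : D'.d (f u) = 0 := by rw [← hf, hdu, hk]
    obtain ⟨c, hc⟩ := hs (D'.cls S' ⟨f u, hS u hu, hfu⟩)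
    obtain ⟨z, rfl⟩ := D.cls_surjective S c
    rw [D.cohomologyMap_cls D' S S' f hf hS z ⟨f z, hS z z.2.1, by rw [← hf, z.2.2, map_zero]⟩ rfl,
      ← sub_eq_zero, ← map_sub, D'.cls_eq_zero S' hp'] at hc
    obtain ⟨y, hy, hdy⟩ := hc
    obtain ⟨u', hu', rfl⟩ := hsurj y hy
    rw [← hf] at hdy
    refine ⟨u - z + D.d u', ⟨?_, add_mem (sub_mem hu z.2.1) (hd _ hu')⟩, ?_⟩
    · rw [map_add, hdy, map_sub]
      simp
    · rw [map_add, map_sub, z.2.2, D.d_d, hdu]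
      simp
  · intro h
    constructor
    · rw [injective_iff_map_eq_zero]
      intro c hc
      obtain ⟨z, rfl⟩ := D.cls_surjective S c
      rw [D.cohomologyMap_cls D' S S' f hf hS z ⟨f z, hS z z.2.1, by rw [← hf, z.2.2, map_zero]⟩ rfl,
        D'.cls_eq_zero S' hp'] at hc
      obtain ⟨y, hy, hdy⟩ := hc
      obtain ⟨u, hu, rfl⟩ := hsurj y hy
      obtain ⟨k, ⟨hk, hkS⟩, hdk⟩ := h (z - D.d u)
        ⟨by rw [map_sub, hf, hdy, sub_self], sub_mem z.2.1 (hd u hu)⟩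
        (by rw [map_sub, z.2.2, D.d_d, sub_zero])
      exact (D.cls_eq_zero S hp _).2 ⟨u + k, add_mem hu hkS, by rw [map_add, hdk]; abel⟩
    · intro c
      obtain ⟨y, rfl⟩ := D'.cls_surjective S' c
      obtain ⟨u, hu, hfu⟩ := hsurj y y.2.1
      obtain ⟨k, ⟨hk, hkS⟩, hdk⟩ := h (D.d u)
        ⟨by rw [hf, hfu, y.2.2], hd u hu⟩ (D.d_d u)
      refine ⟨D.cls S ⟨u - k, sub_mem hu hkS, by rw [map_sub, hdk, sub_self]⟩, ?_⟩
      rw [D.cohomologyMap_cls D' S S' f hf hS _ y]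
      rw [map_sub, hk, hfu, sub_zero]

end SuperDiff

namespace BicovariantStarCalculus
variable {A Γ : Type*} [Ring A] [HopfAlgebra ℂ A] [StarRing A]
    [AddCommGroup Γ] [Module ℂ Γ] [Module A Γ] [Module Aᵐᵒᵖ Γ] [SMulCommClass A Aᵐᵒᵖ Γ]
    [IsScalarTower ℂ A Γ] [IsScalarTower ℂ Aᵐᵒᵖ Γ] (C : BicovariantStarCalculus A Γ)


theorem par_mem_daleth {w : C.Univ} (hw : w ∈ C.daleth) : Super.par w ∈ C.daleth := by
  change C.adTilde _ = iL C.Univ C.Env _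
  rw [(C.adTilde_par_d w).1, show C.adTilde w = iL C.Univ C.Env w from hw, par_iL]

theorem d_mem_daleth {w : C.Univ} (hw : w ∈ C.daleth) : C.diff.d w ∈ C.daleth := by
  change C.adTilde _ = iL C.Univ C.Env _
  rw [(C.adTilde_par_d w).2, show C.adTilde w = iL C.Univ C.Env w from hw, tensorD_iL]

/-- Left multiplication by generators on pairs `(w, H(w))`, where `H` is the contraction
`H(dϑ w) = ϑ w`, `H(ϑ w) = 0`. -/
def contrHom : C.Univ →ₐ[ℂ] Module.End ℂ (C.Univ × C.Univ) :=
  C.univLift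
    (LinearMap.mk₂ ℂ (fun v (z : C.Univ × C.Univ) => (C.θ v * z.1, (0 : C.Univ)))
      (fun v v' z => by simp [add_mul]) (fun c v z => by simp)
      (fun v z z' => by simp [mul_add]) (fun c v z => by simp))
    (LinearMap.mk₂ ℂ (fun v (z : C.Univ × C.Univ) => (C.dθ v * z.1, C.θ v * z.1))
      (fun v v' z => by simp [add_mul]) (fun c v z => by simp)
      (fun v z z' => by simp [mul_add]) (fun c v z => by simp))

theorem contrHom_θ (v : C.inv) (z : C.Univ × C.Univ) :
    C.contrHom (C.θ v) z = (C.θ v * z.1, 0) := by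
  rw [contrHom, univLift_θ]; rfl

theorem contrHom_dθ (v : C.inv) (z : C.Univ × C.Univ) :
    C.contrHom (C.dθ v) z = (C.dθ v * z.1, C.θ v * z.1) := by
  rw [contrHom, univLift_dθ]; rfl

/-- The contraction `H` of the free differential algebra. -/
def contr : C.Univ →ₗ[ℂ] C.Univ :=
  LinearMap.snd ℂ C.Univ C.Univ ∘ₗ LinearMap.applyₗ (1, 0) ∘ₗ C.contrHom.toLinearMap

/-- The augmentation of `Ω`. -/
def augm : C.Univ →ₐ[ℂ] ℂ := C.univLift 0 0

theorem augm_θ (v : C.inv) : C.augm (C.θ v) = 0 := C.univLift_θ _ _ v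
theorem augm_dθ (v : C.inv) : C.augm (C.dθ v) = 0 := C.univLift_dθ _ _ v

theorem fst_contrHom (w : C.Univ) (z : C.Univ × C.Univ) : (C.contrHom w z).1 = w * z.1 := by
  have hw : w ∈ Algebra.adjoin ℂ C.univGen := C.adjoin_univGen ▸ Algebra.mem_top
  induction hw using Algebra.adjoin_induction generalizing z with
  | mem x hx =>
    rcases hx with (⟨v, rfl⟩ | ⟨v, rfl⟩)
    · rw [contrHom_θ]
    · rw [contrHom_dθ]
  | algebraMap r => simp [Algebra.algebraMap_eq_smul_one]
  | add x y _ _ hx hy => simp [hx, hy, add_mul]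
  | mul x y _ _ hx hy => rw [map_mul, Module.End.mul_apply, hx, hy, mul_assoc]

theorem contr_θ_mul (v : C.inv) (w : C.Univ) : C.contr (C.θ v * w) = 0 := by
  change (C.contrHom (C.θ v * w) (1, 0)).2 = 0
  rw [map_mul, Module.End.mul_apply, contrHom_θ]

theorem contr_dθ_mul (v : C.inv) (w : C.Univ) : C.contr (C.dθ v * w) = C.θ v * w := by
  change (C.contrHom (C.dθ v * w) (1, 0)).2 = C.θ v * w
  rw [map_mul, Module.End.mul_apply, contrHom_dθ, fst_contrHom, mul_one]

theorem contr_one : C.contr 1 = 0 := by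
  change (C.contrHom 1 (1, 0)).2 = 0
  rw [map_one]; rfl

/-- Induction on words in the generators of `Ω`. -/
theorem univ_induction {P : C.Univ → Prop} (h1 : P 1) (hadd : ∀ x y, P x → P y → P (x + y))
    (hsmul : ∀ (c : ℂ) x, P x → P (c • x)) (hθ : ∀ v x, P x → P (C.θ v * x))
    (hdθ : ∀ v x, P x → P (C.dθ v * x)) (w : C.Univ) : P w := by
  have h : ∀ x, P x → P (w * x) := by
    have hw : w ∈ Algebra.adjoin ℂ C.univGen := C.adjoin_univGen ▸ Algebra.mem_top
    induction hw using Algebra.adjoin_induction with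
    | mem x hx =>
      rcases hx with (⟨v, rfl⟩ | ⟨v, rfl⟩)
      · exact hθ v
      · exact hdθ v
    | algebraMap r =>
      intro x hx
      rw [Algebra.algebraMap_eq_smul_one, smul_mul_assoc, one_mul]
      exact hsmul r x hx
    | add x y _ _ hx hy => intro z hz; rw [add_mul]; exact hadd _ _ (hx z hz) (hy z hz)
    | mul x y _ _ hx hy => intro z hz; rw [mul_assoc]; exact hx _ (hy z hz)
  have := h 1 h1
  rwa [mul_one] at this

/-- The free differential algebra is contractible. -/
theorem diff_contr (w : C.Univ) :
    C.diff.d (C.contr w) + C.contr (C.diff.d w) = w - algebraMap ℂ _ (C.augm w) := by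
  induction w using C.univ_induction with
  | h1 => rw [contr_one, C.diff.d_one, map_zero, map_zero, map_one, map_one]; simp
  | hadd x y hx hy =>
    simp only [map_add]
    rw [show x + y - (algebraMap ℂ C.Univ (C.augm x) + algebraMap ℂ C.Univ (C.augm y))
      = (x - algebraMap ℂ C.Univ (C.augm x)) + (y - algebraMap ℂ C.Univ (C.augm y)) by abel,
      ← hx, ← hy]
    abel
  | hsmul c x hx =>
    simp only [map_smul, ← smul_add, hx, smul_sub, Algebra.algebraMap_eq_smul_one, smul_assoc]
  | hθ v x hx =>
    rw [contr_θ_mul, C.diff.d_mul, diff_θ, par_θ, map_zero, map_add, contr_dθ_mul, neg_mul, map_neg,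
      contr_θ_mul, map_mul, augm_θ]
    simp
  | hdθ v x hx =>
    rw [contr_dθ_mul, C.diff.d_mul, C.diff.d_mul, diff_θ, diff_dθ, par_θ, par_dθ, zero_mul, zero_add,
      contr_dθ_mul, map_mul, augm_dθ]
    simp

theorem augm_d (w : C.Univ) : C.augm (C.diff.d w) = 0 := by
  induction w using C.univ_induction with
  | h1 => rw [C.diff.d_one, map_zero]
  | hadd x y hx hy => rw [map_add, map_add, hx, hy, add_zero]
  | hsmul c x hx => rw [map_smul, map_smul, hx, smul_zero]
  | hθ v x hx => rw [C.diff.d_mul, diff_θ, par_θ, map_add, map_mul, map_mul, augm_dθ, hx]; simp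
  | hdθ v x hx => rw [C.diff.d_mul, diff_dθ, par_dθ, map_add, map_mul, map_mul, hx]; simp

namespace EmbeddedDifferential
variable {C}
variable (δ : C.EmbeddedDifferential)

theorem augm_K {w : C.Univ} (hw : w ∈ δ.K) : C.augm w = 0 := by
  have hθ : C.augm.toLinearMap ∘ₗ C.θ = 0 := LinearMap.ext C.augm_θ
  have z : ∀ t : C.inv ⊗[ℂ] C.inv, mul₂ (0 : C.inv →ₗ[ℂ] ℂ) 0 t = 0 := by
    intro t
    induction t using TensorProduct.induction_on with
    | zero => simp
    | add s t hs ht => rw [map_add, hs, ht, add_zero]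
    | tmul u v => simp
  have hR : C.augm.toLinearMap ∘ₗ δ.R = 0 := by
    ext v
    simp only [R, LinearMap.comp_apply, LinearMap.sub_apply, map_sub, AlgHom.toLinearMap_apply,
      augm_dθ, map_mul₂, hθ, z]
    simp
  have hR' : ∀ v, C.augm (δ.R v) = 0 := fun v => congrArg (fun f => f v) hR
  refine eq_zero_of_mem_span δ.kGen C.augm.toRingHom ?_ w hw
  rintro w ((⟨t, -, rfl⟩ | ⟨η, ϑ, rfl⟩) | ⟨η, ϑ, rfl⟩)
  · exact (map_mul₂ _ _ C.augm t).trans (by rw [hθ, z])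
  · change C.augm (δ.j₃ η ϑ) = 0
    rw [j₃, map_sub, map_mul, map_mul₂, hR, hθ, z, augm_θ, zero_mul, sub_zero]
  · change C.augm (δ.j₄ η ϑ) = 0
    rw [j₄, map_sub, map_mul, map_mul₂, hR, z, hR', zero_mul, sub_zero]

/-- Since Ω is contractible, the connecting map of 0 → 𝒦 → Ω → Ω_* → 0 identifies H(Ω_*)/ℂ with
H(𝒦). Concretely, the contraction supplies a primitive of a cocycle k of 𝒦 whose class in Ω_* is a
cocycle, say a scalar plus a coboundary, and subtracting lifts of these moves the primitive into 𝒦.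
Scalars are not coboundaries in Ω_*, because the augmentation kills 𝒦 and all exact elements. -/
theorem idealAcyclic_iff : δ.IdealAcyclic ↔ δ.StarTrivial δ.diff_mem_K := by
  let D := δ.diffStar δ.diff_mem_K
  have hcls := D.cls_eq_zero ⊤ (fun _ _ => Algebra.mem_top)
  have halg : ∀ c : ℂ, algebraMap ℂ (D.Cohomology ⊤) c
      = D.cls ⊤ (algebraMap ℂ (D.cocycles ⊤) c) := fun c => ((D.cls ⊤).commutes c).symm
  constructor
  · intro h
    constructor
    · rw [injective_iff_map_eq_zero]
      intro c hc
      rw [halg, hcls] at hc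
      obtain ⟨y, -, hy⟩ := hc
      obtain ⟨u, rfl⟩ := δ.p_surjective y
      have h1 : C.diff.d u - algebraMap ℂ _ c ∈ δ.K := by
        rw [mem_K_iff, map_sub, δ.p_d δ.diff_mem_K, AlgHom.commutes, sub_eq_zero]
        exact hy
      have h2 := δ.augm_K h1
      rw [map_sub, augm_d, AlgHom.commutes, zero_sub, neg_eq_zero] at h2
      exact h2
    · intro z
      obtain ⟨⟨y, -, hy⟩, rfl⟩ := D.cls_surjective ⊤ z
      obtain ⟨u, rfl⟩ := δ.p_surjective y
      obtain ⟨k, hk, hdk⟩ := h (C.diff.d u) ((δ.mem_K_iff _).2 hy) (C.diff.d_d u)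
      refine ⟨C.augm (u - k), ?_⟩
      rw [halg, eq_comm, ← sub_eq_zero, ← map_sub, hcls]
      refine ⟨δ.p (C.contr (u - k)), Algebra.mem_top, ?_⟩
      have h1 := C.diff_contr (u - k)
      rw [map_sub C.diff.d, hdk, sub_self, map_zero, add_zero] at h1
      change δ.p (C.diff.d _) = δ.p u - algebraMap ℂ _ _
      rw [h1, map_sub, AlgHom.commutes, map_sub δ.p u k, δ.p_eq_zero hk, sub_zero]
  · rintro ⟨-, hs⟩ k hk hdk
    have h1 := C.diff_contr k
    rw [hdk, map_zero, add_zero, δ.augm_K hk, map_zero, sub_zero] at h1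
    have hz : D.d (δ.p (C.contr k)) = 0 := by
      rw [← δ.p_d δ.diff_mem_K, h1, δ.p_eq_zero hk]
    obtain ⟨c, hc⟩ := hs (D.cls ⊤ ⟨δ.p (C.contr k), Algebra.mem_top, hz⟩)
    rw [halg, eq_comm, ← sub_eq_zero, ← map_sub, hcls] at hc
    obtain ⟨y, -, hy⟩ := hc
    obtain ⟨u, rfl⟩ := δ.p_surjective y
    refine ⟨C.contr k - algebraMap ℂ _ c - C.diff.d u, ?_, ?_⟩
    · change _ ∈ δ.K
      rw [mem_K_iff, map_sub, map_sub, AlgHom.commutes, sub_eq_zero, δ.p_d δ.diff_mem_K]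
      exact hy.symm
    · rw [map_sub, map_sub, Algebra.algebraMap_eq_smul_one, map_smul, C.diff.d_one, C.diff.d_d, h1]
      simp

/-- With ℸ → ℶ onto, 𝒦 ∩ ℸ is the kernel in a short exact sequence of complexes, and
`bijective_cohomologyMap_iff` applies. The surjectivity is supplied by `exists_mem_daleth`. -/
theorem classesCoincide_iff (hs : ∀ y ∈ δ.beth δ.pAd_eq_zero, ∃ x ∈ C.daleth, δ.p x = y) :
    δ.InvariantPartAcyclic ↔ δ.ClassesCoincide δ.diff_mem_K δ.pAd_eq_zero := by
  have h := C.diff.bijective_cohomologyMap_iff (δ.diffStar δ.diff_mem_K) C.daleth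
    (δ.beth δ.pAd_eq_zero) δ.p (δ.p_d δ.diff_mem_K) (δ.p_mem_beth δ.pAd_eq_zero) hs
    (fun _ => C.par_mem_daleth)
    (fun y hy => by
      obtain ⟨x, hx, rfl⟩ := hs y hy
      exact δ.p_mem_beth δ.pAd_eq_zero _ (C.par_mem_daleth hx))
    (fun _ => C.d_mem_daleth)
  have e : {w | δ.p w = 0 ∧ w ∈ C.daleth} = {w | w ∈ δ.K ∧ w ∈ C.daleth} := by
    ext w
    change _ ∧ _ ↔ _ ∧ _
    rw [mem_K_iff]
  rw [e] at h
  refine h.symm.trans ⟨fun hb => ⟨AlgEquiv.ofBijective _ hb, fun x => rfl⟩, ?_⟩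
  rintro ⟨f, hf⟩
  have : ⇑f = δ.cohomologyP δ.diff_mem_K δ.pAd_eq_zero := funext hf
  change Function.Bijective (δ.cohomologyP δ.diff_mem_K δ.pAd_eq_zero)
  rw [← this]
  exact f.bijective

end EmbeddedDifferential
end BicovariantStarCalculus
end
end QPB

/-! ### The coproduct of Γ^∧. -/

open scoped TensorProduct

namespace QPB

noncomputable section

section SuperTensor
variable {B B' B₂ B₂' : Type*} [Ring B] [Algebra ℂ B] [Super B] [Ring B'] [Algebra ℂ B'] [Super B']
  [Ring B₂] [Algebra ℂ B₂] [Super B₂] [Ring B₂'] [Algebra ℂ B₂'] [Super B₂']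

/-- The graded tensor product as a tensor product of vector spaces. -/
def pl : STensor B B' ≃ₗ[ℂ] B ⊗[ℂ] B' :=
  (GradedTensorProduct.of ℂ (Super.part B) (Super.part B')).symm

theorem pl_mul (b : B) (e : B') : pl (iL B B' b * iR B B' e) = b ⊗ₜ e := by
  rw [iL_mul_iR]; rfl

theorem pl_iL (b : B) : pl (iL B B' b) = b ⊗ₜ 1 := rfl

theorem pl_tensorD (D : SuperDiff B) (D' : SuperDiff B') (z : STensor B B') :
    pl (tensorD D D' z) = TensorProduct.map D.d LinearMap.id (pl z)
      + TensorProduct.map (Super.par (B := B)).toLinearMap D'.d (pl z) := rfl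

theorem pl_mul₂ {M N : Type*} [AddCommGroup M] [Module ℂ M] [AddCommGroup N] [Module ℂ N]
    (f : M →ₗ[ℂ] B) (g : N →ₗ[ℂ] B') (t : M ⊗[ℂ] N) :
    pl (BicovariantStarCalculus.mul₂ ((iL B B').toLinearMap ∘ₗ f) ((iR B B').toLinearMap ∘ₗ g) t)
      = TensorProduct.map f g t := by
  induction t using TensorProduct.induction_on with
  | zero => simp
  | add s t hs ht => simp only [map_add, hs, ht]
  | tmul x y => exact pl_mul _ _

theorem pl_par (z : STensor B B') : pl (Super.par z)
    = TensorProduct.map (Super.par (B := B)).toLinearMap (Super.par (B := B')).toLinearMap (pl z) := by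
  induction z using STensor.induction with
  | h0 => simp
  | ha s t hs ht => simp only [map_add, hs, ht]
  | hm b e => rw [map_mul, par_iL, par_iR, pl_mul, pl_mul]; rfl


/-- The homomorphism `f ⊗ g` of graded tensor products. -/
def stMap (f : B →ₐ[ℂ] B₂) (g : B' →ₐ[ℂ] B₂') (hf : ∀ x, f (Super.par x) = Super.par (f x))
    (hg : ∀ x, g (Super.par x) = Super.par (g x)) : STensor B B' →ₐ[ℂ] STensor B₂ B₂' :=
  stLift ((iL B₂ B₂').comp f) ((iR B₂ B₂').comp g)
    (fun b e he => iR_mul_iL_of_even (show Super.par (g e) = g e by rw [← hg, he]) _)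
    (fun b e he => by
      simp only [AlgHom.comp_apply, hf]
      exact iR_mul_iL_of_odd (show Super.par (g e) = -g e by rw [← hg, he, map_neg]) _)

theorem stMap_iL (f : B →ₐ[ℂ] B₂) (g : B' →ₐ[ℂ] B₂') (hf : ∀ x, f (Super.par x) = Super.par (f x))
    (hg : ∀ x, g (Super.par x) = Super.par (g x)) (b : B) :
    stMap f g hf hg (iL B B' b) = iL B₂ B₂' (f b) := stLift_iL _ _ _ _ b

theorem stMap_iR (f : B →ₐ[ℂ] B₂) (g : B' →ₐ[ℂ] B₂') (hf : ∀ x, f (Super.par x) = Super.par (f x))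
    (hg : ∀ x, g (Super.par x) = Super.par (g x)) (e : B') :
    stMap f g hf hg (iR B B' e) = iR B₂ B₂' (g e) := stLift_iR _ _ _ _ e

theorem pl_stMap (f : B →ₐ[ℂ] B₂) (g : B' →ₐ[ℂ] B₂') (hf : ∀ x, f (Super.par x) = Super.par (f x))
    (hg : ∀ x, g (Super.par x) = Super.par (g x)) (z : STensor B B') :
    pl (stMap f g hf hg z) = TensorProduct.map f.toLinearMap g.toLinearMap (pl z) := by
  induction z using STensor.induction with
  | h0 => simp
  | ha s t hs ht => simp only [map_add, hs, ht]
  | hm b e =>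
    rw [map_mul, stMap_iL, stMap_iR, pl_mul, pl_mul]
    rfl

theorem stMap_mul₂ {M N : Type*} [AddCommGroup M] [Module ℂ M] [AddCommGroup N] [Module ℂ N]
    (f : B →ₐ[ℂ] B₂) (g : B' →ₐ[ℂ] B₂') (hf : ∀ x, f (Super.par x) = Super.par (f x))
    (hg : ∀ x, g (Super.par x) = Super.par (g x)) (u : M →ₗ[ℂ] B) (v : N →ₗ[ℂ] B') (t : M ⊗[ℂ] N) :
    stMap f g hf hg (BicovariantStarCalculus.mul₂ ((iL B B').toLinearMap ∘ₗ u)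
        ((iR B B').toLinearMap ∘ₗ v) t)
      = BicovariantStarCalculus.mul₂ ((iL B₂ B₂').toLinearMap ∘ₗ f.toLinearMap ∘ₗ u)
        ((iR B₂ B₂').toLinearMap ∘ₗ g.toLinearMap ∘ₗ v) t := by
  apply pl.injective
  rw [pl_stMap, pl_mul₂, pl_mul₂, ← LinearMap.comp_apply, ← TensorProduct.map_comp]

theorem self_eq_neg_of_complex {V : Type*} [AddCommGroup V] [Module ℂ V] {v : V} (h : v = -v) :
    v = 0 := by
  have h2 : (2 : ℂ) • v = 0 := by rw [two_smul]; nth_rw 2 [h]; exact add_neg_cancel v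
  exact (smul_eq_zero.1 h2).resolve_left two_ne_zero

/-- The homomorphism `f · g` to an algebra in which the images of `f` and `g` commute, where `g`
vanishes on odd elements. -/
def evLift {P : Type*} [Ring P] [Algebra ℂ P] (f : B →ₐ[ℂ] P) (g : B' →ₐ[ℂ] P)
    (hc : ∀ b e, g e * f b = f b * g e) (hg : ∀ x, g (Super.par x) = g x) :
    STensor B B' →ₐ[ℂ] P :=
  stLift f g (fun b e _ => hc b e) (fun b e he => by
    have h := hg e
    rw [he, map_neg] at h
    have h0 : g e = 0 := self_eq_neg_of_complex h.symm
    rw [h0, zero_mul, mul_zero])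

/-- A multiple of a differential. -/
def SuperDiff.smul (c : ℂ) (D : SuperDiff B) : SuperDiff B where
  d := c • D.d
  d_mul x y := by simp [D.d_mul]
  d_par x := by simp [D.d_par]
  d_d x := by simp [D.d_d]

end SuperTensor

namespace BicovariantStarCalculus
variable {A Γ : Type*} [Ring A] [HopfAlgebra ℂ A] [StarRing A]
    [AddCommGroup Γ] [Module ℂ Γ] [Module A Γ] [Module Aᵐᵒᵖ Γ] [SMulCommClass A Aᵐᵒᵖ Γ]
    [IsScalarTower ℂ A Γ] [IsScalarTower ℂ Aᵐᵒᵖ Γ] (C : BicovariantStarCalculus A Γ)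


/-- Induction on generators for properties of elements of the envelope. -/
theorem env_algHom_ext {P : Type*} [Ring P] [Algebra ℂ P] {f g : C.Env →ₐ[ℂ] P}
    (h : ∀ a, f (C.gA a) = g (C.gA a)) (h' : ∀ γ, f (C.gΓ γ) = g (C.gΓ γ)) : f = g := by
  refine AlgHom.ext_of_adjoin_eq_top C.adjoin_envGen ?_
  rintro _ (⟨a, rfl⟩ | ⟨γ, rfl⟩)
  · exact h a
  · exact h' γ

theorem univ_algHom_ext {P : Type*} [Ring P] [Algebra ℂ P] {f g : C.Univ →ₐ[ℂ] P}
    (h : ∀ v, f (C.θ v) = g (C.θ v)) (h' : ∀ v, f (C.dθ v) = g (C.dθ v)) : f = g := by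
  refine AlgHom.ext_of_adjoin_eq_top C.adjoin_univGen ?_
  rintro _ (⟨a, rfl⟩ | ⟨γ, rfl⟩)
  · exact h a
  · exact h' γ

/-- The map `x ⊗ y ↦ f(x) ⊗ g(y)` into `Γ^∧ ⊗̂ Γ^∧`. -/
abbrev coMul {M N : Type*} [AddCommGroup M] [Module ℂ M] [AddCommGroup N] [Module ℂ N]
    (f : M →ₗ[ℂ] C.Env) (g : N →ₗ[ℂ] C.Env) : M ⊗[ℂ] N →ₗ[ℂ] STensor C.Env C.Env :=
  mul₂ ((iL C.Env C.Env).toLinearMap ∘ₗ f) ((iR C.Env C.Env).toLinearMap ∘ₗ g)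

/-- The coproduct of `Γ^∧` on `A`. -/
def coA : A →ₗ[ℂ] STensor C.Env C.Env := C.coMul C.gA C.gA ∘ₗ Coalgebra.comul

/-- The coproduct of `Γ^∧` on `Γ`. -/
def coΓ : Γ →ₗ[ℂ] STensor C.Env C.Env := C.coMul C.gA C.gΓ ∘ₗ C.lco + C.coMul C.gΓ C.gA ∘ₗ C.rco

section
variable {M N M' N' M'' N'' : Type*} [AddCommGroup M] [Module ℂ M] [AddCommGroup N] [Module ℂ N]
  [AddCommGroup M'] [Module ℂ M'] [AddCommGroup N'] [Module ℂ N']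
  [AddCommGroup M''] [Module ℂ M''] [AddCommGroup N''] [Module ℂ N'']

theorem coMul_map₂ (f : M →ₗ[ℂ] C.Env) (g : N →ₗ[ℂ] C.Env) (f' : M' →ₗ[ℂ] C.Env)
    (g' : N' →ₗ[ℂ] C.Env) (f'' : M'' →ₗ[ℂ] C.Env) (g'' : N'' →ₗ[ℂ] C.Env)
    (u : M →ₗ[ℂ] M' →ₗ[ℂ] M'') (v : N →ₗ[ℂ] N' →ₗ[ℂ] N'')
    (hu : ∀ x y, f'' (u x y) = f x * f' y) (hv : ∀ x y, g'' (v x y) = g x * g' y)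
    (hc : ∀ x y, iR C.Env C.Env (g x) * iL C.Env C.Env (f' y)
      = iL C.Env C.Env (f' y) * iR C.Env C.Env (g x)) (s : M ⊗[ℂ] N) (t : M' ⊗[ℂ] N') :
    C.coMul f'' g'' (TensorProduct.map₂ u v s t) = C.coMul f g s * C.coMul f' g' t := by
  induction s using TensorProduct.induction_on with
  | zero => simp
  | add s t hs ht => simp only [map_add, LinearMap.add_apply, hs, ht, add_mul]
  | tmul x y =>
    induction t using TensorProduct.induction_on with
    | zero => simp
    | add s t hs ht => simp only [map_add, hs, ht, mul_add]
    | tmul x' y' =>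
      simp only [TensorProduct.map₂_apply_tmul, TensorProduct.map_tmul, TensorProduct.lift.tmul, LinearMap.compl₁₂_apply,
        LinearMap.mul_apply', LinearMap.comp_apply, hu, hv, AlgHom.toLinearMap_apply, map_mul,
        mul_assoc]
      rw [← mul_assoc (iR C.Env C.Env (g y)), hc, mul_assoc]

theorem coMul_map₂_flip (f : M →ₗ[ℂ] C.Env) (g : N →ₗ[ℂ] C.Env) (f' : M' →ₗ[ℂ] C.Env)
    (g' : N' →ₗ[ℂ] C.Env) (f'' : M'' →ₗ[ℂ] C.Env) (g'' : N'' →ₗ[ℂ] C.Env)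
    (u : M' →ₗ[ℂ] M →ₗ[ℂ] M'') (v : N' →ₗ[ℂ] N →ₗ[ℂ] N'')
    (hu : ∀ x y, f'' (u x y) = f y * f' x) (hv : ∀ x y, g'' (v x y) = g y * g' x)
    (hc : ∀ x y, iR C.Env C.Env (g x) * iL C.Env C.Env (f' y)
      = iL C.Env C.Env (f' y) * iR C.Env C.Env (g x)) (s : M ⊗[ℂ] N) (t : M' ⊗[ℂ] N') :
    C.coMul f'' g'' (TensorProduct.map₂ u v t s) = C.coMul f g s * C.coMul f' g' t := by
  rw [← C.coMul_map₂ f g f' g' f'' g'' u.flip v.flip (fun x y => hu y x) (fun x y => hv y x) hc]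
  congr 1
  induction s using TensorProduct.induction_on with
  | zero => simp
  | add s t hs ht => simp only [map_add, LinearMap.add_apply, hs, ht]
  | tmul x y =>
    induction t using TensorProduct.induction_on with
    | zero => simp
    | add s t hs ht => simp only [map_add, LinearMap.add_apply, hs, ht]
    | tmul x' y' => simp
end

theorem iR_gA_comm (a : A) (e : C.Env) : iR C.Env C.Env (C.gA a) * iL C.Env C.Env e
      = iL C.Env C.Env e * iR C.Env C.Env (C.gA a) := iR_mul_iL_of_even (C.par_gA a) e

theorem iL_gA_comm (a : A) (e : C.Env) : iR C.Env C.Env e * iL C.Env C.Env (C.gA a)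
      = iL C.Env C.Env (C.gA a) * iR C.Env C.Env e := iR_mul_iL_of_even' (C.par_gA a) e

theorem coA_one : C.coA 1 = 1 := by
  simp [coA, Algebra.TensorProduct.one_def, gA_one]

theorem coA_mul (a b : A) : C.coA (a * b) = C.coA a * C.coA b := by
  simp only [coA, LinearMap.comp_apply, Bialgebra.comul_mul]
  rw [← C.coMul_map₂ C.gA C.gA C.gA C.gA C.gA C.gA (LinearMap.mul ℂ A) (LinearMap.mul ℂ A)
    C.gA_mul C.gA_mul (fun x y => C.iR_gA_comm x _)]
  congr 1
  generalize Coalgebra.comul (R := ℂ) a = s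
  generalize Coalgebra.comul (R := ℂ) b = t
  induction s using TensorProduct.induction_on with
  | zero => simp
  | add s t hs ht => simp only [map_add, LinearMap.add_apply, hs, ht, add_mul]
  | tmul x y =>
    induction t using TensorProduct.induction_on with
    | zero => simp
    | add s t hs ht => simp only [map_add, hs, ht, mul_add]
    | tmul x' y' => simp

theorem coΓ_smul (a : A) (γ : Γ) : C.coΓ (a • γ) = C.coA a * C.coΓ γ := by
  simp only [coA, coΓ, LinearMap.comp_apply, LinearMap.add_apply, lco_smul, rco_smul, lactL, lactR,
    mul_add]
  rw [C.coMul_map₂ C.gA C.gA C.gA C.gΓ C.gA C.gΓ (LinearMap.mul ℂ A) (lact A Γ)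
    C.gA_mul C.gΓ_smul (fun x y => C.iR_gA_comm x _),
    C.coMul_map₂ C.gA C.gA C.gΓ C.gA C.gΓ C.gA (lact A Γ) (LinearMap.mul ℂ A)
    C.gΓ_smul C.gA_mul (fun x y => C.iR_gA_comm x _)]

theorem coΓ_op_smul (a : A) (γ : Γ) : C.coΓ (MulOpposite.op a • γ) = C.coΓ γ * C.coA a := by
  simp only [coA, coΓ, LinearMap.comp_apply, LinearMap.add_apply, lco_op_smul, rco_op_smul, ractL,
    ractR, add_mul]
  rw [C.coMul_map₂_flip C.gA C.gΓ C.gA C.gA C.gA C.gΓ (LinearMap.mul ℂ A).flip (ract A Γ)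
    (fun x y => C.gA_mul y x) C.gΓ_op_smul (fun x y => C.iL_gA_comm y _),
    C.coMul_map₂_flip C.gΓ C.gA C.gA C.gA C.gΓ C.gA (ract A Γ) (LinearMap.mul ℂ A).flip
    C.gΓ_op_smul (fun x y => C.gA_mul y x) (fun x y => C.iR_gA_comm x _)]

theorem coΓ_d (a : A) : C.coΓ (C.d a) = tensorD C.envDiff C.envDiff (C.coA a) := by
  simp only [coA, coΓ, LinearMap.comp_apply, LinearMap.add_apply, lco_d, rco_d]
  generalize Coalgebra.comul (R := ℂ) a = t
  induction t using TensorProduct.induction_on with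
  | zero => simp
  | add s t hs ht => simp only [map_add, ← hs, ← ht]; abel
  | tmul x y =>
    have h := tensorD_mul_iL_iR C.envDiff C.envDiff (C.gA x) (C.gA y)
    rw [envDiff_gA, envDiff_gA, par_gA, add_comm] at h
    exact h.symm

theorem par_coA (a : A) : Super.par (C.coA a) = C.coA a := by
  simp only [coA, LinearMap.comp_apply]
  generalize Coalgebra.comul (R := ℂ) a = t
  induction t using TensorProduct.induction_on with
  | zero => simp
  | add s t hs ht => simp only [map_add, hs, ht]
  | tmul x y => simp [par_iL, par_iR, par_gA]

theorem par_coΓ (γ : Γ) : Super.par (C.coΓ γ) = -C.coΓ γ := by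
  simp only [coΓ, LinearMap.comp_apply, LinearMap.add_apply, map_add, neg_add]
  congr 1
  · generalize C.lco γ = t
    induction t using TensorProduct.induction_on with
    | zero => simp
    | add s t hs ht => simp only [map_add, hs, ht, neg_add]
    | tmul x y => simp [par_iL, par_iR, par_gA, par_gΓ]
  · generalize C.rco γ = t
    induction t using TensorProduct.induction_on with
    | zero => simp
    | add s t hs ht => simp only [map_add, hs, ht, neg_add]
    | tmul x y => simp [par_iL, par_iR, par_gA, par_gΓ]

theorem coΓ_smulD (t : A ⊗[ℂ] A) : C.coΓ (C.smulD t) = mul₂ C.coA (C.coΓ ∘ₗ C.d) t := by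
  induction t using TensorProduct.induction_on with
  | zero => simp
  | add s t hs ht => simp only [map_add, hs, ht]
  | tmul x y => rw [smulD_tmul, coΓ_smul]; rfl

/-- The coproduct of a d(b) is Δ(a) dΔ(b), whose differential is dΔ(a) dΔ(b). Therefore a relation ∑
a_k d(b_k) = 0 forces the corresponding quadratic relation between coproducts, which is what makes Δ
well defined on Γ^∧. -/
theorem tensorD_coΓ (t : A ⊗[ℂ] A) : tensorD C.envDiff C.envDiff (C.coΓ (C.smulD t))
    = mul₂ (C.coΓ ∘ₗ C.d) (C.coΓ ∘ₗ C.d) t := by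
  let D := tensorDiff C.envDiff C.envDiff
  rw [coΓ_smulD]
  induction t using TensorProduct.induction_on with
  | zero => simp
  | add s t hs ht => simp only [map_add, hs, ht]
  | tmul x y =>
    simp only [TensorProduct.lift.tmul, LinearMap.compl₁₂_apply, LinearMap.mul_apply',
      LinearMap.comp_apply]
    have h := D.d_mul (C.coA x) (C.coΓ (C.d y))
    have h2 : D.d (C.coΓ (C.d y)) = 0 := by rw [coΓ_d]; exact D.d_d _
    rw [h2, mul_zero, add_zero] at h
    rw [C.coΓ_d x]
    exact h

set_option maxHeartbeats 1000000 in
/-- The coproduct `Γ^∧ → Γ^∧ ⊗̂ Γ^∧`. -/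
def envCo : C.Env →ₐ[ℂ] STensor C.Env C.Env :=
  C.envLift C.coA C.coΓ C.coA_one C.coA_mul C.coΓ_smul C.coΓ_op_smul (fun t ht => by
    have h := C.tensorD_coΓ t
    rw [ht, map_zero, map_zero] at h
    exact h.symm)

theorem envCo_gA (a : A) : C.envCo (C.gA a) = C.coA a := C.envLift_gA _ _ _ _ _ _ _ a
theorem envCo_gΓ (γ : Γ) : C.envCo (C.gΓ γ) = C.coΓ γ := C.envLift_gΓ _ _ _ _ _ _ _ γ

theorem envCo_par_d (e : C.Env) : C.envCo (Super.par e) = Super.par (C.envCo e) ∧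
    C.envCo (C.envDiff.d e) = tensorD C.envDiff C.envDiff (C.envCo e) := by
  refine map_d_of_adjoin C.envDiff (tensorDiff C.envDiff C.envDiff) C.envCo C.adjoin_envGen ?_ ?_ e
  · rintro _ (⟨a, rfl⟩ | ⟨γ, rfl⟩)
    · rw [par_gA, envCo_gA, par_coA]
    · rw [par_gΓ, map_neg, envCo_gΓ, par_coΓ]
  · rintro _ (⟨a, rfl⟩ | ⟨γ, rfl⟩)
    · rw [envDiff_gA, envCo_gA, envCo_gΓ, coΓ_d]; rfl
    · obtain ⟨t, rfl⟩ := C.smulD_surjective γ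
      rw [envDiff_gΓ, d1_smulD, dd, map_mul₂, envCo_gΓ]
      have h : C.envCo.toLinearMap ∘ₗ C.gΓ ∘ₗ C.d = C.coΓ ∘ₗ C.d :=
        LinearMap.ext fun a => C.envCo_gΓ _
      rw [h]
      exact (C.tensorD_coΓ t).symm

end BicovariantStarCalculus
end
end QPB

/-! ### Generalized inverses, and gradings given by a scaling operator. -/

open scoped TensorProduct

namespace QPB

noncomputable section

section LinearAlgebra
variable {M N X E : Type*} [AddCommGroup M] [Module ℂ M] [AddCommGroup N] [Module ℂ N]
  [AddCommGroup X] [Module ℂ X] [AddCommGroup E] [Module ℂ E]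

theorem rTensor_lTensor (f : M →ₗ[ℂ] N) (g : E →ₗ[ℂ] X) (t : M ⊗[ℂ] E) :
    f.rTensor X (g.lTensor M t) = TensorProduct.map f g t :=
  LinearMap.congr_fun (LinearMap.rTensor_comp_lTensor (f := f) (g := g)) t

theorem lTensor_rTensor (f : M →ₗ[ℂ] N) (g : E →ₗ[ℂ] X) (t : M ⊗[ℂ] E) :
    g.lTensor N (f.rTensor E t) = TensorProduct.map f g t :=
  LinearMap.congr_fun (LinearMap.lTensor_comp_rTensor (f := f) (g := g)) t

/-- Every linear map of vector spaces has a generalized inverse. -/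
theorem exists_pseudoinverse (f : M →ₗ[ℂ] N) : ∃ g : N →ₗ[ℂ] M, ∀ m, f (g (f m)) = f m := by
  obtain ⟨g₀, hg₀⟩ := f.rangeRestrict.exists_rightInverse_of_surjective f.range_rangeRestrict
  obtain ⟨g, hg⟩ := LinearMap.exists_extend g₀
  refine ⟨g, fun m => ?_⟩
  have h1 : g (f m) = g₀ (f.rangeRestrict m) := by rw [← hg]; rfl
  rw [h1]
  exact congrArg Subtype.val (LinearMap.congr_fun hg₀ (f.rangeRestrict m))

theorem exists_linear_lift (f : M →ₗ[ℂ] N) (g : X →ₗ[ℂ] N) (h : ∀ x, ∃ m, f m = g x) :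
    ∃ u : X →ₗ[ℂ] M, ∀ x, f (u x) = g x := by
  obtain ⟨k, hk⟩ := exists_pseudoinverse f
  refine ⟨k ∘ₗ g, fun x => ?_⟩
  obtain ⟨m, hm⟩ := h x
  rw [LinearMap.comp_apply, ← hm, hk]

/-- If `(L ⊗ id) t = 0`, then `t` is fixed by a projection to the kernel of `L`, inside a given
range. -/
theorem exists_proj (q : M →ₗ[ℂ] N) (t : M ⊗[ℂ] E) (L : N →ₗ[ℂ] X)
    (hL : L.rTensor E (q.rTensor E t) = 0) :
    ∃ q' : M →ₗ[ℂ] M, q'.rTensor E t = t ∧ ∀ m, L (q (q' m)) = 0 := by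
  obtain ⟨k, hk⟩ := exists_pseudoinverse (L ∘ₗ q)
  refine ⟨LinearMap.id - k ∘ₗ L ∘ₗ q, ?_, fun m => ?_⟩
  · rw [LinearMap.rTensor_sub, LinearMap.sub_apply, LinearMap.rTensor_id, LinearMap.id_apply,
      LinearMap.rTensor_comp, LinearMap.rTensor_comp, LinearMap.comp_apply, LinearMap.comp_apply,
      hL, map_zero, sub_zero]
  · have := hk m
    simp only [LinearMap.comp_apply] at this
    simp only [LinearMap.sub_apply, LinearMap.id_apply, LinearMap.comp_apply, map_sub, this,
      sub_self]

/-- A grading by natural numbers: the components of degree `k` are eigenvectors of `s` with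
eigenvalue `2 ^ k`, and `pr k` is the projection to them. -/
structure IsGrading (s : M →ₗ[ℂ] M) (pr : ℕ → M →ₗ[ℂ] M) : Prop where
  s_pr : ∀ k m, s (pr k m) = (2 : ℂ) ^ k • pr k m
  pr_eq : ∀ k m, s m = (2 : ℂ) ^ k • m → pr k m = m
  sum : ∀ m, ∃ n, (∀ k, n ≤ k → pr k m = 0) ∧ ∑ k ∈ Finset.range n, pr k m = m

/-- The factor 2 matters only through the distinctness of its powers: an eigenvalue of the scaling
operator determines a degree, so homogeneity becomes a linear equation that passes to subspaces,
tensor products and equivariant maps. -/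
theorem two_pow_sub_ne {i j : ℕ} (h : i ≠ j) : (2 : ℂ) ^ i - 2 ^ j ≠ 0 := by
  rw [sub_ne_zero]
  intro h'
  have h2 : (2 : ℕ) ^ i = 2 ^ j := by exact_mod_cast h'
  exact h (Nat.pow_right_injective le_rfl h2)

/-- A stable subspace contains the homogeneous components of its elements. -/
theorem mem_of_sum_mem (s : M →ₗ[ℂ] M) (K : Submodule ℂ M) (hK : ∀ x ∈ K, s x ∈ K) (x : ℕ → M)
    (hx : ∀ k, s (x k) = (2 : ℂ) ^ k • x k) (n : ℕ) :
    ∑ k ∈ Finset.range n, x k ∈ K → ∀ k < n, x k ∈ K := by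
  induction n generalizing x with
  | zero => intro _ k hk; omega
  | succ n ih =>
    intro hs
    have h1 : ∑ k ∈ Finset.range n, ((2 : ℂ) ^ k - 2 ^ n) • x k ∈ K := by
      have h2 := K.sub_mem (hK _ hs) (K.smul_mem ((2 : ℂ) ^ n) hs)
      rw [map_sum, Finset.smul_sum, ← Finset.sum_sub_distrib, Finset.sum_range_succ] at h2
      simp only [hx, ← sub_smul, sub_self, add_zero] at h2
      exact h2
    have h3 := ih (fun k => ((2 : ℂ) ^ k - 2 ^ n) • x k)
      (fun k => by rw [map_smul, hx, smul_comm]) h1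
    have h4 : ∀ k < n, x k ∈ K := fun k hk => by
      have := h3 k hk
      rwa [Submodule.smul_mem_iff _ (two_pow_sub_ne hk.ne)] at this
    intro k hk
    rcases Nat.lt_succ_iff_lt_or_eq.1 hk with hk | rfl
    · exact h4 k hk
    · rw [Finset.sum_range_succ] at hs
      exact (K.add_mem_iff_right (K.sum_mem fun i hi => h4 i (Finset.mem_range.1 hi))).1 hs

theorem exists_grading (s : M →ₗ[ℂ] M)
    (hs : ∀ m, m ∈ ⨆ k : ℕ, Module.End.eigenspace s ((2 : ℂ) ^ k)) :
    ∃ pr : ℕ → M →ₗ[ℂ] M, IsGrading s pr := by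
  have hinj : Function.Injective (fun k : ℕ => (2 : ℂ) ^ k) := fun i j h => by
    by_contra hne
    exact two_pow_sub_ne hne (sub_eq_zero.2 h)
  have hind : iSupIndep (fun k : ℕ => Module.End.eigenspace s ((2 : ℂ) ^ k)) :=
    (Module.End.eigenspaces_iSupIndep s).comp hinj
  have hI := DirectSum.isInternal_submodule_of_iSupIndep_of_iSup_eq_top hind
    (eq_top_iff.2 fun m _ => hs m)
  let e := LinearEquiv.ofBijective (DirectSum.coeLinearMap _) hI
  let pr : ℕ → M →ₗ[ℂ] M := fun k => (Module.End.eigenspace s ((2 : ℂ) ^ k)).subtype ∘ₗ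
    DirectSum.component ℂ ℕ _ k ∘ₗ e.symm.toLinearMap
  have hpr : ∀ k m, s (pr k m) = (2 : ℂ) ^ k • pr k m := fun k m =>
    Module.End.mem_eigenspace_iff.1 (Subtype.prop _)
  refine ⟨pr, ⟨hpr, fun k m hm => ?_, fun m => ?_⟩⟩
  · have h : e (DirectSum.lof ℂ ℕ (fun k : ℕ => Module.End.eigenspace s ((2 : ℂ) ^ k)) k
        ⟨m, Module.End.mem_eigenspace_iff.2 hm⟩) = m := DirectSum.coeLinearMap_lof _ _ _
    change ((DirectSum.component ℂ ℕ _ k (e.symm m) : _) : M) = m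
    conv_lhs => rw [← h]
    rw [LinearEquiv.symm_apply_apply, DirectSum.component.lof_self]
  · classical
    have hsum : ∑ k ∈ DFinsupp.support (e.symm m), pr k m = m := by
      have h := e.apply_symm_apply m
      conv_rhs => rw [← h]
      exact (DirectSum.coeLinearMap_eq_dfinsuppSum _ _).symm
    refine ⟨(DFinsupp.support (e.symm m)).sup id + 1, fun k hk => ?_, ?_⟩
    · have : k ∉ DFinsupp.support (e.symm m) := fun h => by
        have := Finset.le_sup (f := id) h
        simp only [id] at this
        omega
      have h0 : (e.symm m) k = 0 := DFinsupp.notMem_support_iff.1 this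
      change (((e.symm m) k : _) : M) = 0
      rw [h0]; rfl
    · refine (Finset.sum_subset (fun k hk => ?_) (fun k _ hk => ?_)).symm.trans hsum
      · have := Finset.le_sup (f := id) hk
        simp only [id] at this
        exact Finset.mem_range.2 (by omega)
      · have h0 : (e.symm m) k = 0 := DFinsupp.notMem_support_iff.1 hk
        change (((e.symm m) k : _) : M) = 0
        rw [h0]; rfl

namespace IsGrading
variable {s : M →ₗ[ℂ] M} {pr : ℕ → M →ₗ[ℂ] M}

/-- For an eigenvector m with eigenvalue 2^k, comparing components of s(m) gives (2^i - 2^k) pr_i(m)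
= 0. So only the k-th component remains, and it is m. -/
theorem of_pr_pr (s_pr : ∀ k m, s (pr k m) = (2 : ℂ) ^ k • pr k m)
    (pr_pr : ∀ k m, pr k (pr k m) = pr k m) (pr_ne : ∀ j k m, j ≠ k → pr j (pr k m) = 0)
    (sum : ∀ m, ∃ n, (∀ k, n ≤ k → pr k m = 0) ∧ ∑ k ∈ Finset.range n, pr k m = m) :
    IsGrading s pr where
  s_pr := s_pr
  pr_eq k m hm := by
    obtain ⟨n, hn, hs⟩ := sum m
    have h1 : ∀ i, pr i (s m) = (2 : ℂ) ^ i • pr i m := fun i => by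
      conv_lhs => rw [← hs]
      simp only [map_sum, s_pr, map_smul]
      by_cases hi : i < n
      · rw [Finset.sum_eq_single i (fun j _ hj => by rw [pr_ne i j m hj.symm, smul_zero])
          (fun h => absurd (Finset.mem_range.2 hi) h), pr_pr]
      · rw [hn i (not_lt.1 hi), smul_zero]
        exact Finset.sum_eq_zero fun j hj => by
          rw [pr_ne i j m (fun h => hi (h ▸ Finset.mem_range.1 hj)), smul_zero]
    have h2 : ∀ i, i ≠ k → pr i m = 0 := fun i hi => by
      have h3 := h1 i
      rw [hm, map_smul] at h3
      have h4 : ((2 : ℂ) ^ i - 2 ^ k) • pr i m = 0 := by rw [sub_smul, h3, sub_self]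
      exact (smul_eq_zero.1 h4).resolve_left (two_pow_sub_ne hi)
    by_cases hk : k < n
    · rwa [Finset.sum_eq_single k (fun j _ hj => h2 j hj)
        (fun h => absurd (Finset.mem_range.2 hk) h)] at hs
    · rw [hn k (not_lt.1 hk), ← hs]
      exact (Finset.sum_eq_zero fun j hj => h2 j
        (fun h => hk (h ▸ Finset.mem_range.1 hj))).symm
  sum := sum

theorem pr_ne (h : IsGrading s pr) {j k : ℕ} {m : M} (hm : s m = (2 : ℂ) ^ k • m) (hjk : j ≠ k) :
    pr j m = 0 := by
  obtain ⟨n, hn, hs⟩ := h.sum m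
  by_cases hj : n ≤ j
  · exact hn j hj
  -- Subtracting m from the component of degree k of m gives homogeneous elements with sum zero.
  -- Each of them vanishes by `mem_of_sum_mem` for the zero subspace.
  let x : ℕ → M := fun i => if i = k then pr k m - m else pr i m
  have hx : ∀ i, s (x i) = (2 : ℂ) ^ i • x i := fun i => by
    by_cases hi : i = k
    · subst hi; simp [x, h.pr_eq i m hm]
    · simp [x, hi, h.s_pr]
  have hsum : ∑ i ∈ Finset.range (max n (k + 1)), x i ∈ (⊥ : Submodule ℂ M) := by
    have e : ∀ i, x i = pr i m - if i = k then m else 0 := fun i => by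
      by_cases hi : i = k
      · subst hi; simp [x]
      · simp [x, hi]
    simp only [e, Finset.sum_sub_distrib]
    rw [Finset.sum_ite_eq', if_pos (Finset.mem_range.2 (by omega)),
      ← Finset.sum_subset (Finset.range_subset_range.2 (le_max_left n (k + 1))), hs, sub_self]
    · exact zero_mem _
    · intro i _ hi
      exact hn i (by simpa using hi)
  have := mem_of_sum_mem s ⊥ (fun y hy => by
    rw [Submodule.mem_bot] at hy ⊢; rw [hy, map_zero]) x hx _ hsum j (by omega)
  simpa [x, hjk] using this

theorem pr_pr (h : IsGrading s pr) (k : ℕ) (m : M) : pr k (pr k m) = pr k m :=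
  h.pr_eq k _ (h.s_pr k m)

theorem pr_pr_ne (h : IsGrading s pr) {j k : ℕ} (hjk : j ≠ k) (m : M) : pr j (pr k m) = 0 :=
  h.pr_ne (h.s_pr k m) hjk

theorem induction (h : IsGrading s pr) {P : M → Prop} (h0 : P 0)
    (hadd : ∀ x y, P x → P y → P (x + y)) (hom : ∀ k x, s x = (2 : ℂ) ^ k • x → P x) (x : M) :
    P x := by
  obtain ⟨n, -, hs⟩ := h.sum x
  rw [← hs]
  exact Finset.sum_induction _ P hadd h0 (fun k _ => hom k _ (h.s_pr k x))

theorem ext_pr (h : IsGrading s pr) {x y : M} (hxy : ∀ k, pr k x = pr k y) : x = y := by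
  obtain ⟨n, -, hs⟩ := h.sum (x - y)
  rw [← sub_eq_zero, ← hs]
  exact Finset.sum_eq_zero fun k _ => by rw [map_sub, hxy, sub_self]

/-- A map that raises the degree by `j`. -/
theorem map_pr (h : IsGrading s pr) {s' : N →ₗ[ℂ] N} {pr' : ℕ → N →ₗ[ℂ] N}
    (h' : IsGrading s' pr') (T : M →ₗ[ℂ] N) (j : ℕ) (hT : ∀ x, s' (T x) = (2 : ℂ) ^ j • T (s x))
    (k : ℕ) (x : M) : pr' (k + j) (T x) = T (pr k x) := by
  induction x using h.induction with
  | h0 => simp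
  | hadd x y hx hy => simp only [map_add, hx, hy]
  | hom i x hx =>
    have h1 : s' (T x) = (2 : ℂ) ^ (i + j) • T x := by
      rw [hT, hx, map_smul, smul_smul, ← pow_add, add_comm]
    by_cases hk : k = i
    · subst hk; rw [h.pr_eq k x hx, h'.pr_eq _ _ h1]
    · rw [h.pr_ne hx hk, h'.pr_ne h1 (by omega), map_zero]

theorem map_pr_lt (h : IsGrading s pr) {s' : N →ₗ[ℂ] N} {pr' : ℕ → N →ₗ[ℂ] N}
    (h' : IsGrading s' pr') (T : M →ₗ[ℂ] N) (j : ℕ) (hT : ∀ x, s' (T x) = (2 : ℂ) ^ j • T (s x))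
    {k : ℕ} (hk : k < j) (x : M) : pr' k (T x) = 0 := by
  induction x using h.induction with
  | h0 => simp
  | hadd x y hx hy => simp only [map_add, hx, hy, add_zero]
  | hom i x hx =>
    have h1 : s' (T x) = (2 : ℂ) ^ (i + j) • T x := by
      rw [hT, hx, map_smul, smul_smul, ← pow_add, add_comm]
    exact h'.pr_ne h1 (by omega)

theorem map_pr₀ (h : IsGrading s pr) {s' : N →ₗ[ℂ] N} {pr' : ℕ → N →ₗ[ℂ] N}
    (h' : IsGrading s' pr') (T : M →ₗ[ℂ] N) (hT : ∀ x, s' (T x) = T (s x))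
    (k : ℕ) (x : M) : pr' k (T x) = T (pr k x) :=
  h.map_pr h' T 0 (fun x => by rw [hT, pow_zero, one_smul]) k x

theorem pr_mem (h : IsGrading s pr) (K : Submodule ℂ M) (hK : ∀ x ∈ K, s x ∈ K) {x : M}
    (hx : x ∈ K) (k : ℕ) : pr k x ∈ K := by
  obtain ⟨n, hn, hs⟩ := h.sum x
  by_cases hk : n ≤ k
  · rw [hn k hk]; exact zero_mem _
  · exact mem_of_sum_mem s K hK (fun k => pr k x) (fun k => h.s_pr k x) n (hs.symm ▸ hx) k
      (not_le.1 hk)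

theorem restrict (h : IsGrading s pr) (K : Submodule ℂ M) (hK : ∀ x ∈ K, s x ∈ K) :
    IsGrading (s.restrict hK) (fun k => (pr k).restrict (fun _ hx => h.pr_mem K hK hx k)) where
  s_pr k m := Subtype.ext (h.s_pr k m)
  pr_eq k m hm := Subtype.ext (h.pr_eq k m (congrArg Subtype.val hm))
  sum m := by
    obtain ⟨n, hn, hs⟩ := h.sum m.1
    refine ⟨n, fun k hk => Subtype.ext (hn k hk), Subtype.ext ?_⟩
    rw [← hs, AddSubmonoidClass.coe_finsetSum]
    rfl

/-- Homogeneity by negative or positive shifts. -/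
theorem pr_of_smul (h : IsGrading s pr) {k n : ℕ} {y : M}
    (hy : (2 : ℂ) ^ k • s y = (2 : ℂ) ^ n • y) {j : ℕ} (hj : j + k ≠ n) : pr j y = 0 := by
  have h1 : (2 : ℂ) ^ (j + k) • pr j y = (2 : ℂ) ^ n • pr j y := by
    have h2 := congrArg (pr j) hy
    rw [map_smul, map_smul, h.map_pr₀ h s (fun _ => rfl), h.s_pr, smul_smul, ← pow_add,
      add_comm] at h2
    exact h2
  have h3 : ((2 : ℂ) ^ (j + k) - 2 ^ n) • pr j y = 0 := by rw [sub_smul, h1, sub_self]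
  exact (smul_eq_zero.1 h3).resolve_left (two_pow_sub_ne hj)

/-- A map that lowers the degree by `k`. -/
theorem map_pr_down (h : IsGrading s pr) {s' : N →ₗ[ℂ] N} {pr' : ℕ → N →ₗ[ℂ] N}
    (h' : IsGrading s' pr') (T : M →ₗ[ℂ] N) (k : ℕ) (hT : ∀ x, (2 : ℂ) ^ k • s' (T x) = T (s x))
    (j : ℕ) (x : M) : pr' j (T x) = T (pr (j + k) x) := by
  induction x using h.induction with
  | h0 => simp
  | hadd x y hx hy => simp only [map_add, hx, hy]
  | hom i x hx =>
    have h1 : (2 : ℂ) ^ k • s' (T x) = (2 : ℂ) ^ i • T x := by rw [hT, hx, map_smul]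
    by_cases hi : j + k = i
    · rw [h.pr_eq _ x (hi.symm ▸ hx)]
      refine h'.ext_pr fun j' => ?_
      by_cases hj : j' = j
      · subst hj; exact h'.pr_pr _ _
      · rw [h'.pr_pr_ne hj, h'.pr_of_smul h1 (by omega)]
    · rw [h.pr_ne hx hi, map_zero, h'.pr_of_smul h1 hi]

theorem map_pr_down_lt (h : IsGrading s pr) {s' : N →ₗ[ℂ] N} {pr' : ℕ → N →ₗ[ℂ] N}
    (h' : IsGrading s' pr') (T : M →ₗ[ℂ] N) (k : ℕ) (hT : ∀ x, (2 : ℂ) ^ k • s' (T x) = T (s x))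
    {n : ℕ} (hn : n < k) (x : M) : T (pr n x) = 0 := by
  refine h'.ext_pr fun j => ?_
  rw [h.map_pr_down h' T k hT, h.pr_pr_ne (by omega), map_zero, map_zero]

theorem map_pr_pr (h : IsGrading s pr) {s' : N →ₗ[ℂ] N} {pr' : ℕ → N →ₗ[ℂ] N}
    (h' : IsGrading s' pr') {n : ℕ} {y : M ⊗[ℂ] N}
    (hy : TensorProduct.map s s' y = (2 : ℂ) ^ n • y) {j k : ℕ} (hjk : j + k ≠ n) :
    TensorProduct.map (pr j) (pr' k) y = 0 := by
  have h1 : (2 : ℂ) ^ (j + k) • TensorProduct.map (pr j) (pr' k) y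
      = (2 : ℂ) ^ n • TensorProduct.map (pr j) (pr' k) y := by
    rw [← (TensorProduct.map (pr j) (pr' k)).map_smul ((2 : ℂ) ^ n), ← hy]
    clear hy
    induction y using TensorProduct.induction_on with
    | zero => simp
    | add x y hx hy => simp only [map_add, smul_add, hx, hy]
    | tmul x y =>
      simp only [TensorProduct.map_tmul]
      rw [h.map_pr₀ h s (fun _ => rfl), h'.map_pr₀ h' s' (fun _ => rfl), h.s_pr, h'.s_pr,
        TensorProduct.smul_tmul_smul, pow_add]
  have h3 : ((2 : ℂ) ^ (j + k) - 2 ^ n) • TensorProduct.map (pr j) (pr' k) y = 0 := by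
    rw [sub_smul, h1, sub_self]
  exact (smul_eq_zero.1 h3).resolve_left (two_pow_sub_ne hjk)

theorem lTensor (h : IsGrading s pr) :
    IsGrading (s.lTensor N) (fun k => (pr k).lTensor N) := by
  refine of_pr_pr (fun k t => ?_) (fun k t => ?_) (fun j k t hjk => ?_) (fun t => ?_)
  · rw [← LinearMap.lTensor_comp_apply, ← LinearMap.smul_apply, ← LinearMap.lTensor_smul]
    congr 2
    ext m; exact h.s_pr k m
  · rw [← LinearMap.lTensor_comp_apply]
    congr 2
    ext m; exact h.pr_pr k m
  · rw [← LinearMap.lTensor_comp_apply,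
      show pr j ∘ₗ pr k = 0 from LinearMap.ext fun m => h.pr_pr_ne hjk m, LinearMap.lTensor_zero,
      LinearMap.zero_apply]
  · induction t using TensorProduct.induction_on with
    | zero => exact ⟨0, by simp, by simp⟩
    | tmul x y =>
      obtain ⟨n, hn, hs⟩ := h.sum y
      refine ⟨n, fun k hk => by simp [hn k hk], ?_⟩
      simp only [LinearMap.lTensor_tmul]
      rw [← TensorProduct.tmul_sum, hs]
    | add x y hx hy =>
      obtain ⟨n, hn, hs⟩ := hx
      obtain ⟨n', hn', hs'⟩ := hy
      refine ⟨max n n', fun k hk => by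
        rw [map_add, hn k (le_of_max_le_left hk), hn' k (le_of_max_le_right hk), add_zero], ?_⟩
      simp only [map_add, Finset.sum_add_distrib]
      rw [← Finset.sum_subset (Finset.range_subset_range.2 (le_max_left n n')), hs,
        ← Finset.sum_subset (Finset.range_subset_range.2 (le_max_right n n')), hs']
      · intro i _ hi; exact hn' i (by simpa using hi)
      · intro i _ hi; exact hn i (by simpa using hi)

theorem rTensor (h : IsGrading s pr) :
    IsGrading (s.rTensor N) (fun k => (pr k).rTensor N) := by
  refine of_pr_pr (fun k t => ?_) (fun k t => ?_) (fun j k t hjk => ?_) (fun t => ?_)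
  · rw [← LinearMap.rTensor_comp_apply, ← LinearMap.smul_apply, ← LinearMap.rTensor_smul]
    congr 2
    ext m; exact h.s_pr k m
  · rw [← LinearMap.rTensor_comp_apply]
    congr 2
    ext m; exact h.pr_pr k m
  · rw [← LinearMap.rTensor_comp_apply,
      show pr j ∘ₗ pr k = 0 from LinearMap.ext fun m => h.pr_pr_ne hjk m, LinearMap.rTensor_zero,
      LinearMap.zero_apply]
  · induction t using TensorProduct.induction_on with
    | zero => exact ⟨0, by simp, by simp⟩
    | tmul x y =>
      obtain ⟨n, hn, hs⟩ := h.sum x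
      refine ⟨n, fun k hk => by simp [hn k hk], ?_⟩
      simp only [LinearMap.rTensor_tmul]
      rw [← TensorProduct.sum_tmul, hs]
    | add x y hx hy =>
      obtain ⟨n, hn, hs⟩ := hx
      obtain ⟨n', hn', hs'⟩ := hy
      refine ⟨max n n', fun k hk => by
        rw [map_add, hn k (le_of_max_le_left hk), hn' k (le_of_max_le_right hk), add_zero], ?_⟩
      simp only [map_add, Finset.sum_add_distrib]
      rw [← Finset.sum_subset (Finset.range_subset_range.2 (le_max_left n n')), hs,
        ← Finset.sum_subset (Finset.range_subset_range.2 (le_max_right n n')), hs']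
      · intro i _ hi; exact hn' i (by simpa using hi)
      · intro i _ hi; exact hn i (by simpa using hi)

theorem lTensor_eq (h : IsGrading s pr) (f g : M →ₗ[ℂ] X) (y : N ⊗[ℂ] M)
    (hfg : ∀ i, f ∘ₗ pr i = g ∘ₗ pr i ∨ (pr i).lTensor N y = 0) : f.lTensor N y = g.lTensor N y := by
  obtain ⟨n, -, hs⟩ := (h.lTensor (N := N)).sum y
  rw [← hs, map_sum, map_sum]
  refine Finset.sum_congr rfl fun i _ => ?_
  rcases hfg i with hi | hi
  · rw [← LinearMap.lTensor_comp_apply, ← LinearMap.lTensor_comp_apply, hi]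
  · rw [hi, map_zero, map_zero]

theorem mem_iSup_of_adjoin {B : Type*} [Ring B] [Algebra ℂ B] (s : B →ₐ[ℂ] B) {S : Set B}
    (hS : Algebra.adjoin ℂ S = ⊤) (h : ∀ x ∈ S, ∃ k : ℕ, s x = (2 : ℂ) ^ k • x) (x : B) :
    x ∈ ⨆ k : ℕ, Module.End.eigenspace s.toLinearMap ((2 : ℂ) ^ k) := by
  have hmem : ∀ (k : ℕ) (y : B), s y = (2 : ℂ) ^ k • y →
      y ∈ ⨆ k : ℕ, Module.End.eigenspace s.toLinearMap ((2 : ℂ) ^ k) := fun k y hy =>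
    Submodule.mem_iSup_of_mem k (Module.End.mem_eigenspace_iff.2 hy)
  have hx : x ∈ Algebra.adjoin ℂ S := hS ▸ Algebra.mem_top
  induction hx using Algebra.adjoin_induction with
  | mem x hx => obtain ⟨k, hk⟩ := h x hx; exact hmem k x hk
  | algebraMap r =>
    exact hmem 0 _ (by rw [AlgHom.commutes, pow_zero, one_smul])
  | add x y _ _ hx hy => exact add_mem hx hy
  | mul x y hx' hy' hx hy =>
    clear hx' hy'
    induction hx using Submodule.iSup_induction' with
    | zero => rw [zero_mul]; exact zero_mem _
    | add a b _ _ ha hb => rw [add_mul]; exact add_mem ha hb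
    | mem i a ha =>
      induction hy using Submodule.iSup_induction' with
      | zero => rw [mul_zero]; exact zero_mem _
      | add a b _ _ ha hb => rw [mul_add]; exact add_mem ha hb
      | mem j b hb =>
        have ha' := Module.End.mem_eigenspace_iff.1 ha
        have hb' := Module.End.mem_eigenspace_iff.1 hb
        simp only [AlgHom.toLinearMap_apply] at ha' hb'
        exact hmem (i + j) _ (by rw [map_mul, ha', hb', smul_mul_smul_comm, pow_add])

end IsGrading

end LinearAlgebra
end
end QPB

/-! ### The envelope as a graded comodule: words, degrees, and the left coaction of A. -/

open scoped TensorProduct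

namespace QPB

noncomputable section

namespace BicovariantStarCalculus
variable {A Γ : Type*} [Ring A] [HopfAlgebra ℂ A] [StarRing A]
    [AddCommGroup Γ] [Module ℂ Γ] [Module A Γ] [Module Aᵐᵒᵖ Γ] [SMulCommClass A Aᵐᵒᵖ Γ]
    [IsScalarTower ℂ A Γ] [IsScalarTower ℂ Aᵐᵒᵖ Γ] (C : BicovariantStarCalculus A Γ)

/-! ### Words -/

/-- The product of left-invariant forms. -/
def word (l : List C.inv) : C.Env := (l.map C.invEnv).prod

theorem word_nil : C.word [] = 1 := rfl
theorem word_cons (v : C.inv) (l : List C.inv) : C.word (v :: l) = C.invEnv v * C.word l := by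
  simp [word]

theorem word_append (l l' : List C.inv) : C.word (l ++ l') = C.word l * C.word l' := by
  simp [word]

theorem gΓ_smul_inv (a : A) (v : C.inv) : C.gΓ (a • (v : Γ)) = C.gA a * C.invEnv v := C.gΓ_smul a v

theorem invEnv_mul_gA (v : C.inv) (b : A) :
    C.invEnv v * C.gA b = mul₂ C.gA (C.invEnv ∘ₗ C.circ₂ v) (Coalgebra.comul (R := ℂ) b) := by
  have h := C.gΓ_sweedler (C.inv.subtype ∘ₗ C.circ₂ v) b
  rw [sweedler_circ, gΓ_op_smul] at h
  exact h

/-- The products `a ϑ₁ ⋯ ϑₙ` span `Γ^∧`. -/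
theorem env_induction {P : C.Env → Prop} (h0 : P 0) (hadd : ∀ x y, P x → P y → P (x + y))
    (hw : ∀ a l, P (C.gA a * C.word l)) (e : C.Env) : P e := by
  -- The span contains 1 and is stable under left multiplication by A and by Γ_inv, since ϑb = ∑
  -- b⁽¹⁾(ϑ ∘ b⁽²⁾). As Γ = A Γ_inv, it is a left ideal, hence everything.
  let S : Submodule ℂ C.Env := Submodule.span ℂ {x | ∃ a l, x = C.gA a * C.word l}
  have hS : ∀ a l, C.gA a * C.word l ∈ S := fun a l => Submodule.subset_span ⟨a, l, rfl⟩
  have hA : ∀ a, ∀ x ∈ S, C.gA a * x ∈ S := fun a x hx => by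
    induction hx using Submodule.span_induction with
    | zero => rw [mul_zero]; exact zero_mem _
    | add x y _ _ hx hy => rw [mul_add]; exact add_mem hx hy
    | smul c x _ hx => rw [mul_smul_comm]; exact S.smul_mem _ hx
    | mem x hx =>
      obtain ⟨b, l, rfl⟩ := hx
      rw [← mul_assoc, ← gA_mul]; exact hS _ _
  have hV : ∀ v, ∀ x ∈ S, C.invEnv v * x ∈ S := fun v x hx => by
    induction hx using Submodule.span_induction with
    | zero => rw [mul_zero]; exact zero_mem _
    | add x y _ _ hx hy => rw [mul_add]; exact add_mem hx hy
    | smul c x _ hx => rw [mul_smul_comm]; exact S.smul_mem _ hx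
    | mem x hx =>
      obtain ⟨b, l, rfl⟩ := hx
      rw [← mul_assoc, invEnv_mul_gA]
      generalize Coalgebra.comul (R := ℂ) b = t
      induction t using TensorProduct.induction_on with
      | zero => rw [map_zero, zero_mul]; exact zero_mem _
      | add s t hs ht => rw [map_add, add_mul]; exact add_mem hs ht
      | tmul a b =>
        change C.gA a * C.invEnv (C.circ₂ v b) * C.word l ∈ S
        rw [mul_assoc, ← word_cons]; exact hS _ _
  have hG : ∀ γ, ∀ x ∈ S, C.gΓ γ * x ∈ S := fun γ x hx => by
    obtain ⟨t, rfl⟩ := C.mulInv_surjective γ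
    induction t using TensorProduct.induction_on with
    | zero => rw [map_zero, map_zero, zero_mul]; exact zero_mem _
    | add s t hs ht => rw [map_add, map_add, add_mul]; exact add_mem hs ht
    | tmul a v => rw [mulInv_tmul, gΓ_smul_inv, mul_assoc]; exact hA _ _ (hV _ _ hx)
  have h1 : ∀ y, ∀ x ∈ S, y * x ∈ S := fun y => by
    have hy : y ∈ Algebra.adjoin ℂ C.envGen := C.adjoin_envGen ▸ Algebra.mem_top
    induction hy using Algebra.adjoin_induction with
    | mem y hy =>
      rcases hy with ⟨a, rfl⟩ | ⟨γ, rfl⟩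
      · exact hA a
      · exact hG γ
    | algebraMap r => intro x hx; rw [← Algebra.smul_def]; exact S.smul_mem _ hx
    | add y z _ _ hy hz => intro x hx; rw [add_mul]; exact add_mem (hy x hx) (hz x hx)
    | mul y z _ _ hy hz => intro x hx; rw [mul_assoc]; exact hy _ (hz x hx)
  have he : e ∈ S := by
    have h := h1 e 1 (by have := hS 1 []; rwa [gA_one, word_nil, mul_one] at this)
    rwa [mul_one] at h
  -- The property is not assumed to be stable under scalars; a scalar in front of a word is absorbed
  -- into its coefficient in A.
  have key : ∀ c : ℂ, P (c • e) := by
    induction he using Submodule.span_induction with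
    | zero => intro c; rw [smul_zero]; exact h0
    | add x y _ _ hx hy => intro c; rw [smul_add]; exact hadd _ _ (hx c) (hy c)
    | smul c x _ hx => intro c'; rw [smul_smul]; exact hx _
    | mem x hx =>
      obtain ⟨b, l, rfl⟩ := hx
      intro c
      rw [← smul_mul_assoc, ← map_smul]; exact hw _ _
  have h := key 1
  rwa [one_smul] at h

theorem env_linearMap_ext {P : Type*} [AddCommGroup P] [Module ℂ P] {f g : C.Env →ₗ[ℂ] P}
    (h : ∀ a l, f (C.gA a * C.word l) = g (C.gA a * C.word l)) : f = g :=
  LinearMap.ext fun e => C.env_induction (P := fun e => f e = g e) (by simp)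
    (fun x y hx hy => by rw [map_add, map_add, hx, hy]) h e

/-! ### The grading of the envelope -/

set_option maxHeartbeats 1000000 in
/-- The automorphism of `Γ^∧` equal to `2 ^ k` in degree `k`. -/
def envScale : C.Env →ₐ[ℂ] C.Env :=
  C.envLift C.gA ((2 : ℂ) • C.gΓ) C.gA_one C.gA_mul
    (fun a γ => by rw [LinearMap.smul_apply, gΓ_smul, LinearMap.smul_apply, mul_smul_comm])
    (fun a γ => by rw [LinearMap.smul_apply, gΓ_op_smul, LinearMap.smul_apply, smul_mul_assoc])
    (fun t ht => by
      have e : ∀ t, mul₂ (((2 : ℂ) • C.gΓ) ∘ₗ C.d) (((2 : ℂ) • C.gΓ) ∘ₗ C.d) t = (4 : ℂ) • C.dd t := fun t => by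
        induction t using TensorProduct.induction_on with
        | zero => simp
        | add s t hs ht => simp only [map_add, smul_add] at hs ht ⊢; rw [hs, ht]
        | tmul x y =>
          change ((2 : ℂ) • C.gΓ (C.d x)) * ((2 : ℂ) • C.gΓ (C.d y)) = _
          rw [smul_mul_smul_comm]; norm_num; rfl
      exact (e t).trans (by rw [C.dd_eq_zero t ht, smul_zero]))

theorem envScale_gA (a : A) : C.envScale (C.gA a) = C.gA a := C.envLift_gA _ _ _ _ _ _ _ a
theorem envScale_gΓ (γ : Γ) : C.envScale (C.gΓ γ) = (2 : ℂ) • C.gΓ γ := C.envLift_gΓ _ _ _ _ _ _ _ γ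

theorem envScale_word (a : A) (l : List C.inv) :
    C.envScale (C.gA a * C.word l) = (2 : ℂ) ^ l.length • (C.gA a * C.word l) := by
  rw [map_mul, envScale_gA, ← mul_smul_comm]
  congr 1
  induction l with
  | nil => simp [word_nil]
  | cons v l ih =>
    rw [word_cons, map_mul, ih, show C.envScale (C.invEnv v) = (2 : ℂ) • C.invEnv v from
      C.envScale_gΓ _, smul_mul_smul_comm, List.length_cons, pow_succ']

theorem exists_envPr : ∃ pr : ℕ → C.Env →ₗ[ℂ] C.Env, IsGrading C.envScale.toLinearMap pr :=
  exists_grading _ (IsGrading.mem_iSup_of_adjoin C.envScale C.adjoin_envGen (by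
    rintro _ (⟨a, rfl⟩ | ⟨γ, rfl⟩)
    · exact ⟨0, by rw [envScale_gA, pow_zero, one_smul]⟩
    · exact ⟨1, by rw [envScale_gΓ, pow_one]⟩))

/-- The projections to the homogeneous components of `Γ^∧`. -/
def envPr : ℕ → C.Env →ₗ[ℂ] C.Env := C.exists_envPr.choose

theorem envGrading : IsGrading C.envScale.toLinearMap C.envPr := C.exists_envPr.choose_spec

theorem envPr_word (k : ℕ) (a : A) (l : List C.inv) :
    C.envPr k (C.gA a * C.word l) = if k = l.length then C.gA a * C.word l else 0 := by
  split_ifs with h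
  · exact C.envGrading.pr_eq k _ (h ▸ C.envScale_word a l)
  · exact C.envGrading.pr_ne (C.envScale_word a l) h

set_option maxHeartbeats 1000000 in
/-- The projection `Γ^∧ → A` to degree zero. -/
def envZero : C.Env →ₐ[ℂ] A :=
  C.envLift LinearMap.id 0 rfl (fun _ _ => rfl) (fun a γ => (mul_zero a).symm)
    (fun a γ => (zero_mul a).symm) (fun t ht => by
      clear ht
      induction t using TensorProduct.induction_on with
      | zero => simp
      | add s t hs ht => rw [map_add, hs, ht, add_zero]
      | tmul x y => simp)

theorem envZero_gA (a : A) : C.envZero (C.gA a) = a := C.envLift_gA _ _ _ _ _ _ _ a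
theorem envZero_gΓ (γ : Γ) : C.envZero (C.gΓ γ) = 0 := C.envLift_gΓ _ _ _ _ _ _ _ γ

theorem envPr_zero (e : C.Env) : C.envPr 0 e = C.gA (C.envZero e) := by
  refine LinearMap.congr_fun (C.env_linearMap_ext (f := C.envPr 0)
    (g := C.gA ∘ₗ C.envZero.toLinearMap) fun a l => ?_) e
  rw [envPr_word, LinearMap.comp_apply, AlgHom.toLinearMap_apply, map_mul C.envZero, envZero_gA]
  cases l with
  | nil => simp [word_nil]
  | cons v l =>
    rw [word_cons, map_mul C.envZero, show C.envZero (C.invEnv v) = 0 from C.envZero_gΓ _]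
    simp

theorem envPr_gA (a : A) {k : ℕ} (hk : k ≠ 0) : C.envPr k (C.gA a) = 0 := by
  have := C.envPr_word k a []
  rwa [word_nil, mul_one, if_neg (by simpa using hk)] at this

theorem envScale_envDiff (e : C.Env) :
    C.envScale (C.envDiff.d e) = (2 : ℂ) • C.envDiff.d (C.envScale e) := by
  refine (map_d_of_adjoin C.envDiff (SuperDiff.smul 2 C.envDiff) C.envScale C.adjoin_envGen
    ?_ ?_ e).2
  · rintro _ (⟨a, rfl⟩ | ⟨γ, rfl⟩)
    · rw [par_gA, envScale_gA, par_gA]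
    · rw [par_gΓ, map_neg, envScale_gΓ, map_smul, par_gΓ, smul_neg]
  · rintro _ (⟨a, rfl⟩ | ⟨γ, rfl⟩)
    · rw [envDiff_gA, envScale_gA, envScale_gΓ]
      exact congrArg _ (C.envDiff_gA a).symm
    · change _ = (2 : ℂ) • C.envDiff.d _
      rw [envDiff_gΓ, envScale_gΓ, map_smul, envDiff_gΓ]
      obtain ⟨t, rfl⟩ := C.smulD_surjective γ
      rw [d1_smulD]
      induction t using TensorProduct.induction_on with
      | zero => simp
      | add s t hs ht => simp only [map_add, smul_add, hs, ht]
      | tmul x y => rw [dd_tmul, map_mul, envScale_gΓ, envScale_gΓ, smul_mul_smul_comm, smul_smul]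

theorem envPr_envDiff (k : ℕ) (e : C.Env) :
    C.envPr (k + 1) (C.envDiff.d e) = C.envDiff.d (C.envPr k e) :=
  C.envGrading.map_pr C.envGrading C.envDiff.d 1
    (fun x => by rw [pow_one]; exact C.envScale_envDiff x) k e

theorem envPr_zero_envDiff (e : C.Env) : C.envPr 0 (C.envDiff.d e) = 0 :=
  C.envGrading.map_pr_lt C.envGrading C.envDiff.d 1
    (fun x => by rw [pow_one]; exact C.envScale_envDiff x) one_pos e

theorem envZero_envDiff (e : C.Env) : C.envZero (C.envDiff.d e) = 0 := by
  rw [← C.envZero_gA (C.envZero (C.envDiff.d e)), ← envPr_zero, envPr_zero_envDiff, map_zero]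

theorem envZero_par (e : C.Env) : C.envZero (Super.par e) = C.envZero e := by
  refine congrArg (fun f : C.Env →ₐ[ℂ] A => f e)
    (C.env_algHom_ext (f := C.envZero.comp Super.par) (g := C.envZero) (fun a => ?_) (fun γ => ?_))
  · rw [AlgHom.comp_apply, par_gA]
  · rw [AlgHom.comp_apply, par_gΓ, map_neg, envZero_gΓ, neg_zero]

theorem envPr_par (k : ℕ) (e : C.Env) : C.envPr k (Super.par e) = Super.par (C.envPr k e) := by
  refine C.envGrading.map_pr₀ C.envGrading (Super.par (B := C.Env)).toLinearMap (fun x => ?_) k e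
  refine congrArg (fun f : C.Env →ₐ[ℂ] C.Env => f x)
    (C.env_algHom_ext (f := C.envScale.comp Super.par) (g := Super.par.comp C.envScale)
      (fun a => ?_) (fun γ => ?_))
  · rw [AlgHom.comp_apply, AlgHom.comp_apply, par_gA, envScale_gA, par_gA]
  · rw [AlgHom.comp_apply, AlgHom.comp_apply, par_gΓ, map_neg, envScale_gΓ, map_smul, par_gΓ,
      smul_neg]

/-! ### The coproduct of the envelope -/

/-- The coproduct `Γ^∧ → Γ^∧ ⊗ Γ^∧`, as a linear map. -/
def coE : C.Env →ₗ[ℂ] C.Env ⊗[ℂ] C.Env := pl.toLinearMap ∘ₗ C.envCo.toLinearMap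

theorem coE_apply (e : C.Env) : C.coE e = pl (C.envCo e) := rfl

theorem coE_gA (a : A) :
    C.coE (C.gA a) = TensorProduct.map C.gA C.gA (Coalgebra.comul (R := ℂ) a) := by
  rw [coE_apply, envCo_gA]; exact pl_mul₂ _ _ _

theorem envScale_par (e : C.Env) : C.envScale (Super.par e) = Super.par (C.envScale e) := by
  refine congrArg (fun f : C.Env →ₐ[ℂ] C.Env => f e)
    (C.env_algHom_ext (f := C.envScale.comp Super.par) (g := Super.par.comp C.envScale)
      (fun a => ?_) (fun γ => ?_))
  · rw [AlgHom.comp_apply, AlgHom.comp_apply, par_gA, envScale_gA, par_gA]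
  · rw [AlgHom.comp_apply, AlgHom.comp_apply, par_gΓ, map_neg, envScale_gΓ, map_smul, par_gΓ,
      smul_neg]

theorem envCo_envScale (e : C.Env) : C.envCo (C.envScale e)
    = stMap C.envScale C.envScale C.envScale_par C.envScale_par (C.envCo e) := by
  have hA : C.envScale.toLinearMap ∘ₗ C.gA = C.gA := LinearMap.ext C.envScale_gA
  have hΓ : C.envScale.toLinearMap ∘ₗ C.gΓ = (2 : ℂ) • C.gΓ := LinearMap.ext C.envScale_gΓ
  refine congrArg (fun f : C.Env →ₐ[ℂ] STensor C.Env C.Env => f e)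
    (C.env_algHom_ext (f := C.envCo.comp C.envScale)
      (g := (stMap C.envScale C.envScale C.envScale_par C.envScale_par).comp C.envCo)
      (fun a => ?_) (fun γ => ?_))
  · rw [AlgHom.comp_apply, AlgHom.comp_apply, envScale_gA, envCo_gA]
    refine Eq.symm ((stMap_mul₂ _ _ _ _ _ _ _).trans ?_)
    rw [hA]; rfl
  · rw [AlgHom.comp_apply, AlgHom.comp_apply, envScale_gΓ, map_smul, envCo_gΓ]
    have e1 := stMap_mul₂ C.envScale C.envScale C.envScale_par C.envScale_par C.gA C.gΓ (C.lco γ)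
    have e2 := stMap_mul₂ C.envScale C.envScale C.envScale_par C.envScale_par C.gΓ C.gA (C.rco γ)
    rw [hA, hΓ] at e1 e2
    change _ = stMap C.envScale C.envScale C.envScale_par C.envScale_par (_ + _)
    rw [map_add]
    refine Eq.trans ?_ (congrArg₂ (· + ·) e1 e2).symm
    change (2 : ℂ) • (C.coMul C.gA C.gΓ (C.lco γ) + C.coMul C.gΓ C.gA (C.rco γ)) = _
    rw [smul_add]
    congr 1
    · generalize C.lco γ = t
      induction t using TensorProduct.induction_on with
      | zero => simp
      | add s t hs ht => simp only [map_add, smul_add, hs, ht]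
      | tmul x y => simp
    · generalize C.rco γ = t
      induction t using TensorProduct.induction_on with
      | zero => simp
      | add s t hs ht => simp only [map_add, smul_add, hs, ht]
      | tmul x y => simp

theorem coE_envScale (e : C.Env) : C.coE (C.envScale e)
    = TensorProduct.map C.envScale.toLinearMap C.envScale.toLinearMap (C.coE e) := by
  rw [coE_apply, envCo_envScale, pl_stMap]; rfl

theorem coE_envDiff (e : C.Env) : C.coE (C.envDiff.d e)
    = TensorProduct.map C.envDiff.d LinearMap.id (C.coE e)
      + TensorProduct.map (Super.par (B := C.Env)).toLinearMap C.envDiff.d (C.coE e) := by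
  rw [coE_apply, (C.envCo_par_d e).2, pl_tensorD]; rfl

/-- The left coaction `Γ^∧ → A ⊗ Γ^∧`. -/
def lE : C.Env →ₗ[ℂ] A ⊗[ℂ] C.Env := C.envZero.toLinearMap.rTensor C.Env ∘ₗ C.coE

theorem lE_apply (e : C.Env) : C.lE e = C.envZero.toLinearMap.rTensor C.Env (C.coE e) := rfl

/-- The homomorphism `envZero ⊗ id`. -/
def zeroHom : STensor C.Env C.Env →ₐ[ℂ] A ⊗[ℂ] C.Env :=
  stLift (Algebra.TensorProduct.includeLeft.comp C.envZero) Algebra.TensorProduct.includeRight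
    (fun b e _ => by simp) (fun b e _ => by simp [envZero_par])

theorem zeroHom_apply (z : STensor C.Env C.Env) :
    C.zeroHom z = C.envZero.toLinearMap.rTensor C.Env (pl z) := by
  induction z using STensor.induction with
  | h0 => simp
  | ha s t hs ht => simp only [map_add, hs, ht]
  | hm b e =>
    rw [map_mul, pl_mul]
    refine (congrArg₂ (· * ·) (stLift_iL _ _ _ _ b) (stLift_iR _ _ _ _ e)).trans ?_
    simp

/-- The left coaction, as a homomorphism. -/
def lHom : C.Env →ₐ[ℂ] A ⊗[ℂ] C.Env := C.zeroHom.comp C.envCo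

theorem lHom_apply (e : C.Env) : C.lHom e = C.lE e := C.zeroHom_apply _

theorem lE_gA (a : A) : C.lE (C.gA a) = C.gA.lTensor A (Coalgebra.comul (R := ℂ) a) := by
  rw [lE_apply, coE_gA, LinearMap.rTensor_map,
    show C.envZero.toLinearMap ∘ₗ C.gA = LinearMap.id from LinearMap.ext C.envZero_gA]
  rfl

theorem lE_invEnv (v : C.inv) : C.lE (C.invEnv v) = 1 ⊗ₜ C.invEnv v := by
  change C.envZero.toLinearMap.rTensor C.Env (pl (C.envCo (C.gΓ v))) = _
  rw [envCo_gΓ]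
  change C.envZero.toLinearMap.rTensor C.Env (pl (C.coMul C.gA C.gΓ (C.lco v)
    + C.coMul C.gΓ C.gA (C.rco v))) = _
  have h0 : C.envZero.toLinearMap ∘ₗ C.gΓ = 0 := LinearMap.ext C.envZero_gΓ
  rw [map_add, pl_mul₂, pl_mul₂, map_add, LinearMap.rTensor_map, LinearMap.rTensor_map, h0,
    TensorProduct.map_zero_left, LinearMap.zero_apply, add_zero, C.mem_inv.1 v.2]
  simp [envZero_gA, invEnv]

theorem lE_word (a : A) (l : List C.inv) : C.lE (C.gA a * C.word l)
    = (LinearMap.mulRight ℂ (C.word l) ∘ₗ C.gA).lTensor A (Coalgebra.comul (R := ℂ) a) := by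
  have hl : C.lHom (C.word l) = 1 ⊗ₜ C.word l := by
    induction l with
    | nil => rw [word_nil, map_one]; rfl
    | cons v l ih =>
      rw [word_cons, map_mul, ih, lHom_apply, lE_invEnv, Algebra.TensorProduct.tmul_mul_tmul,
        one_mul]
  rw [← lHom_apply, map_mul, hl, lHom_apply, lE_gA]
  generalize Coalgebra.comul (R := ℂ) a = t
  induction t using TensorProduct.induction_on with
  | zero => simp
  | add s t hs ht => simp only [map_add, add_mul, hs, ht]
  | tmul x y => simp

theorem lE_coassoc (e : C.Env) :
    TensorProduct.assoc ℂ A A C.Env ((Coalgebra.comul (R := ℂ)).rTensor C.Env (C.lE e))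
      = C.lE.lTensor A (C.lE e) := by
  refine LinearMap.congr_fun (C.env_linearMap_ext
    (f := (TensorProduct.assoc ℂ A A C.Env).toLinearMap ∘ₗ
      (Coalgebra.comul (R := ℂ)).rTensor C.Env ∘ₗ C.lE) (g := C.lE.lTensor A ∘ₗ C.lE)
      fun a l => ?_) e
  simp only [LinearMap.comp_apply, lE_word]
  have h := congrArg ((LinearMap.mulRight ℂ (C.word l) ∘ₗ C.gA).lTensor A |>.lTensor A)
    (Coalgebra.coassoc_apply (R := ℂ) a)
  have e1 : ∀ t : A ⊗[ℂ] A, ((LinearMap.mulRight ℂ (C.word l) ∘ₗ C.gA).lTensor A |>.lTensor A)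
      ((Coalgebra.comul (R := ℂ)).lTensor A t)
      = C.lE.lTensor A ((LinearMap.mulRight ℂ (C.word l) ∘ₗ C.gA).lTensor A t) := fun t => by
    induction t using TensorProduct.induction_on with
    | zero => simp
    | add s t hs ht => simp only [map_add, hs, ht]
    | tmul x y =>
      simp only [LinearMap.lTensor_tmul, LinearMap.comp_apply, LinearMap.mulRight_apply, lE_word]
  have e2 : ∀ t : (A ⊗[ℂ] A) ⊗[ℂ] A, ((LinearMap.mulRight ℂ (C.word l) ∘ₗ C.gA).lTensor A
      |>.lTensor A) (TensorProduct.assoc ℂ A A A t)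
      = TensorProduct.assoc ℂ A A C.Env
        ((LinearMap.mulRight ℂ (C.word l) ∘ₗ C.gA).lTensor (A ⊗[ℂ] A) t) := fun t => by
    induction t using TensorProduct.induction_on with
    | zero => simp
    | add s t hs ht => simp only [map_add, hs, ht]
    | tmul x y =>
      induction x using TensorProduct.induction_on with
      | zero => simp
      | add s t hs ht => simp only [map_add, TensorProduct.add_tmul, hs, ht]
      | tmul x z => simp
  rw [e1, e2] at h
  rw [← h]
  exact congrArg _ ((rTensor_lTensor _ _ _).trans (lTensor_rTensor _ _ _).symm)

theorem lE_counit (e : C.Env) :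
    TensorProduct.lid ℂ C.Env ((Coalgebra.counit (R := ℂ)).rTensor C.Env (C.lE e)) = e := by
  refine LinearMap.congr_fun (C.env_linearMap_ext
    (f := (TensorProduct.lid ℂ C.Env).toLinearMap ∘ₗ
      (Coalgebra.counit (R := ℂ)).rTensor C.Env ∘ₗ C.lE) (g := LinearMap.id) fun a l => ?_) e
  simp only [LinearMap.comp_apply, lE_word, LinearMap.id_apply]
  conv_rhs => rw [← (TensorProduct.lid ℂ A).apply_symm_apply a, TensorProduct.lid_symm_apply,
    ← Coalgebra.rTensor_counit_comul (R := ℂ) a]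
  generalize Coalgebra.comul (R := ℂ) a = t
  induction t using TensorProduct.induction_on with
  | zero => simp
  | add s t hs ht => simp only [map_add, add_mul, hs, ht]
  | tmul x y => simp

theorem lE_envDiff (e : C.Env) : C.lE (C.envDiff.d e) = C.envDiff.d.lTensor A (C.lE e) := by
  rw [lE_apply, coE_envDiff, lE_apply]
  generalize C.coE e = t
  induction t using TensorProduct.induction_on with
  | zero => simp
  | add s t hs ht =>
    simp only [map_add] at hs ht ⊢
    rw [← hs, ← ht]; abel
  | tmul x y => simp [envZero_envDiff, envZero_par]

theorem lE_envPr (k : ℕ) (e : C.Env) : C.lE (C.envPr k e) = (C.envPr k).lTensor A (C.lE e) := by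
  refine (C.envGrading.map_pr₀ C.envGrading.lTensor C.lE (fun x => ?_) k e).symm
  change _ = C.lE (C.envScale x)
  rw [lE_apply, lE_apply, coE_envScale]
  generalize C.coE x = t
  induction t using TensorProduct.induction_on with
  | zero => simp
  | add s t hs ht => simp only [map_add, hs, ht]
  | tmul x y =>
    have : C.envZero (C.envScale x) = C.envZero x :=
      congrArg (fun f : C.Env →ₐ[ℂ] A => f x) (C.env_algHom_ext (f := C.envZero.comp C.envScale)
        (g := C.envZero) (fun a => by rw [AlgHom.comp_apply, envScale_gA])
        (fun γ => by rw [AlgHom.comp_apply, envScale_gΓ, map_smul, envZero_gΓ, smul_zero]))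
    simp [this]

theorem coE_bidegree {i j k : ℕ} (h : j + k ≠ i) (e : C.Env) :
    TensorProduct.map (C.envPr j) (C.envPr k) (C.coE (C.envPr i e)) = 0 := by
  refine C.envGrading.map_pr_pr C.envGrading (n := i) ?_ h
  rw [← coE_envScale, ← C.coE.map_smul]
  exact congrArg C.coE (C.envGrading.s_pr i e)

theorem coE_envPr_lt {i k : ℕ} (h : i < k) (e : C.Env) :
    (C.envPr k).lTensor C.Env (C.coE (C.envPr i e)) = 0 := by
  refine (C.envGrading.rTensor (N := C.Env)).ext_pr fun j => ?_
  rw [map_zero, rTensor_lTensor]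
  exact C.coE_bidegree (by omega) e

/-- The coproduct preserves the total degree. For an element of degree k, degree k in the second
factor forces degree zero in the first, and there the coproduct is the left coaction of A. -/
theorem coE_envPr (k : ℕ) (e : C.Env) :
    (C.envPr k).lTensor C.Env (C.coE (C.envPr k e)) = C.gA.rTensor C.Env (C.lE (C.envPr k e)) := by
  have h : (C.envPr k).lTensor C.Env (C.coE (C.envPr k e))
      = (C.envPr 0).rTensor C.Env ((C.envPr k).lTensor C.Env (C.coE (C.envPr k e))) := by
    refine (C.envGrading.rTensor (N := C.Env)).ext_pr fun j => ?_
    by_cases hj : j = 0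
    · subst hj; exact ((C.envGrading.rTensor (N := C.Env)).pr_pr 0 _).symm
    · rw [(C.envGrading.rTensor (N := C.Env)).pr_pr_ne hj, rTensor_lTensor]
      exact C.coE_bidegree (by omega) e
  rw [h]
  conv_rhs => rw [← C.envGrading.pr_pr k e, lE_envPr]
  rw [lE_apply]
  generalize C.coE (C.envPr k e) = t
  induction t using TensorProduct.induction_on with
  | zero => simp
  | add s t hs ht => simp only [map_add, hs, ht]
  | tmul x y => simp [envPr_zero]

/-- The coefficients of the left coaction on closed elements are closed, modulo exact elements. -/
theorem lE_closed (χ : C.Env →ₗ[ℂ] C.Env) (hχ : ∀ x, χ (C.envDiff.d x) = 0) {k : ℕ} {e : C.Env}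
    (hk : C.envPr k e = e) (he : C.envDiff.d e = 0) :
    TensorProduct.map (C.envDiff.d ∘ₗ C.gA) χ (C.lE e) = 0 := by
  have h := C.coE_envDiff e
  rw [he, map_zero] at h
  -- In Δ(de) = 0 the term that differentiates the second factor is killed by χ, which vanishes on
  -- exact elements. In the other term the projection to degree k leaves only the left coaction of
  -- e, by `coE_envPr`.
  have h1 := congrArg ((χ ∘ₗ C.envPr k).lTensor C.Env) h
  have h2 : (χ ∘ₗ C.envPr k) ∘ₗ C.envDiff.d = 0 := by
    ext x
    cases k with
    | zero => simp [envPr_zero_envDiff]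
    | succ k => simp [envPr_envDiff, hχ]
  rw [map_zero, map_add, LinearMap.lTensor_map, LinearMap.lTensor_map, h2, TensorProduct.map_zero_right,
    LinearMap.zero_apply, add_zero] at h1
  have h3 := C.coE_envPr k e
  rw [hk] at h3
  have h4 := congrArg (TensorProduct.map C.envDiff.d χ) h3
  rw [LinearMap.map_lTensor, LinearMap.map_rTensor] at h4
  rw [← h4]
  exact h1.symm

theorem jGerm₂_mul (a : A) (ha : C.germ a = 0) :
    C.jGerm₂ ((LinearMap.mul ℂ C.Env) ∘ₗ C.invEnv) a = 0 := by
  have h := C.invMul_germ₂ a ha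
  ext x
  have h2 := congrArg (fun y => y * x) h
  simp only [zero_mul] at h2
  rw [LinearMap.zero_apply, ← h2]
  simp only [jGerm₂, LinearMap.comp_apply]
  generalize C.germ₂ a = t
  induction t using TensorProduct.induction_on with
  | zero => simp
  | add s t hs ht => simp only [map_add, LinearMap.add_apply, add_mul, hs, ht]
  | tmul x y => simp [mul_assoc]

/-- The projection of `Γ^∧` to its left-invariant part, `a ϑ₁ ⋯ ϑₙ ↦ ε(a) ϑ₁ ⋯ ϑₙ`. -/
def envInv : C.Env →ₗ[ℂ] C.Env :=
  (TensorProduct.lid ℂ C.Env).toLinearMap ∘ₗ (Coalgebra.counit (R := ℂ) (A := A)).rTensor C.Env ∘ₗ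
    (C.envRep ((LinearMap.mul ℂ C.Env) ∘ₗ C.invEnv) C.jGerm₂_mul).toLinearMap.flip (1 ⊗ₜ 1)

theorem envInv_word (a : A) (l : List C.inv) :
    C.envInv (C.gA a * C.word l) = Coalgebra.counit (R := ℂ) a • C.word l := by
  have hl : C.envRep ((LinearMap.mul ℂ C.Env) ∘ₗ C.invEnv) C.jGerm₂_mul (C.word l) (1 ⊗ₜ 1)
      = 1 ⊗ₜ C.word l := by
    induction l with
    | nil => rw [word_nil, map_one]; rfl
    | cons v l ih => rw [word_cons, map_mul, Module.End.mul_apply, ih, envRep_inv]; rfl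
  simp only [envInv, LinearMap.comp_apply, LinearMap.flip_apply, AlgHom.toLinearMap_apply]
  rw [map_mul, Module.End.mul_apply, hl, envRep_gA, repA_tmul]
  simp

theorem mul₂_gA_envInv (e : C.Env) : mul₂ C.gA C.envInv (C.lE e) = e := by
  refine LinearMap.congr_fun (C.env_linearMap_ext
    (f := mul₂ C.gA C.envInv ∘ₗ C.lE) (g := LinearMap.id) fun a l => ?_) e
  simp only [LinearMap.comp_apply, lE_word, LinearMap.id_apply]
  conv_rhs => rw [← (TensorProduct.rid ℂ A).apply_symm_apply a, TensorProduct.rid_symm_apply,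
    ← Coalgebra.lTensor_counit_comul (R := ℂ) a]
  generalize Coalgebra.comul (R := ℂ) a = t
  induction t using TensorProduct.induction_on with
  | zero => simp
  | add s t hs ht => simp only [map_add, add_mul, hs, ht]
  | tmul x y => simp [envInv_word]

theorem envInv_envPr_mem (k : ℕ) (e : C.Env) :
    C.envInv (C.envPr k e) ∈ Submodule.span ℂ {x | ∃ l : List C.inv, l.length = k ∧ x = C.word l} := by
  induction e using C.env_induction with
  | h0 => simp
  | hadd x y hx hy => rw [map_add, map_add]; exact add_mem hx hy
  | hw a l =>
    rw [envPr_word]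
    split_ifs with h
    · rw [envInv_word]
      exact Submodule.smul_mem _ _ (Submodule.subset_span ⟨l, h.symm, rfl⟩)
    · rw [map_zero]; exact zero_mem _

/-! ### Graded differential comodules over Γ^∧: filtration, symbols and the cotensor product. -/

/-- A graded differential comodule over `Γ^∧`, with right multiplications by the elements of
`Γ_inv`. -/
structure ExtComodule (M : Type*) [AddCommGroup M] [Module ℂ M] where
  ad : M →ₗ[ℂ] M ⊗[ℂ] C.Env
  d : M →ₗ[ℂ] M
  par : M →ₗ[ℂ] M
  s : M →ₗ[ℂ] M
  pr : ℕ → M →ₗ[ℂ] M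
  rθ : C.inv → M →ₗ[ℂ] M
  grading : IsGrading s pr
  coassoc : ∀ m, TensorProduct.assoc ℂ M C.Env C.Env (ad.rTensor C.Env (ad m))
    = C.coE.lTensor M (ad m)
  counit : ∀ m, TensorProduct.rid ℂ M
    ((Coalgebra.counit (R := ℂ) (A := A) ∘ₗ C.envZero.toLinearMap).lTensor M (ad m)) = m
  ad_d : ∀ m, ad (d m) = d.rTensor C.Env (ad m) + TensorProduct.map par C.envDiff.d (ad m)
  ad_par : ∀ m, ad (par m) = TensorProduct.map par (Super.par (B := C.Env)).toLinearMap (ad m)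
  ad_s : ∀ m, ad (s m) = TensorProduct.map s C.envScale.toLinearMap (ad m)
  d_d : ∀ m, d (d m) = 0
  par_par : ∀ m, par (par m) = m
  s_d : ∀ m, s (d m) = (2 : ℂ) • d (s m)
  -- The only trace of the multiplication of Ω that is kept: right multiplication by ϑ raises the
  -- filtration by at most one and multiplies the symbol by ϑ. It restricts to ideals, and it
  -- suffices to realize all symbols.
  symbol_rθ : ∀ k v m, (C.envPr (k + 1)).lTensor M (ad m) = 0 →
    (C.envPr (k + 1)).lTensor M (ad (rθ v m))
      = (LinearMap.mulRight ℂ (C.invEnv v)).lTensor M ((C.envPr k).lTensor M (ad m))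

namespace ExtComodule
variable {C} {M : Type*} [AddCommGroup M] [Module ℂ M] (X : C.ExtComodule M)

/-- The coaction of `A`. -/
def c : M →ₗ[ℂ] M ⊗[ℂ] A := C.envZero.toLinearMap.lTensor M ∘ₗ X.ad

/-- The component of degree `k` of the coaction. -/
def lam (k : ℕ) : M →ₗ[ℂ] M ⊗[ℂ] C.Env := (C.envPr k).lTensor M ∘ₗ X.ad

theorem c_apply (m : M) : X.c m = C.envZero.toLinearMap.lTensor M (X.ad m) := rfl
theorem lam_apply (k : ℕ) (m : M) : X.lam k m = (C.envPr k).lTensor M (X.ad m) := rfl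

/-- The filtration by the degree of the coaction. -/
def filt (k : ℕ) : Submodule ℂ M where
  carrier := {m | ∀ j, k < j → X.lam j m = 0}
  zero_mem' j _ := map_zero _
  add_mem' ha hb j hj := by rw [map_add, ha j hj, hb j hj, add_zero]
  smul_mem' c m hm j hj := by rw [map_smul, hm j hj, smul_zero]

/-- The map that detects horizontality. -/
def horMap : M →ₗ[ℂ] M ⊗[ℂ] C.Env := X.ad - C.gA.lTensor M ∘ₗ X.c

theorem gA_c (m : M) : C.gA.lTensor M (X.c m) = X.lam 0 m := by
  rw [c_apply, lam_apply, ← LinearMap.lTensor_comp_apply]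
  congr 2
  exact LinearMap.ext fun e => (C.envPr_zero e).symm

theorem ext_lam {m : M} {z : M ⊗[ℂ] C.Env} (h : ∀ k, X.lam k m = (C.envPr k).lTensor M z) :
    X.ad m = z := C.envGrading.lTensor.ext_pr h

theorem horMap_eq_zero_iff {m : M} : X.horMap m = 0 ↔ m ∈ X.filt 0 := by
  rw [horMap, LinearMap.sub_apply, sub_eq_zero, LinearMap.comp_apply, gA_c]
  refine ⟨fun h j hj => ?_, fun h => X.ext_lam fun k => ?_⟩
  · rw [lam_apply, h]; exact C.envGrading.lTensor.pr_pr_ne hj.ne' _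
  · by_cases hk : k = 0
    · subst hk; exact (C.envGrading.lTensor.pr_pr 0 _).symm
    · rw [h k (Nat.pos_of_ne_zero hk)]
      exact (C.envGrading.lTensor.pr_pr_ne hk _).symm

theorem ad_eq_of_mem_filt {m : M} (hm : m ∈ X.filt 0) : X.ad m = C.gA.lTensor M (X.c m) :=
  sub_eq_zero.1 (X.horMap_eq_zero_iff.2 hm)

/-- The closed elements of the cotensor product. -/
def IsCot (t : M ⊗[ℂ] C.Env) : Prop :=
  TensorProduct.assoc ℂ M C.Env C.Env (X.ad.rTensor C.Env t)
    = (C.gA.rTensor C.Env ∘ₗ C.lE).lTensor M t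

theorem assoc_lTensor {M₁ M₂ E₁ E₂ : Type*} [AddCommGroup M₁] [Module ℂ M₁] [AddCommGroup M₂]
    [Module ℂ M₂] [AddCommGroup E₁] [Module ℂ E₁] [AddCommGroup E₂] [Module ℂ E₂]
    (g : E₁ →ₗ[ℂ] E₂) (z : (M₁ ⊗[ℂ] M₂) ⊗[ℂ] E₁) :
    TensorProduct.assoc ℂ M₁ M₂ E₂ (g.lTensor _ z)
      = (g.lTensor M₂).lTensor M₁ (TensorProduct.assoc ℂ M₁ M₂ E₁ z) := by
  induction z using TensorProduct.induction_on with
  | zero => simp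
  | add s t hs ht => simp only [map_add, hs, ht]
  | tmul x y =>
    induction x using TensorProduct.induction_on with
    | zero => simp
    | add s t hs ht => simp only [map_add, TensorProduct.add_tmul, hs, ht]
    | tmul x z => simp

theorem assoc_rTensor_lTensor {M₁ M₂ M₃ E₁ : Type*} [AddCommGroup M₁] [Module ℂ M₁]
    [AddCommGroup M₂] [Module ℂ M₂] [AddCommGroup E₁] [Module ℂ E₁] [AddCommGroup M₃] [Module ℂ M₃]
    (g : M₂ →ₗ[ℂ] M₃) (z : (M₁ ⊗[ℂ] M₂) ⊗[ℂ] E₁) :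
    TensorProduct.assoc ℂ M₁ M₃ E₁ ((g.lTensor M₁).rTensor E₁ z)
      = (g.rTensor E₁).lTensor M₁ (TensorProduct.assoc ℂ M₁ M₂ E₁ z) := by
  induction z using TensorProduct.induction_on with
  | zero => simp
  | add s t hs ht => simp only [map_add, hs, ht]
  | tmul x y =>
    induction x using TensorProduct.induction_on with
    | zero => simp
    | add s t hs ht => simp only [map_add, TensorProduct.add_tmul, hs, ht]
    | tmul x z => simp

theorem rTensor_lTensor_comm {M₁ M₂ E₁ E₂ : Type*} [AddCommGroup M₁] [Module ℂ M₁]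
    [AddCommGroup M₂] [Module ℂ M₂] [AddCommGroup E₁] [Module ℂ E₁] [AddCommGroup E₂] [Module ℂ E₂]
    (f : M₁ →ₗ[ℂ] M₂) (g : E₁ →ₗ[ℂ] E₂) (t : M₁ ⊗[ℂ] E₁) :
    f.rTensor E₂ (g.lTensor M₁ t) = g.lTensor M₂ (f.rTensor E₁ t) := by
  rw [rTensor_lTensor, lTensor_rTensor]

/-- By coassociativity, the coaction on the first factors of the symbol is the part of the coproduct
with degree k in the last factor. Forms of degree below k contribute nothing to it, forms of degree
k contribute the left coaction of A, and higher degrees do not occur in the coaction of m. -/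
theorem isCot_lam {k : ℕ} {m : M} (hm : m ∈ X.filt k) : X.IsCot (X.lam k m) := by
  rw [IsCot, lam_apply, rTensor_lTensor_comm, assoc_lTensor, X.coassoc,
    ← LinearMap.lTensor_comp_apply, ← LinearMap.lTensor_comp_apply]
  refine C.envGrading.lTensor_eq _ _ _ fun i => ?_
  rcases lt_trichotomy i k with hi | rfl | hi
  · left
    ext e
    simp only [LinearMap.comp_apply]
    rw [C.coE_envPr_lt hi, C.envGrading.pr_pr_ne hi.ne', map_zero, map_zero]
  · left
    ext e
    simp only [LinearMap.comp_apply]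
    rw [C.coE_envPr, C.envGrading.pr_pr]
  · right; exact hm i hi

theorem IsCot.c_rTensor {X : C.ExtComodule M} {t : M ⊗[ℂ] C.Env} (h : X.IsCot t) :
    TensorProduct.assoc ℂ M A C.Env (X.c.rTensor C.Env t) = C.lE.lTensor M t := by
  have h1 := congrArg ((C.envZero.toLinearMap.rTensor C.Env).lTensor M) h
  rw [← assoc_rTensor_lTensor, ← LinearMap.rTensor_comp_apply, ← LinearMap.lTensor_comp_apply] at h1
  refine h1.trans ?_
  congr 2
  ext e
  simp only [LinearMap.comp_apply]
  rw [← LinearMap.rTensor_comp_apply,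
    show C.envZero.toLinearMap ∘ₗ C.gA = LinearMap.id from LinearMap.ext C.envZero_gA,
    LinearMap.rTensor_id, LinearMap.id_apply]

/-- The full coaction and the coaction of A on the first factors are both equal to the left coaction
on the second factor. So the first factors of an element of the cotensor product can be taken
horizontal, by `exists_proj`. -/
theorem IsCot.horMap_rTensor {X : C.ExtComodule M} {t : M ⊗[ℂ] C.Env} (h : X.IsCot t) :
    X.horMap.rTensor C.Env t = 0 := by
  apply (TensorProduct.assoc ℂ M C.Env C.Env).injective
  rw [horMap, LinearMap.rTensor_sub, LinearMap.sub_apply, LinearMap.rTensor_comp_apply, map_sub,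
    assoc_rTensor_lTensor, h.c_rTensor, map_zero, sub_eq_zero, ← LinearMap.lTensor_comp_apply]
  exact h

/-- On symbols d has two parts: the differential of M, which preserves the filtration, and par ⊗ d,
which raises it by one. All estimates of the filtration of coboundaries come from this formula. -/
theorem lam_succ_d (k : ℕ) (m : M) : X.lam (k + 1) (X.d m) = X.d.rTensor C.Env (X.lam (k + 1) m)
    + TensorProduct.map X.par C.envDiff.d (X.lam k m) := by
  rw [lam_apply, X.ad_d, map_add, ← rTensor_lTensor_comm, LinearMap.lTensor_map,
    show C.envPr (k + 1) ∘ₗ C.envDiff.d = C.envDiff.d ∘ₗ C.envPr k from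
      LinearMap.ext (C.envPr_envDiff k), ← LinearMap.map_lTensor]
  rfl

theorem smul_s_lam (k : ℕ) (m : M) :
    (2 : ℂ) ^ k • X.s.rTensor C.Env (X.lam k m) = X.lam k (X.s m) := by
  rw [lam_apply, lam_apply, X.ad_s, LinearMap.lTensor_map, rTensor_lTensor,
    ← LinearMap.smul_apply, ← TensorProduct.map_smul_right]
  congr 2
  ext e
  rw [LinearMap.smul_apply, ← C.envGrading.s_pr]
  exact (C.envGrading.map_pr₀ C.envGrading C.envScale.toLinearMap (fun _ => rfl) k e).symm

theorem lam_pr (j k : ℕ) (m : M) : X.lam k (X.pr (j + k) m) = (X.pr j).rTensor C.Env (X.lam k m) :=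
  (X.grading.map_pr_down X.grading.rTensor (X.lam k) k (X.smul_s_lam k) j m).symm

theorem lam_pr_lt {n k : ℕ} (h : n < k) (m : M) : X.lam k (X.pr n m) = 0 :=
  X.grading.map_pr_down_lt X.grading.rTensor (X.lam k) k (X.smul_s_lam k) h m

theorem pr_mem_filt {k : ℕ} (n : ℕ) {m : M} (hm : m ∈ X.filt k) : X.pr n m ∈ X.filt k := by
  intro j hj
  by_cases h : n < j
  · exact X.lam_pr_lt h m
  · obtain ⟨i, rfl⟩ : ∃ i, n = i + j := ⟨n - j, by omega⟩
    rw [lam_pr, hm j hj, map_zero]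

theorem pr_succ_d (k : ℕ) (m : M) : X.pr (k + 1) (X.d m) = X.d (X.pr k m) :=
  X.grading.map_pr X.grading X.d 1 (fun x => by rw [pow_one]; exact X.s_d x) k m

theorem pr_zero_d (m : M) : X.pr 0 (X.d m) = 0 :=
  X.grading.map_pr_lt X.grading X.d 1 (fun x => by rw [pow_one]; exact X.s_d x) one_pos m

theorem exists_mem_filt (m : M) : ∃ k, m ∈ X.filt k := by
  obtain ⟨n, hn, -⟩ := (C.envGrading.lTensor (N := M)).sum (X.ad m)
  exact ⟨n, fun j hj => hn j hj.le⟩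

theorem c_d (m : M) : X.c (X.d m) = X.d.rTensor A (X.c m) := by
  rw [c_apply, X.ad_d, map_add, ← rTensor_lTensor_comm, LinearMap.lTensor_map,
    show C.envZero.toLinearMap ∘ₗ C.envDiff.d = 0 from LinearMap.ext C.envZero_envDiff,
    TensorProduct.map_zero_right, LinearMap.zero_apply, add_zero]
  rfl

theorem c_par (m : M) : X.c (X.par m) = X.par.rTensor A (X.c m) := by
  rw [c_apply, X.ad_par, LinearMap.lTensor_map,
    show C.envZero.toLinearMap ∘ₗ (Super.par (B := C.Env)).toLinearMap = C.envZero.toLinearMap from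
      LinearMap.ext C.envZero_par, c_apply, rTensor_lTensor]

theorem par_mem_filt_zero {m : M} (hm : m ∈ X.filt 0) : X.par m ∈ X.filt 0 := by
  rw [← horMap_eq_zero_iff, horMap, LinearMap.sub_apply, sub_eq_zero, X.ad_par,
    X.ad_eq_of_mem_filt hm, LinearMap.map_lTensor, LinearMap.comp_apply, c_par,
    lTensor_rTensor,
    show (Super.par (B := C.Env)).toLinearMap ∘ₗ C.gA = C.gA from LinearMap.ext C.par_gA]

/-- The coaction on the coefficients of the coaction of `A`, for horizontal elements. -/
theorem ad_c {m : M} (hm : m ∈ X.filt 0) :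
    TensorProduct.assoc ℂ M C.Env A (X.ad.rTensor A (X.c m))
      = (C.gA.rTensor A ∘ₗ Coalgebra.comul).lTensor M (X.c m) := by
  rw [c_apply, rTensor_lTensor_comm, assoc_lTensor, X.coassoc, ← LinearMap.lTensor_comp_apply,
    ← c_apply, X.ad_eq_of_mem_filt hm, ← LinearMap.lTensor_comp_apply]
  congr 2
  ext a
  simp only [LinearMap.comp_apply]
  rw [coE_gA, LinearMap.lTensor_map,
    show C.envZero.toLinearMap ∘ₗ C.gA = LinearMap.id from LinearMap.ext C.envZero_gA]
  rfl

/-- Symbols of products with words. -/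
theorem exists_symbol_word {m : M} (hm : m ∈ X.filt 0) (l : List C.inv) :
    ∃ v ∈ X.filt l.length, X.lam l.length v
      = (LinearMap.mulRight ℂ (C.word l) ∘ₗ C.gA).lTensor M (X.c m) := by
  induction l using List.reverseRecOn with
  | nil =>
    refine ⟨m, hm, ?_⟩
    rw [List.length_nil, ← gA_c, word_nil, LinearMap.mulRight_one]
    rfl
  | append_singleton l w ih =>
    obtain ⟨v, hv, hv'⟩ := ih
    rw [List.length_append, List.length_singleton]
    refine ⟨X.rθ w v, fun j hj => ?_, ?_⟩
    · obtain ⟨j, rfl⟩ : ∃ i, j = i + 1 := ⟨j - 1, by omega⟩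
      rw [lam_apply, X.symbol_rθ j w v (hv _ (by omega)),
        show (C.envPr j).lTensor M (X.ad v) = 0 from hv _ (by omega), map_zero]
    · rw [lam_apply, X.symbol_rθ _ w v (hv _ (by omega)), ← lam_apply, hv',
        ← LinearMap.lTensor_comp_apply]
      congr 2
      ext a
      simp [word_append, mul_assoc, word_cons, word_nil]

theorem exists_symbol_span {m : M} (hm : m ∈ X.filt 0) {k : ℕ} {x : C.Env}
    (hx : x ∈ Submodule.span ℂ {x | ∃ l : List C.inv, l.length = k ∧ x = C.word l}) :
    ∃ v ∈ X.filt k, X.lam k v = (LinearMap.mulRight ℂ x ∘ₗ C.gA).lTensor M (X.c m) := by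
  have hlin : ∀ (x : C.Env) (y : M ⊗[ℂ] A), (LinearMap.mulRight ℂ x ∘ₗ C.gA).lTensor M y
      = LinearMap.lTensorHom M (((LinearMap.mul ℂ C.Env).flip x) ∘ₗ C.gA) y := fun _ _ => rfl
  induction hx using Submodule.span_induction with
  | zero => refine ⟨0, zero_mem _, ?_⟩; rw [hlin]; simp
  | add x y _ _ hx hy =>
    obtain ⟨v, hv, hv'⟩ := hx
    obtain ⟨w, hw, hw'⟩ := hy
    refine ⟨v + w, add_mem hv hw, ?_⟩
    rw [map_add, hv', hw', hlin, hlin, hlin, map_add, LinearMap.add_comp, map_add,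
      LinearMap.add_apply]
  | smul c x _ hx =>
    obtain ⟨v, hv, hv'⟩ := hx
    refine ⟨c • v, Submodule.smul_mem _ _ hv, ?_⟩
    rw [map_smul, hv', hlin, hlin, map_smul, LinearMap.smul_comp, map_smul, LinearMap.smul_apply]
  | mem x hx =>
    obtain ⟨l, rfl, rfl⟩ := hx
    exact X.exists_symbol_word hm l

/-- Every element of degree `k` of the cotensor product is a symbol. -/
theorem exists_symbol {k : ℕ} {t : M ⊗[ℂ] C.Env} (ht : X.IsCot t)
    (hk : (C.envPr k).lTensor M t = t) : ∃ v ∈ X.filt k, X.lam k v = t := by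
  -- The first factors are made horizontal, and each e is written as ∑ e⁽⁻¹⁾ inv(e⁽⁰⁾) with
  -- inv(e⁽⁰⁾) a combination of words. The cotensor condition exchanges e⁽⁻¹⁾ for the coefficients
  -- of the coaction on the first factor, which leaves symbols of products of horizontal elements
  -- with words.
  obtain ⟨q, hq, hq'⟩ := exists_proj LinearMap.id t X.horMap
    (by rw [LinearMap.rTensor_id, LinearMap.id_apply]; exact ht.horMap_rTensor)
  have key : ∀ z : M ⊗[ℂ] C.Env, ∃ v ∈ X.filt k, X.lam k v = (mul₂ C.gA C.envInv).lTensor M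
      (TensorProduct.assoc ℂ M A C.Env (X.c.rTensor C.Env (TensorProduct.map q (C.envPr k) z))) := by
    intro z
    induction z using TensorProduct.induction_on with
    | zero => exact ⟨0, zero_mem _, by simp⟩
    | add x y hx hy =>
      obtain ⟨v, hv, hv'⟩ := hx
      obtain ⟨w, hw, hw'⟩ := hy
      exact ⟨v + w, add_mem hv hw, by simp only [map_add, hv', hw']⟩
    | tmul m e =>
      obtain ⟨v, hv, hv'⟩ := X.exists_symbol_span (X.horMap_eq_zero_iff.1 (hq' m))
        (C.envInv_envPr_mem k e)
      refine ⟨v, hv, hv'.trans ?_⟩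
      simp only [TensorProduct.map_tmul, LinearMap.rTensor_tmul, LinearMap.id_apply]
      generalize X.c (q m) = y
      induction y using TensorProduct.induction_on with
      | zero => simp
      | add s t hs ht => simp only [map_add, TensorProduct.add_tmul, hs, ht]
      | tmul x z => simp
  obtain ⟨v, hv, hv'⟩ := key t
  refine ⟨v, hv, hv'.trans ?_⟩
  rw [← rTensor_lTensor, hk, hq, ht.c_rTensor, ← LinearMap.lTensor_comp_apply,
    show mul₂ C.gA C.envInv ∘ₗ C.lE = LinearMap.id from LinearMap.ext C.mul₂_gA_envInv,
    LinearMap.lTensor_id, LinearMap.id_apply]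

end ExtComodule

/-! ### Averaging with the Haar functional. -/

/-- The Haar functional of `A`, with the invariance of `a, b ↦ h(a κ(b))`. -/
structure IsHaar (h : A →ₗ[ℂ] ℂ) : Prop where
  one : h 1 = 1
  inv : ∀ a, TensorProduct.rid ℂ A (h.lTensor A (Coalgebra.comul (R := ℂ) a)) = h a • 1
  antipode : ∀ a b, TensorProduct.rid ℂ A
      ((h ∘ₗ LinearMap.mulRight ℂ (HopfAlgebra.antipode ℂ b)).lTensor A (Coalgebra.comul (R := ℂ) a))
    = TensorProduct.lid ℂ A ((h ∘ₗ LinearMap.mulLeft ℂ a ∘ₗ HopfAlgebra.antipode ℂ).rTensor A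
      (Coalgebra.comul (R := ℂ) b))

/-- `a, e ↦ ∑ h(a κ(e⁽⁻¹⁾)) e⁽⁰⁾`. -/
def avgE (h : A →ₗ[ℂ] ℂ) : A →ₗ[ℂ] C.Env →ₗ[ℂ] C.Env :=
  LinearMap.mk₂ ℂ (fun a e => TensorProduct.lid ℂ C.Env
      ((h ∘ₗ LinearMap.mulLeft ℂ a ∘ₗ HopfAlgebra.antipode ℂ).rTensor C.Env (C.lE e)))
    (fun a b e => by
      generalize C.lE e = t
      induction t using TensorProduct.induction_on with
      | zero => simp
      | add s t hs ht => simp only [map_add, hs, ht]; abel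
      | tmul x y => simp [add_mul, add_smul])
    (fun c a e => by
      generalize C.lE e = t
      induction t using TensorProduct.induction_on with
      | zero => simp
      | add s t hs ht => simp only [map_add, smul_add, hs, ht]
      | tmul x y => simp [mul_smul])
    (fun a e e' => by simp only [map_add]) (fun c a e => by simp only [map_smul])

theorem avgE_apply (h : A →ₗ[ℂ] ℂ) (a : A) (e : C.Env) : C.avgE h a e = TensorProduct.lid ℂ C.Env
      ((h ∘ₗ LinearMap.mulLeft ℂ a ∘ₗ HopfAlgebra.antipode ℂ).rTensor C.Env (C.lE e)) := rfl

theorem avgE_comm (h : A →ₗ[ℂ] ℂ) (g : C.Env →ₗ[ℂ] C.Env) (hg : ∀ e, C.lE (g e) = g.lTensor A (C.lE e))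
    (a : A) (e : C.Env) : C.avgE h a (g e) = g (C.avgE h a e) := by
  rw [avgE_apply, avgE_apply, hg]
  generalize C.lE e = t
  induction t using TensorProduct.induction_on with
  | zero => simp
  | add s t hs ht => simp only [map_add, hs, ht]
  | tmul x y => simp

theorem avgE_word (h : A →ₗ[ℂ] ℂ) (a b : A) (l : List C.inv) : C.avgE h a (C.gA b * C.word l)
    = C.gA (TensorProduct.lid ℂ A ((h ∘ₗ LinearMap.mulLeft ℂ a ∘ₗ HopfAlgebra.antipode ℂ).rTensor A
      (Coalgebra.comul (R := ℂ) b))) * C.word l := by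
  rw [avgE_apply, lE_word]
  generalize Coalgebra.comul (R := ℂ) b = t
  induction t using TensorProduct.induction_on with
  | zero => simp
  | add s t hs ht => simp only [map_add, add_mul, hs, ht]
  | tmul x y => simp

/-- The invariance of h(aκ(b)) transfers the average from the coefficient b of a word to a, where
coassociativity applies; the words themselves are left-invariant and are not touched. -/
theorem avgE_comul {h : A →ₗ[ℂ] ℂ} (hh : IsHaar h) (a : A) (e : C.Env) :
    ((C.avgE h).flip e).lTensor A (Coalgebra.comul (R := ℂ) a) = C.lE (C.avgE h a e) := by
  induction e using C.env_induction with
  | h0 => simp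
  | hadd x y hx hy =>
    rw [map_add, LinearMap.lTensor_add, LinearMap.add_apply, hx, hy, map_add (C.avgE h a), map_add]
  | hw b l =>
    rw [avgE_word, ← hh.antipode, lE_word]
    have h2 : (C.avgE h).flip (C.gA b * C.word l) = (LinearMap.mulRight ℂ (C.word l) ∘ₗ C.gA) ∘ₗ
        (TensorProduct.rid ℂ A).toLinearMap ∘ₗ
        (h ∘ₗ LinearMap.mulRight ℂ (HopfAlgebra.antipode ℂ b)).lTensor A ∘ₗ Coalgebra.comul := by
      ext x
      rw [LinearMap.flip_apply, avgE_word, ← hh.antipode]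
      rfl
    rw [h2, LinearMap.lTensor_comp_apply]
    congr 1
    have h3 := Coalgebra.coassoc_apply (R := ℂ) a
    have h4 : ∀ t : A ⊗[ℂ] A, ((TensorProduct.rid ℂ A).toLinearMap ∘ₗ
        (h ∘ₗ LinearMap.mulRight ℂ (HopfAlgebra.antipode ℂ b)).lTensor A ∘ₗ
          Coalgebra.comul).lTensor A t
        = ((TensorProduct.rid ℂ A).toLinearMap ∘ₗ
        (h ∘ₗ LinearMap.mulRight ℂ (HopfAlgebra.antipode ℂ b)).lTensor A).lTensor A
          ((Coalgebra.comul (R := ℂ)).lTensor A t) := fun t =>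
      (LinearMap.lTensor_comp_apply A ((TensorProduct.rid ℂ A).toLinearMap ∘ₗ
        (h ∘ₗ LinearMap.mulRight ℂ (HopfAlgebra.antipode ℂ b)).lTensor A) Coalgebra.comul t)
    rw [h4, ← h3]
    generalize Coalgebra.comul (R := ℂ) a = t
    induction t using TensorProduct.induction_on with
    | zero => simp
    | add s t hs ht => simp only [map_add, hs, ht]
    | tmul x y =>
      simp only [LinearMap.rTensor_tmul, LinearMap.lTensor_tmul, TensorProduct.rid_tmul, map_smul]
      generalize Coalgebra.comul (R := ℂ) x = t
      induction t using TensorProduct.induction_on with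
      | zero => simp
      | add s t hs ht => simp only [map_add, TensorProduct.add_tmul, smul_add, hs, ht]
      | tmul x z => simp

/-- Coassociativity turns the left-hand side into ∑ h(e⁽⁻²⁾κ(e⁽⁻¹⁾)) e⁽⁰⁾, and the antipode reduces
it to h(1)e. Hence averaging fixes the cotensor product. -/
theorem avgE_lE {h : A →ₗ[ℂ] ℂ} (hh : IsHaar h) (e : C.Env) :
    TensorProduct.lift (C.avgE h) (C.lE e) = e := by
  have hS : ∀ a : A, TensorProduct.lift ((LinearMap.mul ℂ A).compl₂ (HopfAlgebra.antipode ℂ))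
      (Coalgebra.comul (R := ℂ) a) = Coalgebra.counit (R := ℂ) a • 1 := fun a => by
    have h1 := HopfAlgebra.mul_antipode_lTensor_comul_apply (R := ℂ) a
    rw [Algebra.algebraMap_eq_smul_one] at h1
    rw [← h1]
    generalize Coalgebra.comul (R := ℂ) a = t
    induction t using TensorProduct.induction_on with
    | zero => simp
    | add s t hs ht => simp only [map_add, hs, ht]
    | tmul x z => simp
  have h1 : ∀ t : A ⊗[ℂ] C.Env, TensorProduct.lift (C.avgE h) t
      = TensorProduct.lid ℂ C.Env ((h ∘ₗ TensorProduct.lift ((LinearMap.mul ℂ A).compl₂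
        (HopfAlgebra.antipode ℂ))).rTensor C.Env ((TensorProduct.assoc ℂ A A C.Env).symm
          (C.lE.lTensor A t))) := fun t => by
    induction t using TensorProduct.induction_on with
    | zero => simp
    | add s t hs ht => simp only [map_add, hs, ht]
    | tmul x e =>
      rw [TensorProduct.lift.tmul, avgE_apply, LinearMap.lTensor_tmul]
      generalize C.lE e = t
      induction t using TensorProduct.induction_on with
      | zero => simp
      | add s t hs ht => simp only [map_add, TensorProduct.tmul_add, hs, ht]
      | tmul x z => simp
  rw [h1, ← lE_coassoc, LinearEquiv.symm_apply_apply, ← LinearMap.rTensor_comp_apply]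
  conv_rhs => rw [← C.lE_counit e]
  congr 3
  ext a
  simp [hS, hh.one]

namespace ExtComodule
variable {C} {M : Type*} [AddCommGroup M] [Module ℂ M] (X : C.ExtComodule M) {h : A →ₗ[ℂ] ℂ}

/-- The projection to the cotensor product. -/
def avg (h : A →ₗ[ℂ] ℂ) : M ⊗[ℂ] C.Env →ₗ[ℂ] M ⊗[ℂ] C.Env :=
  (TensorProduct.lift (C.avgE h)).lTensor M ∘ₗ (TensorProduct.assoc ℂ M A C.Env).toLinearMap ∘ₗ
    X.c.rTensor C.Env

theorem avg_tmul (m : M) (e : C.Env) : X.avg h (m ⊗ₜ e) = ((C.avgE h).flip e).lTensor M (X.c m) := by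
  simp only [avg, LinearMap.comp_apply, LinearMap.rTensor_tmul]
  generalize X.c m = t
  induction t using TensorProduct.induction_on with
  | zero => simp
  | add s t hs ht => simp only [map_add, TensorProduct.add_tmul, hs, ht]
  | tmul x z => simp

theorem avg_of_isCot (hh : IsHaar h) {t : M ⊗[ℂ] C.Env} (ht : X.IsCot t) : X.avg h t = t := by
  simp only [avg, LinearMap.comp_apply, LinearEquiv.coe_coe]
  rw [ht.c_rTensor, ← LinearMap.lTensor_comp_apply,
    show TensorProduct.lift (C.avgE h) ∘ₗ C.lE = LinearMap.id from LinearMap.ext (C.avgE_lE hh),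
    LinearMap.lTensor_id, LinearMap.id_apply]

theorem avg_map (f : M →ₗ[ℂ] M) (g : C.Env →ₗ[ℂ] C.Env) (hf : ∀ m, X.c (f m) = f.rTensor A (X.c m))
    (hg : ∀ e, C.lE (g e) = g.lTensor A (C.lE e)) (t : M ⊗[ℂ] C.Env) :
    X.avg h (TensorProduct.map f g t) = TensorProduct.map f g (X.avg h t) := by
  induction t using TensorProduct.induction_on with
  | zero => simp
  | add s t hs ht => simp only [map_add, hs, ht]
  | tmul m e =>
    rw [TensorProduct.map_tmul, avg_tmul, avg_tmul, hf, lTensor_rTensor, LinearMap.map_lTensor]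
    congr 2
    ext a
    exact C.avgE_comm h g hg a e

theorem avg_lTensor (g : C.Env →ₗ[ℂ] C.Env) (hg : ∀ e, C.lE (g e) = g.lTensor A (C.lE e))
    (t : M ⊗[ℂ] C.Env) : X.avg h (g.lTensor M t) = g.lTensor M (X.avg h t) :=
  X.avg_map LinearMap.id g (fun m => by rw [LinearMap.rTensor_id, LinearMap.id_apply]; rfl) hg t

theorem avg_rTensor (f : M →ₗ[ℂ] M) (hf : ∀ m, X.c (f m) = f.rTensor A (X.c m))
    (t : M ⊗[ℂ] C.Env) : X.avg h (f.rTensor C.Env t) = f.rTensor C.Env (X.avg h t) :=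
  X.avg_map f LinearMap.id hf (fun e => by rw [LinearMap.lTensor_id, LinearMap.id_apply]; rfl) t

/-- For a horizontal element the coaction on the coefficients of the A-coaction is the coproduct of
A (`ad_c`), and `avgE_comul` intertwines this with the left coaction on the second factor. A linear
map f with horizontal values, rather than a submodule, fits the later constructions, which choose
first factors by a projection. -/
theorem isCot_avg (hh : IsHaar h) {N : Type*} [AddCommGroup N] [Module ℂ N] (f : N →ₗ[ℂ] M)
    (hf : ∀ n, f n ∈ X.filt 0) (t : N ⊗[ℂ] C.Env) : X.IsCot (X.avg h (f.rTensor C.Env t)) := by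
  induction t using TensorProduct.induction_on with
  | zero => simp [IsCot]
  | add s t hs ht => simp only [IsCot, map_add] at hs ht ⊢; rw [hs, ht]
  | tmul n e =>
    rw [LinearMap.rTensor_tmul, avg_tmul, IsCot, rTensor_lTensor_comm, assoc_lTensor,
      X.ad_c (hf n), ← LinearMap.lTensor_comp_apply, ← LinearMap.lTensor_comp_apply]
    congr 2
    ext a
    simp only [LinearMap.comp_apply]
    rw [LinearMap.flip_apply, ← C.avgE_comul hh, rTensor_lTensor_comm]

/-- The average of an element over the coaction of `A`. -/
def avgA (h : A →ₗ[ℂ] ℂ) : M →ₗ[ℂ] M := (TensorProduct.rid ℂ M).toLinearMap ∘ₗ h.lTensor M ∘ₗ X.c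

/-- For horizontal m the coaction on the coefficients of m is given by the coproduct of A, and the
invariance of h replaces the coefficient by h(a)·1. -/
theorem ad_avgA (hh : IsHaar h) {m : M} (hm : m ∈ X.filt 0) :
    X.ad (X.avgA h m) = X.avgA h m ⊗ₜ 1 := by
  have h1 := X.ad_c hm
  have h2 := congrArg ((TensorProduct.rid ℂ C.Env).toLinearMap.lTensor M ∘ₗ
    (h.lTensor C.Env).lTensor M) h1
  have e1 : ∀ t : M ⊗[ℂ] A, ((TensorProduct.rid ℂ C.Env).toLinearMap.lTensor M ∘ₗ
      (h.lTensor C.Env).lTensor M) (TensorProduct.assoc ℂ M C.Env A (X.ad.rTensor A t))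
      = X.ad (TensorProduct.rid ℂ M (h.lTensor M t)) := fun t => by
    induction t using TensorProduct.induction_on with
    | zero => simp
    | add s t hs ht => simp only [map_add, hs, ht]
    | tmul m a =>
      simp only [LinearMap.rTensor_tmul, LinearMap.lTensor_tmul, TensorProduct.rid_tmul, map_smul]
      generalize X.ad m = t
      induction t using TensorProduct.induction_on with
      | zero => simp
      | add s t hs ht => simp only [map_add, TensorProduct.add_tmul, smul_add, hs, ht]
      | tmul x z => simp
  have e2 : ∀ t : M ⊗[ℂ] A, ((TensorProduct.rid ℂ C.Env).toLinearMap.lTensor M ∘ₗ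
      (h.lTensor C.Env).lTensor M) ((C.gA.rTensor A ∘ₗ Coalgebra.comul).lTensor M t)
      = TensorProduct.rid ℂ M (h.lTensor M t) ⊗ₜ 1 := fun t => by
    induction t using TensorProduct.induction_on with
    | zero => simp
    | add s t hs ht => simp only [map_add, TensorProduct.add_tmul, hs, ht]
    | tmul m a =>
      have h3 := congrArg C.gA (hh.inv a)
      rw [map_smul, gA_one] at h3
      simp only [LinearMap.lTensor_tmul, LinearMap.comp_apply, TensorProduct.rid_tmul,
        LinearEquiv.coe_coe]
      rw [TensorProduct.smul_tmul, ← h3]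
      congr 1
      generalize Coalgebra.comul (R := ℂ) a = t
      induction t using TensorProduct.induction_on with
      | zero => simp
      | add s t hs ht => simp only [map_add, hs, ht]
      | tmul x z => simp
  rw [e1, e2] at h2
  exact h2

end ExtComodule

/-! ### Acyclicity of a comodule, of its `loc` complex and of its basic elements. -/

namespace ExtComodule
variable {C} {M : Type*} [AddCommGroup M] [Module ℂ M] (X : C.ExtComodule M) {h : A →ₗ[ℂ] ℂ}

/-- The horizontal elements whose coefficients are closed. -/
def loc : Submodule ℂ M := LinearMap.ker X.horMap ⊓ LinearMap.ker (C.envDiff.d.lTensor M ∘ₗ X.ad)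

theorem mem_loc {m : M} : m ∈ X.loc ↔ m ∈ X.filt 0 ∧ C.envDiff.d.lTensor M (X.ad m) = 0 := by
  rw [← horMap_eq_zero_iff]; rfl

theorem map_par_eq_zero {t : M ⊗[ℂ] C.Env}
    (h : TensorProduct.map X.par C.envDiff.d t = 0) : C.envDiff.d.lTensor M t = 0 := by
  have h2 := congrArg (X.par.rTensor C.Env) h
  rw [map_zero, LinearMap.rTensor_map,
    show X.par ∘ₗ X.par = LinearMap.id from LinearMap.ext X.par_par] at h2
  exact h2

theorem ad_eq_lam_zero {m : M} (hm : m ∈ X.filt 0) : X.ad m = X.lam 0 m := by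
  rw [X.ad_eq_of_mem_filt hm, gA_c]

/-- For horizontal m the part of degree one of the coaction on dm is par ⊗ d applied to the coaction
on m. As par is invertible, closed coefficients mean that dm is horizontal. -/
theorem mem_loc_of_lam_d {m : M} (hm : m ∈ X.filt 0) (hd : X.lam 1 (X.d m) = 0) : m ∈ X.loc := by
  refine X.mem_loc.2 ⟨hm, ?_⟩
  have h1 := X.lam_succ_d 0 m
  rw [show X.lam (0 + 1) (X.d m) = 0 from hd, hm (0 + 1) (by omega), map_zero, zero_add] at h1
  rw [X.ad_eq_lam_zero hm]
  exact X.map_par_eq_zero h1.symm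

theorem pr_mem_loc (n : ℕ) {m : M} (hm : m ∈ X.loc) : X.pr n m ∈ X.loc := by
  obtain ⟨h1, h2⟩ := X.mem_loc.1 hm
  have h3 := X.pr_mem_filt n h1
  refine X.mem_loc.2 ⟨h3, ?_⟩
  rw [X.ad_eq_lam_zero h3, show n = n + 0 from rfl, lam_pr, ← X.ad_eq_lam_zero h1,
    ← rTensor_lTensor_comm, h2, map_zero]

/-- The coefficients of a symbol, made closed. -/
theorem exists_proj_loc {t : M ⊗[ℂ] C.Env} {j K : ℕ} (ht : X.IsCot t)
    (hK : (C.envPr K).lTensor M t = t) (hs : X.s.rTensor C.Env t = (2 : ℂ) ^ j • t)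
    (hd : C.envDiff.d.lTensor M t = 0) (χ : C.Env →ₗ[ℂ] C.Env) (hχ : ∀ x, χ (C.envDiff.d x) = 0)
    (hdχ : TensorProduct.map X.d χ t = 0) :
    ∃ q : M →ₗ[ℂ] M, q.rTensor C.Env (χ.lTensor M t) = χ.lTensor M t ∧
      ∀ m, q m ∈ X.loc ∧ X.d (q m) = 0 ∧ X.s (q m) = (2 : ℂ) ^ j • q m := by
  obtain ⟨hE, hE'⟩ := exists_pseudoinverse C.envDiff.d
  set τ := χ.lTensor M t with hτ
  have h1 : X.horMap.rTensor C.Env τ = 0 := by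
    rw [hτ, rTensor_lTensor_comm, ht.horMap_rTensor, map_zero]
  -- The cotensor condition replaces the coaction on the first factors by the left coaction on the
  -- second. Once t is written with closed homogeneous second factors, `lE_closed` says that the
  -- coefficients in A are closed after χ.
  have h2 : (C.envDiff.d.lTensor M ∘ₗ X.ad).rTensor C.Env τ = 0 := by
    apply (TensorProduct.assoc ℂ M C.Env C.Env).injective
    rw [LinearMap.rTensor_comp_apply, assoc_rTensor_lTensor, hτ, rTensor_lTensor_comm,
      assoc_lTensor, ht, ← LinearMap.lTensor_comp_apply, ← LinearMap.lTensor_comp_apply, map_zero]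
    have ht2 : t = (C.envPr K ∘ₗ (LinearMap.id - hE ∘ₗ C.envDiff.d)).lTensor M t := by
      rw [LinearMap.lTensor_comp_apply, LinearMap.lTensor_sub, LinearMap.sub_apply,
        LinearMap.lTensor_comp_apply, hd, map_zero, sub_zero, LinearMap.lTensor_id,
        LinearMap.id_apply, hK]
    rw [ht2, ← LinearMap.lTensor_comp_apply]
    convert LinearMap.zero_apply (σ₁₂ := RingHom.id ℂ) t using 2
    rw [← LinearMap.lTensor_zero]
    congr 1
    ext e
    simp only [LinearMap.comp_apply, LinearMap.zero_apply]
    set y := (LinearMap.id - hE ∘ₗ C.envDiff.d : C.Env →ₗ[ℂ] C.Env) e with hy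
    have hdy : C.envDiff.d y = 0 := by
      rw [hy, LinearMap.sub_apply, LinearMap.id_apply, LinearMap.comp_apply, map_sub, hE', sub_self]
    have h3 := C.lE_closed χ hχ (C.envGrading.pr_pr K y) (by rw [← envPr_envDiff, hdy, map_zero])
    rw [← h3, lTensor_rTensor, LinearMap.rTensor_map]
  have h3 : X.d.rTensor C.Env τ = 0 := by rw [hτ, rTensor_lTensor, hdχ]
  have h4 : (X.s - (2 : ℂ) ^ j • LinearMap.id).rTensor C.Env τ = 0 := by
    rw [LinearMap.rTensor_sub, LinearMap.sub_apply, LinearMap.rTensor_smul, LinearMap.smul_apply,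
      LinearMap.rTensor_id, LinearMap.id_apply, hτ, rTensor_lTensor_comm, hs, map_smul, sub_self]
  -- The four conditions on the first factors are imposed one after the other. Each new projection
  -- is composed on the right, so its values still pass through the earlier ones and the earlier
  -- conditions persist.
  obtain ⟨q1, e1, f1⟩ := exists_proj LinearMap.id τ X.horMap
    (by rw [LinearMap.rTensor_id, LinearMap.id_apply]; exact h1)
  obtain ⟨q2, e2, f2⟩ := exists_proj q1 τ _ (by rw [e1]; exact h2)
  have e2' : (q1 ∘ₗ q2).rTensor C.Env τ = τ := by rw [LinearMap.rTensor_comp_apply, e2, e1]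
  obtain ⟨q3, e3, f3⟩ := exists_proj (q1 ∘ₗ q2) τ _ (by rw [e2']; exact h3)
  have e3' : ((q1 ∘ₗ q2) ∘ₗ q3).rTensor C.Env τ = τ := by
    rw [LinearMap.rTensor_comp_apply, e3, e2']
  obtain ⟨q4, e4, f4⟩ := exists_proj ((q1 ∘ₗ q2) ∘ₗ q3) τ _ (by rw [e3']; exact h4)
  refine ⟨((q1 ∘ₗ q2) ∘ₗ q3) ∘ₗ q4, by rw [LinearMap.rTensor_comp_apply, e4, e3'],
    fun m => ⟨⟨f1 _, f2 _⟩, f3 _, ?_⟩⟩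
  have := f4 m
  rwa [LinearMap.sub_apply, LinearMap.smul_apply, LinearMap.id_apply, sub_eq_zero] at this

/-- The symbol of an element with a differential of lower filtration can be removed by adding a
coboundary. -/
theorem exists_reduce (hh : IsHaar h) {n k : ℕ} {u : M} (hs : X.s u = (2 : ℂ) ^ n • u)
    (hu : u ∈ X.filt (k + 1)) (hdu : X.d u ∈ X.filt k)
    (H : ∀ j, j + k + 1 = n → ∀ b ∈ X.loc, X.d b = 0 → X.s b = (2 : ℂ) ^ j • b →
      ∃ b' ∈ X.loc, X.d b' = b) : ∃ v, u - X.d v ∈ X.filt k := by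
  by_cases hn : n < k + 1
  · refine ⟨0, fun j hj => ?_⟩
    rw [map_zero, sub_zero, ← X.grading.pr_eq n u hs]
    exact X.lam_pr_lt (by omega) u
  obtain ⟨j, rfl⟩ : ∃ j, n = j + (k + 1) := ⟨n - (k + 1), by omega⟩
  set t := X.lam (k + 1) u with ht
  have hcot : X.IsCot t := X.isCot_lam hu
  have hpr : (C.envPr (k + 1)).lTensor M t = t := C.envGrading.lTensor.pr_pr _ _
  obtain ⟨hE, hE'⟩ := exists_pseudoinverse C.envDiff.d
  have hst : X.s.rTensor C.Env t = (2 : ℂ) ^ j • t := by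
    have h1 := X.smul_s_lam (k + 1) u
    rw [hs, map_smul, ← ht] at h1
    have h2 : (2 : ℂ) ^ (k + 1) • (X.s.rTensor C.Env t - (2 : ℂ) ^ j • t) = 0 := by
      rw [smul_sub, h1, smul_smul, ← pow_add, add_comm (k + 1), sub_self]
    exact sub_eq_zero.1 ((smul_eq_zero.1 h2).resolve_left (pow_ne_zero _ two_ne_zero))
  have hdt : C.envDiff.d.lTensor M t = 0 := by
    have h1 := X.lam_succ_d (k + 1) u
    rw [hdu _ (by omega), hu _ (by omega), map_zero, zero_add] at h1
    exact X.map_par_eq_zero h1.symm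
  -- χ vanishes on exact elements and differs from the projection to degree k + 1 by exact elements,
  -- so it represents the passage to cohomology in the second factor.
  let χ : C.Env →ₗ[ℂ] C.Env := C.envPr (k + 1) ∘ₗ (LinearMap.id - C.envDiff.d ∘ₗ hE)
  have hχ : ∀ x, χ (C.envDiff.d x) = 0 := fun x => by
    simp [χ, hE']
  have hdχ : TensorProduct.map X.d χ t = 0 := by
    have h1 := X.lam_succ_d k u
    rw [hdu _ (by omega), ← ht] at h1
    have h2 := congrArg (χ.lTensor M) h1
    rw [map_zero, map_add, ← rTensor_lTensor_comm, rTensor_lTensor, LinearMap.lTensor_map,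
      show χ ∘ₗ C.envDiff.d = 0 from LinearMap.ext hχ, TensorProduct.map_zero_right,
      LinearMap.zero_apply, add_zero] at h2
    exact h2.symm
  obtain ⟨q, hq, hq'⟩ := X.exists_proj_loc hcot hpr hst hdt χ hχ hdχ
  set τ := χ.lTensor M t with hτ
  -- The primitives in `loc` are chosen linearly, so that the choice can be applied to the first
  -- factors of a tensor.
  obtain ⟨b, hb⟩ := exists_linear_lift (X.d ∘ₗ X.loc.subtype) q (fun m => by
    obtain ⟨b', hb', hb''⟩ := H j (by omega) (q m) (hq' m).1 (hq' m).2.1 (hq' m).2.2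
    exact ⟨⟨b', hb'⟩, hb''⟩)
  let β : M →ₗ[ℂ] M := X.loc.subtype ∘ₗ b
  have hβ : ∀ m, β m ∈ X.filt 0 := fun m => (X.mem_loc.1 (b m).2).1
  have hdβ : X.d ∘ₗ β = q := LinearMap.ext hb
  have hprτ : (C.envPr (k + 1)).lTensor M τ = τ := by
    rw [hτ, ← LinearMap.lTensor_comp_apply]
    congr 2
    ext e; exact C.envGrading.pr_pr _ _
  have hdτ : C.envDiff.d.lTensor M τ = 0 := by
    rw [hτ, ← LinearMap.lTensor_comp_apply,
      show C.envDiff.d ∘ₗ χ = C.envPr (k + 2) ∘ₗ C.envDiff.d from LinearMap.ext fun e => by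
        simp only [χ, LinearMap.comp_apply]
        rw [← envPr_envDiff, LinearMap.sub_apply, map_sub, LinearMap.comp_apply, C.envDiff.d_d,
          sub_zero, LinearMap.id_apply], LinearMap.lTensor_comp_apply, hdt, map_zero]
  -- the first correction
  set p := X.avg h (β.rTensor C.Env τ) with hp
  have hpcot : X.IsCot p := X.isCot_avg hh β hβ τ
  have hppr : (C.envPr (k + 1)).lTensor M p = p := by
    rw [hp, ← X.avg_lTensor _ (C.lE_envPr _), ← rTensor_lTensor_comm, hprτ]
  have hpd : C.envDiff.d.lTensor M p = 0 := by
    rw [hp, ← X.avg_lTensor _ C.lE_envDiff, ← rTensor_lTensor_comm, hdτ, map_zero, map_zero]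
  have hdp : X.d.rTensor C.Env p = X.avg h τ := by
    rw [hp, ← X.avg_rTensor _ X.c_d, ← LinearMap.rTensor_comp_apply, hdβ, hq]
  obtain ⟨v, hv, hv'⟩ := X.exists_symbol hpcot hppr
  have hw : u - X.d v ∈ X.filt (k + 1) := by
    refine sub_mem hu fun i hi => ?_
    obtain ⟨i, rfl⟩ : ∃ i', i = i' + 1 := ⟨i - 1, by omega⟩
    rw [lam_succ_d, hv _ hi, map_zero, zero_add]
    by_cases hik : i = k + 1
    · subst hik
      rw [hv', ← rTensor_lTensor, hpd, map_zero]
    · rw [hv i (by omega), map_zero]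
  set x := X.lam (k + 1) (u - X.d v) with hx
  have hxcot : X.IsCot x := X.isCot_lam hw
  have hxpr : (C.envPr (k + 1)).lTensor M x = x := C.envGrading.lTensor.pr_pr _ _
  -- The new symbol is t minus the average of τ, up to an exact term from `lam k v`. Averaging fixes
  -- t and commutes with d, and t - τ is exact in the second factor; so the cohomology class of the
  -- symbol is gone.
  obtain ⟨y, hy⟩ : ∃ y, x = C.envDiff.d.lTensor M y := by
    have h1 : t - τ = C.envDiff.d.lTensor M ((C.envPr k ∘ₗ hE).lTensor M t) := by
      rw [← LinearMap.lTensor_comp_apply, hτ]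
      conv_lhs => rw [← hpr]
      rw [hpr]
      have h2 : C.envDiff.d ∘ₗ C.envPr k ∘ₗ hE = C.envPr (k + 1) - χ := by
        ext e
        simp only [χ, LinearMap.comp_apply, LinearMap.sub_apply, LinearMap.id_apply, map_sub]
        rw [← envPr_envDiff]; abel
      rw [h2, LinearMap.lTensor_sub, LinearMap.sub_apply, hpr]
    refine ⟨X.avg h ((C.envPr k ∘ₗ hE).lTensor M t) - X.par.rTensor C.Env (X.lam k v), ?_⟩
    rw [hx, map_sub, lam_succ_d, hv', hdp, ← ht, map_sub, ← X.avg_lTensor _ C.lE_envDiff, ← h1,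
      map_sub, X.avg_of_isCot hh hcot, lTensor_rTensor, sub_sub]
  -- the second correction
  obtain ⟨q3, hq3, hq3'⟩ := exists_proj LinearMap.id x X.horMap
    (by rw [LinearMap.rTensor_id, LinearMap.id_apply]; exact hxcot.horMap_rTensor)
  have hq3f : ∀ m, (X.par ∘ₗ q3) m ∈ X.filt 0 := fun m =>
    X.par_mem_filt_zero (X.horMap_eq_zero_iff.1 (hq3' m))
  -- The map q3 makes the first factors horizontal, as the averaging requires, and par compensates
  -- for the parity in `lam_succ_d`. The coboundary of an element with symbol y' then has exactly
  -- the symbol x.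
  set y' := X.avg h ((X.par ∘ₗ q3).rTensor C.Env ((C.envPr k).lTensor M y)) with hy'
  have hycot : X.IsCot y' := X.isCot_avg hh _ hq3f _
  have hypr : (C.envPr k).lTensor M y' = y' := by
    rw [hy', ← X.avg_lTensor _ (C.lE_envPr _), ← rTensor_lTensor_comm]
    congr 2
    exact C.envGrading.lTensor.pr_pr _ _
  obtain ⟨v', hw1, hw2⟩ := X.exists_symbol hycot hypr
  have hx2 : TensorProduct.map X.par C.envDiff.d y' = x := by
    rw [hy', ← X.avg_map _ _ X.c_par C.lE_envDiff, rTensor_lTensor, TensorProduct.map_map,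
      show X.par ∘ₗ X.par ∘ₗ q3 = q3 from LinearMap.ext fun m => X.par_par _,
      show C.envDiff.d ∘ₗ C.envPr k = C.envPr (k + 1) ∘ₗ C.envDiff.d from
        LinearMap.ext fun e => (C.envPr_envDiff k e).symm, ← rTensor_lTensor,
      LinearMap.lTensor_comp_apply, ← hy, hxpr, hq3, X.avg_of_isCot hh hxcot]
  refine ⟨v + v', fun i hi => ?_⟩
  rw [map_add, ← sub_sub, map_sub]
  obtain ⟨i, rfl⟩ : ∃ i', i = i' + 1 := ⟨i - 1, by omega⟩
  by_cases hik : i = k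
  · subst hik
    rw [lam_succ_d, hw1 _ (by omega), map_zero, zero_add, hw2, hx2, ← hx, sub_self]
  · rw [hw _ (by omega), lam_succ_d, hw1 _ (by omega), hw1 _ (by omega), map_zero, map_zero]
    simp

/-- A homogeneous version of `exists_reduce`. -/
theorem exists_reduce_hom (hh : IsHaar h) {n k : ℕ} {u : M} (hs : X.s u = (2 : ℂ) ^ n • u)
    (hu : u ∈ X.filt (k + 1)) (hdu : X.d u ∈ X.filt k)
    (H : ∀ j, j + k + 1 = n → ∀ b ∈ X.loc, X.d b = 0 → X.s b = (2 : ℂ) ^ j • b →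
      ∃ b' ∈ X.loc, X.d b' = b) :
    ∃ v, u - X.d v ∈ X.filt k ∧ X.s (u - X.d v) = (2 : ℂ) ^ n • (u - X.d v) := by
  obtain ⟨v, hv⟩ := X.exists_reduce hh hs hu hdu H
  have h1 := X.pr_mem_filt n hv
  have h2 := X.grading.s_pr n (u - X.d v)
  rw [map_sub, X.grading.pr_eq n u hs] at h1 h2
  cases n with
  | zero =>
    rw [pr_zero_d, ← map_zero X.d] at h1 h2
    exact ⟨0, h1, h2⟩
  | succ n =>
    rw [pr_succ_d] at h1 h2
    exact ⟨_, h1, h2⟩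

/-- A cocycle is a coboundary if its homogeneous components are. -/
theorem exists_of_pr (S : Submodule ℂ M) (m : M) (H : ∀ k, ∃ b ∈ S, X.d b = X.pr k m) :
    ∃ b ∈ S, X.d b = m := by
  obtain ⟨n, -, hn⟩ := X.grading.sum m
  choose b hb hb' using H
  refine ⟨∑ k ∈ Finset.range n, b k, S.sum_mem fun k _ => hb k, ?_⟩
  rw [map_sum]
  exact (Finset.sum_congr rfl fun k _ => hb' k).trans hn

theorem d_pr_eq_zero {m : M} (hm : X.d m = 0) (k : ℕ) : X.d (X.pr k m) = 0 := by
  rw [← pr_succ_d, hm, map_zero]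

/-- If the complex of the horizontal elements with closed coefficients is acyclic, then so is the
whole complex. -/
theorem acyclic_of_loc (hh : IsHaar h) (H : ∀ b ∈ X.loc, X.d b = 0 → ∃ b' ∈ X.loc, X.d b' = b)
    {m : M} (hm : X.d m = 0) : ∃ m', X.d m' = m := by
  have key : ∀ k n u, X.s u = (2 : ℂ) ^ n • u → X.d u = 0 → u ∈ X.filt k → ∃ m', X.d m' = u := by
    intro k
    induction k with
    | zero =>
      intro n u _ hd hu
      obtain ⟨b, -, hb⟩ := H u (X.mem_loc_of_lam_d hu (by rw [hd, map_zero])) hd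
      exact ⟨b, hb⟩
    | succ k ih =>
      intro n u hs hd hu
      obtain ⟨v, h1, h2⟩ := X.exists_reduce_hom hh hs hu (by rw [hd]; exact zero_mem _)
        (fun j _ b hb hb' _ => H b hb hb')
      obtain ⟨m', hm'⟩ := ih n _ h2 (by rw [map_sub, hd, X.d_d, sub_zero]) h1
      exact ⟨m' + v, by rw [map_add, hm', sub_add_cancel]⟩
  obtain ⟨b, -, hb⟩ := X.exists_of_pr ⊤ m (fun n => by
    obtain ⟨k, hk⟩ := X.exists_mem_filt (X.pr n m)
    obtain ⟨b, hb⟩ := key k n _ (X.grading.s_pr n m) (X.d_pr_eq_zero hm n) hk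
    exact ⟨b, trivial, hb⟩)
  exact ⟨b, hb⟩

/-- If the complex is acyclic, then so is the complex of the horizontal elements with closed
coefficients. -/
theorem loc_acyclic (hh : IsHaar h) (H : ∀ m, X.d m = 0 → ∃ m', X.d m' = m) {b : M}
    (hb : b ∈ X.loc) (hdb : X.d b = 0) : ∃ b' ∈ X.loc, X.d b' = b := by
  have key : ∀ n, ∀ b ∈ X.loc, X.d b = 0 → X.s b = (2 : ℂ) ^ n • b → ∃ b' ∈ X.loc, X.d b' = b := by
    intro n
    -- A primitive of b has degree one less than b, and the first factors of its symbol of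
    -- filtration k + 1 have degree lower still. The acyclicity of `loc` that the reduction needs is
    -- therefore the induction hypothesis.
    induction n using Nat.strong_induction_on with
    | _ n ih =>
    intro b hb hdb hs
    obtain ⟨u₀, hu₀⟩ := H b hdb
    have h0 := X.grading.pr_eq n b hs
    rw [← hu₀] at h0
    cases n with
    | zero =>
      rw [pr_zero_d] at h0
      exact ⟨0, zero_mem _, by rw [map_zero, h0, hu₀]⟩
    | succ n =>
      rw [pr_succ_d, hu₀] at h0
      have step : ∀ k u, X.s u = (2 : ℂ) ^ n • u → X.d u = b → u ∈ X.filt k →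
          ∃ b' ∈ X.loc, X.d b' = b := by
        intro k
        induction k with
        | zero =>
          intro u _ hd hu
          exact ⟨u, X.mem_loc_of_lam_d hu (by rw [hd]; exact (X.mem_loc.1 hb).1 1 one_pos), hd⟩
        | succ k ihk =>
          intro u hs hd hu
          obtain ⟨v, h1, h2⟩ := X.exists_reduce_hom hh hs hu
            (fun j hj => by rw [hd]; exact (X.mem_loc.1 hb).1 j (by omega))
            (fun j hj => ih j (by omega))
          exact ihk _ h2 (by rw [map_sub, hd, X.d_d, sub_zero]) h1
      obtain ⟨k, hk⟩ := X.exists_mem_filt (X.pr n u₀)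
      exact step k _ (X.grading.s_pr n u₀) h0 hk
  exact X.exists_of_pr X.loc b (fun n => key n _ (X.pr_mem_loc n hb) (X.d_pr_eq_zero hdb n)
    (X.grading.s_pr n b))

/-- The basic elements. -/
def basic : Submodule ℂ M := LinearMap.ker (X.ad - (TensorProduct.mk ℂ M C.Env).flip 1)

theorem mem_basic {m : M} : m ∈ X.basic ↔ X.ad m = m ⊗ₜ 1 := by
  rw [basic, LinearMap.mem_ker, LinearMap.sub_apply, sub_eq_zero]; rfl

theorem c_of_mem_basic {m : M} (hm : m ∈ X.basic) : X.c m = m ⊗ₜ 1 := by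
  rw [c_apply, X.mem_basic.1 hm, LinearMap.lTensor_tmul, AlgHom.toLinearMap_apply, map_one]

theorem basic_le_loc : X.basic ≤ X.loc := fun m hm => by
  have h := X.mem_basic.1 hm
  refine X.mem_loc.2 ⟨X.horMap_eq_zero_iff.1 ?_, ?_⟩
  · rw [horMap, LinearMap.sub_apply, h, LinearMap.comp_apply, X.c_of_mem_basic hm,
      LinearMap.lTensor_tmul, gA_one, sub_self]
  · rw [h, LinearMap.lTensor_tmul, C.envDiff.d_one, TensorProduct.tmul_zero]

theorem avgA_mem_basic (hh : IsHaar h) {m : M} (hm : m ∈ X.filt 0) : X.avgA h m ∈ X.basic :=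
  X.mem_basic.2 (X.ad_avgA hh hm)

theorem avgA_of_c (hh : IsHaar h) {m : M} (hm : X.c m = m ⊗ₜ 1) : X.avgA h m = m := by
  simp only [avgA, LinearMap.comp_apply, hm, LinearMap.lTensor_tmul, hh.one, LinearEquiv.coe_coe,
    TensorProduct.rid_tmul, one_smul]

theorem d_avgA (m : M) : X.d (X.avgA h m) = X.avgA h (X.d m) := by
  simp only [avgA, LinearMap.comp_apply, c_d]
  generalize X.c m = t
  induction t using TensorProduct.induction_on with
  | zero => simp
  | add s t hs ht => simp only [map_add, hs, ht]
  | tmul x z => simp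

/-- A basic cocycle has a primitive in `loc`. Being horizontal, this primitive has a basic average,
which is still a primitive because averaging commutes with d and fixes the given cocycle. -/
theorem basic_acyclic (hh : IsHaar h) (H : ∀ m, X.d m = 0 → ∃ m', X.d m' = m) {b : M}
    (hb : b ∈ X.basic) (hdb : X.d b = 0) : ∃ b' ∈ X.basic, X.d b' = b := by
  obtain ⟨b', hb', hd⟩ := X.loc_acyclic hh H (X.basic_le_loc hb) hdb
  refine ⟨X.avgA h b', X.avgA_mem_basic hh (X.mem_loc.1 hb').1, ?_⟩
  rw [d_avgA, hd, X.avgA_of_c hh (X.c_of_mem_basic hb)]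

/-- If only scalars are annihilated by `d` among the coefficients of the coaction of `A`, then the
horizontal elements with closed coefficients are basic. -/
theorem loc_le_basic {P : Type*} [AddCommGroup P] [Module ℂ P] (g : A →ₗ[ℂ] P)
    (hg : ∀ m, g.lTensor M (X.c m) = 0)
    (hc : ∀ a, g a = 0 → C.envDiff.d (C.gA a) = 0 → ∃ z : ℂ, a = algebraMap ℂ A z) :
    X.loc ≤ X.basic := fun m hm => by
  obtain ⟨h1, h2⟩ := X.mem_loc.1 hm
  have h3 : (C.envDiff.d ∘ₗ C.gA).lTensor M (X.c m) = 0 := by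
    rw [LinearMap.lTensor_comp_apply, ← X.ad_eq_of_mem_filt h1, h2]
  -- The coefficients of m lie in the joint kernel of g, which confines them to the allowed
  -- subspace, and of d. The map q projects to this kernel, which consists of scalars, so the
  -- coaction of A on m is trivial by the counit.
  let D : A →ₗ[ℂ] P × C.Env := g.prod (C.envDiff.d ∘ₗ C.gA)
  have hD : D.lTensor M (X.c m) = 0 := by
    have : D = LinearMap.inl ℂ P C.Env ∘ₗ g + LinearMap.inr ℂ P C.Env ∘ₗ C.envDiff.d ∘ₗ C.gA := by
      ext a <;> simp [D]
    rw [this, LinearMap.lTensor_add, LinearMap.add_apply, LinearMap.lTensor_comp_apply, hg,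
      LinearMap.lTensor_comp_apply, h3, map_zero, map_zero, add_zero]
  obtain ⟨k, hk⟩ := exists_pseudoinverse D
  let q : A →ₗ[ℂ] A := LinearMap.id - k ∘ₗ D
  have hq : q.lTensor M (X.c m) = X.c m := by
    simp only [q]
    rw [LinearMap.lTensor_sub, LinearMap.sub_apply, LinearMap.lTensor_comp_apply, hD, map_zero,
      sub_zero, LinearMap.lTensor_id, LinearMap.id_apply]
  let e : A →ₗ[ℂ] A := Algebra.linearMap ℂ A ∘ₗ Coalgebra.counit (R := ℂ)
  have hqe : e ∘ₗ q = q := by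
    ext a
    have h4 : D (q a) = 0 := by simp [q, hk]
    obtain ⟨z, hz⟩ := hc (q a) (congrArg Prod.fst h4) (congrArg Prod.snd h4)
    rw [LinearMap.comp_apply, hz]
    simp [e]
  have h5 : X.c m = e.lTensor M (X.c m) := by
    conv_lhs => rw [← hq, ← hqe, LinearMap.lTensor_comp_apply, hq]
  have h6 : e.lTensor M (X.c m) = m ⊗ₜ 1 := by
    have h7 := X.counit m
    rw [LinearMap.lTensor_comp_apply, ← c_apply] at h7
    conv_rhs => rw [← h7]
    generalize X.c m = t
    induction t using TensorProduct.induction_on with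
    | zero => simp
    | add s t hs ht => simp only [map_add, TensorProduct.add_tmul, hs, ht]
    | tmul x z => simp [e, Algebra.algebraMap_eq_smul_one, TensorProduct.smul_tmul']
  rw [mem_basic, X.ad_eq_of_mem_filt h1, h5, h6, LinearMap.lTensor_tmul, gA_one]

end ExtComodule
end BicovariantStarCalculus
end
end QPB

/-! ### Existence of the Haar functional. -/

open scoped TensorProduct

namespace QPB

noncomputable section

section Haar

-- For selfadjoint T the product of T^(k+1) M with its adjoint on the left is M* T^(2k+2) M, which
-- contains T^(k+2) M as a factor. So the exponent can be lowered one by one down to 1.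
open scoped ComplexOrder in
theorem matrix_ker_pow {n : Type*} [Fintype n] [DecidableEq n] {T M : Matrix n n ℂ}
    (hT : T.conjTranspose = T) (k : ℕ) (h : T ^ k * M = 0) : T * M = 0 := by
  induction k with
  | zero => rw [pow_zero, one_mul] at h; rw [h, mul_zero]
  | succ k ih =>
    cases k with
    | zero => rwa [zero_add, pow_one] at h
    | succ k =>
      refine ih (Matrix.conjTranspose_mul_self_eq_zero.1 ?_)
      rw [Matrix.conjTranspose_mul, Matrix.conjTranspose_pow, hT, Matrix.mul_assoc,
        ← Matrix.mul_assoc (T ^ (k + 1)), ← pow_add, show k + 1 + (k + 1) = k + (k + 1 + 1) by ring,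
        pow_add, Matrix.mul_assoc (T ^ k), h, Matrix.mul_zero, Matrix.mul_zero]

open scoped ComplexOrder in
/-- A polynomial in `F* F`, with nonzero constant term, that is annihilated by `F`. -/
theorem exists_aeval_mul_eq_zero {m n : Type*} [Fintype m] [Fintype n] [DecidableEq n]
    (F : Matrix m n ℂ) : ∃ q : Polynomial ℂ, q.coeff 0 ≠ 0 ∧
      F * Polynomial.aeval (F.conjTranspose * F) q = 0 := by
  set T := F.conjTranspose * F with hT
  -- q is the characteristic polynomial of T = F*F with its power of X removed. Cayley–Hamilton
  -- gives T^m q(T) = 0, selfadjointness lowers this to T q(T) = 0, and F*F q(T) = 0 implies F q(T)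
  -- = 0.
  obtain ⟨q, hq, hq0⟩ := Polynomial.exists_eq_pow_rootMultiplicity_mul_and_not_dvd T.charpoly
    T.charpoly_monic.ne_zero 0
  refine ⟨q, fun h => hq0 ?_, ?_⟩
  · rw [map_zero, sub_zero]; exact Polynomial.X_dvd_iff.2 h
  · have h1 := T.aeval_self_charpoly
    rw [hq, map_mul, map_pow, map_zero, sub_zero, Polynomial.aeval_X] at h1
    have h2 := matrix_ker_pow (by rw [hT, Matrix.conjTranspose_mul,
      Matrix.conjTranspose_conjTranspose]) _ h1
    rwa [hT, Matrix.conjTranspose_mul_self_mul_eq_zero] at h2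

variable {A : Type*} [Ring A] [HopfAlgebra ℂ A]

/-- The convolution operator `a ↦ ∑ f(a⁽¹⁾) a⁽²⁾`. -/
def convL (f : A →ₗ[ℂ] ℂ) : A →ₗ[ℂ] A :=
  (TensorProduct.lid ℂ A).toLinearMap ∘ₗ f.rTensor A ∘ₗ Coalgebra.comul

theorem convL_apply (f : A →ₗ[ℂ] ℂ) (a : A) :
    convL f a = TensorProduct.lid ℂ A (f.rTensor A (Coalgebra.comul (R := ℂ) a)) := rfl

theorem convL_one (f : A →ₗ[ℂ] ℂ) : convL f 1 = f 1 • 1 := by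
  rw [convL_apply, Bialgebra.comul_one, Algebra.TensorProduct.one_def]; simp

theorem convL_counit (a : A) : convL (Coalgebra.counit (R := ℂ)) a = a := by
  rw [convL_apply, Coalgebra.rTensor_counit_comul]; simp

theorem convL_sub (f g : A →ₗ[ℂ] ℂ) : convL (f - g) = convL f - convL g := by
  simp only [convL, LinearMap.rTensor_sub, LinearMap.sub_comp, LinearMap.comp_sub]

theorem convL_smul (c : ℂ) (f : A →ₗ[ℂ] ℂ) : convL (c • f) = c • convL f := by
  simp only [convL, LinearMap.rTensor_smul, LinearMap.smul_comp, LinearMap.comp_smul]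

variable [StarRing A] {n : ℕ} {u : Matrix (Fin n) (Fin n) A}

theorem IsUnitaryCorep.convL_apply (hu : IsUnitaryCorep u) (f : A →ₗ[ℂ] ℂ) (i j : Fin n) :
    convL f (u i j) = ∑ k, f (u i k) • u k j := by
  rw [QPB.convL_apply, hu.comul_apply]; simp

theorem IsUnitaryCorep.antipode_apply (hu : IsUnitaryCorep u) (i j : Fin n) :
    HopfAlgebra.antipode ℂ (u i j) = star (u j i) := by
  have h1 : u.map (HopfAlgebra.antipode ℂ) * u = 1 := by
    ext i j
    have := HopfAlgebra.mul_antipode_rTensor_comul_apply (R := ℂ) (u i j)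
    rw [hu.comul_apply, hu.counit_apply] at this
    simp only [map_sum, LinearMap.rTensor_tmul, LinearMap.mul'_apply] at this
    rw [Matrix.mul_apply, Matrix.one_apply]
    simp only [Matrix.map_apply, this]
    split_ifs <;> simp
  have h2 : u * star u = 1 := (Unitary.mem_iff.1 hu.unitary).2
  have h3 : u.map (HopfAlgebra.antipode ℂ) = star u := by
    rw [← mul_one (u.map _), ← h2, ← mul_assoc, h1, one_mul]
  exact congrFun (congrFun h3 i) j

variable [StarModule ℂ A]

/-- The functional `a ↦ conj f(κ(a)*)`. -/
def dualStar (f : A →ₗ[ℂ] ℂ) : A →ₗ[ℂ] ℂ where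
  toFun a := star (f (star (HopfAlgebra.antipode ℂ a)))
  map_add' a b := by simp
  map_smul' c a := by simp

theorem IsUnitaryCorep.dualStar_apply (hu : IsUnitaryCorep u) (f : A →ₗ[ℂ] ℂ) (i j : Fin n) :
    dualStar f (u i j) = star (f (u j i)) := by
  change star (f (star (HopfAlgebra.antipode ℂ (u i j)))) = _
  rw [hu.antipode_apply, star_star]

/-- The positive operator of a finite set of functionals. -/
def lapl (S : Finset (A →ₗ[ℂ] ℂ)) : Module.End ℂ A := ∑ f ∈ S, convL f ∘ₗ convL (dualStar f)

/-- The matrix that collects the values of a finite set of functionals. -/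
def stack (S : Finset (A →ₗ[ℂ] ℂ)) (u : Matrix (Fin n) (Fin n) A) :
    Matrix (S × Fin n) (Fin n) ℂ := fun x j => x.1.1 (u x.2 j)

/-- On a unitary corepresentation the matrix of `dualStar f` is the adjoint of the matrix of f. The
operator therefore acts on coefficients through ∑ F_f* F_f, which is F*F for the stacked matrix. -/
theorem IsUnitaryCorep.lapl_apply (hu : IsUnitaryCorep u) (S : Finset (A →ₗ[ℂ] ℂ)) (i j : Fin n) :
    lapl S (u i j) = ∑ k, ((stack S u).conjTranspose * stack S u) i k • u k j := by
  simp only [lapl, LinearMap.sum_apply, LinearMap.comp_apply, hu.convL_apply, map_sum, map_smul,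
    hu.dualStar_apply, Matrix.mul_apply, Matrix.conjTranspose_apply, stack, Fintype.sum_prod_type,
    Finset.sum_smul, Finset.smul_sum, smul_smul]
  rw [← Finset.sum_coe_sort S, Finset.sum_comm]
  rw [Finset.sum_comm]
  refine Eq.trans ?_ Finset.sum_comm
  exact Finset.sum_congr rfl fun f _ => Finset.sum_comm

theorem IsUnitaryCorep.aeval_lapl (hu : IsUnitaryCorep u) (S : Finset (A →ₗ[ℂ] ℂ))
    (q : Polynomial ℂ) (i j : Fin n) : Polynomial.aeval (lapl S) q (u i j)
      = ∑ k, Polynomial.aeval ((stack S u).conjTranspose * stack S u) q i k • u k j := by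
  induction q using Polynomial.induction_on generalizing i with
  | C a => simp [Matrix.algebraMap_matrix_apply, Module.algebraMap_end_apply]
  | add p q hp hq => simp only [map_add, LinearMap.add_apply, hp, hq, Matrix.add_apply, add_smul,
      Finset.sum_add_distrib]
  | monomial m a h =>
    set T := (stack S u).conjTranspose * stack S u with hT
    rw [pow_succ, ← mul_assoc]
    set p := Polynomial.C a * Polynomial.X ^ m
    rw [map_mul (Polynomial.aeval T), map_mul, Polynomial.aeval_X, Polynomial.aeval_X,
      Module.End.mul_apply, hu.lapl_apply, ← hT]
    have hc : Polynomial.aeval T p * T = T * Polynomial.aeval T p := by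
      have := congrArg (Polynomial.aeval T) (mul_comm p Polynomial.X)
      rwa [map_mul _ p, map_mul _ _ p, Polynomial.aeval_X] at this
    rw [hc]
    simp only [map_sum, map_smul, h, Matrix.mul_apply, Finset.sum_smul, Finset.smul_sum,
      smul_smul]
    exact Finset.sum_comm

theorem aeval_lapl_one (S : Finset (A →ₗ[ℂ] ℂ)) (hS : ∀ f ∈ S, f 1 = 0) (q : Polynomial ℂ) :
    Polynomial.aeval (lapl S) q 1 = q.coeff 0 • 1 := by
  have h0 : lapl S 1 = 0 := by
    rw [lapl, LinearMap.sum_apply]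
    refine Finset.sum_eq_zero fun f hf => ?_
    rw [LinearMap.comp_apply, convL_one, map_smul, convL_one, hS f hf, zero_smul, smul_zero]
  induction q using Polynomial.induction_on with
  | C a => simp [Module.algebraMap_end_apply]
  | add p q hp hq => simp only [map_add, LinearMap.add_apply, hp, hq, Polynomial.coeff_add, add_smul]
  | monomial m a h =>
    rw [pow_succ, ← mul_assoc, map_mul, Polynomial.aeval_X, Module.End.mul_apply, h0, map_zero,
      Polynomial.coeff_mul_X_zero, zero_smul]

/-- The elements annihilated by a polynomial in `T` with nonzero constant term. -/
def annih {V : Type*} [AddCommGroup V] [Module ℂ V] (T : Module.End ℂ V) : Submodule ℂ V where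
  carrier := {v | ∃ q : Polynomial ℂ, q.coeff 0 ≠ 0 ∧ Polynomial.aeval T q v = 0}
  zero_mem' := ⟨1, by simp, map_zero _⟩
  add_mem' := by
    rintro v w ⟨p, hp, hv⟩ ⟨q, hq, hw⟩
    refine ⟨p * q, by rw [Polynomial.mul_coeff_zero]; exact mul_ne_zero hp hq, ?_⟩
    rw [map_add, map_mul, Module.End.mul_apply, Module.End.mul_apply, hw, map_zero, add_zero,
      ← Module.End.mul_apply, ← map_mul, mul_comm, map_mul, Module.End.mul_apply, hv, map_zero]
  smul_mem' := by
    rintro c v ⟨p, hp, hv⟩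
    exact ⟨p, hp, by rw [map_smul, hv, smul_zero]⟩

/-- For a coefficient of u the convolution by f is a row of the stacked matrix F, and F q(F*F) = 0.
The polynomial depends on u; this is why `annih` admits all of them, sums being handled by products
of polynomials. -/
theorem IsCompactMatrixQuantumGroup.convL_mem_annih (hG : IsCompactMatrixQuantumGroup A)
    (S : Finset (A →ₗ[ℂ] ℂ)) (f : A →ₗ[ℂ] ℂ) (hf : f ∈ S) (a : A) : convL f a ∈ annih (lapl S) := by
  have ha : a ∈ Submodule.span ℂ _ := hG.span_coeff ▸ Submodule.mem_top
  induction ha using Submodule.span_induction with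
  | zero => rw [map_zero]; exact zero_mem _
  | add x y _ _ hx hy => rw [map_add]; exact add_mem hx hy
  | smul c x _ hx => rw [map_smul]; exact Submodule.smul_mem _ c hx
  | mem x hx =>
    obtain ⟨n, u, hu, i, j, rfl⟩ := hx
    obtain ⟨q, hq, hq'⟩ := exists_aeval_mul_eq_zero (stack S u)
    refine ⟨q, hq, ?_⟩
    simp only [hu.convL_apply, map_sum, map_smul, hu.aeval_lapl, Finset.smul_sum, smul_smul]
    rw [Finset.sum_comm]
    refine Finset.sum_eq_zero fun l _ => ?_
    rw [← Finset.sum_smul]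
    have h := congrFun (congrFun hq' (⟨f, hf⟩, i)) l
    rw [Matrix.mul_apply] at h
    exact (congrArg (· • u l j) h).trans (zero_smul _ _)

/-- If 1 were a finite sum of such convolutions, it would be annihilated by a polynomial q in `lapl
S` with q(0) ≠ 0. But functionals vanishing at 1 give `lapl S` 1 = 0, so q acts on 1 as the scalar
q(0). -/
theorem IsCompactMatrixQuantumGroup.one_notMem (hG : IsCompactMatrixQuantumGroup A) :
    (1 : A) ∉ Submodule.span ℂ {x | ∃ (f : A →ₗ[ℂ] ℂ) (a : A), f 1 = 0 ∧ x = convL f a} := by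
  classical
  intro h
  obtain ⟨T, hT, h1⟩ := Submodule.mem_span_finite_of_mem_span h
  choose! F a hF using hT
  have h2 : (1 : A) ∈ annih (lapl (T.image F)) := by
    refine (Submodule.span_le.2 fun x hx => ?_) h1
    rw [(hF hx).2]
    exact hG.convL_mem_annih _ _ (Finset.mem_image_of_mem F hx) _
  obtain ⟨q, hq, hq'⟩ := h2
  rw [aeval_lapl_one _ (fun f hf => by
    obtain ⟨x, hx, rfl⟩ := Finset.mem_image.1 hf
    exact (hF hx).1)] at hq'
  have h3 := congrArg (Coalgebra.counit (R := ℂ)) hq'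
  rw [map_smul, Bialgebra.counit_one, map_zero, smul_eq_mul, mul_one] at h3
  exact hq h3

theorem IsCompactMatrixQuantumGroup.exists_haar (hG : IsCompactMatrixQuantumGroup A) :
    ∃ h : A →ₗ[ℂ] ℂ, BicovariantStarCalculus.IsHaar h := by
  obtain ⟨h₀, h1, hN⟩ := Submodule.exists_le_ker_of_notMem hG.one_notMem
  set h : A →ₗ[ℂ] ℂ := (h₀ 1)⁻¹ • h₀ with hh
  -- The functional g - g(1)ε vanishes at 1, and convolution by ε is the identity.
  have hconvL : ∀ (g : A →ₗ[ℂ] ℂ) a, h (convL g a) = g 1 * h a := by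
    intro g a
    have h2 : h₀ (convL (g - g 1 • Coalgebra.counit (R := ℂ)) a) = 0 :=
      hN (Submodule.subset_span ⟨_, a, by simp, rfl⟩)
    rw [convL_sub, convL_smul, LinearMap.sub_apply, LinearMap.smul_apply, convL_counit, map_sub,
      map_smul, sub_eq_zero] at h2
    simp only [hh, LinearMap.smul_apply, h2, smul_eq_mul]
    ring
  have hinv : ∀ a, TensorProduct.rid ℂ A (h.lTensor A (Coalgebra.comul (R := ℂ) a)) = h a • 1 := by
    intro a
    rw [← sub_eq_zero, ← Module.forall_dual_apply_eq_zero_iff ℂ]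
    intro g
    rw [map_sub, map_smul, smul_eq_mul, mul_comm, ← hconvL, convL_apply, sub_eq_zero]
    generalize Coalgebra.comul (R := ℂ) a = t
    induction t using TensorProduct.induction_on with
    | zero => simp
    | add s t hs ht => simp only [map_add, hs, ht]
    | tmul x y => simp [mul_comm]
  refine ⟨h, by simp [hh, h1], hinv, fun a b => ?_⟩
  have hb : b ∈ Submodule.span ℂ _ := hG.span_coeff ▸ Submodule.mem_top
  induction hb using Submodule.span_induction with
  | zero =>
    have : h ∘ₗ LinearMap.mulRight ℂ (HopfAlgebra.antipode ℂ (0 : A)) = 0 := by ext; simp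
    rw [this]; simp
  | add x y _ _ hx hy =>
    have : h ∘ₗ LinearMap.mulRight ℂ (HopfAlgebra.antipode ℂ (x + y))
        = h ∘ₗ LinearMap.mulRight ℂ (HopfAlgebra.antipode ℂ x)
          + h ∘ₗ LinearMap.mulRight ℂ (HopfAlgebra.antipode ℂ y) := by ext; simp [mul_add]
    rw [this, LinearMap.lTensor_add, LinearMap.add_apply, map_add, hx, hy, map_add, map_add, map_add]
  | smul c x _ hx =>
    have : h ∘ₗ LinearMap.mulRight ℂ (HopfAlgebra.antipode ℂ (c • x))
        = c • (h ∘ₗ LinearMap.mulRight ℂ (HopfAlgebra.antipode ℂ x)) := by ext; simp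
    rw [this, LinearMap.lTensor_smul, LinearMap.smul_apply, map_smul, hx, map_smul, map_smul,
      map_smul]
  | mem x hx =>
    obtain ⟨n, u, hu, i, j, rfl⟩ := hx
    have hstar : ∀ k l, Coalgebra.comul (R := ℂ) (star (u k l))
        = ∑ m, star (u k m) ⊗ₜ[ℂ] star (u m l) := by
      intro k l
      rw [hG.comul_star, hu.comul_apply, star_sum]
      exact Finset.sum_congr rfl fun m _ => TensorProduct.star_tmul _ _
    have hunit : ∀ l, ∑ k, star (u k l) * u k j = if l = j then 1 else 0 := by
      intro l
      have := congrFun (congrFun (Unitary.mem_iff.1 hu.unitary).1 l) j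
      rwa [Matrix.mul_apply, Matrix.one_apply] at this
    -- Invariance is applied to a·u_ki*. After multiplication by u_kj and summation over k,
    -- unitarity leaves only the term with l = j, which is the other side of the identity.
    have hk : ∀ k, h (a * star (u k i)) • (1 : A) = ∑ l, TensorProduct.rid ℂ A
        ((h ∘ₗ LinearMap.mulRight ℂ (star (u l i))).lTensor A (Coalgebra.comul (R := ℂ) a))
          * star (u k l) := by
      intro k
      rw [← hinv, Bialgebra.comul_mul, hstar, Finset.mul_sum, map_sum, map_sum]
      refine Finset.sum_congr rfl fun l _ => ?_
      generalize Coalgebra.comul (R := ℂ) a = t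
      induction t using TensorProduct.induction_on with
      | zero => simp
      | add s t hs ht => simp only [map_add, add_mul, hs, ht]
      | tmul x y => simp
    rw [hu.antipode_apply, hu.comul_apply]
    have h5 : ∀ k, h (a * star (u k i)) • u k j = ∑ l, TensorProduct.rid ℂ A
        ((h ∘ₗ LinearMap.mulRight ℂ (star (u l i))).lTensor A (Coalgebra.comul (R := ℂ) a))
          * (star (u k l) * u k j) := by
      intro k
      rw [← one_mul (u k j), ← smul_mul_assoc, hk, Finset.sum_mul]
      simp only [mul_assoc, one_mul]
    simp only [map_sum, LinearMap.rTensor_tmul, LinearMap.comp_apply, hu.antipode_apply,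
      LinearMap.mulLeft_apply, TensorProduct.lid_tmul, h5]
    rw [Finset.sum_comm]
    simp only [← Finset.mul_sum, hunit]
    simp

end Haar
end
end QPB

/-! ### Ω and 𝒦 as comodules over Γ^∧. -/

open scoped TensorProduct

namespace QPB

noncomputable section

namespace BicovariantStarCalculus
variable {A Γ : Type*} [Ring A] [HopfAlgebra ℂ A] [StarRing A]
    [AddCommGroup Γ] [Module ℂ Γ] [Module A Γ] [Module Aᵐᵒᵖ Γ] [SMulCommClass A Aᵐᵒᵖ Γ]
    [IsScalarTower ℂ A Γ] [IsScalarTower ℂ Aᵐᵒᵖ Γ] (C : BicovariantStarCalculus A Γ)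


section PlainTensor
variable {B B₂ B' : Type*} [Ring B] [Algebra ℂ B] [Super B] [Ring B₂] [Algebra ℂ B₂] [Super B₂]
  [Ring B'] [Algebra ℂ B'] [Super B']

theorem pl_tensorMap (f : B →ₐ[ℂ] B₂) (hf : ∀ x, f (Super.par x) = Super.par (f x))
    (z : STensor B B') : pl (tensorMap f hf z) = f.toLinearMap.rTensor B' (pl z) := by
  induction z using STensor.induction with
  | h0 => simp
  | ha s t hs ht => simp only [map_add, hs, ht]
  | hm b e => rw [map_mul, tensorMap_iL, tensorMap_iR, pl_mul, pl_mul]; rfl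

end PlainTensor

/-- The automorphism of `Ω` equal to `2 ^ k` in degree `k`. -/
def univScale : C.Univ →ₐ[ℂ] C.Univ := C.univLift ((2 : ℂ) • C.θ) ((4 : ℂ) • C.dθ)

theorem univScale_θ (v : C.inv) : C.univScale (C.θ v) = (2 : ℂ) • C.θ v := C.univLift_θ _ _ v

theorem univScale_dθ (v : C.inv) : C.univScale (C.dθ v) = (4 : ℂ) • C.dθ v := C.univLift_dθ _ _ v

theorem univScale_par_d (w : C.Univ) : C.univScale (Super.par w) = Super.par (C.univScale w) ∧
    C.univScale (C.diff.d w) = (2 : ℂ) • C.diff.d (C.univScale w) := by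
  refine map_d_of_adjoin C.diff (C.diff.smul 2) C.univScale C.adjoin_univGen ?_ ?_ w
  · rintro _ (⟨v, rfl⟩ | ⟨v, rfl⟩)
    · rw [par_θ, map_neg, univScale_θ, map_smul, par_θ, smul_neg]
    · rw [par_dθ, univScale_dθ, map_smul, par_dθ]
  · rintro _ (⟨v, rfl⟩ | ⟨v, rfl⟩)
    · rw [diff_θ, univScale_θ, univScale_dθ]
      change _ = (2 : ℂ) • C.diff.d ((2 : ℂ) • C.θ v)
      rw [map_smul, diff_θ, smul_smul]; norm_num
    · rw [diff_dθ, univScale_dθ, map_zero]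
      change _ = (2 : ℂ) • C.diff.d ((4 : ℂ) • C.dθ v)
      rw [map_smul, diff_dθ, smul_zero, smul_zero]

theorem exists_univPr : ∃ pr : ℕ → C.Univ →ₗ[ℂ] C.Univ, IsGrading C.univScale.toLinearMap pr :=
  exists_grading _ (IsGrading.mem_iSup_of_adjoin C.univScale C.adjoin_univGen (by
    rintro _ (⟨v, rfl⟩ | ⟨v, rfl⟩)
    · exact ⟨1, by rw [univScale_θ, pow_one]⟩
    · exact ⟨2, by rw [univScale_dθ]; norm_num⟩))

/-- The homomorphism `univScale ⊗ envScale`. -/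
abbrev scaleHom : STensor C.Univ C.Env →ₐ[ℂ] STensor C.Univ C.Env :=
  stMap C.univScale C.envScale (fun w => (C.univScale_par_d w).1) C.envScale_par

theorem scaleHom_tensorD (z : STensor C.Univ C.Env) : C.scaleHom (tensorD C.diff C.envDiff z)
    = (2 : ℂ) • tensorD C.diff C.envDiff (C.scaleHom z) := by
  induction z using STensor.induction with
  | h0 => simp
  | ha s t hs ht => simp only [map_add, smul_add, hs, ht]
  | hm b e =>
    rw [tensorD_mul_iL_iR]
    simp only [scaleHom, map_add, map_mul, stMap_iL, stMap_iR]
    rw [tensorD_mul_iL_iR, envScale_envDiff, (C.univScale_par_d b).1, (C.univScale_par_d b).2,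
      map_smul, map_smul, smul_mul_assoc, mul_smul_comm, smul_add]

theorem adTilde_univScale (w : C.Univ) : C.adTilde (C.univScale w) = C.scaleHom (C.adTilde w) := by
  have h : ∀ v, C.adTilde (C.univScale (C.θ v)) = C.scaleHom (C.adTilde (C.θ v)) := by
    intro v
    have hθ : C.univScale.toLinearMap ∘ₗ C.θ = (2 : ℂ) • C.θ := LinearMap.ext C.univScale_θ
    have hA : C.envScale.toLinearMap ∘ₗ C.gA = C.gA := LinearMap.ext C.envScale_gA
    rw [univScale_θ, map_smul, adTilde_θ, adGen_apply, map_add, stMap_iR, stMap_mul₂, hθ, hA,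
      show C.envScale (C.invEnv v) = (2 : ℂ) • C.invEnv v from C.envScale_gΓ _, map_smul, smul_add]
    congr 1
    generalize C.varpi v = t
    induction t using TensorProduct.induction_on with
    | zero => simp
    | add s t hs ht => simp only [map_add, smul_add, hs, ht]
    | tmul x y => simp
  refine congrArg (fun f : C.Univ →ₐ[ℂ] STensor C.Univ C.Env => f w)
    (C.univ_algHom_ext (f := C.adTilde.comp C.univScale) (g := C.scaleHom.comp C.adTilde) h
      (fun v => ?_))
  rw [AlgHom.comp_apply, AlgHom.comp_apply, ← diff_θ, (C.univScale_par_d _).2, map_smul,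
    (C.adTilde_par_d _).2, (C.adTilde_par_d _).2, h, scaleHom_tensorD]

/-- The extended adjoint action as a map of vector spaces. -/
def adU : C.Univ →ₗ[ℂ] C.Univ ⊗[ℂ] C.Env := pl.toLinearMap ∘ₗ C.adTilde.toLinearMap

theorem adU_apply (w : C.Univ) : C.adU w = pl (C.adTilde w) := rfl

section Coassoc

/-- The graded tensor product `Ω ⊗̂ Γ^∧ ⊗̂ Γ^∧`. -/
abbrev Univ₂ : Type _ := STensor (STensor C.Univ C.Env) C.Env

/-- The differential of `Ω ⊗̂ Γ^∧ ⊗̂ Γ^∧`. -/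
abbrev diff₂ : SuperDiff C.Univ₂ := tensorDiff (tensorDiff C.diff C.envDiff) C.envDiff

theorem adTilde_par (w : C.Univ) : C.adTilde (Super.par w) = Super.par (C.adTilde w) :=
  (C.adTilde_par_d w).1

theorem iR_par (e : C.Env) : iR C.Univ C.Env (Super.par e) = Super.par (iR C.Univ C.Env e) :=
  (par_iR e).symm

/-- The iterated action. -/
def ad₂ : C.Univ →ₐ[ℂ] C.Univ₂ := (tensorMap C.adTilde C.adTilde_par).comp C.adTilde

/-- The coproduct of `Γ^∧` into the last two factors. -/
def coR : C.Env →ₐ[ℂ] C.Univ₂ := (tensorMap (iR C.Univ C.Env) C.iR_par).comp C.envCo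

theorem tensorMap_par {B B₂ B' : Type*} [Ring B] [Algebra ℂ B] [Super B] [Ring B₂] [Algebra ℂ B₂]
    [Super B₂] [Ring B'] [Algebra ℂ B'] [Super B'] (f : B →ₐ[ℂ] B₂)
    (hf : ∀ x, f (Super.par x) = Super.par (f x)) (z : STensor B B') :
    tensorMap f hf (Super.par z) = Super.par (tensorMap f hf z) := by
  induction z using STensor.induction with
  | h0 => simp
  | ha s t hs ht => simp only [map_add, hs, ht]
  | hm b e => simp only [map_mul, par_iL, par_iR, tensorMap_iL, tensorMap_iR, hf]

theorem coR_par (e : C.Env) : C.coR (Super.par e) = Super.par (C.coR e) := by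
  rw [coR, AlgHom.comp_apply, (C.envCo_par_d e).1, tensorMap_par]; rfl

theorem coR_d (e : C.Env) : C.coR (C.envDiff.d e) = C.diff₂.d (C.coR e) := by
  rw [coR, AlgHom.comp_apply, (C.envCo_par_d e).2]
  exact tensorMap_d _ C.iR_par C.envDiff (tensorDiff C.diff C.envDiff) C.envDiff
    (fun x => (tensorD_iR _ _ x).symm) _

theorem ad₂_d (w : C.Univ) : C.ad₂ (C.diff.d w) = C.diff₂.d (C.ad₂ w) := by
  rw [ad₂, AlgHom.comp_apply, (C.adTilde_par_d w).2]
  exact tensorMap_d _ C.adTilde_par C.diff (tensorDiff C.diff C.envDiff) C.envDiff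
    (fun x => (C.adTilde_par_d x).2) _

theorem coR_mul_iL (b : C.Univ) (e : C.Env) : (Super.par e = e → C.coR e * iL _ C.Env (iL C.Univ C.Env b)
      = iL _ C.Env (iL C.Univ C.Env b) * C.coR e) ∧ (Super.par e = -e →
      C.coR e * iL _ C.Env (iL C.Univ C.Env b) = iL _ C.Env (iL C.Univ C.Env (Super.par b)) * C.coR e) := by
  have key : ∀ b : C.Univ, (Super.par b = b → ∀ z, tensorMap (iR C.Univ C.Env) C.iR_par z *
      iL _ C.Env (iL C.Univ C.Env b) = iL _ C.Env (iL C.Univ C.Env b) *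
      tensorMap (iR C.Univ C.Env) C.iR_par z) ∧ (Super.par b = -b →
      ∀ z, tensorMap (iR C.Univ C.Env) C.iR_par z * iL _ C.Env (iL C.Univ C.Env b)
        = iL _ C.Env (iL C.Univ C.Env b) * tensorMap (iR C.Univ C.Env) C.iR_par (Super.par z)) := by
    intro b
    constructor
    · intro hb z
      induction z using STensor.induction with
      | h0 => simp
      | ha s t hs ht => simp only [map_add, add_mul, mul_add, hs, ht]
      | hm x y =>
        rw [map_mul, tensorMap_iL, tensorMap_iR, mul_assoc,
          iR_mul_iL_of_even' (by rw [par_iL, hb]), ← mul_assoc, ← map_mul,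
          iR_mul_iL_of_even' hb, map_mul, mul_assoc]
    · intro hb z
      induction z using STensor.induction with
      | h0 => simp
      | ha s t hs ht => simp only [map_add, add_mul, mul_add, hs, ht]
      | hm x y =>
        rw [map_mul, map_mul, map_mul, par_iL, par_iR, tensorMap_iL, tensorMap_iR, tensorMap_iL,
          tensorMap_iR, mul_assoc, iR_mul_iL_of_odd' (by rw [par_iL, hb, map_neg]), ← mul_assoc,
          ← map_mul, iR_mul_iL_of_odd' hb, map_mul, mul_assoc]
  obtain ⟨y, z, hy, hz, rfl⟩ := Super.exists_add b
  have h1 := (key y).1 hy (C.envCo e)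
  have h2 := (key z).2 hz (C.envCo e)
  rw [← (C.envCo_par_d e).1] at h2
  refine ⟨fun he => ?_, fun he => ?_⟩
  · rw [he] at h2
    simp only [map_add, mul_add, add_mul]
    exact congrArg₂ (· + ·) h1 h2
  · rw [he] at h2
    simp only [map_add, mul_add, add_mul, hy, hz]
    refine congrArg₂ (· + ·) h1 (h2.trans ?_)
    simp only [map_neg, neg_mul, mul_neg]; rfl

/-- The homomorphism `id ⊗ coproduct`. -/
def coHom : STensor C.Univ C.Env →ₐ[ℂ] C.Univ₂ :=
  stLift ((iL _ C.Env).comp (iL C.Univ C.Env)) C.coR (fun b e => (C.coR_mul_iL b e).1)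
    (fun b e => (C.coR_mul_iL b e).2)

theorem coHom_iL (b : C.Univ) : C.coHom (iL C.Univ C.Env b) = iL _ C.Env (iL C.Univ C.Env b) :=
  stLift_iL _ _ _ _ b
theorem coHom_iR (e : C.Env) : C.coHom (iR C.Univ C.Env e) = C.coR e := stLift_iR _ _ _ _ e

theorem coHom_d (z : STensor C.Univ C.Env) :
    C.coHom (tensorD C.diff C.envDiff z) = C.diff₂.d (C.coHom z) := by
  refine (map_d_of_adjoin (tensorDiff C.diff C.envDiff) C.diff₂ C.coHom
    (adjoin_iL_iR (s := Set.univ) (s' := Set.univ) (Algebra.adjoin_univ ℂ _)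
      (Algebra.adjoin_univ ℂ _)) ?_ ?_ z).2
  · rintro _ (⟨b, -, rfl⟩ | ⟨e, -, rfl⟩)
    · rw [par_iL, coHom_iL, coHom_iL, par_iL, par_iL]
    · rw [par_iR, coHom_iR, coHom_iR, coR_par]
  · rintro _ (⟨b, -, rfl⟩ | ⟨e, -, rfl⟩)
    · change C.coHom (tensorD C.diff C.envDiff _) = tensorD (tensorDiff C.diff C.envDiff) C.envDiff _
      rw [tensorD_iL, coHom_iL, coHom_iL, tensorD_iL]
      exact congrArg _ (tensorD_iL _ _ b).symm
    · change C.coHom (tensorD C.diff C.envDiff _) = _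
      rw [tensorD_iR, coHom_iR, coHom_iR, coR_d]

end Coassoc

theorem coHom_adTilde_θ (v : C.inv) : C.ad₂ (C.θ v) = C.coHom (C.adTilde (C.θ v)) := by
  have hco : C.coR.toLinearMap ∘ₗ C.gA = conv ((iL _ C.Env).toLinearMap ∘ₗ C.iA C.Univ)
      (C.iA (STensor C.Univ C.Env)) := by
    ext a
    change tensorMap (iR C.Univ C.Env) C.iR_par (C.envCo (C.gA a)) = _
    rw [envCo_gA, coA, LinearMap.comp_apply, map_mul₂, conv, LinearMap.comp_apply]
    generalize Coalgebra.comul (R := ℂ) a = t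
    induction t using TensorProduct.induction_on with
    | zero => simp
    | add s t hs ht => simp only [map_add, hs, ht]
    | tmul x y => simp [tensorMap_iL, tensorMap_iR, iA]
  have hinv : C.coR (C.invEnv v) = mul₂ ((iL _ C.Env).toLinearMap ∘ₗ C.iV C.Univ)
      (C.iA (STensor C.Univ C.Env)) (C.varpi v) + C.iV (STensor C.Univ C.Env) v := by
    change tensorMap (iR C.Univ C.Env) C.iR_par (C.envCo (C.gΓ v)) = _
    rw [envCo_gΓ, coΓ, LinearMap.add_apply, LinearMap.comp_apply, LinearMap.comp_apply,
      C.mem_inv.1 v.2, ← varpi_spec, add_comm, map_add]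
    congr 1
    · generalize C.varpi v = t
      induction t using TensorProduct.induction_on with
      | zero => simp
      | add s t hs ht => simp only [map_add, hs, ht]
      | tmul x y => simp [tensorMap_iL, tensorMap_iR, iA, iV, invEnv]
    · simp [tensorMap_iR, iV, invEnv, gA_one]
  have hθ : C.adTilde.toLinearMap ∘ₗ C.θ = C.twist C.θ + C.iV C.Univ := by
    rw [← adGen_eq]; exact LinearMap.ext C.adTilde_θ
  have h1 : C.ad₂ (C.θ v) = mul₂ ((iL _ C.Env).toLinearMap ∘ₗ (C.twist C.θ + C.iV C.Univ))
      (C.iA (STensor C.Univ C.Env)) (C.varpi v) + C.iV (STensor C.Univ C.Env) v := by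
    rw [ad₂, AlgHom.comp_apply, adTilde_θ, adGen_apply, map_add, tensorMap_iR, ← hθ]
    congr 1
    rw [map_mul₂]
    generalize C.varpi v = t
    induction t using TensorProduct.induction_on with
    | zero => simp
    | add s t hs ht => simp only [map_add, hs, ht]
    | tmul x y => simp [tensorMap_iL, tensorMap_iR, iA]
  have h2 : C.coHom (C.adTilde (C.θ v)) = mul₂ ((iL _ C.Env).toLinearMap ∘ₗ
      (iL C.Univ C.Env).toLinearMap ∘ₗ C.θ) (C.coR.toLinearMap ∘ₗ C.gA) (C.varpi v)
      + C.coR (C.invEnv v) := by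
    rw [adTilde_θ, adGen_apply, map_add, coHom_iR]
    congr 1
    rw [map_mul₂]
    generalize C.varpi v = t
    induction t using TensorProduct.induction_on with
    | zero => simp
    | add s t hs ht => simp only [map_add, hs, ht]
    | tmul x y => simp [coHom_iL, coHom_iR]
  have h3 : (iL _ C.Env).toLinearMap ∘ₗ C.twist C.θ
      = mul₂ ((iL _ C.Env).toLinearMap ∘ₗ (iL C.Univ C.Env).toLinearMap ∘ₗ C.θ)
        ((iL (STensor C.Univ C.Env) C.Env).toLinearMap ∘ₗ C.iA C.Univ) ∘ₗ C.varpi := by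
    ext w
    exact map_mul₂ _ _ (iL (STensor C.Univ C.Env) C.Env) _
  rw [h1, h2, hco, hinv, ← mul₂_varpi_varpi, ← h3, ← add_assoc]
  congr 1
  generalize C.varpi v = t
  induction t using TensorProduct.induction_on with
  | zero => simp
  | add s t hs ht => simp only [map_add, hs, ht]; abel
  | tmul x y => simp

/-- Both sides are homomorphisms compatible with the differentials, so only the generators ϑ matter.
There the identity follows from the coassociativity of ϖ together with ℓ(ϑ) = 1 ⊗ ϑ and ℘(ϑ) = ϖ(ϑ).
-/
theorem ad₂_eq (w : C.Univ) : C.ad₂ w = C.coHom (C.adTilde w) :=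
  congrArg (fun f : C.Univ →ₐ[ℂ] C.Univ₂ => f w)
    (C.univ_algHom_ext (f := C.ad₂) (g := C.coHom.comp C.adTilde) C.coHom_adTilde_θ (fun v => by
      rw [AlgHom.comp_apply, ← diff_θ, (C.adTilde_par_d _).2, coHom_d, ← AlgHom.comp_apply,
        ad₂_d, coHom_adTilde_θ]
      rfl))

/-- The graded tensor product `Ω ⊗̂ Γ^∧ ⊗̂ Γ^∧` as a tensor product of vector spaces. -/
def pl₂ : C.Univ₂ ≃ₗ[ℂ] C.Univ ⊗[ℂ] (C.Env ⊗[ℂ] C.Env) :=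
  pl ≪≫ₗ TensorProduct.congr pl (LinearEquiv.refl ℂ C.Env) ≪≫ₗ
    TensorProduct.assoc ℂ C.Univ C.Env C.Env

theorem pl₂_apply (z : C.Univ₂) : C.pl₂ z = TensorProduct.assoc ℂ C.Univ C.Env C.Env
    (pl.toLinearMap.rTensor C.Env (pl z)) := rfl

theorem pl₂_mul (b : C.Univ) (e e' : C.Env) : C.pl₂ (iL _ C.Env (iL C.Univ C.Env b) *
    (iL _ C.Env (iR C.Univ C.Env e) * iR _ C.Env e')) = b ⊗ₜ (e ⊗ₜ e') := by
  rw [← mul_assoc, ← map_mul, pl₂_apply, pl_mul, LinearMap.rTensor_tmul, LinearEquiv.coe_coe,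
    pl_mul, TensorProduct.assoc_tmul]

theorem pl₂_coHom (z : STensor C.Univ C.Env) : C.pl₂ (C.coHom z) = C.coE.lTensor C.Univ (pl z) := by
  induction z using STensor.induction with
  | h0 => simp
  | ha s t hs ht => simp only [map_add, hs, ht]
  | hm b e =>
    rw [map_mul, coHom_iL, coHom_iR, pl_mul, LinearMap.lTensor_tmul, coE_apply, coR,
      AlgHom.comp_apply]
    generalize C.envCo e = z
    induction z using STensor.induction with
    | h0 => simp
    | ha s t hs ht => simp only [map_add, mul_add, TensorProduct.tmul_add, hs, ht]
    | hm x y => rw [map_mul (tensorMap _ _), tensorMap_iL, tensorMap_iR, pl₂_mul, pl_mul]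

theorem adU_coassoc (w : C.Univ) : TensorProduct.assoc ℂ C.Univ C.Env C.Env
    (C.adU.rTensor C.Env (C.adU w)) = C.coE.lTensor C.Univ (C.adU w) := by
  rw [adU_apply, ← pl₂_coHom, ← ad₂_eq, ad₂, AlgHom.comp_apply, pl₂_apply, pl_tensorMap, adU, LinearMap.rTensor_comp_apply]

section
variable {B B' P : Type*} [Ring B] [Algebra ℂ B] [Super B] [Ring B'] [Algebra ℂ B'] [Super B']
  [Ring P] [Algebra ℂ P] (f : B →ₐ[ℂ] P) (g : B' →ₐ[ℂ] P)
  (hc : ∀ b e, g e * f b = f b * g e) (hg : ∀ x, g (Super.par x) = g x)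

theorem evLift_iL (b : B) : evLift f g hc hg (iL B B' b) = f b := stLift_iL _ _ _ _ b
theorem evLift_iR (e : B') : evLift f g hc hg (iR B B' e) = g e := stLift_iR _ _ _ _ e
end

/-- The homomorphism `id ⊗ ε`. -/
def univCounit : STensor C.Univ C.Env →ₐ[ℂ] C.Univ :=
  evLift (AlgHom.id ℂ C.Univ) ((Algebra.ofId ℂ C.Univ).comp
    ((Bialgebra.counitAlgHom ℂ A).comp C.envZero))
    (fun b e => Algebra.commutes (Coalgebra.counit (R := ℂ) (C.envZero e)) b) (fun e => by
      rw [AlgHom.comp_apply, AlgHom.comp_apply, envZero_par]; rfl)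

theorem univCounit_mul (b : C.Univ) (e : C.Env) : C.univCounit (iL C.Univ C.Env b * iR C.Univ C.Env e)
    = Coalgebra.counit (R := ℂ) (C.envZero e) • b := by
  rw [map_mul]
  have h1 : C.univCounit (iL C.Univ C.Env b) = b := evLift_iL _ _ _ _ b
  have h2 : C.univCounit (iR C.Univ C.Env e)
      = algebraMap ℂ C.Univ (Coalgebra.counit (R := ℂ) (C.envZero e)) := evLift_iR _ _ _ _ e
  rw [h1, h2, ← Algebra.commutes, ← Algebra.smul_def]

theorem univCounit_d (z : STensor C.Univ C.Env) :
    C.univCounit (tensorD C.diff C.envDiff z) = C.diff.d (C.univCounit z) := by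
  induction z using STensor.induction with
  | h0 => simp
  | ha s t hs ht => simp only [map_add, hs, ht]
  | hm b e =>
    rw [tensorD_mul_iL_iR, map_add, univCounit_mul, univCounit_mul, univCounit_mul,
      envZero_envDiff, map_zero, zero_smul, add_zero, map_smul]

theorem univCounit_adTilde (w : C.Univ) : C.univCounit (C.adTilde w) = w := by
  have h : ∀ v, C.univCounit (C.adTilde (C.θ v)) = C.θ v := by
    intro v
    have h0 : C.univCounit (iR C.Univ C.Env (C.invEnv v)) = 0 := by
      have := C.univCounit_mul 1 (C.invEnv v)
      rw [map_one, one_mul] at this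
      rw [this, show C.envZero (C.invEnv v) = 0 from C.envZero_gΓ _, map_zero, zero_smul]
    rw [adTilde_θ, adGen_apply, map_add, h0, add_zero]
    conv_rhs => rw [← C.varpi_counit v]
    generalize C.varpi v = t
    induction t using TensorProduct.induction_on with
    | zero => simp
    | add s t hs ht => simp only [map_add, hs, ht]
    | tmul x y =>
      change C.univCounit (iL C.Univ C.Env (C.θ x) * iR C.Univ C.Env (C.gA y)) = _
      rw [univCounit_mul, envZero_gA]; simp
  refine congrArg (fun f : C.Univ →ₐ[ℂ] C.Univ => f w)
    (C.univ_algHom_ext (f := C.univCounit.comp C.adTilde) (g := AlgHom.id ℂ C.Univ) h (fun v => ?_))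
  rw [AlgHom.comp_apply, ← diff_θ, (C.adTilde_par_d _).2, univCounit_d, h]; rfl

theorem adU_counit (w : C.Univ) : TensorProduct.rid ℂ C.Univ
    ((Coalgebra.counit (R := ℂ) (A := A) ∘ₗ C.envZero.toLinearMap).lTensor C.Univ (C.adU w)) = w := by
  conv_rhs => rw [← C.univCounit_adTilde w]
  rw [adU_apply]
  generalize C.adTilde w = z
  induction z using STensor.induction with
  | h0 => simp
  | ha s t hs ht => simp only [map_add, hs, ht]
  | hm b e => rw [univCounit_mul, pl_mul]; simp

theorem envPr_mul_gA (k : ℕ) (e : C.Env) (a : A) : C.envPr k (e * C.gA a) = C.envPr k e * C.gA a :=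
  C.envGrading.map_pr₀ C.envGrading (LinearMap.mulRight ℂ (C.gA a)) (fun x => by
    change C.envScale (x * C.gA a) = C.envScale x * C.gA a
    rw [map_mul, envScale_gA]) k e

theorem envPr_mul_invEnv (k : ℕ) (e : C.Env) (v : C.inv) :
    C.envPr (k + 1) (e * C.invEnv v) = C.envPr k e * C.invEnv v :=
  C.envGrading.map_pr C.envGrading (LinearMap.mulRight ℂ (C.invEnv v)) 1 (fun x => by
    change C.envScale (x * C.invEnv v) = _ • (C.envScale x * C.invEnv v)
    rw [map_mul, show C.envScale (C.invEnv v) = (2 : ℂ) • C.invEnv v from C.envScale_gΓ _,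
      mul_smul_comm, pow_one]) k e

/-- The right multiplication by `∑ θ(v_k) ⊗ c_k`, where `t = ∑ v_k ⊗ c_k`. -/
def mulTwist (t : C.inv ⊗[ℂ] A) : C.Univ ⊗[ℂ] C.Env →ₗ[ℂ] C.Univ ⊗[ℂ] C.Env :=
  pl.toLinearMap ∘ₗ LinearMap.mulRight ℂ (mul₂ ((iL C.Univ C.Env).toLinearMap ∘ₗ C.θ)
    (C.iA C.Univ) t) ∘ₗ pl.symm.toLinearMap

theorem mulTwist_pl (t : C.inv ⊗[ℂ] A) (z : STensor C.Univ C.Env) :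
    C.mulTwist t (pl z) = pl (z * mul₂ ((iL C.Univ C.Env).toLinearMap ∘ₗ C.θ) (C.iA C.Univ) t) := by
  simp [mulTwist]

theorem mulTwist_tmul (x : C.inv) (a : A) (b : C.Univ) (e : C.Env) :
    C.mulTwist (x ⊗ₜ a) (b ⊗ₜ e) = (b * C.θ x) ⊗ₜ (Super.par e * C.gA a) := by
  rw [← pl_mul, mulTwist_pl, ← pl_mul]
  congr 1
  simp only [TensorProduct.lift.tmul, LinearMap.compl₁₂_apply, LinearMap.mul_apply',
    LinearMap.comp_apply, AlgHom.toLinearMap_apply, iA, map_mul]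
  rw [mul_assoc, ← mul_assoc (iR C.Univ C.Env e), iR_mul_iL_of_odd' (C.par_θ x), mul_assoc,
    mul_assoc]

/-- In Γ^∧ only elements of degree zero are multiplied. So the summand ϖ(ϑ) of the action on ϑ does
not raise the filtration, and the symbol of wϑ comes from the summand 1 ⊗ ϑ alone. -/
theorem envPr_mulTwist (k : ℕ) (t : C.inv ⊗[ℂ] A) (z : C.Univ ⊗[ℂ] C.Env) :
    (C.envPr k).lTensor C.Univ (C.mulTwist t z) = C.mulTwist t ((C.envPr k).lTensor C.Univ z) := by
  induction t using TensorProduct.induction_on with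
  | zero => simp [mulTwist]
  | add s t hs ht =>
    have h : C.mulTwist (s + t) = C.mulTwist s + C.mulTwist t := by
      ext b e
      simp [mulTwist, mul_add]
    rw [h, LinearMap.add_apply, map_add, hs, ht, LinearMap.add_apply]
  | tmul x a =>
    induction z using TensorProduct.induction_on with
    | zero => simp
    | add s t hs ht => simp only [map_add, hs, ht]
    | tmul b e =>
      rw [mulTwist_tmul, LinearMap.lTensor_tmul, LinearMap.lTensor_tmul, mulTwist_tmul,
        envPr_mul_gA, envPr_par]

theorem adU_mul_θ (w : C.Univ) (v : C.inv) : C.adU (w * C.θ v)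
    = C.mulTwist (C.varpi v) (C.adU w) + (LinearMap.mulRight ℂ (C.invEnv v)).lTensor C.Univ (C.adU w) := by
  rw [adU_apply, adU_apply, map_mul, adTilde_θ, adGen_apply, mul_add, map_add, mulTwist_pl]
  congr 1
  generalize C.adTilde w = z
  induction z using STensor.induction with
  | h0 => simp
  | ha s t hs ht => simp only [map_add, add_mul, hs, ht]
  | hm b e => rw [mul_assoc, ← map_mul, pl_mul, pl_mul]; rfl

/-- The free differential algebra as a graded differential comodule over the envelope. -/
def univComodule : C.ExtComodule C.Univ where
  ad := C.adU
  d := C.diff.d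
  par := (Super.par (B := C.Univ)).toLinearMap
  s := C.univScale.toLinearMap
  pr := C.exists_univPr.choose
  rθ v := LinearMap.mulRight ℂ (C.θ v)
  grading := C.exists_univPr.choose_spec
  coassoc := C.adU_coassoc
  counit := C.adU_counit
  ad_d w := by rw [adU_apply, (C.adTilde_par_d w).2, pl_tensorD]; rfl
  ad_par w := by
    rw [adU_apply, AlgHom.toLinearMap_apply, (C.adTilde_par_d w).1, pl_par]; rfl
  ad_s w := by
    rw [adU_apply, AlgHom.toLinearMap_apply, adTilde_univScale, pl_stMap]; rfl
  d_d := C.diff.d_d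
  par_par := Super.par_par
  s_d w := (C.univScale_par_d w).2
  symbol_rθ k v w hw := by
    rw [LinearMap.mulRight_apply, adU_mul_θ, map_add, envPr_mulTwist, hw, map_zero, zero_add,
      ← LinearMap.lTensor_comp_apply, ← LinearMap.lTensor_comp_apply]
    congr 2
    ext e
    exact C.envPr_mul_invEnv k e v

namespace ExtComodule

theorem assoc_rTensor {M₁ M₂ E₁ E₂ : Type*} [AddCommGroup M₁] [Module ℂ M₁]
    [AddCommGroup M₂] [Module ℂ M₂] [AddCommGroup E₁] [Module ℂ E₁] [AddCommGroup E₂] [Module ℂ E₂]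
    (f : M₁ →ₗ[ℂ] M₂) (z : (M₁ ⊗[ℂ] E₁) ⊗[ℂ] E₂) :
    TensorProduct.assoc ℂ M₂ E₁ E₂ ((f.rTensor E₁).rTensor E₂ z)
      = f.rTensor (E₁ ⊗[ℂ] E₂) (TensorProduct.assoc ℂ M₁ E₁ E₂ z) := by
  induction z using TensorProduct.induction_on with
  | zero => simp
  | add s t hs ht => simp only [map_add, hs, ht]
  | tmul x y =>
    induction x using TensorProduct.induction_on with
    | zero => simp
    | add s t hs ht => simp only [map_add, TensorProduct.add_tmul, hs, ht]
    | tmul x z => simp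

variable {C} {M N : Type*} [AddCommGroup M] [Module ℂ M] [AddCommGroup N] [Module ℂ N]
  (X : C.ExtComodule M) (q : M →ₗ[ℂ] N)

theorem rTensor_subtype_injective (K : Submodule ℂ M) (E : Type*) [AddCommGroup E] [Module ℂ E] :
    Function.Injective (K.subtype.rTensor E) :=
  Module.Flat.rTensor_preserves_injective_linearMap _ K.injective_subtype

theorem exists_ad_ker (hq : Function.Surjective q) (had : ∀ m, q m = 0 → q.rTensor C.Env (X.ad m) = 0) :
    ∃ u : LinearMap.ker q →ₗ[ℂ] LinearMap.ker q ⊗[ℂ] C.Env,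
      ∀ m, (LinearMap.ker q).subtype.rTensor C.Env (u m) = X.ad m :=
  exists_linear_lift _ (X.ad ∘ₗ (LinearMap.ker q).subtype) fun m =>
    (rTensor_exact C.Env (LinearMap.exact_subtype_ker_map q) hq _).1 (had _ m.2)

variable (hq : Function.Surjective q) (had : ∀ m, q m = 0 → q.rTensor C.Env (X.ad m) = 0)
  (hd : ∀ m ∈ LinearMap.ker q, X.d m ∈ LinearMap.ker q)
  (hpar : ∀ m ∈ LinearMap.ker q, X.par m ∈ LinearMap.ker q)
  (hs : ∀ m ∈ LinearMap.ker q, X.s m ∈ LinearMap.ker q)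
  (hθ : ∀ v, ∀ m ∈ LinearMap.ker q, X.rθ v m ∈ LinearMap.ker q)

/-- The coaction on a subcomodule, given as a kernel. -/
def adKer : LinearMap.ker q →ₗ[ℂ] LinearMap.ker q ⊗[ℂ] C.Env := (X.exists_ad_ker q hq had).choose

theorem rTensor_adKer (m : LinearMap.ker q) :
    (LinearMap.ker q).subtype.rTensor C.Env (X.adKer q hq had m) = X.ad m :=
  (X.exists_ad_ker q hq had).choose_spec m

/-- A subcomodule, given as a kernel. -/
def ofKer : C.ExtComodule (LinearMap.ker q) where
  ad := X.adKer q hq had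
  d := X.d.restrict hd
  par := X.par.restrict hpar
  s := X.s.restrict hs
  pr k := (X.pr k).restrict (fun _ hx => X.grading.pr_mem _ hs hx k)
  rθ v := (X.rθ v).restrict (hθ v)
  grading := X.grading.restrict _ hs
  coassoc m := by
    apply rTensor_subtype_injective (LinearMap.ker q)
    rw [← assoc_rTensor, ← LinearMap.rTensor_comp_apply,
      show (LinearMap.ker q).subtype.rTensor C.Env ∘ₗ X.adKer q hq had
        = X.ad ∘ₗ (LinearMap.ker q).subtype from LinearMap.ext (X.rTensor_adKer q hq had),
      LinearMap.rTensor_comp_apply, rTensor_adKer, X.coassoc, rTensor_lTensor_comm, rTensor_adKer]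
  counit m := by
    apply (LinearMap.ker q).injective_subtype
    refine Eq.trans ?_ (X.counit m)
    rw [← X.rTensor_adKer q hq had]
    generalize X.adKer q hq had m = t
    induction t using TensorProduct.induction_on with
    | zero => simp
    | add s t hs ht => simp only [map_add, hs, ht]
    | tmul x y => simp
  ad_d m := by
    apply rTensor_subtype_injective (LinearMap.ker q)
    rw [rTensor_adKer, map_add, LinearMap.rTensor_map, ← LinearMap.rTensor_comp_apply]
    refine (X.ad_d m).trans ?_
    rw [← X.rTensor_adKer q hq had, LinearMap.map_rTensor, ← LinearMap.rTensor_comp_apply]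
    rfl
  ad_par m := by
    apply rTensor_subtype_injective (LinearMap.ker q)
    rw [rTensor_adKer, LinearMap.rTensor_map]
    refine (X.ad_par m).trans ?_
    rw [← X.rTensor_adKer q hq had, LinearMap.map_rTensor]
    rfl
  ad_s m := by
    apply rTensor_subtype_injective (LinearMap.ker q)
    rw [rTensor_adKer, LinearMap.rTensor_map]
    refine (X.ad_s m).trans ?_
    rw [← X.rTensor_adKer q hq had, LinearMap.map_rTensor]
    rfl
  d_d m := Subtype.ext (X.d_d m)
  par_par m := Subtype.ext (X.par_par m)
  s_d m := Subtype.ext (X.s_d m)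
  symbol_rθ k v m hm := by
    apply rTensor_subtype_injective (LinearMap.ker q)
    rw [rTensor_lTensor_comm, rTensor_adKer, rTensor_lTensor_comm, rTensor_lTensor_comm,
      rTensor_adKer]
    refine X.symbol_rθ k v m ?_
    rw [← X.rTensor_adKer q hq had, ← rTensor_lTensor_comm, hm, map_zero]

/-- The coaction of `A` on a subcomodule. -/
theorem c_ofKer (m : LinearMap.ker q) : (LinearMap.ker q).subtype.rTensor A
    ((X.ofKer q hq had hd hpar hs hθ).c m) = X.c m := by
  rw [c_apply, rTensor_lTensor_comm, c_apply]
  exact congrArg _ (X.rTensor_adKer q hq had m)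

theorem mem_basic_ofKer (m : LinearMap.ker q) :
    m ∈ (X.ofKer q hq had hd hpar hs hθ).basic ↔ (m : M) ∈ X.basic := by
  rw [mem_basic, mem_basic, ← X.rTensor_adKer q hq had,
    ← (rTensor_subtype_injective (LinearMap.ker q) C.Env).eq_iff]
  rfl

end ExtComodule

/-- In the truncated representation γ sends 1 ⊗ (1, 0, 0) to its own left trivialization. The
injectivity translates closedness in Γ^∧ back to d(a) = 0 in Γ, the form in which connectedness is
given. -/
theorem gΓ_injective : Function.Injective C.gΓ := by
  have hj : ∀ a, C.germ a = 0 → C.jGerm₂ C.truncAct a = 0 := by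
    intro a ha
    refine LinearMap.ext fun n => ?_
    refine (C.truncAct_mul (C.germ₂ a) n).trans ?_
    have : C.quadRel.mkQ (C.germ₂ a) = 0 :=
      (Submodule.Quotient.mk_eq_zero _).2 ⟨a, ha, rfl⟩
    rw [this, smul_zero]; rfl
  rw [injective_iff_map_eq_zero]
  intro γ hγ
  have h1 : C.trivAct C.truncAct (C.triv γ) (1, 0, 0) = 0 := by
    have h2 := C.envRep_gΓ C.truncAct hj γ
    rw [hγ, map_zero] at h2
    have h3 := C.repΓ_tmul C.truncAct γ 1 (1, 0, 0)
    rw [← h2, MulOpposite.op_one, one_smul] at h3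
    exact h3.symm
  have h2 : ∀ t, (LinearMap.fst ℂ C.inv _ ∘ₗ LinearMap.snd ℂ ℂ _).lTensor A
      (C.trivAct C.truncAct t (1, 0, 0)) = t := by
    intro t
    induction t using TensorProduct.induction_on with
    | zero => simp
    | add s t hs ht => simp only [map_add, LinearMap.add_apply, hs, ht]
    | tmul x y => simp [trivAct_tmul, truncAct]
  apply C.triv.injective
  rw [← h2 (C.triv γ), h1, map_zero, map_zero]

theorem eq_zero_of_rTensor_dual {V Q : Type*} [AddCommGroup V] [Module ℂ V] [AddCommGroup Q]
    [Module ℂ Q] {t : V ⊗[ℂ] Q} (h : ∀ f : V →ₗ[ℂ] ℂ, f.rTensor Q t = 0) : t = 0 := by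
  classical
  let b := Module.Basis.ofVectorSpace ℂ V
  apply (TensorProduct.equivFinsuppOfBasisLeft b).injective
  rw [map_zero]
  ext i
  rw [TensorProduct.equivFinsuppOfBasisLeft_apply, h, map_zero, Finsupp.zero_apply]

/-! ### Coefficients of the adjoint action, and the equivalence of (i) and (ii). -/

section AdCoeff

/-- The subspace of the subalgebra generated by the matrix coefficients of the adjoint action. -/
abbrev adAlg : Submodule ℂ A := Subalgebra.toSubmodule (Algebra.adjoin ℂ C.adCoeff)

theorem mkQ_varpi (v : C.inv) : C.adAlg.mkQ.lTensor C.inv (C.varpi v) = 0 := by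
  refine eq_zero_of_rTensor_dual fun f => ?_
  rw [ExtComodule.rTensor_lTensor_comm]
  apply (TensorProduct.lid ℂ _).injective
  have h : TensorProduct.lid ℂ A (f.rTensor A (C.varpi v)) ∈ C.adAlg :=
    Algebra.subset_adjoin ⟨f, v, rfl⟩
  rw [map_zero, ← (Submodule.Quotient.mk_eq_zero _).2 h]
  generalize f.rTensor A (C.varpi v) = t
  induction t using TensorProduct.induction_on with
  | zero => simp
  | add s t hs ht => simp only [map_add, hs, ht]; rfl
  | tmul x y => simp

/-- The homomorphism `id ⊗ ρ`, where `ρ` is the projection to degree zero. -/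
def univZero : STensor C.Univ C.Env →ₐ[ℂ] C.Univ ⊗[ℂ] A :=
  evLift Algebra.TensorProduct.includeLeft
    ((Algebra.TensorProduct.includeRight : A →ₐ[ℂ] C.Univ ⊗[ℂ] A).comp C.envZero)
    (fun b e => by simp) (fun e => by
      rw [AlgHom.comp_apply, envZero_par]; rfl)

theorem univZero_apply (z : STensor C.Univ C.Env) :
    C.univZero z = C.envZero.toLinearMap.lTensor C.Univ (pl z) := by
  induction z using STensor.induction with
  | h0 => simp
  | ha s t hs ht => simp only [map_add, hs, ht]
  | hm b e => rw [map_mul, univZero, evLift_iL, evLift_iR, pl_mul]; simp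

theorem c_eq (w : C.Univ) : C.univComodule.c w = C.univZero (C.adTilde w) :=
  (C.univZero_apply _).symm

theorem mkQ_c_iff (w : C.Univ) : C.adAlg.mkQ.lTensor C.Univ (C.univComodule.c w) = 0 ↔
    C.univComodule.c w ∈ (Algebra.TensorProduct.map (AlgHom.id ℂ C.Univ)
      (Algebra.adjoin ℂ C.adCoeff).val).range :=
  lTensor_exact C.Univ (LinearMap.exact_subtype_mkQ C.adAlg) (Submodule.mkQ_surjective _) _

/-- The coaction of A on Ω is a homomorphism, and the tensors with second factors in the subalgebra
generated by the coefficients of ϖ form a subalgebra of Ω ⊗ A. Generators suffice, and dϑ inherits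
the property from ϑ because the coaction commutes with d. -/
theorem mkQ_c (w : C.Univ) : C.adAlg.mkQ.lTensor C.Univ (C.univComodule.c w) = 0 := by
  have hθ : ∀ v, C.adAlg.mkQ.lTensor C.Univ (C.univComodule.c (C.θ v)) = 0 := by
    intro v
    have h : C.univComodule.c (C.θ v) = C.θ.rTensor A (C.varpi v) := by
      have h0 : C.univZero (iR C.Univ C.Env (C.invEnv v)) = 0 := by
        rw [univZero, evLift_iR, AlgHom.comp_apply, show C.envZero (C.invEnv v) = 0 from
          C.envZero_gΓ _, map_zero]
      rw [c_eq, adTilde_θ, adGen_apply, map_add, h0, add_zero, map_mul₂]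
      generalize C.varpi v = t
      induction t using TensorProduct.induction_on with
      | zero => simp
      | add s t hs ht => simp only [map_add, hs, ht]
      | tmul x y => simp [univZero, evLift_iL, evLift_iR, envZero_gA]
    rw [h, ← ExtComodule.rTensor_lTensor_comm, mkQ_varpi, map_zero]
  rw [mkQ_c_iff, c_eq]
  have hw : w ∈ Algebra.adjoin ℂ C.univGen := C.adjoin_univGen ▸ Algebra.mem_top
  refine Algebra.adjoin_le (S := (Algebra.TensorProduct.map (AlgHom.id ℂ C.Univ)
      (Algebra.adjoin ℂ C.adCoeff).val).range.comap (C.univZero.comp C.adTilde)) ?_ hw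
  rintro _ (⟨v, rfl⟩ | ⟨v, rfl⟩)
  · have h := (C.mkQ_c_iff _).1 (hθ v)
    rw [c_eq] at h
    exact h
  · have h := C.univComodule.c_d (C.θ v)
    have h2 : C.adAlg.mkQ.lTensor C.Univ (C.univComodule.c (C.dθ v)) = 0 := by
      rw [← diff_θ, show C.diff.d (C.θ v) = C.univComodule.d (C.θ v) from rfl, h,
        ← ExtComodule.rTensor_lTensor_comm, hθ, map_zero]
    have h3 := (C.mkQ_c_iff _).1 h2
    rw [c_eq] at h3
    exact h3

theorem AdConnected.eq_algebraMap {C : BicovariantStarCalculus A Γ} (hC : C.AdConnected) (a : A)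
    (h : C.adAlg.mkQ a = 0) (hd : C.envDiff.d (C.gA a) = 0) : ∃ z : ℂ, a = algebraMap ℂ A z := by
  refine hC a ((Submodule.Quotient.mk_eq_zero _).1 h) (C.gΓ_injective ?_)
  rw [← envDiff_gA, hd, map_zero]

end AdCoeff

namespace EmbeddedDifferential
variable {C} (δ : C.EmbeddedDifferential)

theorem mem_ker_p {w : C.Univ} : w ∈ LinearMap.ker δ.p.toLinearMap ↔ w ∈ δ.K :=
  (δ.mem_K_iff w).symm

theorem univScale_R (v : C.inv) : C.univScale (δ.R v) = (4 : ℂ) • δ.R v := by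
  have h : ∀ t, C.univScale (mul₂ C.θ C.θ t) = (4 : ℂ) • mul₂ C.θ C.θ t := by
    intro t
    rw [map_mul₂]
    induction t using TensorProduct.induction_on with
    | zero => simp
    | add s t hs ht => simp only [map_add, smul_add, hs, ht]
    | tmul x y =>
      simp [univScale_θ, smul_smul]; norm_num
  change C.univScale (C.dθ v - mul₂ C.θ C.θ (δ.δ v)) = (4 : ℂ) • (C.dθ v - mul₂ C.θ C.θ (δ.δ v))
  rw [map_sub, h, univScale_dθ, smul_sub]

theorem univScale_mul₂ {f g : C.inv →ₗ[ℂ] C.Univ} (a b : ℂ) (hf : ∀ v, C.univScale (f v) = a • f v)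
    (hg : ∀ v, C.univScale (g v) = b • g v) (t : C.inv ⊗[ℂ] C.inv) :
    C.univScale (mul₂ f g t) = (a * b) • mul₂ f g t := by
  rw [map_mul₂]
  induction t using TensorProduct.induction_on with
  | zero => simp
  | add s t hs ht => simp only [map_add, smul_add, hs, ht]
  | tmul x y => simp [hf, hg, smul_smul, mul_comm]

theorem univScale_mem_K {w : C.Univ} (hw : w ∈ δ.K) : C.univScale w ∈ δ.K := by
  refine δ.mem_ker_p.1 (eq_zero_of_mem_span δ.kGen (δ.p.comp C.univScale).toRingHom ?_ w hw)
  intro x hx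
  have hK : δ.p x = 0 := δ.p_eq_zero (TwoSidedIdeal.subset_span hx)
  suffices h : ∃ c : ℂ, C.univScale x = c • x by
    obtain ⟨c, hc⟩ := h
    change δ.p (C.univScale x) = 0
    rw [hc, map_smul, hK, smul_zero]
  rcases hx with (⟨t, ht, rfl⟩ | ⟨η, ϑ, rfl⟩) | ⟨η, ϑ, rfl⟩
  · exact ⟨_, univScale_mul₂ 2 2 C.univScale_θ C.univScale_θ t⟩
  · refine ⟨4 * 2, ?_⟩
    rw [j₃, map_sub, univScale_mul₂ 4 2 δ.univScale_R C.univScale_θ, map_mul, univScale_θ,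
      univScale_R, smul_mul_smul_comm, smul_sub, mul_comm (2 : ℂ)]
  · refine ⟨4 * 4, ?_⟩
    rw [j₄, map_sub, univScale_mul₂ 4 4 δ.univScale_R δ.univScale_R, map_mul, univScale_R,
      univScale_R, smul_mul_smul_comm, smul_sub]

/-- The ideal `𝒦` as a graded differential comodule over the envelope. -/
def kerComodule : C.ExtComodule (LinearMap.ker δ.p.toLinearMap) :=
  C.univComodule.ofKer δ.p.toLinearMap δ.p_surjective
    (fun w hw => by
      refine (pl_tensorMap δ.p δ.par_p (C.adTilde w)).symm.trans ?_
      have := δ.pAd_eq_zero w (δ.mem_ker_p.1 hw)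
      rw [pTensor] at this
      rw [this, map_zero])
    (fun w hw => δ.mem_ker_p.2 (δ.diff_mem_K w (δ.mem_ker_p.1 hw)))
    (fun w hw => δ.p_par (δ.mem_ker_p.1 hw))
    (fun w hw => δ.mem_ker_p.2 (δ.univScale_mem_K (δ.mem_ker_p.1 hw)))
    (fun v w hw => by
      change δ.p (w * C.θ v) = 0
      rw [map_mul, show δ.p w = 0 from hw, zero_mul])

theorem mem_basic_iff {w : C.Univ} : w ∈ C.univComodule.basic ↔ w ∈ C.daleth := by
  rw [ExtComodule.mem_basic]
  exact pl.injective.eq_iff (a := C.adTilde w) (b := iL C.Univ C.Env w)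

theorem mem_basic_kerComodule (w : LinearMap.ker δ.p.toLinearMap) :
    w ∈ δ.kerComodule.basic ↔ (w : C.Univ) ∈ C.daleth :=
  (ExtComodule.mem_basic_ofKer _ _ _ _ _ _ _ _ w).trans mem_basic_iff

theorem c_kerComodule (w : LinearMap.ker δ.p.toLinearMap) :
    (LinearMap.ker δ.p.toLinearMap).subtype.rTensor A (δ.kerComodule.c w) = C.univComodule.c w :=
  ExtComodule.c_ofKer _ _ _ _ _ _ _ _ w

theorem idealAcyclic_iff_kerComodule : δ.IdealAcyclic ↔
    ∀ m, δ.kerComodule.d m = 0 → ∃ m', δ.kerComodule.d m' = m := by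
  constructor
  · intro H m hm
    obtain ⟨w, hw, hd⟩ := H m (δ.mem_ker_p.1 m.2) (congrArg Subtype.val hm)
    exact ⟨⟨w, δ.mem_ker_p.2 hw⟩, Subtype.ext hd⟩
  · intro H w hw hd
    obtain ⟨m, hm⟩ := H ⟨w, δ.mem_ker_p.2 hw⟩ (Subtype.ext hd)
    exact ⟨m, δ.mem_ker_p.1 m.2, congrArg Subtype.val hm⟩

theorem invariantPartAcyclic_iff_kerComodule : δ.InvariantPartAcyclic ↔
    ∀ m ∈ δ.kerComodule.basic, δ.kerComodule.d m = 0 →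
      ∃ m' ∈ δ.kerComodule.basic, δ.kerComodule.d m' = m := by
  constructor
  · intro H m hm hd
    obtain ⟨w, ⟨hw, hw'⟩, hdw⟩ := H m ⟨δ.mem_ker_p.1 m.2, (δ.mem_basic_kerComodule m).1 hm⟩
      (congrArg Subtype.val hd)
    exact ⟨⟨w, δ.mem_ker_p.2 hw⟩, (δ.mem_basic_kerComodule _).2 hw', Subtype.ext hdw⟩
  · rintro H w ⟨hw, hw'⟩ hd
    obtain ⟨m, hm, hdm⟩ := H ⟨w, δ.mem_ker_p.2 hw⟩ ((δ.mem_basic_kerComodule _).2 hw')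
      (Subtype.ext hd)
    exact ⟨m, ⟨δ.mem_ker_p.1 m.2, (δ.mem_basic_kerComodule m).1 hm⟩, congrArg Subtype.val hdm⟩

theorem invariantPartAcyclic_of_idealAcyclic {h : A →ₗ[ℂ] ℂ} (hh : IsHaar h)
    (H : δ.IdealAcyclic) : δ.InvariantPartAcyclic :=
  δ.invariantPartAcyclic_iff_kerComodule.2 fun _ hm hd =>
    δ.kerComodule.basic_acyclic hh (δ.idealAcyclic_iff_kerComodule.1 H) hm hd

/-- Connectedness is needed only to identify the complex `loc` of 𝒦 with 𝒦 ∩ ℸ; the passage from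
`loc` to all of 𝒦 is general. -/
theorem idealAcyclic_of_invariantPartAcyclic {h : A →ₗ[ℂ] ℂ} (hh : IsHaar h) (hC : C.AdConnected)
    (H : δ.InvariantPartAcyclic) : δ.IdealAcyclic := by
  have hle : δ.kerComodule.loc ≤ δ.kerComodule.basic := by
    refine δ.kerComodule.loc_le_basic C.adAlg.mkQ (fun m => ?_) hC.eq_algebraMap
    apply ExtComodule.rTensor_subtype_injective (LinearMap.ker δ.p.toLinearMap)
    rw [ExtComodule.rTensor_lTensor_comm, c_kerComodule, mkQ_c, map_zero]
  refine δ.idealAcyclic_iff_kerComodule.2 fun m hm =>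
    δ.kerComodule.acyclic_of_loc hh (fun b hb hd => ?_) hm
  obtain ⟨b', hb', hd'⟩ := δ.invariantPartAcyclic_iff_kerComodule.1 H b (hle hb) hd
  exact ⟨b', δ.kerComodule.basic_le_loc hb', hd'⟩

end EmbeddedDifferential

/-! ### Lifting invariant elements from Ω_* to Ω. -/

namespace EmbeddedDifferential
variable {C} (δ : C.EmbeddedDifferential)

section Retraction

/-- The homomorphism `Ω → Ω_*` with `ϑ ↦ 0` and `dϑ ↦ R(ϑ)`. -/
def retrU : C.Univ →ₐ[ℂ] δ.OmegaStar := C.univLift 0 δ.r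

theorem retrU_θ (v : C.inv) : δ.retrU (C.θ v) = 0 := C.univLift_θ _ _ v
theorem retrU_dθ (v : C.inv) : δ.retrU (C.dθ v) = δ.r v := C.univLift_dθ _ _ v

theorem retrU_comp_θ : δ.retrU.toLinearMap ∘ₗ C.θ = 0 := LinearMap.ext δ.retrU_θ

theorem mul₂_zero_right {P M N : Type*} [Ring P] [Algebra ℂ P] [AddCommGroup M] [Module ℂ M]
    [AddCommGroup N] [Module ℂ N] (f : M →ₗ[ℂ] P) (t : M ⊗[ℂ] N) : mul₂ f 0 t = 0 := by
  induction t using TensorProduct.induction_on with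
  | zero => simp
  | add s t hs ht => rw [map_add, hs, ht, add_zero]
  | tmul u v => simp

theorem mul₂_zero_left {P M N : Type*} [Ring P] [Algebra ℂ P] [AddCommGroup M] [Module ℂ M]
    [AddCommGroup N] [Module ℂ N] (g : N →ₗ[ℂ] P) (t : M ⊗[ℂ] N) : mul₂ 0 g t = 0 := by
  induction t using TensorProduct.induction_on with
  | zero => simp
  | add s t hs ht => rw [map_add, hs, ht, add_zero]
  | tmul u v => simp

theorem retrU_R (v : C.inv) : δ.retrU (δ.R v) = δ.r v := by
  change δ.retrU (C.dθ v - mul₂ C.θ C.θ (δ.δ v)) = _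
  rw [map_sub, retrU_dθ, map_mul₂, retrU_comp_θ, mul₂_zero_right, sub_zero]

theorem retrU_comp_R : δ.retrU.toLinearMap ∘ₗ δ.R = δ.r := LinearMap.ext δ.retrU_R

/-- The quadratic generators and j₃ contain a factor ϑ in every term and are sent to zero. The
generators j₄ are sent to the same relations among the classes of R, which hold in Ω_*. -/
theorem retrU_eq_zero : ∀ w ∈ δ.K, δ.retrU w = 0 := by
  refine eq_zero_of_mem_span δ.kGen δ.retrU.toRingHom ?_
  rintro w ((⟨t, -, rfl⟩ | ⟨η, ϑ, rfl⟩) | ⟨η, ϑ, rfl⟩)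
  · exact (map_mul₂ _ _ δ.retrU t).trans (by rw [retrU_comp_θ, mul₂_zero_right])
  · change δ.retrU (δ.j₃ η ϑ) = 0
    rw [j₃, map_sub, map_mul, map_mul₂, retrU_comp_θ, mul₂_zero_right, retrU_θ, zero_mul, sub_zero]
  · change δ.retrU (δ.j₄ η ϑ) = 0
    rw [j₄, map_sub, map_mul, map_mul₂, retrU_comp_R, retrU_R, retrU_R, δ.commutes_r, braid_tmul,
      mul₂_lTensor, sub_self]

/-- The endomorphism of `Ω_*` with `ϑ ↦ 0` that fixes the classes of the elements `R(ϑ)`. -/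
def retr : δ.OmegaStar →ₐ[ℂ] δ.OmegaStar := idealLift δ.K δ.retrU δ.retrU_eq_zero

theorem retr_x (v : C.inv) : δ.retr (δ.x v) = 0 := δ.retrU_θ v
theorem retr_r (v : C.inv) : δ.retr (δ.r v) = δ.r v := δ.retrU_R v

theorem retr_par (y : δ.OmegaStar) : δ.retr (Super.par y) = Super.par (δ.retr y) := by
  obtain ⟨w, rfl⟩ := δ.p_surjective y
  refine congrArg (fun f : C.Univ →ₐ[ℂ] δ.OmegaStar => f w)
    (C.univ_algHom_ext (f := δ.retrU.comp Super.par) (g := Super.par.comp δ.retrU) ?_ ?_)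
  · intro v
    rw [AlgHom.comp_apply, AlgHom.comp_apply, par_θ, map_neg, retrU_θ, neg_zero, map_zero]
  · intro v
    rw [AlgHom.comp_apply, AlgHom.comp_apply, par_dθ, retrU_dθ, par_r]

theorem retr_mem (y : δ.OmegaStar) : δ.retr y ∈ Algebra.adjoin ℂ (Set.range δ.r) := by
  obtain ⟨w, rfl⟩ := δ.p_surjective y
  have hw : w ∈ Algebra.adjoin ℂ C.univGen := C.adjoin_univGen ▸ Algebra.mem_top
  refine Algebra.adjoin_le (S := (Algebra.adjoin ℂ (Set.range δ.r)).comap δ.retrU) ?_ hw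
  rintro _ (⟨v, rfl⟩ | ⟨v, rfl⟩)
  · change δ.retrU (C.θ v) ∈ Algebra.adjoin ℂ (Set.range δ.r)
    rw [retrU_θ]; exact zero_mem _
  · change δ.retrU (C.dθ v) ∈ Algebra.adjoin ℂ (Set.range δ.r)
    rw [retrU_dθ]; exact Algebra.subset_adjoin ⟨v, rfl⟩

end Retraction

section NormalForm

/-- The words in the classes of the generators. -/
def xword (l : List C.inv) : δ.OmegaStar := (l.map δ.x).prod

theorem xword_cons (v : C.inv) (l : List C.inv) : δ.xword (v :: l) = δ.x v * δ.xword l :=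
  List.prod_cons

/-- The span of the products of elements generated by the `R(ϑ)` with words in the `ϑ`. -/
def normalSpan : Submodule ℂ δ.OmegaStar :=
  Submodule.span ℂ {y | ∃ a ∈ Algebra.adjoin ℂ (Set.range δ.r), ∃ l, y = a * δ.xword l}

theorem r_mul_mem {a y : δ.OmegaStar} (ha : a ∈ Algebra.adjoin ℂ (Set.range δ.r))
    (hy : y ∈ δ.normalSpan) : a * y ∈ δ.normalSpan := by
  induction hy using Submodule.span_induction with
  | zero => rw [mul_zero]; exact zero_mem _
  | add y z _ _ hy hz => rw [mul_add]; exact add_mem hy hz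
  | smul c y _ hy => rw [mul_smul_comm]; exact Submodule.smul_mem _ c hy
  | mem y hy =>
    obtain ⟨b, hb, l, rfl⟩ := hy
    rw [← mul_assoc]
    exact Submodule.subset_span ⟨_, mul_mem ha hb, l, rfl⟩

/-- The relations j₃ move one ϑ to the right past every R. Both change on the way, but exactly one
factor of each kind remains at every exchange, so the normal form is reached. -/
theorem x_mul_r_mem {a : δ.OmegaStar} (ha : a ∈ Algebra.adjoin ℂ (Set.range δ.r)) (v : C.inv) :
    δ.x v * a ∈ Submodule.span ℂ {y | ∃ a ∈ Algebra.adjoin ℂ (Set.range δ.r), ∃ w, y = a * δ.x w} := by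
  induction ha using Algebra.adjoin_induction generalizing v with
  | mem a ha =>
    obtain ⟨ϑ, rfl⟩ := ha
    rw [δ.commutes_x]
    generalize C.varpi ϑ = t
    induction t using TensorProduct.induction_on with
    | zero => rw [map_zero]; exact zero_mem _
    | add s t hs ht => rw [map_add]; exact add_mem hs ht
    | tmul u c => exact Submodule.subset_span ⟨_, Algebra.subset_adjoin ⟨u, rfl⟩, _, rfl⟩
  | algebraMap z =>
    rw [← Algebra.commutes]
    exact Submodule.subset_span ⟨_, Subalgebra.algebraMap_mem _ z, v, rfl⟩
  | add a b _ _ ha hb => rw [mul_add]; exact add_mem (ha v) (hb v)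
  | mul a b _ _ ha hb =>
    rw [← mul_assoc]
    have h := ha v
    generalize δ.x v * a = y at h ⊢
    clear ha
    induction h using Submodule.span_induction with
    | zero => rw [zero_mul]; exact zero_mem _
    | add y z _ _ hy hz => rw [add_mul]; exact add_mem hy hz
    | smul c y _ hy => rw [smul_mul_assoc]; exact Submodule.smul_mem _ c hy
    | mem y hy =>
      obtain ⟨a', ha', w, rfl⟩ := hy
      rw [mul_assoc]
      have h := hb w
      generalize δ.x w * b = y at h ⊢
      clear hb
      induction h using Submodule.span_induction with
      | zero => rw [mul_zero]; exact zero_mem _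
      | add y z _ _ hy hz => rw [mul_add]; exact add_mem hy hz
      | smul c y _ hy => rw [mul_smul_comm]; exact Submodule.smul_mem _ c hy
      | mem y hy =>
        obtain ⟨b', hb', w', rfl⟩ := hy
        rw [← mul_assoc]
        exact Submodule.subset_span ⟨_, mul_mem ha' hb', w', rfl⟩

theorem x_mul_mem (v : C.inv) {y : δ.OmegaStar} (hy : y ∈ δ.normalSpan) :
    δ.x v * y ∈ δ.normalSpan := by
  induction hy using Submodule.span_induction with
  | zero => rw [mul_zero]; exact zero_mem _
  | add y z _ _ hy hz => rw [mul_add]; exact add_mem hy hz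
  | smul c y _ hy => rw [mul_smul_comm]; exact Submodule.smul_mem _ c hy
  | mem y hy =>
    obtain ⟨a, ha, l, rfl⟩ := hy
    rw [← mul_assoc]
    have h := δ.x_mul_r_mem ha v
    generalize δ.x v * a = y at h ⊢
    induction h using Submodule.span_induction with
    | zero => rw [zero_mul]; exact zero_mem _
    | add y z _ _ hy hz => rw [add_mul]; exact add_mem hy hz
    | smul c y _ hy => rw [smul_mul_assoc]; exact Submodule.smul_mem _ c hy
    | mem y hy =>
      obtain ⟨a', ha', w, rfl⟩ := hy
      rw [mul_assoc, ← xword_cons]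
      exact Submodule.subset_span ⟨_, ha', _, rfl⟩

theorem mem_normalSpan (y : δ.OmegaStar) : y ∈ δ.normalSpan := by
  obtain ⟨w, rfl⟩ := δ.p_surjective y
  induction w using C.univ_induction with
  | h1 =>
    rw [map_one]
    exact Submodule.subset_span ⟨1, one_mem _, [], (mul_one _).symm⟩
  | hadd x y hx hy => rw [map_add]; exact add_mem hx hy
  | hsmul c x hx => rw [map_smul]; exact Submodule.smul_mem _ c hx
  | hθ v x hx => rw [map_mul]; exact δ.x_mul_mem v hx
  | hdθ v x hx =>
    have h : δ.p (C.dθ v) = δ.r v + mul₂ δ.x δ.x (δ.δ v) := by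
      rw [← diff_θ]; exact δ.pd_θ v
    rw [map_mul, h, add_mul]
    refine add_mem (δ.r_mul_mem (Algebra.subset_adjoin ⟨v, rfl⟩) hx) ?_
    generalize δ.δ v = t
    induction t using TensorProduct.induction_on with
    | zero => rw [map_zero, zero_mul]; exact zero_mem _
    | add s t hs ht => rw [map_add, add_mul]; exact add_mem hs ht
    | tmul u u' =>
      change δ.x u * δ.x u' * δ.p x ∈ _
      rw [mul_assoc]
      exact δ.x_mul_mem u (δ.x_mul_mem u' hx)

end NormalForm

section Beth

/-- The action on `Ω_*`, followed by the retraction. -/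
def retrAd : δ.OmegaStar →ₐ[ℂ] STensor δ.OmegaStar C.Env :=
  (tensorMap δ.retr δ.retr_par).comp (δ.adStar δ.pAd_eq_zero)

theorem tensorMap_twist (y : C.inv →ₗ[ℂ] δ.OmegaStar) (v : C.inv) :
    tensorMap δ.retr δ.retr_par (C.twist y v) = C.twist (δ.retr.toLinearMap ∘ₗ y) v := by
  rw [twist, twist, LinearMap.comp_apply, map_mul₂, LinearMap.comp_apply]
  generalize C.varpi v = t
  induction t using TensorProduct.induction_on with
  | zero => simp
  | add s t hs ht => simp only [map_add, hs, ht]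
  | tmul x y => simp [tensorMap_iL, tensorMap_iR, iA]

theorem retrAd_r (v : C.inv) : δ.retrAd (δ.r v) = C.twist δ.r v := by
  change tensorMap δ.retr δ.retr_par (δ.pAd (δ.R v)) = _
  rw [pAd_R, tensorMap_twist, show δ.retr.toLinearMap ∘ₗ δ.r = δ.r from LinearMap.ext δ.retr_r]

theorem retrAd_x (v : C.inv) : δ.retrAd (δ.x v) = C.iV δ.OmegaStar v := by
  change tensorMap δ.retr δ.retr_par (δ.pAd (C.θ v)) = _
  rw [pAd_θ, map_add, tensorMap_twist, show δ.retr.toLinearMap ∘ₗ δ.x = 0 from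
    LinearMap.ext δ.retr_x, iV, LinearMap.comp_apply, AlgHom.toLinearMap_apply, tensorMap_iR]
  rw [add_eq_right, twist, LinearMap.comp_apply, LinearMap.comp_zero, mul₂_zero_left]

theorem retrAd_xword (l : List C.inv) :
    δ.retrAd (δ.xword l) = iR δ.OmegaStar C.Env (C.word l) := by
  induction l with
  | nil => rw [word_nil, map_one]; exact map_one _
  | cons v l ih => rw [xword_cons, map_mul, ih, retrAd_x, word_cons, map_mul]; rfl

/-- The action of `Γ_inv` on `Ω_*` by left multiplication. -/
def xAct : C.inv →ₗ[ℂ] Module.End ℂ δ.OmegaStar := LinearMap.mul ℂ δ.OmegaStar ∘ₗ δ.x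

theorem jGerm₂_xAct (a : A) (ha : C.germ a = 0) : C.jGerm₂ δ.xAct a = 0 := by
  have h : ∀ t, mul₂ (P := Module.End ℂ δ.OmegaStar) δ.xAct δ.xAct t
      = LinearMap.mul ℂ δ.OmegaStar (mul₂ δ.x δ.x t) := by
    intro t
    induction t using TensorProduct.induction_on with
    | zero => simp
    | add s t hs ht => simp only [map_add, hs, ht]
    | tmul x y =>
      ext z
      simp [xAct, mul_assoc]
  rw [jGerm₂, LinearMap.comp_apply, h, mul₂_x_germ₂, ha, map_zero, map_zero, neg_zero, map_zero]

/-- The evaluation `e ↦ (ε ⊗ id) e (1 ⊗ 1)`. -/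
def envEval : C.Env →ₗ[ℂ] δ.OmegaStar :=
  (TensorProduct.lid ℂ δ.OmegaStar).toLinearMap ∘ₗ
    (Coalgebra.counit (R := ℂ) (A := A)).rTensor δ.OmegaStar ∘ₗ
    LinearMap.applyₗ (1 ⊗ₜ 1) ∘ₗ (C.envRep δ.xAct δ.jGerm₂_xAct).toLinearMap

theorem envEval_apply (e : C.Env) : δ.envEval e = TensorProduct.lid ℂ δ.OmegaStar
    ((Coalgebra.counit (R := ℂ) (A := A)).rTensor δ.OmegaStar
      (C.envRep δ.xAct δ.jGerm₂_xAct e (1 ⊗ₜ 1))) := rfl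

theorem envEval_word (l : List C.inv) : δ.envEval (C.word l) = δ.xword l := by
  have h : C.envRep δ.xAct δ.jGerm₂_xAct (C.word l) (1 ⊗ₜ 1) = 1 ⊗ₜ δ.xword l := by
    induction l with
    | nil => rw [word_nil, map_one]; rfl
    | cons v l ih => rw [word_cons, map_mul, Module.End.mul_apply, ih, envRep_inv, xword_cons]; rfl
  rw [envEval_apply, h]
  simp

theorem envEval_gA_mul (a : A) (e : C.Env) :
    δ.envEval (C.gA a * e) = Coalgebra.counit (R := ℂ) a • δ.envEval e := by
  rw [envEval_apply, envEval_apply, map_mul, Module.End.mul_apply, envRep_gA, repA_apply]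
  generalize C.envRep δ.xAct δ.jGerm₂_xAct e (1 ⊗ₜ 1) = t
  induction t using TensorProduct.induction_on with
  | zero => simp
  | add s t hs ht => simp only [map_add, smul_add, hs, ht]
  | tmul x y => simp [mul_smul]

/-- The map `s ⊗ e ↦ s envEval(e)`. -/
def flat : STensor δ.OmegaStar C.Env →ₗ[ℂ] δ.OmegaStar := mul₂ LinearMap.id δ.envEval ∘ₗ pl.toLinearMap

theorem flat_mul (b : δ.OmegaStar) (e : C.Env) :
    δ.flat (iL δ.OmegaStar C.Env b * iR δ.OmegaStar C.Env e) = b * δ.envEval e := by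
  rw [flat, LinearMap.comp_apply, LinearEquiv.coe_coe, pl_mul]; rfl

/-- The second factors of ϖ(v) are even and pass the first factors without sign; `envEval` replaces
them by their counits, and the counit property of ϖ returns v. -/
theorem flat_twist (v : C.inv) (z : STensor δ.OmegaStar C.Env) :
    δ.flat (C.twist δ.r v * z) = δ.r v * δ.flat z := by
  conv_rhs => rw [← C.varpi_counit v]
  rw [twist, LinearMap.comp_apply]
  generalize C.varpi v = t
  induction t using TensorProduct.induction_on with
  | zero => simp
  | add s t hs ht => simp only [map_add, add_mul, hs, ht]
  | tmul u c =>
    induction z using STensor.induction with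
    | h0 => simp
    | ha s t hs ht => simp only [map_add, mul_add, hs, ht]
    | hm b e =>
      have h : mul₂ ((iL δ.OmegaStar C.Env).toLinearMap ∘ₗ δ.r) (C.iA δ.OmegaStar) (u ⊗ₜ c)
          * (iL δ.OmegaStar C.Env b * iR δ.OmegaStar C.Env e)
          = iL δ.OmegaStar C.Env (δ.r u * b) * iR δ.OmegaStar C.Env (C.gA c * e) := by
        change iL δ.OmegaStar C.Env (δ.r u) * C.iA δ.OmegaStar c * _ = _
        rw [mul_assoc, ← mul_assoc (C.iA δ.OmegaStar c), iA_mul_iL, map_mul, map_mul, mul_assoc,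
          mul_assoc]
        rfl
      rw [h, flat_mul, flat_mul, envEval_gA_mul]
      simp [mul_assoc]

theorem flat_retrAd_mul {a : δ.OmegaStar} (ha : a ∈ Algebra.adjoin ℂ (Set.range δ.r))
    (z : STensor δ.OmegaStar C.Env) : δ.flat (δ.retrAd a * z) = a * δ.flat z := by
  induction ha using Algebra.adjoin_induction generalizing z with
  | mem a ha => obtain ⟨v, rfl⟩ := ha; rw [retrAd_r, flat_twist]
  | algebraMap c =>
    rw [AlgHom.commutes, Algebra.algebraMap_eq_smul_one, smul_mul_assoc, one_mul, map_smul,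
      Algebra.algebraMap_eq_smul_one, smul_mul_assoc, one_mul]
  | add a b _ _ ha hb => rw [map_add, add_mul, map_add, ha, hb, add_mul]
  | mul a b _ _ ha hb => rw [map_mul δ.retrAd a b, mul_assoc, ha, hb, mul_assoc]

/-- On a normal form, a polynomial in the r times a word in the x, the retracted action keeps the
horizontal action on the polynomial and sends the word to 1 ⊗ word. Evaluating the second factor
restores the word, so the curvature part and the connection part of y are both recovered. -/
theorem flat_retrAd (y : δ.OmegaStar) : δ.flat (δ.retrAd y) = y := by
  induction δ.mem_normalSpan y using Submodule.span_induction with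
  | zero => rw [map_zero, map_zero]
  | add y z _ _ hy hz => rw [map_add, map_add, hy, hz]
  | smul c y _ hy => rw [map_smul, map_smul, hy]
  | mem y hy =>
    obtain ⟨a, ha, l, rfl⟩ := hy
    have h := δ.flat_mul 1 (C.word l)
    rw [map_one, one_mul, one_mul] at h
    rw [map_mul, δ.flat_retrAd_mul ha, retrAd_xword, h, envEval_word]

/-- When the action on y is y ⊗ 1, the identity `flat_retrAd` reads retr(y)·1 = y. Together with
`retr_mem`, invariant elements of Ω_* are therefore polynomials in the classes of the R(ϑ). -/
theorem retr_of_mem_beth {y : δ.OmegaStar} (hy : y ∈ δ.beth δ.pAd_eq_zero) : δ.retr y = y := by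
  have h1 : δ.adStar δ.pAd_eq_zero y = iL δ.OmegaStar C.Env y := hy
  have h2 := δ.flat_mul (δ.retr y) 1
  conv_rhs => rw [← δ.flat_retrAd y]
  rw [retrAd, AlgHom.comp_apply, h1, tensorMap_iL]
  rw [map_one, mul_one] at h2
  rw [h2, ← C.word_nil, envEval_word]
  exact (mul_one _).symm

end Beth

end EmbeddedDifferential

section Horizontal

/-- The homomorphism `a ↦ 1 ⊗ a` into the envelope. -/
def gAHom : A →ₐ[ℂ] C.Env := AlgHom.ofLinearMap C.gA C.gA_one C.gA_mul

/-- The homomorphism `Ω ⊗ A → Ω ⊗̂ Γ^∧`. -/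
def horHom : C.Univ ⊗[ℂ] A →ₐ[ℂ] STensor C.Univ C.Env :=
  Algebra.TensorProduct.lift (iL C.Univ C.Env) ((iR C.Univ C.Env).comp C.gAHom)
    fun b a => (C.iA_mul_iL a b).symm

theorem horHom_tmul (b : C.Univ) (a : A) :
    C.horHom (b ⊗ₜ a) = iL C.Univ C.Env b * iR C.Univ C.Env (C.gA a) :=
  Algebra.TensorProduct.lift_tmul _ _ _ _ _

theorem pl_horHom (t : C.Univ ⊗[ℂ] A) : pl (C.horHom t) = C.gA.lTensor C.Univ t := by
  induction t using TensorProduct.induction_on with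
  | zero => simp
  | add s t hs ht => simp only [map_add, hs, ht]
  | tmul b a => rw [horHom_tmul, pl_mul, LinearMap.lTensor_tmul]

theorem mem_filt_zero {w : C.Univ} (hw : C.adTilde w ∈ C.horHom.range) :
    w ∈ C.univComodule.filt 0 := by
  obtain ⟨t, ht⟩ := hw
  intro j hj
  rw [ExtComodule.lam_apply]
  have h : C.univComodule.ad w = C.gA.lTensor C.Univ t := by
    rw [← pl_horHom, show C.horHom t = C.adTilde w from ht]; rfl
  rw [h, ← LinearMap.lTensor_comp_apply,
    show C.envPr j ∘ₗ C.gA = 0 from LinearMap.ext fun a => C.envPr_gA a hj.ne',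
    LinearMap.lTensor_zero, LinearMap.zero_apply]

theorem twist_mem_range (y : C.inv →ₗ[ℂ] C.Univ) (v : C.inv) : C.twist y v ∈ C.horHom.range := by
  rw [twist, LinearMap.comp_apply]
  generalize C.varpi v = t
  induction t using TensorProduct.induction_on with
  | zero => rw [map_zero]; exact zero_mem _
  | add s t hs ht => rw [map_add]; exact add_mem hs ht
  | tmul u a => exact ⟨y u ⊗ₜ a, C.horHom_tmul _ _⟩

end Horizontal

namespace EmbeddedDifferential
variable {C} (δ : C.EmbeddedDifferential)

theorem adTilde_R_mem (v : C.inv) : C.adTilde (δ.R v) ∈ C.horHom.range := by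
  obtain ⟨a, rfl, ha⟩ := δ.exists_germ v
  have h : δ.R (C.germ a) = C.dθ (C.germ a) + mul₂ C.θ C.θ (C.germ₂ a) := by
    change C.dθ (C.germ a) - mul₂ C.θ C.θ (δ.δ (C.germ a)) = _
    rw [ha, map_neg, sub_neg_eq_add]
  rw [h, adTilde_R_aux]
  refine add_mem (C.twist_mem_range _ _) ?_
  generalize C.germ₂ a = t
  induction t using TensorProduct.induction_on with
  | zero => rw [map_zero]; exact zero_mem _
  | add s t hs ht => rw [map_add]; exact add_mem hs ht
  | tmul u v => exact mul_mem (C.twist_mem_range _ u) (C.twist_mem_range _ v)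

theorem mem_filt_zero_of_mem_adjoin {u : C.Univ} (hu : u ∈ Algebra.adjoin ℂ (Set.range δ.R)) :
    u ∈ C.univComodule.filt 0 := by
  refine C.mem_filt_zero (Algebra.adjoin_le (S := C.horHom.range.comap C.adTilde) ?_ hu)
  rintro _ ⟨v, rfl⟩
  exact δ.adTilde_R_mem v

theorem p_avgA {h : A →ₗ[ℂ] ℂ} (hh : IsHaar h) {u : C.Univ} (hu : δ.p u ∈ δ.beth δ.pAd_eq_zero) :
    δ.p (C.univComodule.avgA h u) = δ.p u := by
  have h1 : δ.p.toLinearMap.rTensor A (C.univComodule.c u) = δ.p u ⊗ₜ 1 := by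
    have h2 : δ.p.toLinearMap.rTensor C.Env (C.adU u) = δ.p u ⊗ₜ 1 := by
      refine (pl_tensorMap δ.p δ.par_p (C.adTilde u)).symm.trans ?_
      rw [← pl_iL]
      exact congrArg pl hu
    rw [ExtComodule.c_apply, ExtComodule.rTensor_lTensor_comm]
    refine (congrArg _ h2).trans ?_
    rw [LinearMap.lTensor_tmul, AlgHom.toLinearMap_apply, map_one]
  have h3 : ∀ t : C.Univ ⊗[ℂ] A, δ.p (TensorProduct.rid ℂ C.Univ (h.lTensor C.Univ t))
      = TensorProduct.rid ℂ δ.OmegaStar (h.lTensor δ.OmegaStar (δ.p.toLinearMap.rTensor A t)) := by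
    intro t
    induction t using TensorProduct.induction_on with
    | zero => simp
    | add s t hs ht => simp only [map_add, hs, ht]
    | tmul x z => simp
  refine (h3 _).trans ?_
  rw [h1, LinearMap.lTensor_tmul, hh.one, TensorProduct.rid_tmul, one_smul]

/-- The polynomial in the classes of the R(ϑ) that represents y lifts to the same polynomial in Ω,
which is horizontal. Its average is invariant in Ω, and it still lies over y because y is invariant
itself. -/
theorem exists_mem_daleth {h : A →ₗ[ℂ] ℂ} (hh : IsHaar h) {y : δ.OmegaStar}
    (hy : y ∈ δ.beth δ.pAd_eq_zero) : ∃ x ∈ C.daleth, δ.p x = y := by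
  have h1 : y ∈ (Algebra.adjoin ℂ (Set.range δ.R)).map δ.p := by
    rw [AlgHom.map_adjoin, ← Set.range_comp]
    have := δ.retr_mem y
    rw [δ.retr_of_mem_beth hy] at this
    exact this
  obtain ⟨u, hu, rfl⟩ := h1
  exact ⟨_, mem_basic_iff.1 (C.univComodule.avgA_mem_basic hh (δ.mem_filt_zero_of_mem_adjoin hu)),
    δ.p_avgA hh hy⟩

end EmbeddedDifferential
end BicovariantStarCalculus
end
end QPB

/-- The complexes `𝒦 ∩ ℸ` and `𝒦`, and the comparison of the universal characteristic classes
in the general case, `H(ℸ)`, and in the regular case, `H(ℶ)`. -/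
theorem mainTheorem4 {A Γ : Type*} [Ring A] [HopfAlgebra ℂ A] [StarRing A] [StarModule ℂ A]
    [AddCommGroup Γ] [Module ℂ Γ] [Module A Γ] [Module Aᵐᵒᵖ Γ] [SMulCommClass A Aᵐᵒᵖ Γ]
    [IsScalarTower ℂ A Γ] [IsScalarTower ℂ Aᵐᵒᵖ Γ]
    (hG : QPB.IsCompactMatrixQuantumGroup A) (C : QPB.BicovariantStarCalculus A Γ)
    (δ : C.EmbeddedDifferential) :
    ∃ (hd : ∀ w ∈ δ.K, C.diff.d w ∈ δ.K) (had : ∀ w ∈ δ.K, δ.pTensor (C.adTilde w) = 0),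
      (δ.InvariantPartAcyclic ↔ δ.ClassesCoincide hd had) ∧
      (δ.IdealAcyclic ↔ δ.StarTrivial hd) ∧
      (δ.IdealAcyclic → δ.InvariantPartAcyclic) ∧
      (C.AdConnected → [δ.InvariantPartAcyclic, δ.IdealAcyclic, δ.StarTrivial hd,
        δ.ClassesCoincide hd had].TFAE) := by
  obtain ⟨h, hh⟩ := hG.exists_haar
  have h14 := δ.classesCoincide_iff fun _ hy => δ.exists_mem_daleth hh hy
  have h23 := δ.idealAcyclic_iff
  have h21 := δ.invariantPartAcyclic_of_idealAcyclic hh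
  refine ⟨δ.diff_mem_K, δ.pAd_eq_zero, h14, h23, h21, fun hC => ?_⟩
  tfae_have 1 ↔ 4 := h14
  tfae_have 2 ↔ 3 := h23
  tfae_have 2 → 1 := h21
  tfae_have 1 → 2 := δ.idealAcyclic_of_invariantPartAcyclic hh hC
  tfae_finish
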